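/- Let $a\in\mathbb R$, let $m$ be a smooth real function on an open set $J\subseteq\mathbb R$, and consider the ingoing Kerr–Vaidya metric in coordinates $(v,r,\theta,\phi)$ ($v\in J$, $0<\theta<\pi$, $R^2>0$), $$ds^2=-\Big(1-\frac{2m(v)r}{R^2}\Big)dv^2+2\,dv\,dr+R^2d\theta^2-\frac{4a\,m(v)\,r\sin^2\theta}{R^2}\,d\phi\,dv-2a\sin^2\theta\,d\phi\,dr+\frac{(r^2+a^2)^2-a^2\Delta\sin^2\theta}{R^2}\sin^2\theta\,d\phi^2,$$ where $R^2=r^2+a^2\cos^2\theta$ and $\Delta=r^2+a^2-2m(v)r$. With $C_{abcd}$ the Weyl tensor and $C^*_{abcd}$ its Hodge dual, put $I_1=C_{abcd}C^{abcd}$, $I_2=C^*_{abcd}C^{abcd}$, $I_3=C_{abcd;e}C^{abcd;e}$, $I_{3a}=C_{abcd;e}C^{ebcd;a}$, $I_5=I_{1;e}I_1{}^{;e}$, $J_4=6I_1I_3-16I_1I_{3a}+I_5$. (1) In the null tetrad $l=-\partial_r$, $n=R^{-2}\big((r^2+a^2)\partial_v+\tfrac12\Delta\,\partial_r+a\,\partial_\phi\big)$,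 $\mathbf m=\big(\sqrt2\,(r+ia\cos\theta)\big)^{-1}\big(ia\sin\theta\,\partial_v+\partial_\theta+\tfrac{i}{\sin\theta}\partial_\phi\big)$ the Weyl scalars satisfy $\Psi_0=\Psi_1=0$, and $I_1+iI_2=48\Psi_2^2$, where $\Psi_2=C_{abcd}\,l^a\mathbf m^b\bar{\mathbf m}^c n^d$ and the orientation is that of $(v,r,\theta,\phi)$. On an open set on which $I_1\neq0$ and on which a continuous branch of $\ln\Psi_2$ is chosen, define the conformal invariants $$I_1'=-2i\,[\ln\Psi_2-\ln\bar\Psi_2],\qquad (\nabla I_1)'=\frac{|\nabla I_1'|^2}{|I_1|^{1/2}},\qquad J'=\frac{J_4}{|I_1|^{5/2}}.$$ (2) There is a polynomial $P$, independent of $a$, $m$ and the point, such that on every such set $$\big|dI_1'\wedge d(\nabla I_1)'\wedge dJ'\big|^2=a^3\,m\,F_0,\qquad F_0=\frac{P(a,r,\cos\theta,m,m_{,v},m_{,vv},m_{,vvv})}{R^{74}\,I_1^{6}},$$ where the squared norm of the wedge is the Gram determinant of the three differentials. (3) On every connected such set, this squared wedge vanishes identically if and only if $m$ is constant there or $a=0$.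 (4) Let $a\neq0$, and let $U$ be a nonempty open subset of the spacetime such that $m_{,v}$ does not vanish identically on any nonempty open subset of $U$ (for example, $m_{,v}\neq0$ throughout $U$). The cohomogeneity is $4$ minus the maximal dimension of the orbits of the local isometries (the dimension at a point being that of the space of values there of the Killing fields defined near the point). Then the Kerr–Vaidya metric on $U$ has cohomogeneity $3$, and no conformally related metric $e^{2u}g$ with $u$ smooth on $U$ has lower cohomogeneity. In particular, the Kerr–Vaidya solution with $a\ne0$ and $m_{,v}\neq0$ is not conformally related to a black hole of lower cohomogeneity. -/

import Mathlib

open scoped ContDiff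

noncomputable section

namespace KerrVaidya

/-! ## Tensor calculus of a metric in a four-dimensional coordinate chart -/

/-- Points of a four-dimensional coordinate chart. -/
abbrev Coord : Type := Fin 4 → ℝ

/-- A (pseudo-Riemannian) metric given by its components `g_{ab}` in the chart. -/
abbrev MetricField : Type := Coord → Matrix (Fin 4) (Fin 4) ℝ

/-- The partial derivative `∂_i f`. -/
def pd (i : Fin 4) (f : Coord → ℝ) (p : Coord) : ℝ := fderiv ℝ f p (Pi.single i 1)

/-- The inverse metric `g^{ab}`. -/
def ginv (g : MetricField) (a b : Fin 4) (p : Coord) : ℝ := (g p)⁻¹ a b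

/-- The Christoffel symbols `Γ^a_{bc}` of the Levi-Civita connection. -/
def christoffel (g : MetricField) (a b c : Fin 4) (p : Coord) : ℝ :=
  (1 / 2) * ∑ e, ginv g a e p *
    (pd b (fun q => g q e c) p + pd c (fun q => g q e b) p - pd e (fun q => g q b c) p)

/-- The curvature tensor `R^a_{bcd} = ∂_c Γ^a_{db} - ∂_d Γ^a_{cb} + Γ^a_{ce} Γ^e_{db}
- Γ^a_{de} Γ^e_{cb}`. -/
def riemannUp (g : MetricField) (a b c d : Fin 4) (p : Coord) : ℝ :=
  pd c (christoffel g a d b) p - pd d (christoffel g a c b) p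
    + ∑ e, (christoffel g a c e p * christoffel g e d b p
      - christoffel g a d e p * christoffel g e c b p)

/-- The curvature tensor `R_{abcd}`. -/
def riemann (g : MetricField) (a b c d : Fin 4) (p : Coord) : ℝ :=
  ∑ e, g p a e * riemannUp g e b c d p

/-- The Ricci tensor `R_{ab} = R^c_{acb}`. -/
def ricci (g : MetricField) (a b : Fin 4) (p : Coord) : ℝ := ∑ c, riemannUp g c a c b p

/-- The scalar curvature. -/
def scalarCurv (g : MetricField) (p : Coord) : ℝ := ∑ a, ∑ b, ginv g a b p * ricci g a b p

/-- The Weyl tensor `C_{abcd}` in dimension four. -/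
def weyl (g : MetricField) (a b c d : Fin 4) (p : Coord) : ℝ :=
  riemann g a b c d p
    - (1 / 2) * (g p a c * ricci g b d p - g p a d * ricci g b c p
        - g p b c * ricci g a d p + g p b d * ricci g a c p)
    + (1 / 6) * scalarCurv g p * (g p a c * g p b d - g p a d * g p b c)

/-- The Weyl tensor with raised indices, `C^{abcd}`. -/
def weylUp (g : MetricField) (a b c d : Fin 4) (p : Coord) : ℝ :=
  ∑ a', ∑ b', ∑ c', ∑ d',
    ginv g a a' p * ginv g b b' p * ginv g c c' p * ginv g d d' p * weyl g a' b' c' d' p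

/-- The covariant derivative `C_{abcd;e}` of the Weyl tensor. -/
def covWeyl (g : MetricField) (a b c d e : Fin 4) (p : Coord) : ℝ :=
  pd e (weyl g a b c d) p
    - ∑ h, (christoffel g h e a p * weyl g h b c d p + christoffel g h e b p * weyl g a h c d p
      + christoffel g h e c p * weyl g a b h d p + christoffel g h e d p * weyl g a b c h p)

/-- The covariant derivative of the Weyl tensor with raised indices, `C^{abcd;e}`. -/
def covWeylUp (g : MetricField) (a b c d e : Fin 4) (p : Coord) : ℝ :=
  ∑ a', ∑ b', ∑ c', ∑ d', ∑ e',
    ginv g a a' p * ginv g b b' p * ginv g c c' p * ginv g d d' p * ginv g e e' p *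
      covWeyl g a' b' c' d' e' p

/-- The permutation symbol: the sign of `(a,b,c,d)` as a permutation of the four indices, and
zero if an index repeats. -/
def permSymbol (a b c d : Fin 4) : ℝ :=
  (Matrix.of fun i j : Fin 4 => if ![a, b, c, d] i = j then (1 : ℝ) else 0).det

/-- The volume form `ε_{abcd}` for the orientation given by the order of the coordinates. -/
def volForm (g : MetricField) (a b c d : Fin 4) (p : Coord) : ℝ :=
  Real.sqrt |(g p).det| * permSymbol a b c d

/-- The Hodge dual `C*_{abcd} = (1/2) ε_{abef} C^{ef}_{cd}` of the Weyl tensor. -/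
def weylDual (g : MetricField) (a b c d : Fin 4) (p : Coord) : ℝ :=
  (1 / 2) * ∑ e, ∑ f, ∑ e', ∑ f',
    volForm g a b e f p * ginv g e e' p * ginv g f f' p * weyl g e' f' c d p

/-- The inner product `g^{ab} ∂_a f ∂_b h` of two gradients. -/
def gradInner (g : MetricField) (f h : Coord → ℝ) (p : Coord) : ℝ :=
  ∑ a, ∑ b, ginv g a b p * pd a f p * pd b h p

/-- `I_1 = C_{abcd} C^{abcd}`. -/
def I1 (g : MetricField) (p : Coord) : ℝ :=
  ∑ a, ∑ b, ∑ c, ∑ d, weyl g a b c d p * weylUp g a b c d p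

/-- `I_2 = C*_{abcd} C^{abcd}`. -/
def I2 (g : MetricField) (p : Coord) : ℝ :=
  ∑ a, ∑ b, ∑ c, ∑ d, weylDual g a b c d p * weylUp g a b c d p

/-- `I_3 = C_{abcd;e} C^{abcd;e}`. -/
def I3 (g : MetricField) (p : Coord) : ℝ :=
  ∑ a, ∑ b, ∑ c, ∑ d, ∑ e, covWeyl g a b c d e p * covWeylUp g a b c d e p

/-- `I_{3a} = C_{abcd;e} C^{ebcd;a}`. -/
def I3a (g : MetricField) (p : Coord) : ℝ :=
  ∑ a, ∑ b, ∑ c, ∑ d, ∑ e, covWeyl g a b c d e p * covWeylUp g e b c d a p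

/-- `I_5 = I_{1;e} I_1^{;e}`. -/
def I5 (g : MetricField) (p : Coord) : ℝ := gradInner g (I1 g) (I1 g) p

/-- The conformally covariant invariant `J_4 = 6 I_1 I_3 - 16 I_1 I_{3a} + I_5`. -/
def J4 (g : MetricField) (p : Coord) : ℝ :=
  6 * I1 g p * I3 g p - 16 * I1 g p * I3a g p + I5 g p

/-- The squared norm `|df₀ ∧ df₁ ∧ df₂|²`, i.e. the Gram determinant of the three differentials
with respect to the inverse metric. -/
def wedgeNormSq (g : MetricField) (f : Fin 3 → Coord → ℝ) (p : Coord) : ℝ :=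
  (Matrix.of fun i j : Fin 3 => gradInner g (f i) (f j) p).det

/-! ## Null tetrads and Newman-Penrose scalars -/

/-- Three of the four legs of a complex null tetrad `(l, n, m, m̄)`. -/
structure Tetrad where
  l : Coord → Fin 4 → ℂ
  n : Coord → Fin 4 → ℂ
  m : Coord → Fin 4 → ℂ

/-- The complex bilinear extension of the metric. -/
def metricC (g : MetricField) (p : Coord) (X Y : Fin 4 → ℂ) : ℂ :=
  ∑ a, ∑ b, (g p a b : ℂ) * X a * Y b

/-- The complex multilinear extension of the Weyl tensor. -/
def weylC (g : MetricField) (p : Coord) (X Y Z W : Fin 4 → ℂ) : ℂ :=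
  ∑ a, ∑ b, ∑ c, ∑ d, (weyl g a b c d p : ℂ) * X a * Y b * Z c * W d

/-- `(l, n, m, m̄)` is a null tetrad at `p` (signature `-+++`): `l`, `n` are real, the only
nonzero products being `l·n = -1` and `m·m̄ = 1`. -/
structure Tetrad.IsNullAt (T : Tetrad) (g : MetricField) (p : Coord) : Prop where
  l_real : star (T.l p) = T.l p
  n_real : star (T.n p) = T.n p
  ll : metricC g p (T.l p) (T.l p) = 0
  nn : metricC g p (T.n p) (T.n p) = 0
  ln : metricC g p (T.l p) (T.n p) = -1
  lm : metricC g p (T.l p) (T.m p) = 0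
  nm : metricC g p (T.n p) (T.m p) = 0
  mm : metricC g p (T.m p) (T.m p) = 0
  mmbar : metricC g p (T.m p) (star (T.m p)) = 1

/-- `Ψ_0 = C(l, m, l, m)`. -/
def Psi0 (g : MetricField) (T : Tetrad) (p : Coord) : ℂ :=
  weylC g p (T.l p) (T.m p) (T.l p) (T.m p)

/-- `Ψ_1 = C(l, n, l, m)`. -/
def Psi1 (g : MetricField) (T : Tetrad) (p : Coord) : ℂ :=
  weylC g p (T.l p) (T.n p) (T.l p) (T.m p)

/-- `Ψ_2 = C(l, m, m̄, n)`. -/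
def Psi2 (g : MetricField) (T : Tetrad) (p : Coord) : ℂ :=
  weylC g p (T.l p) (T.m p) (star (T.m p)) (T.n p)

/-! ## Killing vector fields, cohomogeneity, conformal rescalings -/

/-- `K` is a smooth Killing vector field of `g` on the open set `W`: the Lie derivative of `g`
along `K` vanishes. -/
def IsKillingOn (g : MetricField) (W : Set Coord) (K : Coord → Coord) : Prop :=
  ContDiffOn ℝ ∞ K W ∧ ∀ p ∈ W, ∀ a b : Fin 4,
    ∑ c, (K p c * pd c (fun q => g q a b) p + g p c b * pd a (fun q => K q c) p
      + g p a c * pd b (fun q => K q c) p) = 0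

/-- The dimension of the orbit through `p` of the local isometries of `g`: the dimension of the
space of values at `p` of the Killing vector fields defined near `p`. -/
def orbitDim (g : MetricField) (p : Coord) : ℕ :=
  Module.finrank ℝ (Submodule.span ℝ
    {w : Coord | ∃ (W : Set Coord) (K : Coord → Coord),
      IsOpen W ∧ p ∈ W ∧ IsKillingOn g W K ∧ K p = w})

/-- The cohomogeneity of the spacetime `(U, g)`: four minus the maximal dimension of the orbits
of the local isometries. -/
def cohomogeneity (g : MetricField) (U : Set Coord) : ℕ :=
  sInf {n : ℕ | ∃ p ∈ U, n = 4 - orbitDim g p}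

/-- The conformally related metric `e^{2u} g`. -/
def conformalMetric (u : Coord → ℝ) (g : MetricField) : MetricField :=
  fun p => Real.exp (2 * u p) • g p

/-! ## The ingoing Kerr-Vaidya spacetime, in coordinates `(v, r, θ, φ) = (p 0, p 1, p 2, p 3)` -/

/-- `R² = r² + a² cos² θ`. -/
def Rsq (a : ℝ) (p : Coord) : ℝ := p 1 ^ 2 + a ^ 2 * Real.cos (p 2) ^ 2

/-- `Δ = r² + a² - 2 m(v) r`. -/
def Delta (a : ℝ) (m : ℝ → ℝ) (p : Coord) : ℝ := p 1 ^ 2 + a ^ 2 - 2 * m (p 0) * p 1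

/-- The ingoing Kerr-Vaidya metric with rotation parameter `a` and mass function `m`. -/
def kvMetric (a : ℝ) (m : ℝ → ℝ) : MetricField := fun p =>
  let r := p 1
  let s := Real.sin (p 2)
  let M := m (p 0)
  let S := Rsq a p
  !![-(1 - 2 * M * r / S), 1, 0, -(2 * a * M * r * s ^ 2 / S);
     1, 0, 0, -(a * s ^ 2);
     0, 0, S, 0;
     -(2 * a * M * r * s ^ 2 / S), -(a * s ^ 2), 0,
       ((r ^ 2 + a ^ 2) ^ 2 - a ^ 2 * Delta a m p * s ^ 2) / S * s ^ 2]

/-- The coordinate domain of the Kerr-Vaidya metric, `m` being a function on `J`: the curvature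
singularity `R = 0` and the coordinate singularity on the axis are removed. -/
def kvDomain (a : ℝ) (J : Set ℝ) : Set Coord :=
  {p | p 0 ∈ J ∧ 0 < p 2 ∧ p 2 < Real.pi ∧ 0 < Rsq a p}

/-- The null tetrad adapted to the repeated principal null direction `∂_r`. -/
def kvTetrad (a : ℝ) (m : ℝ → ℝ) : Tetrad where
  l := fun _ => ![0, -1, 0, 0]
  n := fun p => ![(((p 1 ^ 2 + a ^ 2) / Rsq a p : ℝ) : ℂ), ((Delta a m p / (2 * Rsq a p) : ℝ) : ℂ),
    0, ((a / Rsq a p : ℝ) : ℂ)]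
  m := fun p => (1 / ((Real.sqrt 2 : ℂ) * ((p 1 : ℂ) + Complex.I * (a * Real.cos (p 2) : ℝ)))) •
    ![Complex.I * (a * Real.sin (p 2) : ℝ), 0, 1, Complex.I / (Real.sin (p 2) : ℝ)]

/-- The scalar `Ψ_2` of the Kerr-Vaidya spacetime. -/
def kvPsi2 (a : ℝ) (m : ℝ → ℝ) (p : Coord) : ℂ := Psi2 (kvMetric a m) (kvTetrad a m) p

/-- `L` is a continuous branch of `ln Ψ_2` on `U`. -/
def IsLogBranch (a : ℝ) (m : ℝ → ℝ) (U : Set Coord) (L : Coord → ℂ) : Prop :=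
  ContinuousOn L U ∧ ∀ p ∈ U, Complex.exp (L p) = kvPsi2 a m p

/-- The conformal invariant `I_1' = -2i (ln Ψ_2 - ln Ψ̄_2)` for the branch `L` of `ln Ψ_2`
(this number is real). -/
def confI (L : Coord → ℂ) (p : Coord) : ℝ :=
  (-2 * Complex.I * (L p - star (L p))).re

/-- The conformal invariant `(∇ I_1)' = |∇ I_1'|² / |I_1|^{1/2}`. -/
def confGradI (g : MetricField) (L : Coord → ℂ) (p : Coord) : ℝ :=
  gradInner g (confI L) (confI L) p / |I1 g p| ^ (1 / 2 : ℝ)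

/-- The conformal invariant `J' = J_4 / |I_1|^{5/2}`. -/
def confJ (g : MetricField) (p : Coord) : ℝ := J4 g p / |I1 g p| ^ (5 / 2 : ℝ)

/-- The squared wedge `|dI_1' ∧ d(∇I_1)' ∧ dJ'|²` of the Kerr-Vaidya spacetime. -/
def kvWedge (a : ℝ) (m : ℝ → ℝ) (L : Coord → ℂ) (p : Coord) : ℝ :=
  wedgeNormSq (kvMetric a m) ![confI L, confGradI (kvMetric a m) L, confJ (kvMetric a m)] p

end KerrVaidya

end

/-! Everything is reduced to commutative algebra. Germs of smooth complex functions at a point form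
a ring with four commuting derivations, and the tensors involved are differential polynomials in the
germs of the metric and its inverse. The Kerr-Vaidya metric needs only a few generators: Z = 1/(r +
ia cos θ), its conjugate W, t = ia sin θ, i/sin θ, cot θ and the derivatives of m, with the
relations recorded in `KVRing`. Each geometric claim becomes an identity between such elements,
within reach of `ring` or `grind`.

A null frame keeps these identities small. It is the tetrad rescaled to l, 2n, √2 m, √2 m̄, so that
no square root occurs. Its connection coefficients are recognised by metricity and torsion
(`NullFrame.nabV_eq`), and the curvature splits into a trace-free part built from bivectors and a
trace-free Ricci part (`curv_eq`, `fr4_weylA`). The Weyl tensor is then a pair of symmetric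
trace-free 3×3 matrices, one on self-dual and one on anti-self-dual bivectors. The missing entries
are Ψ₀ = Ψ₁ = 0, the middle entry gives Ψ₂ = -mZ³, and the Hodge dual multiplies the two blocks by
-i and i, whence I₁ + iI₂ = 48Ψ₂².

For the wedge: m is real, so it cancels from ln Ψ₂ - ln Ψ̄₂, and dI₁' is a constant times dZ/Z -
dW/W, without a v-component. The Jacobian of the three invariants in (v,r,θ) therefore involves only
∂_v and the vector field ξ of the (r,θ)-plane that annihilates Z/W. On polynomials in Z and W, ξ is
-2tZW times the degree, so the powers of |I₁| contribute only multiples of the undifferentiated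
functions, and the Jacobian is a multiple of t m H T with an explicit polynomial T (`ξj`,
`wedge_det`). The Gram determinant is its square times a 3×3 minor V·ZW of the inverse metric
(`gradForm_det`). Counting poles in r ± ia cos θ gives the denominator. If the wedge vanishes and a
≠ 0, then at fixed v the product VT is zero as a rational function of r and cos θ; V is not zero, so
T = 0 also on the equator, where the part of T odd in r demands both m m'' = 4m'² and m m'' = 2m'²,
so m' = 0.

The cohomogeneity does not go through the wedge. A Killing field K of e^{2u}g is conformal Killing
for g, so L_K C = 2λC (`LieCurv.lie_weylA`). Read in the null frame, this forces L_K(mZ³) = -2λ mZ³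
and the conjugate equation (`kill_psi`). Hence Z/W is invariant under K. So are, after correction by
powers of 1/(mZ³), the squared gradient of Z/W and the inner product of the gradients of these two
invariants. The Jacobian of the three functions is governed by `polyJac`, and points where the
required factors are nonzero exist in every open set on which m' is not identically zero
(`exists_generic`). There K is a multiple of ∂_φ, and by continuity everywhere; as ∂_φ is a Killing
field of g, its orbits have dimension exactly one. -/

noncomputable section

namespace KerrVaidya

set_option linter.unusedSectionVars false

open Filter Topology

/-! ## The differential ring of germs of smooth complex functions -/

/-- Smoothness at a point of a complex function on the chart. -/
def Sm (p : Coord) (f : Coord → ℂ) : Prop := ContDiffAt ℝ ∞ f p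

/-- The complex functions which are smooth at `p`. -/
def smoothAt (p : Coord) : Subalgebra ℂ (Coord → ℂ) where
  carrier := {f | Sm p f}
  mul_mem' {f g} hf hg := ContDiffAt.mul (show Sm p f from hf) (show Sm p g from hg)
  add_mem' {f g} hf hg := ContDiffAt.add (show Sm p f from hf) (show Sm p g from hg)
  algebraMap_mem' c := (contDiffAt_const : ContDiffAt ℝ ∞ (fun _ : Coord => c) _)

/-- The functions smooth at `p` which vanish near `p`. -/
def vanishAt (p : Coord) : Ideal (smoothAt p) where
  carrier := {f | (f : Coord → ℂ) =ᶠ[𝓝 p] 0}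
  zero_mem' := EventuallyEq.rfl
  add_mem' {f g} hf hg := by
    filter_upwards [hf, hg] with q h1 h2
    change (f : Coord → ℂ) q + (g : Coord → ℂ) q = 0
    rw [h1, h2]; simp
  smul_mem' c f hf := by
    filter_upwards [hf] with q h1
    change (c : Coord → ℂ) q * (f : Coord → ℂ) q = 0
    rw [h1]; simp

/-- Germs at `p` of smooth complex functions. -/
def SmoothGerm (p : Coord) : Type := smoothAt p ⧸ vanishAt p

instance (p : Coord) : CommRing (SmoothGerm p) :=
  inferInstanceAs (CommRing (smoothAt p ⧸ vanishAt p))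

instance (p : Coord) : Algebra ℂ (SmoothGerm p) :=
  inferInstanceAs (Algebra ℂ (smoothAt p ⧸ vanishAt p))

/-- The class of a smooth function. -/
def SmoothGerm.mk (p : Coord) : smoothAt p →ₐ[ℂ] SmoothGerm p :=
  Ideal.Quotient.mkₐ ℂ (vanishAt p)

theorem SmoothGerm.mk_eq {p : Coord} {f g : smoothAt p} :
    SmoothGerm.mk p f = SmoothGerm.mk p g ↔ (f : Coord → ℂ) =ᶠ[𝓝 p] g := by
  refine (Ideal.Quotient.mk_eq_mk_iff_sub_mem (I := vanishAt p) f g).trans ?_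
  constructor
  · intro h
    have h' : ((f - g : smoothAt p) : Coord → ℂ) =ᶠ[𝓝 p] 0 := h
    filter_upwards [h'] with q hq
    exact sub_eq_zero.1 hq
  · intro h
    change ((f - g : smoothAt p) : Coord → ℂ) =ᶠ[𝓝 p] 0
    filter_upwards [h] with q hq
    exact sub_eq_zero.2 hq

theorem SmoothGerm.mk_surjective (p : Coord) : Function.Surjective (SmoothGerm.mk p) :=
  Ideal.Quotient.mk_surjective

/-- The partial derivative of a complex function. -/
def pdC (i : Fin 4) (f : Coord → ℂ) (p : Coord) : ℂ := fderiv ℝ f p (Pi.single i 1)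

theorem Sm.pdC {p : Coord} {f : Coord → ℂ} (hf : Sm p f) (i : Fin 4) : Sm p (pdC i f) := by
  have h : ContDiffAt ℝ ∞ (fderiv ℝ f) p := ContDiffAt.fderiv_right hf (by simp)
  exact h.clm_apply contDiffAt_const

theorem Sm.eventually_diff {p : Coord} {f : Coord → ℂ} (hf : Sm p f) :
    ∀ᶠ q in 𝓝 p, DifferentiableAt ℝ f q := by
  have h : ContDiffAt ℝ 1 f p := ContDiffAt.of_le hf (by simp)
  filter_upwards [h.eventually (by simp)] with q hq
  exact hq.differentiableAt (by simp)

/-- The partial derivative of germs, as a linear map on smooth functions. -/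
def pdLin (p : Coord) (i : Fin 4) : smoothAt p →ₗ[ℂ] SmoothGerm p where
  toFun f := SmoothGerm.mk p ⟨pdC i f, Sm.pdC f.2 i⟩
  map_add' f g := by
    rw [← map_add, SmoothGerm.mk_eq]
    filter_upwards [Sm.eventually_diff f.2, Sm.eventually_diff g.2] with q h1 h2
    change fderiv ℝ ((f : Coord → ℂ) + (g : Coord → ℂ)) q _ = _
    rw [fderiv_add h1 h2]; rfl
  map_smul' c f := by
    rw [RingHom.id_apply, ← map_smul, SmoothGerm.mk_eq]
    filter_upwards [Sm.eventually_diff f.2] with q h1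
    change fderiv ℝ (c • (f : Coord → ℂ)) q _ = _
    rw [fderiv_const_smul h1]; rfl

/-- The partial derivatives as derivations of the ring of germs. -/
def SmoothGerm.der (p : Coord) (i : Fin 4) : Derivation ℂ (SmoothGerm p) (SmoothGerm p) :=
  Derivation.mk' (Submodule.liftQ (M := smoothAt p) ((vanishAt p).restrictScalars ℂ) (pdLin p i) (by
      intro f (hf : f ∈ vanishAt p)
      have hf' : (f : Coord → ℂ) =ᶠ[𝓝 p] 0 := hf
      change SmoothGerm.mk p _ = 0
      rw [← map_zero (SmoothGerm.mk p), SmoothGerm.mk_eq]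
      filter_upwards [hf'.fderiv (𝕜 := ℝ)] with q hq
      change fderiv ℝ (f : Coord → ℂ) q _ = 0
      rw [hq]; simp)) (by
    intro a b
    obtain ⟨f, rfl⟩ := SmoothGerm.mk_surjective p a
    obtain ⟨g, rfl⟩ := SmoothGerm.mk_surjective p b
    change SmoothGerm.mk p _ = SmoothGerm.mk p f * SmoothGerm.mk p _
      + SmoothGerm.mk p g * SmoothGerm.mk p _
    rw [← map_mul, ← map_mul, ← map_add, SmoothGerm.mk_eq]
    filter_upwards [Sm.eventually_diff f.2, Sm.eventually_diff g.2] with q h1 h2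
    change fderiv ℝ ((f : Coord → ℂ) * (g : Coord → ℂ)) q _ = _
    rw [fderiv_mul h1 h2]; rfl)

open Classical in
/-- The germ of a function (zero if it is not smooth). -/
def germ (p : Coord) (f : Coord → ℂ) : SmoothGerm p :=
  if h : Sm p f then SmoothGerm.mk p ⟨f, h⟩ else 0

section germ

variable {p : Coord} {f g : Coord → ℂ}

theorem germ_of (h : Sm p f) : germ p f = SmoothGerm.mk p ⟨f, h⟩ := dif_pos h

theorem germ_eq_iff (hf : Sm p f) (hg : Sm p g) : germ p f = germ p g ↔ f =ᶠ[𝓝 p] g := by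
  rw [germ_of hf, germ_of hg, SmoothGerm.mk_eq]

theorem Sm.congr (hf : Sm p f) (h : g =ᶠ[𝓝 p] f) : Sm p g := ContDiffAt.congr_of_eventuallyEq hf h

theorem germ_congr (h : f =ᶠ[𝓝 p] g) : germ p f = germ p g := by
  by_cases hf : Sm p f
  · exact (germ_eq_iff hf (hf.congr h.symm)).2 h
  · have hg : ¬ Sm p g := fun hg => hf (hg.congr h)
    rw [germ, germ, dif_neg hf, dif_neg hg]

theorem Sm.const (c : ℂ) : Sm p (fun _ => c) := contDiffAt_const
theorem Sm.add (hf : Sm p f) (hg : Sm p g) : Sm p (fun q => f q + g q) := ContDiffAt.add hf hg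
theorem Sm.sub (hf : Sm p f) (hg : Sm p g) : Sm p (fun q => f q - g q) := ContDiffAt.sub hf hg
theorem Sm.mul (hf : Sm p f) (hg : Sm p g) : Sm p (fun q => f q * g q) := ContDiffAt.mul hf hg
theorem Sm.neg (hf : Sm p f) : Sm p (fun q => -f q) := ContDiffAt.neg hf
theorem Sm.sum {ι : Type*} {s : Finset ι} {f : ι → Coord → ℂ} (hf : ∀ i, Sm p (f i)) :
    Sm p (fun q => ∑ i ∈ s, f i q) := ContDiffAt.sum fun i _ => hf i

theorem germ_const (c : ℂ) : germ p (fun _ => c) = algebraMap ℂ _ c := by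
  rw [germ_of (Sm.const c)]; exact (SmoothGerm.mk p).commutes c
theorem germ_add (hf : Sm p f) (hg : Sm p g) :
    germ p (fun q => f q + g q) = germ p f + germ p g := by
  rw [germ_of hf, germ_of hg, germ_of (hf.add hg), ← map_add]; rfl
theorem germ_sub (hf : Sm p f) (hg : Sm p g) :
    germ p (fun q => f q - g q) = germ p f - germ p g := by
  rw [germ_of hf, germ_of hg, germ_of (hf.sub hg), ← map_sub]; rfl
theorem germ_mul (hf : Sm p f) (hg : Sm p g) :
    germ p (fun q => f q * g q) = germ p f * germ p g := by
  rw [germ_of hf, germ_of hg, germ_of (hf.mul hg), ← map_mul]; rfl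
theorem germ_neg (hf : Sm p f) : germ p (fun q => -f q) = -germ p f := by
  rw [germ_of hf, germ_of hf.neg, ← map_neg]; rfl
theorem germ_sum {ι : Type*} {s : Finset ι} {f : ι → Coord → ℂ} (hf : ∀ i, Sm p (f i)) :
    germ p (fun q => ∑ i ∈ s, f i q) = ∑ i ∈ s, germ p (f i) := by
  classical
  induction s using Finset.induction_on with
  | empty => simpa using germ_const (p := p) 0
  | insert a s ha ih =>
    simp only [Finset.sum_insert ha]
    rw [germ_add (hf a) (Sm.sum hf), ih]

theorem der_germ (hf : Sm p f) (i : Fin 4) :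
    SmoothGerm.der p i (germ p f) = germ p (pdC i f) := by
  rw [germ_of hf, germ_of (hf.pdC i)]; rfl

/-- The value of a germ at the point. -/
def SmoothGerm.ev (p : Coord) : SmoothGerm p →ₐ[ℂ] ℂ :=
  Ideal.Quotient.liftₐ (vanishAt p) ((Pi.evalAlgHom ℂ (fun _ : Coord => ℂ) p).comp
    (smoothAt p).val) (by
      intro f hf
      have hf' : (f : Coord → ℂ) =ᶠ[𝓝 p] 0 := hf
      exact hf'.self_of_nhds)

theorem ev_germ (hf : Sm p f) : SmoothGerm.ev p (germ p f) = f p := by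
  rw [germ_of hf]; rfl

theorem exists_germ (a : SmoothGerm p) : ∃ f, Sm p f ∧ germ p f = a := by
  obtain ⟨f, rfl⟩ := SmoothGerm.mk_surjective p a
  exact ⟨f, f.2, germ_of f.2⟩

/-- Symmetry of the second derivative. This supplies the hypothesis `hc` under which the algebra
below yields the Ricci identity and the Lie derivative of the curvature. -/
theorem der_comm (i j : Fin 4) (a : SmoothGerm p) :
    SmoothGerm.der p i (SmoothGerm.der p j a) = SmoothGerm.der p j (SmoothGerm.der p i a) := by
  obtain ⟨f, hf, rfl⟩ := exists_germ a
  rw [der_germ hf, der_germ hf, der_germ (hf.pdC j), der_germ (hf.pdC i)]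
  apply germ_congr
  have h2 : ContDiffAt ℝ 2 f p := mod_cast contDiffAt_infty.1 hf 2
  filter_upwards [h2.eventually (by simp)] with q hq
  have hd : DifferentiableAt ℝ (fderiv ℝ f) q :=
    (ContDiffAt.fderiv_right (m := 1) hq (by norm_num)).differentiableAt (by simp)
  have key : ∀ k l : Fin 4, pdC k (pdC l f) q
      = fderiv ℝ (fderiv ℝ f) q (Pi.single k 1) (Pi.single l 1) := by
    intro k l
    have : pdC l f = fun q' => fderiv ℝ f q' (Pi.single l 1) := rfl
    rw [pdC, this, fderiv_clm_apply hd (differentiableAt_const _)]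
    simp
  rw [key, key]
  exact (hq.isSymmSndFDerivAt (by simp)).eq _ _

end germ

/-! ## Tensor calculus over a differential ring -/

section algebraic

variable {A : Type*} [CommRing A] [Algebra ℂ A] (D : Fin 4 → Derivation ℂ A A)

/-- Christoffel symbols over a differential ring. -/
def chrA (g gi : Fin 4 → Fin 4 → A) (a b c : Fin 4) : A :=
  (1 / 2 : ℂ) • ∑ e, gi a e * (D b (g e c) + D c (g e b) - D e (g b c))

/-- Curvature of a connection over a differential ring. -/
def riemUpA (Γ : Fin 4 → Fin 4 → Fin 4 → A) (a b c d : Fin 4) : A :=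
  D c (Γ a d b) - D d (Γ a c b) + ∑ e, (Γ a c e * Γ e d b - Γ a d e * Γ e c b)

/-- Lowering of the first index. -/
def riemA (g : Fin 4 → Fin 4 → A) (R : Fin 4 → Fin 4 → Fin 4 → Fin 4 → A) (a b c d : Fin 4) : A :=
  ∑ e, g a e * R e b c d

/-- The Ricci contraction. -/
def ricA (R : Fin 4 → Fin 4 → Fin 4 → Fin 4 → A) (a b : Fin 4) : A := ∑ c, R c a c b

/-- The trace of a symmetric tensor. -/
def scA (gi P : Fin 4 → Fin 4 → A) : A := ∑ a, ∑ b, gi a b * P a b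

/-- The Weyl tensor built from the curvature, the Ricci tensor and the scalar curvature. -/
def weylA (g : Fin 4 → Fin 4 → A) (R : Fin 4 → Fin 4 → Fin 4 → Fin 4 → A) (P : Fin 4 → Fin 4 → A)
    (s : A) (a b c d : Fin 4) : A :=
  R a b c d - (1 / 2 : ℂ) • (g a c * P b d - g a d * P b c - g b c * P a d + g b d * P a c)
    + (1 / 6 : ℂ) • (s * (g a c * g b d - g a d * g b c))

/-- The covariant derivative of a four-index tensor. -/
def covA (Γ : Fin 4 → Fin 4 → Fin 4 → A) (C : Fin 4 → Fin 4 → Fin 4 → Fin 4 → A)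
    (a b c d e : Fin 4) : A :=
  D e (C a b c d) - ∑ h, (Γ h e a * C h b c d + Γ h e b * C a h c d + Γ h e c * C a b h d
    + Γ h e d * C a b c h)

end algebraic

/-! ## Germs of real functions -/

/-- The germ of a real function. -/
def germR (p : Coord) (f : Coord → ℝ) : SmoothGerm p := germ p (fun q => (f q : ℂ))

section germR

variable {p : Coord} {f g : Coord → ℝ}

theorem sm_ofReal (hf : ContDiffAt ℝ ∞ f p) : Sm p (fun q => (f q : ℂ)) :=
  Complex.ofRealCLM.contDiff.contDiffAt.comp p hf

theorem germR_add (hf : ContDiffAt ℝ ∞ f p) (hg : ContDiffAt ℝ ∞ g p) :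
    germR p (fun q => f q + g q) = germR p f + germR p g := by
  simp only [germR, Complex.ofReal_add]; exact germ_add (sm_ofReal hf) (sm_ofReal hg)
theorem germR_sub (hf : ContDiffAt ℝ ∞ f p) (hg : ContDiffAt ℝ ∞ g p) :
    germR p (fun q => f q - g q) = germR p f - germR p g := by
  simp only [germR, Complex.ofReal_sub]; exact germ_sub (sm_ofReal hf) (sm_ofReal hg)
theorem germR_mul (hf : ContDiffAt ℝ ∞ f p) (hg : ContDiffAt ℝ ∞ g p) :
    germR p (fun q => f q * g q) = germR p f * germR p g := by
  simp only [germR, Complex.ofReal_mul]; exact germ_mul (sm_ofReal hf) (sm_ofReal hg)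
theorem germR_const (c : ℝ) : germR p (fun _ => c) = algebraMap ℂ _ (c : ℂ) := germ_const _
theorem germR_const_mul (c : ℝ) (hf : ContDiffAt ℝ ∞ f p) :
    germR p (fun q => c * f q) = (c : ℂ) • germR p f := by
  rw [germR_mul contDiffAt_const hf, germR_const, Algebra.smul_def]
theorem germR_sum {f : Fin 4 → Coord → ℝ} (hf : ∀ i, ContDiffAt ℝ ∞ (f i) p) :
    germR p (fun q => ∑ i, f i q) = ∑ i, germR p (f i) := by
  simp only [germR, Complex.ofReal_sum]; exact germ_sum fun i => sm_ofReal (hf i)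

theorem ev_germR (hf : ContDiffAt ℝ ∞ f p) : SmoothGerm.ev p (germR p f) = f p :=
  ev_germ (sm_ofReal hf)

theorem germR_congr (h : f =ᶠ[𝓝 p] g) : germR p f = germR p g :=
  germ_congr (by filter_upwards [h] with q hq; rw [hq])

theorem contDiffAt_pd (hf : ContDiffAt ℝ ∞ f p) (i : Fin 4) : ContDiffAt ℝ ∞ (pd i f) p := by
  have h : ContDiffAt ℝ ∞ (fderiv ℝ f) p := ContDiffAt.fderiv_right hf (by simp)
  exact h.clm_apply contDiffAt_const

theorem der_germR (hf : ContDiffAt ℝ ∞ f p) (i : Fin 4) :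
    SmoothGerm.der p i (germR p f) = germR p (pd i f) := by
  rw [germR, der_germ (sm_ofReal hf)]
  apply germ_congr
  have h2 : ContDiffAt ℝ 1 f p := ContDiffAt.of_le hf (by simp)
  filter_upwards [h2.eventually (by simp)] with q hq
  have hd : DifferentiableAt ℝ f q := hq.differentiableAt (by simp)
  have := (Complex.ofRealCLM.hasFDerivAt.comp q hd.hasFDerivAt).fderiv
  change fderiv ℝ (fun q => (f q : ℂ)) q _ = _
  have h3 : (fun q => (f q : ℂ)) = Complex.ofRealCLM ∘ f := rfl
  rw [h3, this]; rfl

end germR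

/-! ## The tensors of a smooth metric as germs -/

section transfer

variable {g : MetricField} {p : Coord}

/-- A metric which is smooth at a point together with its inverse. -/
structure SmoothMetric (g : MetricField) (p : Coord) : Prop where
  metric : ∀ a b, ContDiffAt ℝ ∞ (fun q => g q a b) p
  inverse : ∀ a b, ContDiffAt ℝ ∞ (ginv g a b) p

/-- The germs of the metric. -/
def gG (g : MetricField) (p : Coord) (a b : Fin 4) : SmoothGerm p := germR p (fun q => g q a b)
/-- The germs of the inverse metric. -/
def giG (g : MetricField) (p : Coord) (a b : Fin 4) : SmoothGerm p := germR p (ginv g a b)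
/-- The germs of the Christoffel symbols. -/
def chrG (g : MetricField) (p : Coord) (a b c : Fin 4) : SmoothGerm p :=
  germR p (christoffel g a b c)
/-- The germs of the Weyl tensor. -/
def weylG (g : MetricField) (p : Coord) (a b c d : Fin 4) : SmoothGerm p :=
  germR p (weyl g a b c d)

theorem SmoothMetric.contDiffAt_christoffel (h : SmoothMetric g p) (a b c : Fin 4) :
    ContDiffAt ℝ ∞ (christoffel g a b c) p := by
  refine contDiffAt_const.mul (ContDiffAt.sum fun e _ => (h.inverse _ _).mul ?_)
  exact ((contDiffAt_pd (h.metric _ _) _).add (contDiffAt_pd (h.metric _ _) _)).sub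
    (contDiffAt_pd (h.metric _ _) _)

theorem SmoothMetric.chrG_eq (h : SmoothMetric g p) (a b c : Fin 4) :
    chrG g p a b c = chrA (SmoothGerm.der p) (gG g p) (giG g p) a b c := by
  have h1 := fun i a b => contDiffAt_pd (h.metric a b) i
  have h2 := h.inverse
  unfold chrG christoffel chrA
  rw [germR_const_mul _ (ContDiffAt.sum fun e _ => (h2 _ _).mul (((h1 _ _ _).add (h1 _ _ _)).sub
    (h1 _ _ _))), germR_sum (fun e => (h2 _ _).mul (((h1 _ _ _).add (h1 _ _ _)).sub (h1 _ _ _)))]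
  congr 1
  · push_cast; rfl
  refine Finset.sum_congr rfl fun e _ => ?_
  rw [germR_mul (h2 _ _) (((h1 _ _ _).add (h1 _ _ _)).sub (h1 _ _ _)),
    germR_sub ((h1 _ _ _).add (h1 _ _ _)) (h1 _ _ _), germR_add (h1 _ _ _) (h1 _ _ _),
    ← der_germR (h.metric _ _), ← der_germR (h.metric _ _), ← der_germR (h.metric _ _)]
  rfl

theorem SmoothMetric.contDiffAt_riemannUp (h : SmoothMetric g p) (a b c d : Fin 4) :
    ContDiffAt ℝ ∞ (riemannUp g a b c d) p := by
  have h1 := h.contDiffAt_christoffel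
  exact ((contDiffAt_pd (h1 _ _ _) _).sub (contDiffAt_pd (h1 _ _ _) _)).add
    (ContDiffAt.sum fun e _ => ((h1 _ _ _).mul (h1 _ _ _)).sub ((h1 _ _ _).mul (h1 _ _ _)))

theorem SmoothMetric.riemannUpG_eq (h : SmoothMetric g p) (a b c d : Fin 4) :
    germR p (riemannUp g a b c d) = riemUpA (SmoothGerm.der p) (chrG g p) a b c d := by
  have h1 := h.contDiffAt_christoffel
  have h2 := fun i a b c => contDiffAt_pd (h1 a b c) i
  unfold riemannUp riemUpA
  rw [germR_add ((h2 _ _ _ _).sub (h2 _ _ _ _)) (ContDiffAt.sum fun e _ =>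
    ((h1 _ _ _).mul (h1 _ _ _)).sub ((h1 _ _ _).mul (h1 _ _ _))), germR_sub (h2 _ _ _ _)
    (h2 _ _ _ _), germR_sum fun e => ((h1 _ _ _).mul (h1 _ _ _)).sub ((h1 _ _ _).mul (h1 _ _ _)),
    ← der_germR (h1 _ _ _), ← der_germR (h1 _ _ _)]
  congr 1
  refine Finset.sum_congr rfl fun e _ => ?_
  rw [germR_sub ((h1 _ _ _).mul (h1 _ _ _)) ((h1 _ _ _).mul (h1 _ _ _)),
    germR_mul (h1 _ _ _) (h1 _ _ _), germR_mul (h1 _ _ _) (h1 _ _ _)]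
  rfl

theorem SmoothMetric.contDiffAt_riemann (h : SmoothMetric g p) (a b c d : Fin 4) :
    ContDiffAt ℝ ∞ (riemann g a b c d) p :=
  ContDiffAt.sum fun _ _ => (h.metric _ _).mul (h.contDiffAt_riemannUp _ _ _ _)

theorem SmoothMetric.contDiffAt_ricci (h : SmoothMetric g p) (a b : Fin 4) :
    ContDiffAt ℝ ∞ (ricci g a b) p :=
  ContDiffAt.sum fun _ _ => h.contDiffAt_riemannUp _ _ _ _

theorem SmoothMetric.contDiffAt_scalarCurv (h : SmoothMetric g p) :
    ContDiffAt ℝ ∞ (scalarCurv g) p :=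
  ContDiffAt.sum fun _ _ => ContDiffAt.sum fun _ _ => (h.inverse _ _).mul (h.contDiffAt_ricci _ _)

theorem SmoothMetric.contDiffAt_weyl (h : SmoothMetric g p) (a b c d : Fin 4) :
    ContDiffAt ℝ ∞ (weyl g a b c d) p := by
  have h1 := h.metric
  have h2 := h.contDiffAt_ricci
  have h3 := h.contDiffAt_scalarCurv
  have h4 := h.contDiffAt_riemann
  unfold weyl
  fun_prop

theorem SmoothMetric.riemannG_eq (h : SmoothMetric g p) (a b c d : Fin 4) :
    germR p (riemann g a b c d)
      = riemA (gG g p) (riemUpA (SmoothGerm.der p) (chrG g p)) a b c d := by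
  unfold riemann riemA
  rw [germR_sum fun e => (h.metric _ _).mul (h.contDiffAt_riemannUp _ _ _ _)]
  refine Finset.sum_congr rfl fun e _ => ?_
  rw [germR_mul (h.metric _ _) (h.contDiffAt_riemannUp _ _ _ _), h.riemannUpG_eq]
  rfl

theorem SmoothMetric.ricciG_eq (h : SmoothMetric g p) (a b : Fin 4) :
    germR p (ricci g a b) = ricA (riemUpA (SmoothGerm.der p) (chrG g p)) a b := by
  unfold ricci ricA
  rw [germR_sum fun e => (h.contDiffAt_riemannUp _ _ _ _)]
  exact Finset.sum_congr rfl fun e _ => h.riemannUpG_eq _ _ _ _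

theorem SmoothMetric.scalarG_eq (h : SmoothMetric g p) :
    germR p (scalarCurv g)
      = scA (giG g p) (ricA (riemUpA (SmoothGerm.der p) (chrG g p))) := by
  unfold scalarCurv scA
  rw [germR_sum fun a => ContDiffAt.sum fun b _ => (h.inverse _ _).mul (h.contDiffAt_ricci _ _)]
  refine Finset.sum_congr rfl fun a _ => ?_
  rw [germR_sum fun b => (h.inverse _ _).mul (h.contDiffAt_ricci _ _)]
  refine Finset.sum_congr rfl fun b _ => ?_
  rw [germR_mul (h.inverse _ _) (h.contDiffAt_ricci _ _), h.ricciG_eq]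
  rfl

theorem SmoothMetric.weylG_eq (h : SmoothMetric g p) (a b c d : Fin 4) :
    weylG g p a b c d = weylA (gG g p)
      (riemA (gG g p) (riemUpA (SmoothGerm.der p) (chrG g p)))
      (ricA (riemUpA (SmoothGerm.der p) (chrG g p)))
      (scA (giG g p) (ricA (riemUpA (SmoothGerm.der p) (chrG g p)))) a b c d := by
  have h1 := h.metric
  have h2 := h.contDiffAt_ricci
  have h3 := h.contDiffAt_scalarCurv
  have h4 := h.contDiffAt_riemann
  have m2 := fun a b c d => (h1 a b).mul (h2 c d)
  have m1 := fun a b c d => (h1 a b).mul (h1 c d)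
  unfold weylG weyl
  -- Reassociation brings `1/6 * s * (...)` to the shape of a constant times a function, matching
  -- the scalar action in `weylA`.
  simp only [mul_assoc]
  rw [germR_add (by fun_prop) (by fun_prop), germR_sub (by fun_prop) (by fun_prop),
    germR_const_mul _ (by fun_prop), germR_const_mul _ (by fun_prop),
    germR_mul (by fun_prop) (by fun_prop), germR_add (by fun_prop) (by fun_prop),
    germR_sub (by fun_prop) (by fun_prop), germR_sub (by fun_prop) (by fun_prop),
    germR_sub (by fun_prop) (by fun_prop), germR_mul (h1 _ _) (h2 _ _), germR_mul (h1 _ _) (h2 _ _),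
    germR_mul (h1 _ _) (h2 _ _), germR_mul (h1 _ _) (h2 _ _), germR_mul (h1 _ _) (h1 _ _),
    germR_mul (h1 _ _) (h1 _ _), h.riemannG_eq, h.scalarG_eq]
  simp only [h.ricciG_eq]
  unfold weylA gG
  push_cast
  rfl

theorem SmoothMetric.contDiffAt_covWeyl (h : SmoothMetric g p) (a b c d e : Fin 4) :
    ContDiffAt ℝ ∞ (covWeyl g a b c d e) p := by
  have h1 := h.contDiffAt_christoffel
  have h2 := h.contDiffAt_weyl
  refine (contDiffAt_pd (h2 _ _ _ _) _).sub (ContDiffAt.sum fun k _ => ?_)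
  fun_prop

theorem SmoothMetric.covWeylG_eq (h : SmoothMetric g p) (a b c d e : Fin 4) :
    germR p (covWeyl g a b c d e)
      = covA (SmoothGerm.der p) (chrG g p) (weylG g p) a b c d e := by
  have h1 := h.contDiffAt_christoffel
  have h2 := h.contDiffAt_weyl
  have m := fun a b c a' b' c' d' => (h1 a b c).mul (h2 a' b' c' d')
  unfold covWeyl covA
  rw [germR_sub (contDiffAt_pd (h2 _ _ _ _) _) (ContDiffAt.sum fun k _ => by fun_prop),
    germR_sum fun k => by fun_prop, ← der_germR (h2 _ _ _ _)]
  congr 1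
  refine Finset.sum_congr rfl fun k _ => ?_
  rw [germR_add (by fun_prop) (m _ _ _ _ _ _ _), germR_add (by fun_prop) (m _ _ _ _ _ _ _),
    germR_add (m _ _ _ _ _ _ _) (m _ _ _ _ _ _ _), germR_mul (h1 _ _ _) (h2 _ _ _ _),
    germR_mul (h1 _ _ _) (h2 _ _ _ _), germR_mul (h1 _ _ _) (h2 _ _ _ _),
    germR_mul (h1 _ _ _) (h2 _ _ _ _)]
  rfl

end transfer

/-! ## Moving frames over a differential ring -/

section frames

variable {A : Type*} [CommRing A] [Algebra ℂ A] {D : Fin 4 → Derivation ℂ A A}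
  {g gi : Fin 4 → Fin 4 → A} {Γ : Fin 4 → Fin 4 → Fin 4 → A}

/-- The directional derivative along a vector. -/
def dirD (D : Fin 4 → Derivation ℂ A A) (X : Fin 4 → A) (f : A) : A := ∑ c, X c * D c f

/-- The covariant derivative of a vector along a coordinate direction. -/
def nab (D : Fin 4 → Derivation ℂ A A) (Γ : Fin 4 → Fin 4 → Fin 4 → A) (c : Fin 4)
    (X : Fin 4 → A) (a : Fin 4) : A := D c (X a) + ∑ b, Γ a c b * X b

/-- The covariant derivative of a vector along a vector. -/
def nabV (D : Fin 4 → Derivation ℂ A A) (Γ : Fin 4 → Fin 4 → Fin 4 → A) (Y X : Fin 4 → A)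
    (a : Fin 4) : A := ∑ c, Y c * nab D Γ c X a

/-- The inner product of vectors. -/
def ip (g : Fin 4 → Fin 4 → A) (X Y : Fin 4 → A) : A := ∑ a, ∑ b, g a b * X a * Y b

/-- Metric connections. -/
def Compat (D : Fin 4 → Derivation ℂ A A) (g : Fin 4 → Fin 4 → A)
    (Γ : Fin 4 → Fin 4 → Fin 4 → A) : Prop :=
  ∀ a b c, D c (g a b) = ∑ e, (Γ e c a * g e b + Γ e c b * g a e)

theorem chrA_symm (hg : ∀ a b, g a b = g b a) (a b c : Fin 4) :
    chrA D g gi a b c = chrA D g gi a c b := by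
  unfold chrA
  congr 1
  refine Finset.sum_congr rfl fun e _ => ?_
  rw [hg b c]; ring

theorem lower_chrA (hinv : ∀ a b, ∑ c, g a c * gi c b = if a = b then 1 else 0)
    (a b c : Fin 4) : ∑ e, g a e * chrA D g gi e b c
      = (1 / 2 : ℂ) • (D b (g a c) + D c (g a b) - D a (g b c)) := by
  simp only [chrA, Algebra.mul_smul_comm, ← Finset.smul_sum, Finset.mul_sum]
  rw [Finset.sum_comm]
  have : ∀ f : Fin 4, ∑ e, g a e * (gi e f * (D b (g f c) + D c (g f b) - D f (g b c)))
      = (if a = f then 1 else 0) * (D b (g f c) + D c (g f b) - D f (g b c)) := by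
    intro f; rw [← hinv, Finset.sum_mul]; exact Finset.sum_congr rfl fun _ _ => by ring
  simp only [this]
  simp

/-- The two lowered Christoffel symbols are Koszul expressions; in their sum the terms
differentiated along a and b cancel and D_c g_ab remains, counted twice with the factor 1/2. -/
theorem chrA_compat (hg : ∀ a b, g a b = g b a)
    (hinv : ∀ a b, ∑ c, g a c * gi c b = if a = b then 1 else 0) :
    Compat D g (chrA D g gi) := by
  intro a b c
  have h1 := lower_chrA (D := D) hinv b c a
  have h2 := lower_chrA (D := D) hinv a c b
  rw [Finset.sum_add_distrib]
  have e1 : ∑ e, chrA D g gi e c a * g e b = ∑ e, g b e * chrA D g gi e c a :=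
    Finset.sum_congr rfl fun e _ => by rw [hg e b, mul_comm]
  have e2 : ∑ e, chrA D g gi e c b * g a e = ∑ e, g a e * chrA D g gi e c b :=
    Finset.sum_congr rfl fun e _ => by rw [mul_comm]
  rw [e1, e2, h1, h2, ← smul_add, hg b a, hg c a, hg c b]
  have : D c (g a b) + D a (g b c) - D b (g a c) + (D c (g a b) + D b (g a c) - D a (g b c))
      = (2 : ℂ) • D c (g a b) := by rw [two_smul]; ring
  rw [this, smul_smul]; norm_num

theorem der_ip (h : Compat D g Γ) (c : Fin 4) (X Y : Fin 4 → A) :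
    D c (ip g X Y) = ip g (nab D Γ c X) Y + ip g X (nab D Γ c Y) := by
  have e : ∀ a b, D c (g a b) = ∑ e, (Γ e c a * g e b + Γ e c b * g a e) := fun a b => h a b c
  simp only [ip, nab, map_sum, Derivation.leibniz, smul_eq_mul, e]
  simp only [Fin.sum_univ_four]
  ring

theorem ip_comm (hg : ∀ a b, g a b = g b a) (X Y : Fin 4 → A) : ip g X Y = ip g Y X := by
  unfold ip
  rw [Finset.sum_comm]
  exact Finset.sum_congr rfl fun a _ => Finset.sum_congr rfl fun b _ => by rw [hg b a]; ring

theorem ip_sum_smul_left {ι : Type*} (s : Finset ι) (f : ι → A) (X : ι → Fin 4 → A)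
    (Y : Fin 4 → A) : ip g (fun a => ∑ c ∈ s, f c * X c a) Y = ∑ c ∈ s, f c * ip g (X c) Y := by
  simp only [ip, Finset.mul_sum, Finset.sum_mul]
  symm
  rw [Finset.sum_comm]
  refine Finset.sum_congr rfl fun a _ => ?_
  rw [Finset.sum_comm]
  exact Finset.sum_congr rfl fun b _ => Finset.sum_congr rfl fun c _ => by ring

theorem ip_sub_left (X X' Y : Fin 4 → A) :
    ip g (fun a => X a - X' a) Y = ip g X Y - ip g X' Y := by
  simp only [ip, mul_sub, sub_mul, Finset.sum_sub_distrib]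

theorem dirD_ip (hg : ∀ a b, g a b = g b a) (h : Compat D g Γ) (Z X Y : Fin 4 → A) :
    dirD D Z (ip g X Y) = ip g (nabV D Γ Z X) Y + ip g X (nabV D Γ Z Y) := by
  unfold dirD
  simp_rw [der_ip h, mul_add, Finset.sum_add_distrib]
  rw [ip_comm hg X (nabV D Γ Z Y)]
  simp_rw [ip_comm hg X (nab D Γ _ Y)]
  unfold nabV
  rw [ip_sum_smul_left, ip_sum_smul_left]

theorem nab_nab (hc : ∀ i j f, D i (D j f) = D j (D i f)) (c d : Fin 4) (X : Fin 4 → A)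
    (a : Fin 4) : nab D Γ c (nab D Γ d X) a - nab D Γ d (nab D Γ c X) a
      = ∑ b, riemUpA D Γ a b c d * X b := by
  simp only [nab, riemUpA, map_add, map_sum, Derivation.leibniz, smul_eq_mul, hc c d]
  simp only [Fin.sum_univ_four]
  ring

/-- The opposite leg in a null frame. -/
def opp : Fin 4 → Fin 4 := ![1, 0, 3, 2]
/-- The nonzero inner products of the frame. -/
def epC : Fin 4 → ℂ := ![-2, -2, 2, 2]
/-- The inverses of the nonzero inner products of the frame. -/
def wtC : Fin 4 → ℂ := ![-(1 / 2), -(1 / 2), 1 / 2, 1 / 2]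

theorem opp_opp (i : Fin 4) : opp (opp i) = i := by fin_cases i <;> rfl
theorem epC_opp (i : Fin 4) : epC (opp i) = epC i := by fin_cases i <;> rfl
theorem epC_mul_wtC (i : Fin 4) : epC i * wtC i = 1 := by fin_cases i <;> simp [epC, wtC]

/-- A null frame with connection coefficients `γ^k_{ij}`, `∇_{E_j} E_i = γ^k_{ij} E_k`. -/
structure NullFrame (D : Fin 4 → Derivation ℂ A A) (g : Fin 4 → Fin 4 → A)
    (E : Fin 4 → Fin 4 → A) (γ : Fin 4 → Fin 4 → Fin 4 → A) : Prop where
  gram : ∀ i j, ip g (E i) (E j) = if j = opp i then algebraMap ℂ A (epC i) else 0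
  torsion : ∀ i j a, dirD D (E j) (E i a) - dirD D (E i) (E j a)
    = ∑ k, (γ k i j - γ k j i) * E k a
  metric : ∀ i j k, epC k • γ (opp k) i j + epC i • γ (opp i) k j = 0

variable {E : Fin 4 → Fin 4 → A} {γ : Fin 4 → Fin 4 → Fin 4 → A}

/-- The Gram relations say that the matrix of the legs times the matrix of the weighted lowered
opposite legs is 1. Over a commutative ring a one-sided inverse of a square matrix is two-sided,
which gives the completeness relation; uniqueness of the inverse of g then identifies `gi`. -/
theorem frame_inverse (hg : ∀ a b, g a b = g b a)
    (hinv : ∀ a b, ∑ c, g a c * gi c b = if a = b then 1 else 0)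
    (gram : ∀ i j, ip g (E i) (E j) = if j = opp i then algebraMap ℂ A (epC i) else 0) :
    (∀ a b, gi a b = ∑ i, wtC i • (E i a * E (opp i) b)) ∧
    (∀ a b, ∑ i, wtC i • (E i a * ∑ c, g b c * E (opp i) c) = if a = b then 1 else 0) := by
  set Em : Matrix (Fin 4) (Fin 4) A := Matrix.of E with hEm
  set G : Matrix (Fin 4) (Fin 4) A := Matrix.of g with hG
  set Gi : Matrix (Fin 4) (Fin 4) A := Matrix.of gi with hGi
  set F : Matrix (Fin 4) (Fin 4) A := Matrix.of fun a i => wtC i • ∑ c, g a c * E (opp i) c with hF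
  have h1 : Em * F = 1 := by
    ext i j
    simp only [Matrix.mul_apply, hEm, hF, Matrix.of_apply, Algebra.mul_smul_comm,
      ← Finset.smul_sum]
    have := gram i (opp j)
    simp only [ip] at this
    have e : ∑ a, E i a * ∑ c, g a c * E (opp j) c = ∑ a, ∑ b, g a b * E i a * E (opp j) b := by
      refine Finset.sum_congr rfl fun a _ => ?_
      rw [Finset.mul_sum]; exact Finset.sum_congr rfl fun b _ => by ring
    rw [e, this, Matrix.one_apply]
    by_cases hij : i = j
    · subst hij; rw [if_pos rfl, if_pos rfl, Algebra.smul_def, ← map_mul, mul_comm, epC_mul_wtC,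
        map_one]
    · rw [if_neg hij, if_neg, smul_zero]
      intro h; apply hij; rw [← opp_opp i, ← h, opp_opp]
  have h2 : F * Em = 1 := mul_eq_one_comm.1 h1
  have h3 : G * Gi = 1 := by
    ext a b; simp only [Matrix.mul_apply, hG, hGi, Matrix.of_apply, hinv, Matrix.one_apply]
  have key : ∀ a b, ∑ i, wtC i • (E i a * ∑ c, g b c * E (opp i) c) = if a = b then 1 else 0 := by
    intro a b
    have := congrFun (congrFun h2 b) a
    rw [Matrix.mul_apply, Matrix.one_apply] at this
    simp only [hEm, hF, Matrix.of_apply] at this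
    rw [show (if a = b then (1 : A) else 0) = if b = a then 1 else 0 by simp [eq_comm], ← this]
    exact Finset.sum_congr rfl fun i _ => by rw [Algebra.smul_mul_assoc, mul_comm]
  refine ⟨?_, key⟩
  set H : Matrix (Fin 4) (Fin 4) A := Matrix.of fun a b => ∑ i, wtC i • (E i a * E (opp i) b)
    with hH
  have h4 : H * G = 1 := by
    ext a b
    rw [Matrix.one_apply, ← key a b, Matrix.mul_apply]
    simp only [hH, hG, Matrix.of_apply, Finset.sum_mul, Finset.mul_sum, Finset.smul_sum]
    rw [Finset.sum_comm]
    refine Finset.sum_congr rfl fun i _ => Finset.sum_congr rfl fun c _ => ?_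
    rw [hg b c, Algebra.smul_mul_assoc, mul_assoc, mul_comm (g c b)]
  have h5 : Gi = H := by
    calc Gi = (H * G) * Gi := by rw [h4, one_mul]
      _ = H := by rw [mul_assoc, h3, mul_one]
  intro a b
  exact congrFun (congrFun h5 a) b

theorem eq_zero_of_add_self {x : A} (h : x + x = 0) : x = 0 := by
  have h2 : (2 : ℂ) • x = 0 := by rw [two_smul, h]
  have : ((2 : ℂ)⁻¹ * 2) • x = 0 := by rw [mul_smul, h2, smul_zero]
  simpa using this

theorem eq_zero_of_ip_frame
    (key : ∀ a b, ∑ i, wtC i • (E i a * ∑ c, g b c * E (opp i) c) = if a = b then 1 else 0)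
    {Y : Fin 4 → A} (h : ∀ k, ip g Y (E k) = 0) (a : Fin 4) : Y a = 0 := by
  have e : Y a = ∑ b, (if a = b then 1 else 0) * Y b := by simp
  have e2 : ∀ i, ∑ b, (wtC i • (E i a * ∑ c, g b c * E (opp i) c)) * Y b
      = wtC i • (E i a * ip g Y (E (opp i))) := by
    intro i
    simp only [ip, Algebra.smul_mul_assoc, Finset.smul_sum, Finset.mul_sum, Finset.sum_mul]
    exact Finset.sum_congr rfl fun b _ => Finset.sum_congr rfl fun c _ => by
      congr 1; ring
  rw [e]
  simp_rw [← key a, Finset.sum_mul]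
  rw [Finset.sum_comm]
  simp only [e2, h, mul_zero, smul_zero, Finset.sum_const_zero]

/-- The connection coefficients of a null frame compute the Levi-Civita derivatives. -/
theorem NullFrame.nabV_eq (hE : NullFrame D g E γ) (hg : ∀ a b, g a b = g b a)
    (hinv : ∀ a b, ∑ c, g a c * gi c b = if a = b then 1 else 0) (hΓ : Compat D g Γ)
    (hs : ∀ a b c, Γ a b c = Γ a c b) (i j a : Fin 4) :
    nabV D Γ (E j) (E i) a = ∑ k, γ k i j * E k a := by
  -- X is the lowered difference between the Levi-Civita derivative of the legs and the proposed
  -- coefficients γ. Metricity makes it antisymmetric in (k,i), vanishing torsion makes it symmetric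
  -- in (i,j).
  set X : Fin 4 → Fin 4 → Fin 4 → A := fun k i j =>
    ip g (fun a => nabV D Γ (E j) (E i) a - ∑ m, γ m i j * E m a) (E k) with hX
  have hX' : ∀ k i j, X k i j = ip g (nabV D Γ (E j) (E i)) (E k)
      - epC k • γ (opp k) i j := by
    intro k i j
    simp only [hX]
    rw [ip_sub_left, ip_sum_smul_left]
    congr 1
    simp only [hE.gram]
    rw [Finset.sum_eq_single (opp k)]
    · rw [opp_opp, if_pos rfl, epC_opp, Algebra.smul_def, mul_comm]
    · intro b _ hb
      rw [if_neg, mul_zero]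
      intro h; apply hb; rw [h, opp_opp]
    · simp
  have h1 : ∀ k i j, X k i j = -X i k j := by
    intro k i j
    have e1 := dirD_ip hg hΓ (E j) (E i) (E k)
    have e2 := hE.metric i j k
    rw [hE.gram] at e1
    have e3 : dirD D (E j) (if k = opp i then algebraMap ℂ A (epC i) else 0) = 0 := by
      split_ifs <;> simp [dirD]
    rw [e3, ip_comm hg (E i)] at e1
    rw [hX', hX']
    linear_combination (-1 : A) * e1 - e2
  have h2 : ∀ k i j, X k i j = X k j i := by
    intro k i j
    have e : ∀ a, nabV D Γ (E j) (E i) a - nabV D Γ (E i) (E j) a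
        = dirD D (E j) (E i a) - dirD D (E i) (E j a) := by
      intro a
      simp only [nabV, nab, dirD, mul_add, Finset.sum_add_distrib, Finset.mul_sum]
      have : ∑ c, ∑ b, E j c * (Γ a c b * E i b) = ∑ c, ∑ b, E i c * (Γ a c b * E j b) := by
        rw [Finset.sum_comm]
        exact Finset.sum_congr rfl fun c _ => Finset.sum_congr rfl fun b _ => by
          rw [hs a b c]; ring
      rw [this]; ring
    simp only [hX]
    congr 1
    funext a
    have e1 := e a
    rw [hE.torsion] at e1
    simp only [sub_mul, Finset.sum_sub_distrib] at e1
    linear_combination e1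
  -- Alternating the two symmetries six times returns to the same index triple with the opposite
  -- sign, so 2X = 0.
  have h3 : ∀ k i j, X k i j = 0 := by
    intro k i j
    apply eq_zero_of_add_self
    linear_combination h1 k i j - h2 i k j - h1 i j k + h2 j i k + h1 j k i - h2 k j i
  have key := (frame_inverse hg hinv hE.gram).2
  have := eq_zero_of_ip_frame key (Y := fun a => nabV D Γ (E j) (E i) a - ∑ m, γ m i j * E m a)
    (fun k => h3 k i j) a
  exact sub_eq_zero.1 this

/-- The components of the curvature in a frame. -/
def curvF (D : Fin 4 → Derivation ℂ A A) (E : Fin 4 → Fin 4 → A)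
    (γ : Fin 4 → Fin 4 → Fin 4 → A) (m j k l : Fin 4) : A :=
  dirD D (E k) (γ m j l) - dirD D (E l) (γ m j k)
    + ∑ n, (γ m n k * γ n j l - γ m n l * γ n j k) - ∑ n, (γ n l k - γ n k l) * γ m j n

theorem nabV_sum_smul (Z : Fin 4 → A) (f : Fin 4 → A) (X : Fin 4 → Fin 4 → A) (a : Fin 4) :
    nabV D Γ Z (fun a => ∑ m, f m * X m a) a
      = ∑ m, (dirD D Z (f m) * X m a + f m * nabV D Γ Z (X m) a) := by
  simp only [nabV, nab, dirD, map_sum, Derivation.leibniz, smul_eq_mul]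
  simp only [Fin.sum_univ_four]
  ring

/-- The Ricci identity along arbitrary vector fields: the coordinate commutator `nab_nab` supplies
the curvature, and differentiating the coefficients of Y and Z supplies the derivative along their
bracket. -/
theorem nabV_nabV (hc : ∀ i j f, D i (D j f) = D j (D i f)) (Y Z X : Fin 4 → A) (a : Fin 4) :
    nabV D Γ Y (nabV D Γ Z X) a - nabV D Γ Z (nabV D Γ Y X) a
      = ∑ d, (dirD D Y (Z d) - dirD D Z (Y d)) * nab D Γ d X a
        + ∑ b, ∑ c, ∑ d, riemUpA D Γ a b c d * X b * Y c * Z d := by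
  have e1 : ∀ Y Z : Fin 4 → A, nabV D Γ Y (nabV D Γ Z X) a
      = ∑ d, dirD D Y (Z d) * nab D Γ d X a
        + ∑ c, ∑ d, Y c * Z d * nab D Γ c (nab D Γ d X) a := by
    intro Y Z
    have := nabV_sum_smul (D := D) (Γ := Γ) Y Z (fun d => nab D Γ d X) a
    unfold nabV at this ⊢
    rw [this, Finset.sum_add_distrib]
    congr 1
    simp only [Finset.mul_sum]
    rw [Finset.sum_comm]
    exact Finset.sum_congr rfl fun c _ => Finset.sum_congr rfl fun b _ => by ring
  have e2 : ∑ b, ∑ c, ∑ d, riemUpA D Γ a b c d * X b * Y c * Z d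
      = ∑ c, ∑ d, Y c * Z d * (nab D Γ c (nab D Γ d X) a - nab D Γ d (nab D Γ c X) a) := by
    simp_rw [nab_nab hc, Finset.mul_sum]
    rw [Finset.sum_comm]
    refine Finset.sum_congr rfl fun c _ => ?_
    rw [Finset.sum_comm]
    exact Finset.sum_congr rfl fun b _ => Finset.sum_congr rfl fun c _ => by ring
  have e3 : ∑ c, ∑ d, Z c * Y d * nab D Γ c (nab D Γ d X) a
      = ∑ c, ∑ d, Y c * Z d * nab D Γ d (nab D Γ c X) a := by
    rw [Finset.sum_comm]
    exact Finset.sum_congr rfl fun b _ => Finset.sum_congr rfl fun c _ => by ring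
  rw [e1, e1, e2, e3]
  simp only [sub_mul, mul_sub, Finset.sum_sub_distrib]
  ring

/-- Cartan's second structure equation. Both iterated derivatives of a leg are expanded with γ, and
the bracket of two legs is rewritten with the torsion equation; this produces the last sum in
`curvF`. -/
theorem NullFrame.curv_eq (hE : NullFrame D g E γ) (hc : ∀ i j f, D i (D j f) = D j (D i f))
    (hn : ∀ i j a, nabV D Γ (E j) (E i) a = ∑ k, γ k i j * E k a) (j k l a : Fin 4) :
    ∑ b, ∑ c, ∑ d, riemUpA D Γ a b c d * E j b * E k c * E l d
      = ∑ m, curvF D E γ m j k l * E m a := by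
  have h1 := nabV_nabV (Γ := Γ) hc (E k) (E l) (E j) a
  have hn' : ∀ i j, nabV D Γ (E j) (E i) = fun a => ∑ k, γ k i j * E k a :=
    fun i j => funext (hn i j)
  have h2 : ∑ d, (dirD D (E k) (E l d) - dirD D (E l) (E k d)) * nab D Γ d (E j) a
      = ∑ n, (γ n l k - γ n k l) * ∑ m, γ m j n * E m a := by
    simp_rw [hE.torsion, ← hn, nabV, Finset.sum_mul, Finset.mul_sum]
    rw [Finset.sum_comm]
    exact Finset.sum_congr rfl fun b _ => Finset.sum_congr rfl fun c _ => by ring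
  rw [h2, hn', hn', nabV_sum_smul, nabV_sum_smul] at h1
  simp only [hn] at h1
  rw [← sub_eq_iff_eq_add'] at h1
  rw [← h1]
  simp only [curvF, Fin.sum_univ_four]
  ring

end frames

/-! ## Frame components of tensors -/

section components

variable {A : Type*} [CommRing A] [Algebra ℂ A] {D : Fin 4 → Derivation ℂ A A}
  {gi : Fin 4 → Fin 4 → A} {Γ : Fin 4 → Fin 4 → Fin 4 → A}
  {E : Fin 4 → Fin 4 → A} {γ : Fin 4 → Fin 4 → Fin 4 → A}

/-- The value of a four-index tensor on vectors. -/
def ten4 (C : Fin 4 → Fin 4 → Fin 4 → Fin 4 → A) (X Y Z W : Fin 4 → A) : A :=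
  ∑ a, X a * ∑ b, Y b * ∑ c, Z c * ∑ d, W d * C a b c d

/-- The Leibniz rule for a single slot, with a connection term added and subtracted. Four
applications give `der_ten4` without expanding a sum over all four indices. -/
theorem der_slot (e : Fin 4) (X f : Fin 4 → A) :
    D e (∑ a, X a * f a) = ∑ a, nab D Γ e X a * f a
      + (∑ a, X a * D e (f a) - ∑ a, X a * ∑ h, Γ h e a * f h) := by
  simp only [nab, map_add, Derivation.leibniz, smul_eq_mul, Fin.sum_univ_four]
  ring

theorem sum_push (r Y : Fin 4 → A) (F : Fin 4 → Fin 4 → A) :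
    ∑ h, r h * ∑ b, Y b * F h b = ∑ b, Y b * ∑ h, r h * F h b := by
  simp only [Finset.mul_sum]
  rw [Finset.sum_comm]
  exact Finset.sum_congr rfl fun b _ => Finset.sum_congr rfl fun c _ => by ring

theorem sum_push₂ (r X Y : Fin 4 → A) (F : Fin 4 → Fin 4 → Fin 4 → A) :
    ∑ h, r h * ∑ a, X a * ∑ b, Y b * F h a b = ∑ a, X a * ∑ b, Y b * ∑ h, r h * F h a b := by
  rw [sum_push]
  exact Finset.sum_congr rfl fun a _ => by rw [sum_push]

theorem sum_push₃ (r X Y Z : Fin 4 → A) (F : Fin 4 → Fin 4 → Fin 4 → Fin 4 → A) :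
    ∑ h, r h * ∑ a, X a * ∑ b, Y b * ∑ c, Z c * F h a b c
      = ∑ a, X a * ∑ b, Y b * ∑ c, Z c * ∑ h, r h * F h a b c := by
  rw [sum_push]
  exact Finset.sum_congr rfl fun a _ => by rw [sum_push₂]

theorem der_ten4 (C : Fin 4 → Fin 4 → Fin 4 → Fin 4 → A) (e : Fin 4) (X Y Z W : Fin 4 → A) :
    D e (ten4 C X Y Z W) = ten4 (fun a b c d => covA D Γ C a b c d e) X Y Z W
      + (ten4 C (nab D Γ e X) Y Z W + ten4 C X (nab D Γ e Y) Z W + ten4 C X Y (nab D Γ e Z) W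
        + ten4 C X Y Z (nab D Γ e W)) := by
  have e1 : ten4 (fun a b c d => covA D Γ C a b c d e) X Y Z W
      = ∑ a, X a * ∑ b, Y b * ∑ c, Z c * ∑ d, W d * D e (C a b c d)
      - ∑ a, X a * ∑ b, Y b * ∑ c, Z c * ∑ d, W d * ∑ h, Γ h e a * C h b c d
      - ∑ a, X a * ∑ b, Y b * ∑ c, Z c * ∑ d, W d * ∑ h, Γ h e b * C a h c d
      - ∑ a, X a * ∑ b, Y b * ∑ c, Z c * ∑ d, W d * ∑ h, Γ h e c * C a b h d
      - ∑ a, X a * ∑ b, Y b * ∑ c, Z c * ∑ d, W d * ∑ h, Γ h e d * C a b c h := by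
    simp only [ten4, covA, Finset.sum_add_distrib, mul_sub, mul_add, Finset.sum_sub_distrib]
    ring
  rw [e1]
  simp only [ten4]
  rw [der_slot (Γ := Γ)]
  simp_rw [der_slot (Γ := Γ) (D := D) e Y, der_slot (Γ := Γ) (D := D) e Z,
    der_slot (Γ := Γ) (D := D) e W, sum_push₃ (fun h => Γ h e _), sum_push₂ (fun h => Γ h e _),
    sum_push (fun h => Γ h e _), mul_add, mul_sub, Finset.sum_add_distrib,
    Finset.sum_sub_distrib, mul_add, mul_sub, Finset.sum_add_distrib,
    Finset.sum_sub_distrib, mul_add, mul_sub, Finset.sum_add_distrib, Finset.sum_sub_distrib]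
  ring

theorem slot_sum (r f : Fin 4 → A) (X : Fin 4 → Fin 4 → A) :
    ∑ a, (∑ m, r m * X m a) * f a = ∑ m, r m * ∑ a, X m a * f a := by
  simp only [Finset.mul_sum, Finset.sum_mul]
  rw [Finset.sum_comm]
  exact Finset.sum_congr rfl fun b _ => Finset.sum_congr rfl fun c _ => by ring

theorem ten4_sum₁ (C : Fin 4 → Fin 4 → Fin 4 → Fin 4 → A) (r : Fin 4 → A) (X : Fin 4 → Fin 4 → A)
    (Y Z W : Fin 4 → A) : ten4 C (fun a => ∑ m, r m * X m a) Y Z W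
      = ∑ m, r m * ten4 C (X m) Y Z W := slot_sum _ _ _

theorem ten4_sum₂ (C : Fin 4 → Fin 4 → Fin 4 → Fin 4 → A) (r : Fin 4 → A) (X : Fin 4 → Fin 4 → A)
    (Y Z W : Fin 4 → A) : ten4 C Y (fun a => ∑ m, r m * X m a) Z W
      = ∑ m, r m * ten4 C Y (X m) Z W := by
  simp only [ten4, slot_sum]
  exact (sum_push r Y _).symm

theorem ten4_sum₃ (C : Fin 4 → Fin 4 → Fin 4 → Fin 4 → A) (r : Fin 4 → A) (X : Fin 4 → Fin 4 → A)
    (Y Z W : Fin 4 → A) : ten4 C Y Z (fun a => ∑ m, r m * X m a) W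
      = ∑ m, r m * ten4 C Y Z (X m) W := by
  simp only [ten4, slot_sum]
  exact (sum_push₂ r Y Z _).symm

theorem ten4_sum₄ (C : Fin 4 → Fin 4 → Fin 4 → Fin 4 → A) (r : Fin 4 → A) (X : Fin 4 → Fin 4 → A)
    (Y Z W : Fin 4 → A) : ten4 C Y Z W (fun a => ∑ m, r m * X m a)
      = ∑ m, r m * ten4 C Y Z W (X m) := by
  simp only [ten4, slot_sum]
  exact (sum_push₃ r Y Z W _).symm

/-- Frame components of a four-index tensor. -/
def fr4 (E : Fin 4 → Fin 4 → A) (C : Fin 4 → Fin 4 → Fin 4 → Fin 4 → A) (i j k l : Fin 4) : A :=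
  ten4 C (E i) (E j) (E k) (E l)

/-- Frame components of a five-index tensor. -/
def fr5 (E : Fin 4 → Fin 4 → A) (T : Fin 4 → Fin 4 → Fin 4 → Fin 4 → Fin 4 → A)
    (i j k l h : Fin 4) : A := ∑ e, E h e * fr4 E (fun a b c d => T a b c d e) i j k l

/-- The algebraic derivative of frame components: a derivative corrected by a matrix acting on
every index. -/
def actF (M : Fin 4 → Fin 4 → A) (d : A → A) (C : Fin 4 → Fin 4 → Fin 4 → Fin 4 → A)
    (i j k l : Fin 4) : A :=
  d (C i j k l) - ∑ m, (M m i * C m j k l + M m j * C i m k l + M m k * C i j m l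
    + M m l * C i j k m)

/-- In frame components a covariant derivative is the directional derivative corrected by γ in each
slot: the derivatives of the legs themselves are linear combinations of the legs. -/
theorem fr5_covA (hn : ∀ i j a, nabV D Γ (E j) (E i) a = ∑ k, γ k i j * E k a)
    (C : Fin 4 → Fin 4 → Fin 4 → Fin 4 → A) (i j k l h : Fin 4) :
    fr5 E (covA D Γ C) i j k l h
      = actF (fun m i => γ m i h) (dirD D (E h)) (fr4 E C) i j k l := by
  have hn' : ∀ i j, (fun a => ∑ c, E j c * nab D Γ c (E i) a) = fun a => ∑ k, γ k i j * E k a :=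
    fun i j => funext (hn i j)
  have s1 := fun Y Z W => ten4_sum₁ C (E h) (fun c => nab D Γ c (E i)) Y Z W
  have s2 := fun Y Z W => ten4_sum₂ C (E h) (fun c => nab D Γ c (E j)) Y Z W
  have s3 := fun Y Z W => ten4_sum₃ C (E h) (fun c => nab D Γ c (E k)) Y Z W
  have s4 := fun Y Z W => ten4_sum₄ C (E h) (fun c => nab D Γ c (E l)) Y Z W
  rw [hn'] at s1 s2 s3 s4
  simp only [ten4_sum₁, ten4_sum₂, ten4_sum₃, ten4_sum₄] at s1 s2 s3 s4
  unfold fr5 actF dirD fr4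
  simp_rw [der_ten4 (Γ := Γ) C, mul_add, Finset.sum_add_distrib]
  rw [← s1, ← s2, ← s3, ← s4]
  ring

/-- Nested index sums become one sum over functions on `Fin n`, so that `contract_frame` can be
proved for every rank at once and then specialised to ranks 2, 4 and 5. -/
theorem sum_fun_succ {ι : Type*} [Fintype ι] {n : ℕ} {B : Type*} [AddCommMonoid B]
    (f : (Fin (n + 1) → ι) → B) : ∑ x, f x = ∑ a, ∑ y : Fin n → ι, f (Matrix.vecCons a y) := by
  rw [← Fintype.sum_prod_type']
  exact (Fintype.sum_equiv (Fin.consEquiv (fun _ => ι)) _ _ fun _ => rfl).symm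

theorem sum_fun_zero {ι : Type*} [Fintype ι] {B : Type*} [AddCommMonoid B]
    (f : (Fin 0 → ι) → B) : ∑ x, f x = f ![] := by
  rw [Fintype.sum_unique]; congr 1

theorem sum_fun_four {ι : Type*} [Fintype ι] {B : Type*} [AddCommMonoid B]
    (f : (Fin 4 → ι) → B) : ∑ x, f x = ∑ a, ∑ b, ∑ c, ∑ d, f ![a, b, c, d] := by
  simp only [sum_fun_succ, sum_fun_zero]

theorem sum_fun_five {ι : Type*} [Fintype ι] {B : Type*} [AddCommMonoid B]
    (f : (Fin 5 → ι) → B) : ∑ x, f x = ∑ a, ∑ b, ∑ c, ∑ d, ∑ e, f ![a, b, c, d, e] := by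
  simp only [sum_fun_succ, sum_fun_zero]

/-- Full contractions are computed in a null frame by pairing opposite legs. -/
theorem contract_frame (hgi : ∀ a b, gi a b = ∑ i, wtC i • (E i a * E (opp i) b)) (n : ℕ)
    (X Y : (Fin n → Fin 4) → A) :
    ∑ x, ∑ y, (∏ s, gi (x s) (y s)) * (X x * Y y)
      = ∑ i : Fin n → Fin 4, (∏ s, wtC (i s)) • ((∑ x, (∏ s, E (i s) (x s)) * X x)
        * ∑ y, (∏ s, E (opp (i s)) (y s)) * Y y) := by
  have e : ∀ x y : Fin n → Fin 4, ∏ s, gi (x s) (y s)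
      = ∑ i : Fin n → Fin 4, (∏ s, wtC (i s)) • ((∏ s, E (i s) (x s)) * ∏ s, E (opp (i s)) (y s)) := by
    intro x y
    simp_rw [hgi]
    rw [Finset.prod_univ_sum, Fintype.piFinset_univ]
    refine Finset.sum_congr rfl fun i _ => ?_
    simp only [Algebra.smul_def, Finset.prod_mul_distrib, map_prod]
  conv_lhs => simp only [e, Finset.sum_mul]
  rw [Finset.sum_congr rfl fun x _ => Finset.sum_comm, Finset.sum_comm]
  refine Finset.sum_congr rfl fun i _ => ?_
  rw [Finset.sum_mul_sum, Finset.smul_sum]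
  refine Finset.sum_congr rfl fun x _ => ?_
  rw [Finset.smul_sum]
  refine Finset.sum_congr rfl fun y _ => ?_
  simp only [Algebra.smul_def]
  ring

/-- The full contraction of two four-index tensors. -/
def contr4 (gi : Fin 4 → Fin 4 → A) (C C' : Fin 4 → Fin 4 → Fin 4 → Fin 4 → A) : A :=
  ∑ a, ∑ b, ∑ c, ∑ d, C a b c d * ∑ a', ∑ b', ∑ c', ∑ d',
    gi a a' * gi b b' * gi c c' * gi d d' * C' a' b' c' d'

/-- The full contraction of two five-index tensors. -/
def contr5 (gi : Fin 4 → Fin 4 → A) (C C' : Fin 4 → Fin 4 → Fin 4 → Fin 4 → Fin 4 → A) : A :=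
  ∑ a, ∑ b, ∑ c, ∑ d, ∑ e, C a b c d e * ∑ a', ∑ b', ∑ c', ∑ d', ∑ e',
    gi a a' * gi b b' * gi c c' * gi d d' * gi e e' * C' a' b' c' d' e'

theorem contr4_frame (hgi : ∀ a b, gi a b = ∑ i, wtC i • (E i a * E (opp i) b))
    (C C' : Fin 4 → Fin 4 → Fin 4 → Fin 4 → A) :
    contr4 gi C C' = ∑ i, ∑ j, ∑ k, ∑ l, (wtC i * wtC j * wtC k * wtC l) •
      (fr4 E C i j k l * fr4 E C' (opp i) (opp j) (opp k) (opp l)) := by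
  have := contract_frame hgi 4 (fun x => C (x 0) (x 1) (x 2) (x 3))
    (fun x => C' (x 0) (x 1) (x 2) (x 3))
  simp only [sum_fun_four, Fin.prod_univ_four] at this
  simp only [Matrix.cons_val_zero, Matrix.cons_val_one, Matrix.cons_val] at this
  unfold contr4
  simp only [Finset.mul_sum]
  convert this using 1
  · refine Finset.sum_congr rfl fun a _ => Finset.sum_congr rfl fun b _ =>
      Finset.sum_congr rfl fun c _ => Finset.sum_congr rfl fun d _ =>
      Finset.sum_congr rfl fun a' _ => Finset.sum_congr rfl fun b' _ =>
      Finset.sum_congr rfl fun c' _ => Finset.sum_congr rfl fun d' _ => ?_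
    ring
  · refine Finset.sum_congr rfl fun i _ => Finset.sum_congr rfl fun j _ =>
      Finset.sum_congr rfl fun k _ => Finset.sum_congr rfl fun l _ => ?_
    simp only [fr4, ten4, Finset.mul_sum, mul_assoc]

theorem contr5_frame (hgi : ∀ a b, gi a b = ∑ i, wtC i • (E i a * E (opp i) b))
    (C C' : Fin 4 → Fin 4 → Fin 4 → Fin 4 → Fin 4 → A) :
    contr5 gi C C' = ∑ i, ∑ j, ∑ k, ∑ l, ∑ h, (wtC i * wtC j * wtC k * wtC l * wtC h) •
      (fr5 E C i j k l h * fr5 E C' (opp i) (opp j) (opp k) (opp l) (opp h)) := by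
  have key : ∀ (E' : Fin 4 → Fin 4 → A) (C : Fin 4 → Fin 4 → Fin 4 → Fin 4 → Fin 4 → A)
      (i j k l h : Fin 4), fr5 E' C i j k l h = ∑ a, ∑ b, ∑ c, ∑ d, ∑ e,
        E' i a * E' j b * E' k c * E' l d * E' h e * C a b c d e := by
    intro E' C i j k l h
    have h1 := sum_push (E' h) (E' i) (fun e a => ∑ b, E' j b * ∑ c, E' k c * ∑ d, E' l d *
      C a b c d e)
    have h2 := fun a => sum_push₃ (E' h) (E' j) (E' k) (E' l) (fun e b c d => C a b c d e)
    simp only [fr5, fr4, ten4, h1, h2]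
    simp only [Finset.mul_sum, mul_assoc]
  have h1 : contr5 gi C C' = ∑ x : Fin 5 → Fin 4, ∑ y : Fin 5 → Fin 4, (∏ s, gi (x s) (y s)) *
      (C (x 0) (x 1) (x 2) (x 3) (x 4) * C' (y 0) (y 1) (y 2) (y 3) (y 4)) := by
    rw [sum_fun_five]
    unfold contr5
    refine Finset.sum_congr rfl fun a _ => Finset.sum_congr rfl fun b _ =>
      Finset.sum_congr rfl fun c _ => Finset.sum_congr rfl fun d _ =>
      Finset.sum_congr rfl fun e _ => ?_
    rw [sum_fun_five, Finset.mul_sum]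
    refine Finset.sum_congr rfl fun a' _ => ?_
    rw [Finset.mul_sum]
    refine Finset.sum_congr rfl fun b' _ => ?_
    rw [Finset.mul_sum]
    refine Finset.sum_congr rfl fun c' _ => ?_
    rw [Finset.mul_sum]
    refine Finset.sum_congr rfl fun d' _ => ?_
    rw [Finset.mul_sum]
    refine Finset.sum_congr rfl fun e' _ => ?_
    rw [Fin.prod_univ_five]
    simp only [Matrix.cons_val_zero, Matrix.cons_val_one, Matrix.cons_val]
    ring
  rw [h1, contract_frame hgi 5 (fun x => C (x 0) (x 1) (x 2) (x 3) (x 4))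
    (fun x => C' (x 0) (x 1) (x 2) (x 3) (x 4)), sum_fun_five]
  refine Finset.sum_congr rfl fun i _ => Finset.sum_congr rfl fun j _ =>
    Finset.sum_congr rfl fun k _ => Finset.sum_congr rfl fun l _ =>
    Finset.sum_congr rfl fun h _ => ?_
  rw [key, key, sum_fun_five, sum_fun_five, Fin.prod_univ_five]
  simp only [Fin.prod_univ_five, Matrix.cons_val_zero, Matrix.cons_val_one, Matrix.cons_val]

end components

/-! ## Tensors built from self-dual and anti-self-dual bivectors -/

section bivectors

variable {A : Type*} [CommRing A] [Algebra ℂ A]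

/-- The frame components of the bivectors `V`, `W`, `U` and of their conjugates. -/
def bivZ : Fin 6 → Fin 4 → Fin 4 → ℤ :=
  ![![![0, 0, 1, 0], ![0, 0, 0, 0], ![-1, 0, 0, 0], ![0, 0, 0, 0]],
    ![![0, 1, 0, 0], ![-1, 0, 0, 0], ![0, 0, 0, -1], ![0, 0, 1, 0]],
    ![![0, 0, 0, 0], ![0, 0, 0, 1], ![0, 0, 0, 0], ![0, -1, 0, 0]],
    ![![0, 0, 0, 1], ![0, 0, 0, 0], ![0, 0, 0, 0], ![-1, 0, 0, 0]],
    ![![0, 1, 0, 0], ![-1, 0, 0, 0], ![0, 0, 0, 1], ![0, 0, -1, 0]],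
    ![![0, 0, 0, 0], ![0, 0, 1, 0], ![0, -1, 0, 0], ![0, 0, 0, 0]]]

/-- The bivectors as elements of the algebra. -/
def biv (a : Fin 6) (i j : Fin 4) : A := (bivZ a i j : A)

/-- The four-index tensor `P^{ab} S_a ⊗ S_b`. -/
def bivTab (P : Matrix (Fin 6) (Fin 6) A) (i j k l : Fin 4) : A :=
  ∑ a, ∑ b, P a b * (biv a i j * biv b k l)

/-- The signs of the frame inner products. -/
def sgZ : Fin 4 → ℤ := ![-1, -1, 1, 1]

theorem wtC_eq (i : Fin 4) : wtC i = (1 / 2 : ℂ) * (sgZ i : ℂ) := by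
  fin_cases i <;> simp [wtC, sgZ]

theorem wtC_smul (i : Fin 4) (x : A) : wtC i • x = (1 / 2 : ℂ) • ((sgZ i : A) * x) := by
  rw [wtC_eq, mul_smul]
  congr 1
  rw [Algebra.smul_def]; simp

/-- The index of the bivector dual to a given one. -/
def rev6 : Fin 6 → Fin 6 := ![2, 1, 0, 5, 4, 3]

/-- The inner products of dual bivectors. -/
def gZ : Fin 6 → ℤ := ![-2, -4, -2, -2, -4, -2]

/-- Each bivector pairs nontrivially with exactly one other, its dual under `rev6`. The components
are integers, so this is a finite check that can be cast into any ring afterwards. -/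
theorem bivZ_gram (a c : Fin 6) : ∑ i, ∑ j, sgZ i * sgZ j * (bivZ a i j * bivZ c (opp i) (opp j))
    = if c = rev6 a then gZ a else 0 := by
  revert a c; decide

theorem biv_gram (a c : Fin 6) :
    ∑ i, ∑ j, (sgZ i : A) * (sgZ j : A) * (biv a i j * biv c (opp i) (opp j))
    = if c = rev6 a then (gZ a : A) else 0 := by
  have := congrArg (Int.cast : ℤ → A) (bivZ_gram a c)
  push_cast at this
  exact this

/-- A tensor in its last two indices, contracted with its dual. -/
theorem bivTab_contract_right (P R : Matrix (Fin 6) (Fin 6) A) (i j i' j' : Fin 4) :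
    ∑ k, ∑ l, (sgZ k : A) * (sgZ l : A) * (bivTab P i j k l * bivTab R i' j' (opp k) (opp l))
      = ∑ a, ∑ c, (∑ b, (gZ b : A) * (P a b * R c (rev6 b))) * (biv a i j * biv c i' j') := by
  have e : ∀ k l, (sgZ k : A) * (sgZ l : A) * (bivTab P i j k l * bivTab R i' j' (opp k) (opp l))
      = ∑ a, ∑ c, ∑ b, ∑ d, (P a b * R c d * (biv a i j * biv c i' j'))
        * ((sgZ k : A) * (sgZ l : A) * (biv b k l * biv d (opp k) (opp l))) := by
    intro k l
    unfold bivTab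
    rw [Finset.sum_mul_sum, Finset.mul_sum]
    refine Finset.sum_congr rfl fun a _ => ?_
    rw [Finset.mul_sum]
    refine Finset.sum_congr rfl fun c _ => ?_
    rw [Finset.sum_mul_sum, Finset.mul_sum]
    refine Finset.sum_congr rfl fun b _ => ?_
    rw [Finset.mul_sum]
    exact Finset.sum_congr rfl fun d _ => by ring
  simp_rw [e]
  have sw : ∀ f : Fin 4 → Fin 4 → Fin 6 → Fin 6 → Fin 6 → Fin 6 → A,
      ∑ k, ∑ l, ∑ a, ∑ c, ∑ b, ∑ d, f k l a c b d
        = ∑ a, ∑ c, ∑ b, ∑ d, ∑ k, ∑ l, f k l a c b d := by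
    intro f
    have s1 : ∀ h : Fin 4 → Fin 4 → Fin 6 → A, ∑ k, ∑ l, ∑ a, h k l a = ∑ a, ∑ k, ∑ l, h k l a := by
      intro h
      rw [Finset.sum_congr rfl fun k _ => Finset.sum_comm, Finset.sum_comm]
    rw [s1]
    refine Finset.sum_congr rfl fun a _ => ?_
    rw [s1]
    refine Finset.sum_congr rfl fun c _ => ?_
    rw [s1]
    refine Finset.sum_congr rfl fun b _ => ?_
    rw [s1]
  rw [sw]
  refine Finset.sum_congr rfl fun a _ => Finset.sum_congr rfl fun c _ => ?_
  rw [Finset.sum_mul]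
  refine Finset.sum_congr rfl fun b _ => ?_
  simp_rw [← Finset.mul_sum, biv_gram]
  simp
  ring

/-- The full contraction of two tensors built from bivectors. -/
theorem bivTab_contract (P R : Matrix (Fin 6) (Fin 6) A) :
    ∑ i, ∑ j, ∑ k, ∑ l, (wtC i * wtC j * wtC k * wtC l) •
      (bivTab P i j k l * bivTab R (opp i) (opp j) (opp k) (opp l))
      = (1 / 16 : ℂ) • ∑ a, ∑ b, (gZ a : A) * (gZ b : A) * (P a b * R (rev6 a) (rev6 b)) := by
  have e : ∀ i j, ∑ k, ∑ l, (wtC i * wtC j * wtC k * wtC l) •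
      (bivTab P i j k l * bivTab R (opp i) (opp j) (opp k) (opp l))
      = (1 / 16 : ℂ) • ((sgZ i : A) * (sgZ j : A) * ∑ k, ∑ l, (sgZ k : A) * (sgZ l : A) *
        (bivTab P i j k l * bivTab R (opp i) (opp j) (opp k) (opp l))) := by
    intro i j
    rw [Finset.mul_sum, Finset.smul_sum]
    refine Finset.sum_congr rfl fun k _ => ?_
    rw [Finset.mul_sum, Finset.smul_sum]
    refine Finset.sum_congr rfl fun l _ => ?_
    have h16 : (1 / 16 : ℂ) = 1 / 2 * (1 / 2) * (1 / 2) * (1 / 2) := by norm_num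
    rw [h16]
    simp only [wtC_eq, Algebra.smul_def, map_mul, map_intCast]
    ring
  simp_rw [e, bivTab_contract_right, ← Finset.smul_sum]
  congr 1
  have s1 : ∀ h : Fin 4 → Fin 4 → Fin 6 → A, ∑ k, ∑ l, ∑ a, h k l a = ∑ a, ∑ k, ∑ l, h k l a := by
    intro h
    rw [Finset.sum_congr rfl fun k _ => Finset.sum_comm, Finset.sum_comm]
  simp_rw [Finset.mul_sum]
  rw [s1]
  refine Finset.sum_congr rfl fun a _ => ?_
  rw [s1]
  have e2 : ∀ c, ∑ i, ∑ j, (sgZ i : A) * (sgZ j : A) * ((∑ b, (gZ b : A) * (P a b * R c (rev6 b))) *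
      (biv a i j * biv c (opp i) (opp j)))
      = (∑ b, (gZ b : A) * (P a b * R c (rev6 b))) * (if c = rev6 a then (gZ a : A) else 0) := by
    intro c
    rw [← biv_gram, Finset.mul_sum]
    refine Finset.sum_congr rfl fun i _ => ?_
    rw [Finset.mul_sum]
    exact Finset.sum_congr rfl fun j _ => by ring
  simp_rw [e2]
  simp only [mul_ite, mul_zero, Finset.sum_ite_eq', Finset.mem_univ, if_true, Finset.sum_mul]
  exact Finset.sum_congr rfl fun b _ => by ring

/-- The contraction of two tensors built from bivectors with one free index each. -/
theorem bivTab_contract_mixed (P R : Matrix (Fin 6) (Fin 6) A) (i i' : Fin 4) :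
    ∑ j, ∑ k, ∑ l, (sgZ j : A) * ((sgZ k : A) * (sgZ l : A) *
      (bivTab P i j k l * bivTab R i' (opp j) (opp k) (opp l)))
      = ∑ a, ∑ c, (∑ b, (gZ b : A) * (P a b * R c (rev6 b)))
          * ((∑ j, sgZ j * (bivZ a i j * bivZ c i' (opp j)) : ℤ) : A) := by
  simp_rw [← Finset.mul_sum, bivTab_contract_right]
  simp_rw [Finset.mul_sum]
  rw [Finset.sum_comm]
  refine Finset.sum_congr rfl fun a _ => ?_
  rw [Finset.sum_comm]
  refine Finset.sum_congr rfl fun c _ => ?_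
  push_cast
  rw [Finset.mul_sum]
  exact Finset.sum_congr rfl fun j _ => by unfold biv; ring

/-- Block-diagonal matrices of symmetric traceless type: `P = x₁(VW+WV) + x₂(VU+UV-WW) + …`. -/
def symT6 (x y : Fin 4 → A) : Matrix (Fin 6) (Fin 6) A :=
  !![0, x 0, x 1, 0, 0, 0;
     x 0, -x 1, x 2, 0, 0, 0;
     x 1, x 2, x 3, 0, 0, 0;
     0, 0, 0, 0, y 0, y 1;
     0, 0, 0, y 0, -y 1, y 2;
     0, 0, 0, y 1, y 2, y 3]

/-- By `bivTab_contract` only dual entries meet. For the parameter x₁ the two VU entries contribute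
4 + 4 and the WW entry 16, which after division by 16 gives 3/2; for x₀ against x₂ the two equal
terms 8 + 8 give 1. -/
theorem symT6_contract (x y x' y' : Fin 4 → A) :
    ∑ i, ∑ j, ∑ k, ∑ l, (wtC i * wtC j * wtC k * wtC l) •
      (bivTab (symT6 x y) i j k l * bivTab (symT6 x' y') (opp i) (opp j) (opp k) (opp l))
      = (3 / 2 : ℂ) • (x 1 * x' 1) + x 0 * x' 2 + x 2 * x' 0
        + ((3 / 2 : ℂ) • (y 1 * y' 1) + y 0 * y' 2 + y 2 * y' 0) := by
  rw [bivTab_contract]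
  have : ∑ a, ∑ b, (gZ a : A) * (gZ b : A) * (symT6 x y a b * symT6 x' y' (rev6 a) (rev6 b))
      = 8 * (3 * (x 1 * x' 1) + 2 * (x 0 * x' 2 + x 2 * x' 0)
        + (3 * (y 1 * y' 1) + 2 * (y 0 * y' 2 + y 2 * y' 0))) := by
    simp [Fin.sum_univ_succ, symT6, gZ, rev6, Fin.succ]
    ring
  rw [this]
  have h8 : (8 : A) = algebraMap ℂ A 8 := (map_ofNat _ 8).symm
  have h3 : (3 : A) = algebraMap ℂ A 3 := (map_ofNat _ 3).symm
  have h2 : (2 : A) = algebraMap ℂ A 2 := (map_ofNat _ 2).symm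
  rw [h8, h3, h2]
  simp only [← Algebra.smul_def]
  module

/-- The coefficients of the mixed contraction. -/
def mixZ : Fin 4 → Fin 4 → Fin 6 → Fin 6 → ℤ :=
  ![![![![0, 0, 1, 0, 0, 0], ![0, 1, 0, 0, 1, 0], 0, ![0, 0, 0, 0, 0, 1], ![0, 1, 0, 0, 1, 0], 0],
      ![![0, 0, 0, 1, 0, 0], 0, 0, ![1, 0, 0, 0, 0, 0], 0, 0],
      ![0, ![0, 0, 0, -1, 0, 0], 0, ![0, -1, 0, 0, 1, 0], ![0, 0, 0, -1, 0, 0], 0],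
      ![![0, 1, 0, 0, -1, 0], ![-1, 0, 0, 0, 0, 0], 0, 0, ![-1, 0, 0, 0, 0, 0], 0]],
    ![![0, 0, ![0, 0, 0, 0, 0, 1], 0, 0, ![0, 0, 1, 0, 0, 0]],
      ![0, ![0, 1, 0, 0, 1, 0], ![1, 0, 0, 0, 0, 0], 0, ![0, 1, 0, 0, 1, 0], ![0, 0, 0, 1, 0, 0]],
      ![0, ![0, 0, 1, 0, 0, 0], ![0, -1, 0, 0, 1, 0], 0, ![0, 0, 1, 0, 0, 0], 0],
      ![0, ![0, 0, 0, 0, 0, 1], 0, 0, ![0, 0, 0, 0, 0, 1], ![0, 1, 0, 0, -1, 0]]],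
    ![![0, ![0, 0, 0, 0, 0, 1], 0, 0, ![0, 0, 0, 0, 0, -1], ![0, 1, 0, 0, 1, 0]],
      ![![0, -1, 0, 0, -1, 0], ![1, 0, 0, 0, 0, 0], 0, 0, ![-1, 0, 0, 0, 0, 0], 0],
      ![![0, 0, -1, 0, 0, 0], ![0, -1, 0, 0, 1, 0], 0, 0, ![0, 1, 0, 0, -1, 0], ![0, 0, 0, -1, 0, 0]],
      ![![0, 0, 0, 0, 0, -1], 0, 0, 0, 0, ![-1, 0, 0, 0, 0, 0]]],
    ![![0, ![0, 0, -1, 0, 0, 0], ![0, 1, 0, 0, 1, 0], 0, ![0, 0, 1, 0, 0, 0], 0],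
      ![0, ![0, 0, 0, -1, 0, 0], 0, ![0, -1, 0, 0, -1, 0], ![0, 0, 0, 1, 0, 0], 0],
      ![0, 0, ![0, 0, 0, -1, 0, 0], ![0, 0, -1, 0, 0, 0], 0, 0],
      ![0, ![0, -1, 0, 0, 1, 0], ![-1, 0, 0, 0, 0, 0], ![0, 0, 0, 0, 0, -1], ![0, 1, 0, 0, -1, 0], 0]]]

/-- The coefficients K stay abstract, so the integer table `mixZ` is verified once by `decide` and
its zeros drop out before any tensor components are inserted. -/
theorem sum_mixed (K : Fin 4 → Fin 4 → Fin 6 → Fin 6 → A) :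
    ∑ i, ∑ h, (sgZ i : A) * (sgZ h : A) * ∑ a, ∑ c, K h (opp i) a c
      * ((∑ j, sgZ j * (bivZ a i j * bivZ c (opp h) (opp j)) : ℤ) : A)
      = K 0 1 0 2 + K 0 1 1 1 + K 0 1 1 4 + K 0 1 3 5 + K 0 1 4 1 + K 0 1 4 4 + K 1 1 0 3 +
        K 1 1 3 0 - K 2 1 1 3 - K 2 1 3 1 + K 2 1 3 4 - K 2 1 4 3 + K 3 1 0 1 - K 3 1 0 4 -
        K 3 1 1 0 - K 3 1 4 0 + K 0 0 2 5 + K 0 0 5 2 + K 1 0 1 1 + K 1 0 1 4 + K 1 0 2 0 +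
        K 1 0 4 1 + K 1 0 4 4 + K 1 0 5 3 + K 2 0 1 2 - K 2 0 2 1 + K 2 0 2 4 + K 2 0 4 2 +
        K 3 0 1 5 + K 3 0 4 5 + K 3 0 5 1 - K 3 0 5 4 + K 0 3 1 5 - K 0 3 4 5 + K 0 3 5 1 +
        K 0 3 5 4 - K 1 3 0 1 - K 1 3 0 4 + K 1 3 1 0 - K 1 3 4 0 - K 2 3 0 2 - K 2 3 1 1 +
        K 2 3 1 4 + K 2 3 4 1 - K 2 3 4 4 - K 2 3 5 3 - K 3 3 0 5 - K 3 3 5 0 - K 0 2 1 2 +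
        K 0 2 2 1 + K 0 2 2 4 + K 0 2 4 2 - K 1 2 1 3 - K 1 2 3 1 - K 1 2 3 4 + K 1 2 4 3 -
        K 2 2 2 3 - K 2 2 3 2 - K 3 2 1 1 + K 3 2 1 4 - K 3 2 2 0 - K 3 2 3 5 + K 3 2 4 1 -
        K 3 2 4 4 := by
  have e : ∀ i h, (sgZ i : A) * (sgZ h : A) * ∑ a, ∑ c, K h (opp i) a c
      * ((∑ j, sgZ j * (bivZ a i j * bivZ c (opp h) (opp j)) : ℤ) : A)
      = ∑ a, ∑ c, K h (opp i) a c * ((sgZ i * sgZ h *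
        ∑ j, sgZ j * (bivZ a i j * bivZ c (opp h) (opp j)) : ℤ) : A) := by
    intro i h
    push_cast
    rw [Finset.mul_sum]
    refine Finset.sum_congr rfl fun a _ => ?_
    rw [Finset.mul_sum]
    exact Finset.sum_congr rfl fun c _ => by ring
  have t : ∀ i h a c, sgZ i * sgZ h * ∑ j, sgZ j * (bivZ a i j * bivZ c (opp h) (opp j))
      = mixZ i h a c := by decide
  simp only [e, t]
  simp [Fin.sum_univ_succ, mixZ, opp, Fin.succ]
  ring

/-- The mixed products of the bivectors with one contracted index. -/
theorem symT6_contract_mixed (x y : Fin 4 → Fin 4 → A) :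
    ∑ i, ∑ j, ∑ k, ∑ l, ∑ h, (wtC i * wtC j * wtC k * wtC l * wtC h) •
      (bivTab (symT6 (x h) (y h)) i j k l
        * bivTab (symT6 (x (opp i)) (y (opp i))) (opp h) (opp j) (opp k) (opp l))
      = (1 / 8 : ℂ) • (-3 * (x 0 0 * x 1 2) + (x 0 0 * x 2 3) - 3 * (x 0 1 * x 1 1) - 3 * (x 0 1 * x 2 2) -
        (x 0 2 * x 1 0) + 3 * (x 0 2 * x 2 1) - (x 0 3 * x 2 0) - 3 * (x 1 0 * x 3 1) + 3 *
        (x 1 1 * x 3 0) + 3 * (x 2 0 * x 3 2) + 3 * (x 2 1 * x 3 1) + (x 2 2 * x 3 0) - 3 *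
        (y 0 0 * y 1 2) + (y 0 0 * y 3 3) - 3 * (y 0 1 * y 1 1) - 3 * (y 0 1 * y 3 2) -
        (y 0 2 * y 1 0) + 3 * (y 0 2 * y 3 1) - (y 0 3 * y 3 0) - 3 * (y 1 0 * y 2 1) + 3 *
        (y 1 1 * y 2 0) + (y 2 0 * y 3 2) + 3 * (y 2 1 * y 3 1) + 3 * (y 2 2 * y 3 0)) := by
  have e : ∑ i, ∑ j, ∑ k, ∑ l, ∑ h, (wtC i * wtC j * wtC k * wtC l * wtC h) •
      (bivTab (symT6 (x h) (y h)) i j k l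
        * bivTab (symT6 (x (opp i)) (y (opp i))) (opp h) (opp j) (opp k) (opp l))
      = (1 / 32 : ℂ) • ∑ i, ∑ h, (sgZ i : A) * (sgZ h : A) * ∑ j, ∑ k, ∑ l,
      (sgZ j : A) * ((sgZ k : A) * (sgZ l : A) * (bivTab (symT6 (x h) (y h)) i j k l
        * bivTab (symT6 (x (opp i)) (y (opp i))) (opp h) (opp j) (opp k) (opp l))) := by
    rw [Finset.smul_sum]
    refine Finset.sum_congr rfl fun i _ => ?_
    have sw : ∀ f : Fin 4 → Fin 4 → Fin 4 → Fin 4 → A,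
        ∑ j, ∑ k, ∑ l, ∑ h, f j k l h = ∑ h, ∑ j, ∑ k, ∑ l, f j k l h := by
      intro f
      rw [Finset.sum_congr rfl fun j _ => Finset.sum_congr rfl fun k _ => Finset.sum_comm,
        Finset.sum_congr rfl fun j _ => Finset.sum_comm, Finset.sum_comm]
    rw [sw, Finset.smul_sum]
    refine Finset.sum_congr rfl fun h _ => ?_
    rw [Finset.mul_sum, Finset.smul_sum]
    refine Finset.sum_congr rfl fun j _ => ?_
    rw [Finset.mul_sum, Finset.smul_sum]
    refine Finset.sum_congr rfl fun k _ => ?_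
    rw [Finset.mul_sum, Finset.smul_sum]
    refine Finset.sum_congr rfl fun l _ => ?_
    have h16 : (1 / 32 : ℂ) = 1 / 2 * (1 / 2) * (1 / 2) * (1 / 2) * (1 / 2) := by norm_num
    rw [h16]
    simp only [wtC_eq, Algebra.smul_def, map_mul, map_intCast]
    ring
  rw [e]
  simp_rw [bivTab_contract_mixed]
  rw [sum_mixed (fun h h' a c => ∑ b, (gZ b : A) * (symT6 (x h) (y h) a b
    * symT6 (x h') (y h') c (rev6 b)))]
  have h4 : (1 / 8 : ℂ) = 1 / 32 * 4 := by norm_num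
  rw [h4, mul_smul]
  congr 1
  rw [Algebra.smul_def (4 : ℂ), map_ofNat]
  simp [Fin.sum_univ_succ, symT6, gZ, rev6, Fin.succ]
  ring

end bivectors

/-! ### Action of infinitesimal frame rotations on bivectors -/

section bivectors

variable {A : Type*} [CommRing A] [Algebra ℂ A]

/-- A matrix of the Lie algebra of the frame metric. -/
structure SkewFrame (M : Fin 4 → Fin 4 → A) : Prop where
  e10 : M 1 0 = 0
  e01 : M 0 1 = 0
  e32 : M 3 2 = 0
  e23 : M 2 3 = 0
  e11 : M 1 1 = -M 0 0
  e33 : M 3 3 = -M 2 2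
  e12 : M 1 2 = M 3 0
  e13 : M 1 3 = M 2 0
  e02 : M 0 2 = M 3 1
  e03 : M 0 3 = M 2 1

theorem SkewFrame.of_metric {M : Fin 4 → Fin 4 → A}
    (h : ∀ i k, epC k • M (opp k) i + epC i • M (opp i) k = 0) : SkewFrame M := by
  have h2 : ∀ x y : A, 2 * x = 2 * y → x = y := by
    intro x y e
    have e' : (2 : ℂ) • x = (2 : ℂ) • y := by
      rwa [Algebra.smul_def, Algebra.smul_def, map_ofNat]
    simpa [smul_smul] using congrArg (fun z => (1 / 2 : ℂ) • z) e'
  have h3 : ∀ i k, ((![-2, -2, 2, 2] k : ℤ) : A) * M (opp k) i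
      + ((![-2, -2, 2, 2] i : ℤ) : A) * M (opp i) k = 0 := by
    intro i k
    have e : ∀ i, epC i = ((![-2, -2, 2, 2] i : ℤ) : ℂ) := by
      intro i; fin_cases i <;> simp [epC]
    have := h i k
    rwa [Algebra.smul_def, Algebra.smul_def, e, e, map_intCast, map_intCast] at this
  constructor <;> apply h2
  · have := h3 0 0; simp [opp] at this; apply h2; linear_combination -this
  · have := h3 1 1; simp [opp] at this; apply h2; linear_combination -this
  · have := h3 2 2; simp [opp] at this; apply h2; linear_combination this
  · have := h3 3 3; simp [opp] at this; apply h2; linear_combination this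
  · have := h3 1 0; simp [opp] at this; linear_combination -this
  · have := h3 3 2; simp [opp] at this; linear_combination this
  · have := h3 0 2; simp [opp] at this; linear_combination -this
  · have := h3 0 3; simp [opp] at this; linear_combination -this
  · have := h3 1 2; simp [opp] at this; linear_combination -this
  · have := h3 1 3; simp [opp] at this; linear_combination -this

/-- The generators of the Lie algebra of the frame metric, for the coordinates `skewCoord`. -/
def genZ : Fin 6 → Fin 4 → Fin 4 → ℤ :=
  ![![![1, 0, 0, 0], ![0, -1, 0, 0], 0, 0], ![0, 0, ![0, 0, 1, 0], ![0, 0, 0, -1]],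
    ![0, ![0, 0, 1, 0], 0, ![1, 0, 0, 0]], ![0, ![0, 0, 0, 1], ![1, 0, 0, 0], 0],
    ![![0, 0, 1, 0], 0, 0, ![0, 1, 0, 0]], ![![0, 0, 0, 1], 0, ![0, 1, 0, 0], 0]]

/-- The coordinates of a skew matrix. -/
def skewCoord (M : Fin 4 → Fin 4 → A) : Fin 6 → A :=
  ![M 0 0, M 2 2, M 3 0, M 2 0, M 3 1, M 2 1]

theorem SkewFrame.eq_sum {M : Fin 4 → Fin 4 → A} (h : SkewFrame M) (i j : Fin 4) :
    M i j = ∑ p, skewCoord M p * (genZ p i j : A) := by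
  fin_cases i <;> fin_cases j <;>
    simp [Fin.sum_univ_six, genZ, skewCoord, h.e10, h.e01, h.e32, h.e23, h.e11, h.e33, h.e12,
      h.e13, h.e02, h.e03]

/-- The action of the generators on the bivectors. -/
def actZ : Fin 6 → Fin 6 → Fin 6 → ℤ :=
  ![![![-1, 0, 0, 0, 0, 0], 0, ![0, 0, 1, 0, 0, 0], ![0, 0, 0, -1, 0, 0], 0, ![0, 0, 0, 0, 0, 1]],
    ![![-1, 0, 0, 0, 0, 0], 0, ![0, 0, 1, 0, 0, 0], ![0, 0, 0, 1, 0, 0], 0, ![0, 0, 0, 0, 0, -1]],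
    ![0, ![-2, 0, 0, 0, 0, 0], ![0, 1, 0, 0, 0, 0], 0, 0, 0],
    ![0, 0, 0, 0, ![0, 0, 0, -2, 0, 0], ![0, 0, 0, 0, 1, 0]],
    ![0, 0, 0, ![0, 0, 0, 0, -1, 0], ![0, 0, 0, 0, 0, 2], 0],
    ![![0, -1, 0, 0, 0, 0], ![0, 0, 2, 0, 0, 0], 0, 0, 0, 0]]

/-- The representation of the frame Lie algebra on bivectors, as integer matrices. The minus sign
compensates the one in `actF`, so that corrected derivatives of tensors become congruence terms with
a plus sign. -/
theorem actZ_spec (p a : Fin 6) (i j : Fin 4) :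
    ∑ m, (genZ p m i * bivZ a m j + genZ p m j * bivZ a i m) = -∑ b, actZ p a b * bivZ b i j := by
  revert p a i j; decide

/-- The action of a skew matrix on the bivectors. -/
def actB (M : Fin 4 → Fin 4 → A) : Matrix (Fin 6) (Fin 6) A :=
  fun a b => ∑ p, skewCoord M p * (actZ p a b : A)

theorem SkewFrame.biv {M : Fin 4 → Fin 4 → A} (h : SkewFrame M) (a : Fin 6) (i j : Fin 4) :
    ∑ m, (M m i * biv a m j + M m j * biv a i m) = -∑ b, actB M a b * biv b i j := by
  have e := fun p => congrArg (fun z : ℤ => skewCoord M p * (z : A)) (actZ_spec p a i j)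
  have e2 := Finset.sum_congr (rfl : (Finset.univ : Finset (Fin 6)) = _) fun p _ => e p
  push_cast at e2
  unfold KerrVaidya.biv actB
  simp_rw [h.eq_sum]
  simp only [Finset.sum_mul, mul_neg, Finset.mul_sum, Finset.sum_neg_distrib, mul_add,
    Finset.sum_add_distrib] at e2 ⊢
  simp only [mul_assoc]
  refine Eq.trans ?_ (e2.trans ?_)
  · exact congrArg₂ _ Finset.sum_comm Finset.sum_comm
  · exact congrArg _ Finset.sum_comm

/-- The block form reflects the splitting of the complexified Lorentz algebra into two copies of
so(3,ℂ): the self-dual block sees only M₀₀ + M₂₂, M₂₁ and M₃₀, the anti-self-dual one only M₀₀ -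
M₂₂, M₃₁ and M₂₀. Hence `symT6` tensors are differentiated block by block. -/
theorem actB_eq {M : Fin 4 → Fin 4 → A} : actB M
    = !![-M 0 0 - M 2 2, -M 2 1, 0, 0, 0, 0;
         -(2 * M 3 0), 0, 2 * M 2 1, 0, 0, 0;
         0, M 3 0, M 0 0 + M 2 2, 0, 0, 0;
         0, 0, 0, -M 0 0 + M 2 2, -M 3 1, 0;
         0, 0, 0, -(2 * M 2 0), 0, 2 * M 3 1;
         0, 0, 0, 0, M 2 0, M 0 0 - M 2 2] := by
  ext a b
  fin_cases a <;> fin_cases b <;> simp [actB, Fin.sum_univ_six, actZ, skewCoord] <;> ring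

/-- The bivector components are integers, so the derivation reaches only the coefficient matrix P;
the correction on each antisymmetric pair of indices is one multiplication by `actB`. -/
theorem actF_bivTab {M : Fin 4 → Fin 4 → A} (h : SkewFrame M) (d : Derivation ℂ A A)
    (P : Matrix (Fin 6) (Fin 6) A) (i j k l : Fin 4) : actF M d (bivTab P) i j k l
      = bivTab (P.map d + (actB M).transpose * P + P * actB M) i j k l := by
  have hd : ∀ a i j, d (KerrVaidya.biv a i j : A) = 0 := fun a i j => d.map_intCast _
  have e1 : d (bivTab P i j k l) = bivTab (P.map d) i j k l := by
    simp [bivTab, map_sum, Derivation.leibniz, hd, mul_comm]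
  have e2 : bivTab ((actB M).transpose * P) i j k l
      = -∑ m, (M m i * bivTab P m j k l + M m j * bivTab P i m k l) := by
    have hP : ∀ c b, (∑ a, actB M c a * P c b * (KerrVaidya.biv a i j * KerrVaidya.biv b k l))
        = -∑ m, (M m i * (P c b * (KerrVaidya.biv c m j * KerrVaidya.biv b k l))
          + M m j * (P c b * (KerrVaidya.biv c i m * KerrVaidya.biv b k l))) := by
      intro c b
      have e := congrArg (fun z => -(P c b * KerrVaidya.biv b k l) * z) (h.biv c i j)
      simp only [Fin.sum_univ_six, Fin.sum_univ_four] at e ⊢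
      linear_combination -e
    simp only [bivTab, Matrix.mul_apply, Matrix.transpose_apply, Finset.sum_mul]
    rw [Finset.sum_congr rfl fun a _ => Finset.sum_comm, Finset.sum_comm,
      Finset.sum_congr rfl fun a _ => Finset.sum_comm]
    simp_rw [hP, Finset.sum_neg_distrib]
    congr 1
    simp only [Finset.mul_sum, Finset.sum_add_distrib]
    congr 1 <;>
    · rw [Finset.sum_congr rfl fun a _ => Finset.sum_comm, Finset.sum_comm]
  have e3 : bivTab (P * actB M) i j k l
      = -∑ m, (M m k * bivTab P i j m l + M m l * bivTab P i j k m) := by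
    have hP : ∀ c b, (∑ a, P b c * actB M c a * (KerrVaidya.biv b i j * KerrVaidya.biv a k l))
        = -∑ m, (M m k * (P b c * (KerrVaidya.biv b i j * KerrVaidya.biv c m l))
          + M m l * (P b c * (KerrVaidya.biv b i j * KerrVaidya.biv c k m))) := by
      intro c b
      have e := congrArg (fun z => -(P b c * KerrVaidya.biv b i j) * z) (h.biv c k l)
      simp only [Fin.sum_univ_six, Fin.sum_univ_four] at e ⊢
      linear_combination -e
    simp only [bivTab, Matrix.mul_apply, Finset.sum_mul]
    rw [Finset.sum_congr rfl fun a _ => Finset.sum_comm]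
    simp_rw [hP, Finset.sum_neg_distrib]
    congr 1
    simp only [Finset.mul_sum, Finset.sum_add_distrib]
    congr 1 <;>
    · rw [Finset.sum_congr rfl fun a _ => Finset.sum_comm, Finset.sum_comm]
  have e4 : bivTab (P.map d + (actB M).transpose * P + P * actB M) i j k l
      = bivTab (P.map d) i j k l + bivTab ((actB M).transpose * P) i j k l
        + bivTab (P * actB M) i j k l := by
    simp only [bivTab, Matrix.add_apply, add_mul, Finset.sum_add_distrib]
  rw [e4, ← e1, e2, e3, actF]
  simp only [Finset.sum_add_distrib]
  ring

set_option maxHeartbeats 4000000 in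
/-- The covariant derivative of a tensor without `VV` and `VW` parts. -/
theorem actF_symT6 {M : Fin 4 → Fin 4 → A} (h : SkewFrame M) (d : Derivation ℂ A A)
    (p q r p' q' r' : A) (i j k l : Fin 4) :
    actF M d (bivTab (symT6 ![0, p, q, r] ![0, p', q', r'])) i j k l
      = bivTab (symT6 ![3 * p * M 3 0, d p - 2 * M 3 0 * q,
          d q - 3 * p * M 2 1 + (M 0 0 + M 2 2) * q + M 3 0 * r,
          d r + 2 * (M 0 0 + M 2 2) * r + 4 * M 2 1 * q]
        ![3 * p' * M 2 0, d p' - 2 * M 2 0 * q',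
          d q' - 3 * p' * M 3 1 + (M 0 0 - M 2 2) * q' + M 2 0 * r',
          d r' + 2 * (M 0 0 - M 2 2) * r' + 4 * M 3 1 * q']) i j k l := by
  rw [actF_bivTab h, actB_eq]
  congr 1
  ext a b
  rw [Matrix.add_apply, Matrix.add_apply, Matrix.mul_apply, Matrix.mul_apply, Fin.sum_univ_six,
    Fin.sum_univ_six]
  fin_cases a <;> fin_cases b <;> simp [symT6] <;> ring

end bivectors

/-! ## The Kerr-Vaidya geometry in a differential ring -/

/-- The functions `Z = (r + i a cos θ)⁻¹`, its conjugate `W`, `t = i a sin θ`, `y = i / sin θ`,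
`c = cot θ`, and the derivatives `μ k` of the mass function, as elements of a differential ring. -/
structure KVRing {A : Type*} [CommRing A] [Algebra ℂ A] (D : Fin 4 → Derivation ℂ A A) where
  z : A
  w : A
  Z : A
  W : A
  t : A
  c : A
  y : A
  Y : A
  μ : ℕ → A
  zZ : z * Z = 1
  wW : w * W = 1
  yY : y * Y = 1
  tc : 2 * t * c = z - w
  D0Z : D 0 Z = 0
  D0W : D 0 W = 0
  D0t : D 0 t = 0
  D0c : D 0 c = 0
  D0y : D 0 y = 0
  D0μ : ∀ k, D 0 (μ k) = μ (k + 1)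
  D1Z : D 1 Z = -Z ^ 2
  D1W : D 1 W = -W ^ 2
  D1t : D 1 t = 0
  D1c : D 1 c = 0
  D1y : D 1 y = 0
  D1μ : ∀ k, D 1 (μ k) = 0
  D2Z : D 2 Z = t * Z ^ 2
  D2W : D 2 W = -(t * W ^ 2)
  D2t : D 2 t = t * c
  D2c : D 2 c = -(1 + c ^ 2)
  D2y : D 2 y = -(y * c)
  D2μ : ∀ k, D 2 (μ k) = 0
  D3Z : D 3 Z = 0
  D3W : D 3 W = 0
  D3t : D 3 t = 0
  D3c : D 3 c = 0
  D3y : D 3 y = 0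
  D3μ : ∀ k, D 3 (μ k) = 0

namespace KVRing

variable {A : Type*} [CommRing A] [Algebra ℂ A] {D : Fin 4 → Derivation ℂ A A} (K : KVRing D)

attribute [simp] D0Z D0W D0t D0c D0y D0μ D1Z D1W D1t D1c D1y D1μ D2Z D2W D2t D2c D2y D2μ
  D3Z D3W D3t D3c D3y D3μ

/-- The metric. -/
def g : Fin 4 → Fin 4 → A :=
  ![![-1 + K.μ 0 * (K.Z + K.W), 1, 0, -(K.t * K.Y * (K.μ 0 * (K.Z + K.W)))],
    ![1, 0, 0, -(K.t * K.Y)],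
    ![0, 0, K.z * K.w, 0],
    ![-(K.t * K.Y * (K.μ 0 * (K.Z + K.W))), -(K.t * K.Y), 0,
      -(K.Y ^ 2 * (K.z * K.w - K.t ^ 2 - K.μ 0 * (K.Z + K.W) * K.t ^ 2))]]

/-- The null frame. -/
def E : Fin 4 → Fin 4 → A :=
  ![![0, -1, 0, 0],
    ![2 - 2 * K.t ^ 2 * K.Z * K.W, 1 - K.t ^ 2 * K.Z * K.W - K.μ 0 * (K.Z + K.W), 0,
      -(2 * K.t * K.y * K.Z * K.W)],
    ![K.t * K.Z, 0, K.Z, K.y * K.Z],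
    ![-(K.t * K.W), 0, K.W, -(K.y * K.W)]]

/-- The connection coefficients of the null frame. -/
def γ : Fin 4 → Fin 4 → Fin 4 → A :=
  let Z := K.Z; let W := K.W; let t := K.t; let c := K.c; let m := K.μ 0; let m1 := K.μ 1
  let α := Z ^ 2 * W * t ^ 2 + Z ^ 2 * m + Z * W ^ 2 * t ^ 2 + W ^ 2 * m
  let β := Z * W * t * m1 + W ^ 2 * t * m1
  let β' := -(Z ^ 2 * t * m1) - Z * W * t * m1
  let δ := -(Z ^ 2 * W * t ^ 2) - Z ^ 2 * m - Z * W * m + Z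
  let δ' := -(Z * W ^ 2 * t ^ 2) - Z * W * m - W ^ 2 * m + W
  ![![![0, -α, Z * W * t, -(Z * W * t)],
      ![0, 0, 0, 0],
      ![Z * W * t, β', 0, δ'],
      ![-(Z * W * t), β, δ, 0]],
    ![![0, 0, 0, 0],
      ![0, α, -(Z * W * t), Z * W * t],
      ![0, -(Z ^ 2 * t), 0, -Z],
      ![0, W ^ 2 * t, -W, 0]],
    ![![0, W ^ 2 * t, -W, 0],
      ![-(Z * W * t), β, δ, 0],
      ![Z - W, 0, Z ^ 2 * t + c * Z, W ^ 2 * t - c * W],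
      ![0, 0, 0, 0]],
    ![![0, -(Z ^ 2 * t), 0, -Z],
      ![Z * W * t, β', 0, δ'],
      ![0, 0, 0, 0],
      ![W - Z, 0, -(Z ^ 2 * t) - c * Z, -(W ^ 2 * t) + c * W]]]

theorem gram (i j : Fin 4) :
    ip K.g (K.E i) (K.E j) = if j = opp i then algebraMap ℂ A (epC i) else 0 := by
  have h1 := K.zZ
  have h2 := K.wW
  have h3 := K.yY
  have h4 : algebraMap ℂ A 2 = 2 := map_ofNat _ 2
  unfold ip
  fin_cases i <;> fin_cases j <;> simp [Fin.sum_univ_four, g, E, opp, epC, h4] <;> grind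

theorem metric (i j k : Fin 4) : epC k • K.γ (opp k) i j + epC i • K.γ (opp i) k j = 0 := by
  fin_cases i <;> fin_cases k <;> fin_cases j <;> simp [γ, epC, opp] <;> module

/-- The derivations along the legs of the frame. -/
def δ (j : Fin 4) : Derivation ℂ A A := ∑ c, K.E j c • D c

theorem δ_apply (j : Fin 4) (f : A) : K.δ j f = dirD D (K.E j) f := by
  simp [δ, dirD, Fin.sum_univ_four]

theorem δ0 (f : A) : K.δ 0 f = -D 1 f := by
  simp [δ, Fin.sum_univ_four, E]
theorem δ1 (f : A) : K.δ 1 f = (2 - 2 * K.t ^ 2 * K.Z * K.W) * D 0 f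
    + (1 - K.t ^ 2 * K.Z * K.W - K.μ 0 * (K.Z + K.W)) * D 1 f
    - 2 * K.t * K.y * K.Z * K.W * D 3 f := by
  simp [δ, Fin.sum_univ_four, E]; ring
theorem δ2 (f : A) : K.δ 2 f = K.Z * (K.t * D 0 f + D 2 f + K.y * D 3 f) := by
  simp [δ, Fin.sum_univ_four, E]; ring
theorem δ3 (f : A) : K.δ 3 f = K.W * (-(K.t * D 0 f) + D 2 f - K.y * D 3 f) := by
  simp [δ, Fin.sum_univ_four, E]; ring

theorem der_two (d : Derivation ℂ A A) : d 2 = 0 := d.map_natCast 2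

set_option maxHeartbeats 2000000 in
theorem torsion (i j a : Fin 4) : K.δ j (K.E i a) - K.δ i (K.E j a)
    = ∑ k, (K.γ k i j - K.γ k j i) * K.E k a := by
  have h := K.tc
  have h1 := K.zZ
  have h2 := K.wW
  -- Multiplied by ZW, the relation 2tc = z - w mentions Z and W only. In this form it eliminates
  -- cot θ from all frame identities.
  have key : 2 * K.t * K.c * K.Z * K.W = K.W - K.Z := by
    linear_combination K.Z * K.W * h + K.W * h1 - K.Z * h2
  fin_cases i <;> fin_cases j <;> fin_cases a <;>
    simp [Fin.sum_univ_four, γ, E, δ0, δ1, δ2, δ3, Derivation.leibniz_pow, der_two] <;> grind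

end KVRing

/-! ## The Weyl tensor in a null frame -/

section frameCurvature

variable {A : Type*} [CommRing A] [Algebra ℂ A] {D : Fin 4 → Derivation ℂ A A}
  {g gi : Fin 4 → Fin 4 → A} {E : Fin 4 → Fin 4 → A}

/-- Frame components of a two-index tensor. -/
def fr2 (E : Fin 4 → Fin 4 → A) (P : Fin 4 → Fin 4 → A) (i j : Fin 4) : A :=
  ∑ a, E i a * ∑ b, E j b * P a b

theorem sum_mul_const_mul (c : A) (f h : Fin 4 → A) :
    ∑ x, f x * (c * h x) = c * ∑ x, f x * h x := by
  rw [Finset.mul_sum]; exact Finset.sum_congr rfl fun x _ => by ring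

theorem sum_mul_mul_const (c : A) (f h : Fin 4 → A) :
    ∑ x, f x * (h x * c) = (∑ x, f x * h x) * c := by
  rw [Finset.sum_mul]; exact Finset.sum_congr rfl fun x _ => by ring

theorem fr4_mul₁ (P Q : Fin 4 → Fin 4 → A) (i j k l : Fin 4) :
    fr4 E (fun a b c d => P a c * Q b d) i j k l = fr2 E P i k * fr2 E Q j l := by
  simp only [fr4, ten4, fr2, sum_mul_const_mul, sum_mul_mul_const]

theorem fr4_mul₂ (P Q : Fin 4 → Fin 4 → A) (i j k l : Fin 4) :
    fr4 E (fun a b c d => P a d * Q b c) i j k l = fr2 E P i l * fr2 E Q j k := by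
  simp only [fr4, ten4, fr2, sum_mul_const_mul, sum_mul_mul_const]

theorem fr2_g (i j : Fin 4) : fr2 E g i j = ip g (E i) (E j) := by
  unfold fr2 ip
  refine Finset.sum_congr rfl fun a _ => ?_
  rw [Finset.mul_sum]
  exact Finset.sum_congr rfl fun b _ => by ring

theorem ten4_add (C C' : Fin 4 → Fin 4 → Fin 4 → Fin 4 → A) (X Y Z W : Fin 4 → A) :
    ten4 (fun a b c d => C a b c d + C' a b c d) X Y Z W = ten4 C X Y Z W + ten4 C' X Y Z W := by
  simp only [ten4, mul_add, Finset.sum_add_distrib]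

theorem ten4_sub (C C' : Fin 4 → Fin 4 → Fin 4 → Fin 4 → A) (X Y Z W : Fin 4 → A) :
    ten4 (fun a b c d => C a b c d - C' a b c d) X Y Z W = ten4 C X Y Z W - ten4 C' X Y Z W := by
  simp only [ten4, mul_sub, Finset.sum_sub_distrib]

theorem ten4_smul (r : ℂ) (C : Fin 4 → Fin 4 → Fin 4 → Fin 4 → A) (X Y Z W : Fin 4 → A) :
    ten4 (fun a b c d => r • C a b c d) X Y Z W = r • ten4 C X Y Z W := by
  simp only [ten4, Algebra.mul_smul_comm, Finset.smul_sum, Finset.mul_sum]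

theorem ten4_mul_left (r : A) (C : Fin 4 → Fin 4 → Fin 4 → Fin 4 → A) (X Y Z W : Fin 4 → A) :
    ten4 (fun a b c d => r * C a b c d) X Y Z W = r * ten4 C X Y Z W := by
  simp only [ten4, sum_mul_const_mul]

variable {R F : Fin 4 → Fin 4 → Fin 4 → Fin 4 → A}

theorem fr4_riemA
    (gram : ∀ i j, ip g (E i) (E j) = if j = opp i then algebraMap ℂ A (epC i) else 0)
    (hR : ∀ j k l a, ∑ b, ∑ c, ∑ d, R a b c d * E j b * E k c * E l d
      = ∑ m, F m j k l * E m a) (i j k l : Fin 4) :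
    fr4 E (riemA g R) i j k l = epC i • F (opp i) j k l := by
  have hR' : ∀ j k l a, ∑ b, E j b * ∑ c, E k c * ∑ d, E l d * R a b c d
      = ∑ m, F m j k l * E m a := by
    intro j k l a
    rw [← hR]
    simp only [Finset.mul_sum]
    exact Finset.sum_congr rfl fun b _ => Finset.sum_congr rfl fun c _ =>
      Finset.sum_congr rfl fun d _ => by ring
  have e : fr4 E (riemA g R) i j k l
      = ∑ a, E i a * ∑ e, g a e * ∑ m, F m j k l * E m e := by
    unfold fr4 ten4 riemA
    refine Finset.sum_congr rfl fun a _ => congrArg _ ?_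
    simp_rw [← hR']
    exact (sum_push₃ (g a) (E j) (E k) (E l) R).symm
  rw [e]
  have e2 : ∑ a, E i a * ∑ e, g a e * ∑ m, F m j k l * E m e
      = ∑ m, F m j k l * ip g (E i) (E m) := by
    unfold ip
    simp only [Finset.mul_sum]
    rw [Finset.sum_congr rfl fun a _ => Finset.sum_comm, Finset.sum_comm]
    exact Finset.sum_congr rfl fun m _ => Finset.sum_congr rfl fun a _ =>
      Finset.sum_congr rfl fun b _ => by ring
  rw [e2]
  simp_rw [gram]
  simp only [mul_ite, mul_zero, Finset.sum_ite_eq', Finset.mem_univ, if_true]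
  rw [Algebra.smul_def, mul_comm]

theorem fr2_ricA
    (gram : ∀ i j, ip g (E i) (E j) = if j = opp i then algebraMap ℂ A (epC i) else 0)
    (key : ∀ a b, ∑ i, wtC i • (E i a * ∑ c, g b c * E (opp i) c) = if a = b then 1 else 0)
    (hR : ∀ j k l a, ∑ b, ∑ c, ∑ d, R a b c d * E j b * E k c * E l d
      = ∑ m, F m j k l * E m a) (j l : Fin 4) :
    fr2 E (ricA R) j l = ∑ i, F i j i l := by
  -- The trace is written with a Kronecker symbol so that the completeness relation `key` can
  -- replace it by a sum over legs.
  have e1 : fr2 E (ricA R) j l = ∑ c, ∑ c', (∑ b, ∑ d, R c b c' d * E j b * E l d)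
      * (if c' = c then 1 else 0) := by
    simp only [mul_ite, mul_one, mul_zero, Finset.sum_ite_eq', Finset.mem_univ, if_true, fr2, ricA]
    simp only [Finset.mul_sum]
    rw [Finset.sum_congr rfl fun a _ => Finset.sum_comm, Finset.sum_comm]
    exact Finset.sum_congr rfl fun m _ => Finset.sum_congr rfl fun a _ =>
      Finset.sum_congr rfl fun b _ => by ring
  have e2 : ∀ i, ∑ c, ∑ c', (∑ b, ∑ d, R c b c' d * E j b * E l d)
      * (E i c' * ∑ e, g c e * E (opp i) e) = epC i • F i j i l := by
    intro i
    have : ∀ c, ∑ c', (∑ b, ∑ d, R c b c' d * E j b * E l d)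
        * (E i c' * ∑ e, g c e * E (opp i) e)
        = (∑ m, F m j i l * E m c) * ∑ e, g c e * E (opp i) e := by
      intro c
      rw [← hR j i l c]
      simp only [Fin.sum_univ_four]
      ring
    simp_rw [this]
    have e3 : ∑ c, (∑ m, F m j i l * E m c) * ∑ e, g c e * E (opp i) e
        = ∑ m, F m j i l * ip g (E m) (E (opp i)) := by
      unfold ip
      simp only [Fin.sum_univ_four]
      ring
    rw [e3]
    have e4 : ∀ m, ip g (E m) (E (opp i)) = if m = i then algebraMap ℂ A (epC i) else 0 := by
      intro m
      rw [gram]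
      by_cases h : m = i
      · subst h; simp
      · rw [if_neg h, if_neg]
        intro h'; apply h; rw [← opp_opp m, ← h', opp_opp]
    simp_rw [e4]
    simp only [mul_ite, mul_zero, Finset.sum_ite_eq', Finset.mem_univ, if_true]
    rw [Algebra.smul_def, mul_comm]
  rw [e1]
  have e5 : ∀ c c', (∑ b, ∑ d, R c b c' d * E j b * E l d) * (if c' = c then 1 else 0)
      = ∑ i, wtC i • ((∑ b, ∑ d, R c b c' d * E j b * E l d)
        * (E i c' * ∑ e, g c e * E (opp i) e)) := by
    intro c c'
    rw [← key, Finset.mul_sum]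
    simp only [Algebra.mul_smul_comm]
  simp_rw [e5]
  rw [Finset.sum_congr rfl fun c _ => Finset.sum_comm, Finset.sum_comm]
  simp_rw [← Finset.smul_sum, e2, smul_smul, mul_comm (wtC _), epC_mul_wtC, one_smul]

theorem scA_frame (hgi : ∀ a b, gi a b = ∑ i, wtC i • (E i a * E (opp i) b))
    (P : Fin 4 → Fin 4 → A) : scA gi P = ∑ i, wtC i • fr2 E P i (opp i) := by
  simp only [scA, hgi, fr2, Finset.mul_sum, Finset.sum_mul, Finset.smul_sum]
  rw [Finset.sum_congr rfl fun c _ => Finset.sum_comm, Finset.sum_comm]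
  exact Finset.sum_congr rfl fun m _ => Finset.sum_congr rfl fun a _ =>
      Finset.sum_congr rfl fun b _ => by rw [Algebra.smul_mul_assoc, mul_assoc]

/-- The frame metric. -/
def etaA (i j : Fin 4) : A := if j = opp i then algebraMap ℂ A (epC i) else 0

/-- The frame components of the Weyl tensor, read off from a decomposition of the curvature. -/
theorem fr4_weylA
    (gram : ∀ i j, ip g (E i) (E j) = if j = opp i then algebraMap ℂ A (epC i) else 0)
    (hgi : ∀ a b, gi a b = ∑ i, wtC i • (E i a * E (opp i) b))
    (key : ∀ a b, ∑ i, wtC i • (E i a * ∑ c, g b c * E (opp i) c) = if a = b then 1 else 0)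
    (hR : ∀ j k l a, ∑ b, ∑ c, ∑ d, R a b c d * E j b * E k c * E l d
      = ∑ m, F m j k l * E m a)
    {B : Fin 4 → Fin 4 → Fin 4 → Fin 4 → A} {ρ : Fin 4 → Fin 4 → A}
    (hF : ∀ i j k l, epC i • F (opp i) j k l = B i j k l + (1 / 2 : ℂ) • (etaA i k * ρ j l
      - etaA i l * ρ j k - etaA j k * ρ i l + etaA j l * ρ i k))
    (hB : ∀ j l, ∑ i, wtC i • B (opp i) j i l = 0) (hρ : ∑ i, wtC i • ρ (opp i) i = 0)
    (hρ' : ∑ i, wtC i • ρ i (opp i) = 0)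
    (i j k l : Fin 4) :
    fr4 E (weylA g (riemA g R) (ricA R) (scA gi (ricA R))) i j k l = B i j k l := by
  -- In the trace of the decomposition B drops out by `hB`, and the four metric terms give ½(4 - 1 -
  -- 1)ρ, the last one vanishing because ρ is trace-free. So ρ is the Ricci tensor, the scalar
  -- curvature is zero, and B is what remains as Weyl tensor.
  have ric : ∀ j l, fr2 E (ricA R) j l = ρ j l := by
    intro j l
    rw [fr2_ricA gram key hR]
    have e : ∀ i, F i j i l = wtC i • B (opp i) j i l + (1 / 2 : ℂ) • (wtC i • (etaA (opp i) i * ρ j l)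
      - wtC i • (etaA (opp i) l * ρ j i) - wtC i • (etaA j i * ρ (opp i) l)
      + wtC i • (etaA j l * ρ (opp i) i)) := by
      intro i
      have := congrArg (fun x => wtC i • x) (hF (opp i) j i l)
      simp only [opp_opp, epC_opp, smul_smul, mul_comm (wtC i), epC_mul_wtC, one_smul] at this
      rw [this]
      module
    have h1 : ∀ i, wtC i • (etaA (opp i) i * ρ j l) = ρ j l := by
      intro i
      rw [etaA, opp_opp, if_pos rfl, ← Algebra.smul_def, smul_smul, epC_opp, mul_comm,
        epC_mul_wtC, one_smul]
    have h2 : ∑ i, wtC i • (etaA (opp i) l * ρ j i) = ρ j l := by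
      have : ∀ i, wtC i • (etaA (opp i) l * ρ j i) = if l = i then ρ j i else 0 := by
        intro i
        rw [etaA, opp_opp]
        split_ifs
        · rw [← Algebra.smul_def, smul_smul, epC_opp, mul_comm, epC_mul_wtC, one_smul]
        · simp
      simp_rw [this]
      simp
    have h3 : ∑ i, wtC i • (etaA j i * ρ (opp i) l) = ρ j l := by
      have : ∀ i, wtC i • (etaA j i * ρ (opp i) l) = if i = opp j then ρ (opp i) l else 0 := by
        intro i
        rw [etaA]
        split_ifs with h
        · subst h
          rw [← Algebra.smul_def, smul_smul, ← epC_opp j, mul_comm, epC_mul_wtC, one_smul]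
        · simp
      simp_rw [this]
      simp [opp_opp]
    have h4 : ∑ i, wtC i • (etaA j l * ρ (opp i) i) = 0 := by
      simp_rw [← Algebra.mul_smul_comm, ← Finset.mul_sum, hρ, mul_zero]
    simp_rw [e, Finset.sum_add_distrib, hB, ← Finset.smul_sum, Finset.sum_add_distrib,
      Finset.sum_sub_distrib, h1, h2, h3, h4]
    simp only [Finset.sum_const, Finset.card_univ, Fintype.card_fin]
    module
  have sc : scA gi (ricA R) = 0 := by rw [scA_frame hgi]; simp_rw [ric]; exact hρ'
  have eta : ∀ i j, fr2 E g i j = etaA i j := fun i j => by rw [fr2_g, gram]; rfl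
  have h1 : fr4 E (weylA g (riemA g R) (ricA R) (scA gi (ricA R))) i j k l
      = fr4 E (riemA g R) i j k l - (1 / 2 : ℂ) • (fr4 E (fun a b c d => g a c * ricA R b d) i j k l
        - fr4 E (fun a b c d => g a d * ricA R b c) i j k l
        - fr4 E (fun a b c d => ricA R a d * g b c) i j k l
        + fr4 E (fun a b c d => ricA R a c * g b d) i j k l) := by
    simp only [fr4, ← ten4_smul, ← ten4_sub, ← ten4_add]
    congr 1
    funext a b c d
    rw [weylA, sc, zero_mul, smul_zero, add_zero, mul_comm (g b c), mul_comm (g b d)]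
  rw [h1, fr4_mul₁, fr4_mul₂, fr4_mul₂, fr4_mul₁, fr4_riemA gram hR, hF, ric, ric, ric, ric,
    eta, eta, eta, eta, mul_comm (ρ i l), mul_comm (ρ i k)]
  module

end frameCurvature

/-! ## The Weyl tensor of the Kerr-Vaidya metric -/

namespace KVRing

variable {A : Type*} [CommRing A] [Algebra ℂ A] {D : Fin 4 → Derivation ℂ A A} (K : KVRing D)

theorem nullFrame : NullFrame D K.g K.E K.γ where
  gram := K.gram
  torsion i j a := by simpa only [δ_apply] using K.torsion i j a
  metric := fun i j k => K.metric i j k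

/-- The components of the Weyl tensor. -/
def ψ₂ : A := 4 * K.μ 0 * K.Z ^ 3
def ψ₂' : A := 4 * K.μ 0 * K.W ^ 3
def ψ₃ : A := -((4 * K.Z ^ 2 * K.W + 2 * K.Z * K.W ^ 2) * K.t * K.μ 1)
def ψ₃' : A := (4 * K.Z * K.W ^ 2 + 2 * K.Z ^ 2 * K.W) * K.t * K.μ 1
def ψ₄ : A := -((4 * K.Z ^ 2 * K.W ^ 2 + 4 * K.Z * K.W ^ 3) * K.t ^ 2 * K.μ 1)
  - (2 * K.Z * K.W ^ 2 + 2 * K.W ^ 3) * K.t ^ 2 * K.μ 2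
def ψ₄' : A := -((4 * K.Z ^ 2 * K.W ^ 2 + 4 * K.Z ^ 3 * K.W) * K.t ^ 2 * K.μ 1)
  - (2 * K.Z ^ 2 * K.W + 2 * K.Z ^ 3) * K.t ^ 2 * K.μ 2

/-- The frame components of the Weyl tensor. -/
def weylT : Matrix (Fin 6) (Fin 6) A :=
  symT6 ![0, K.ψ₂, K.ψ₃, K.ψ₄] ![0, K.ψ₂', K.ψ₃', K.ψ₄']

/-- The frame components of the Ricci tensor. -/
def ρ : Fin 4 → Fin 4 → A :=
  ![![0, 0, 0, 0],
    ![0, 2 * (K.Z ^ 2 * K.W + K.Z * K.W ^ 2) * K.t ^ 2 * K.μ 2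
      + 2 * (K.Z + K.W) ^ 2 * K.μ 1, -(2 * K.Z ^ 3 * K.t * K.μ 1), 2 * K.W ^ 3 * K.t * K.μ 1],
    ![0, -(2 * K.Z ^ 3 * K.t * K.μ 1), 0, 0],
    ![0, 2 * K.W ^ 3 * K.t * K.μ 1, 0, 0]]

/-- The curvature predicted from its Weyl and Ricci parts. -/
def curvT (i j k l : Fin 4) : A :=
  bivTab K.weylT i j k l + (1 / 2 : ℂ) • (etaA i k * K.ρ j l
      - etaA i l * K.ρ j k - etaA j k * K.ρ i l + etaA j l * K.ρ i k)

theorem weylT_bivTab (i j k l : Fin 4) : bivTab K.weylT i j k l =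
    K.ψ₂ * ((bivZ 0 i j * bivZ 2 k l + bivZ 2 i j * bivZ 0 k l - bivZ 1 i j * bivZ 1 k l : ℤ) : A)
    + K.ψ₃ * ((bivZ 1 i j * bivZ 2 k l + bivZ 2 i j * bivZ 1 k l : ℤ) : A)
    + K.ψ₄ * ((bivZ 2 i j * bivZ 2 k l : ℤ) : A)
    + K.ψ₂' * ((bivZ 3 i j * bivZ 5 k l + bivZ 5 i j * bivZ 3 k l - bivZ 4 i j * bivZ 4 k l : ℤ) : A)
    + K.ψ₃' * ((bivZ 4 i j * bivZ 5 k l + bivZ 5 i j * bivZ 4 k l : ℤ) : A)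
    + K.ψ₄' * ((bivZ 5 i j * bivZ 5 k l : ℤ) : A) := by
  simp [bivTab, Fin.sum_univ_six, weylT, symT6, biv]
  ring

-- The actual curvature computation. The last two indices run only over the six increasing pairs;
-- antisymmetry supplies the others in `curv_eq`.
set_option maxHeartbeats 40000000 in
theorem curv_pairs (i j : Fin 4) (p : Fin 6) :
    epC i • curvF D K.E K.γ (opp i) j (![0, 0, 0, 1, 1, 2] p) (![1, 2, 3, 2, 3, 3] p)
      = K.curvT i j (![0, 0, 0, 1, 1, 2] p) (![1, 2, 3, 2, 3, 3] p) := by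
  have h := K.tc
  have h1 := K.zZ
  have h2 := K.wW
  have h4 : algebraMap ℂ A 2 = 2 := map_ofNat _ 2
  have h5 : 2 * algebraMap ℂ A 2⁻¹ = 1 := by rw [← h4, ← map_mul]; norm_num
  have key : 2 * K.t * K.c * K.Z * K.W = K.W - K.Z := by
    linear_combination K.Z * K.W * h + K.W * h1 - K.Z * h2
  unfold curvF curvT
  simp only [← δ_apply, weylT_bivTab]
  fin_cases p <;> fin_cases i <;> fin_cases j <;>
    simp [Fin.sum_univ_four, γ, δ0, δ1, δ2, δ3, Derivation.leibniz_pow, etaA, opp, epC, bivZ,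
      ψ₂, ψ₃, ψ₄, ψ₂', ψ₃', ψ₄', ρ, Algebra.smul_def, h4] <;> clear h h1 h2 h4 <;> grind

theorem curv_eq (i j k l : Fin 4) : epC i • curvF D K.E K.γ (opp i) j k l = K.curvT i j k l := by
  have a1 : ∀ k l, curvF D K.E K.γ (opp i) j k l = -curvF D K.E K.γ (opp i) j l k := by
    intro k l
    simp only [curvF, Fin.sum_univ_four]
    ring
  have a2 : ∀ k l, K.curvT i j k l = -K.curvT i j l k := by
    intro k l
    have hz : ∀ a k l, (biv a k l : A) = -biv a l k := by
      intro a k l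
      have : bivZ a k l = -bivZ a l k := by revert a k l; decide
      rw [biv, this, Int.cast_neg, biv]
    have : bivTab K.weylT i j k l = -bivTab K.weylT i j l k := by
      unfold bivTab
      rw [← Finset.sum_neg_distrib]
      refine Finset.sum_congr rfl fun a _ => ?_
      rw [← Finset.sum_neg_distrib]
      refine Finset.sum_congr rfl fun b _ => ?_
      rw [hz b k l]; ring
    rw [curvT, this, curvT]
    module
  have a3 : ∀ k l, epC i • curvF D K.E K.γ (opp i) j l k = K.curvT i j l k →
      epC i • curvF D K.E K.γ (opp i) j k l = K.curvT i j k l := by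
    intro k l h
    rw [a1, a2, smul_neg, h]
  have a4 : ∀ k, epC i • curvF D K.E K.γ (opp i) j k k = K.curvT i j k k := by
    intro k
    have e1 := eq_zero_of_add_self (add_eq_zero_iff_eq_neg.2 (a1 k k))
    have e2 := eq_zero_of_add_self (add_eq_zero_iff_eq_neg.2 (a2 k k))
    rw [e1, e2, smul_zero]
  have h := K.curv_pairs i j
  fin_cases k <;> fin_cases l
  · exact a4 0
  · exact h 0
  · exact h 1
  · exact h 2
  · exact a3 _ _ (h 0)
  · exact a4 1
  · exact h 3
  · exact h 4
  · exact a3 _ _ (h 1)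
  · exact a3 _ _ (h 3)
  · exact a4 2
  · exact h 5
  · exact a3 _ _ (h 2)
  · exact a3 _ _ (h 4)
  · exact a3 _ _ (h 5)
  · exact a4 3

end KVRing

/-! ## Curvature invariants of the Kerr-Vaidya metric -/

namespace KVRing

variable {A : Type*} [CommRing A] [Algebra ℂ A] {D : Fin 4 → Derivation ℂ A A} (K : KVRing D)

theorem der_four (d : Derivation ℂ A A) : d 4 = 0 := d.map_natCast 4

theorem g_symm (a b : Fin 4) : K.g a b = K.g b a := by
  fin_cases a <;> fin_cases b <;> simp [g]

/-- The Weyl tensor. -/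
def weylK (gi : Fin 4 → Fin 4 → A) : Fin 4 → Fin 4 → Fin 4 → Fin 4 → A :=
  weylA K.g (riemA K.g (riemUpA D (chrA D K.g gi))) (ricA (riemUpA D (chrA D K.g gi)))
    (scA gi (ricA (riemUpA D (chrA D K.g gi))))

variable {gi : Fin 4 → Fin 4 → A}

theorem nabV_eq (hinv : ∀ a b, ∑ c, K.g a c * gi c b = if a = b then 1 else 0) (i j a : Fin 4) :
    nabV D (chrA D K.g gi) (K.E j) (K.E i) a = ∑ k, K.γ k i j * K.E k a :=
  K.nullFrame.nabV_eq K.g_symm hinv (chrA_compat K.g_symm hinv) (chrA_symm K.g_symm) i j a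

/-- The decomposition `curvT` meets the hypotheses of `fr4_weylA`: each elementary bivector tensor
multiplying some ψ is trace-free, an integer identity, and ρ has no entries on dual pairs of legs.
-/
theorem weyl_frame (hc : ∀ i j f, D i (D j f) = D j (D i f))
    (hinv : ∀ a b, ∑ c, K.g a c * gi c b = if a = b then 1 else 0) :
    fr4 K.E (K.weylK gi) = bivTab K.weylT := by
  obtain ⟨h1, h2⟩ := frame_inverse K.g_symm hinv K.gram
  funext i j k l
  refine fr4_weylA (ρ := K.ρ) K.gram h1 h2 (K.nullFrame.curv_eq hc (K.nabV_eq hinv))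
    K.curv_eq ?_ ?_ ?_ i j k l
  · intro j l
    have e : ∀ i, wtC i • bivTab K.weylT (opp i) j i l
        = (1 / 2 : ℂ) • ((sgZ i : A) * bivTab K.weylT (opp i) j i l) := fun i => wtC_smul _ _
    simp_rw [e, ← Finset.smul_sum, weylT_bivTab]
    have t0 : ∀ j l, ∑ i, sgZ i * (bivZ 0 (opp i) j * bivZ 2 i l + bivZ 2 (opp i) j * bivZ 0 i l
      - bivZ 1 (opp i) j * bivZ 1 i l) = 0 := by decide
    have t1 : ∀ j l, ∑ i, sgZ i * (bivZ 1 (opp i) j * bivZ 2 i l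
      + bivZ 2 (opp i) j * bivZ 1 i l) = 0 := by decide
    have t2 : ∀ j l, ∑ i, sgZ i * (bivZ 2 (opp i) j * bivZ 2 i l) = 0 := by decide
    have t3 : ∀ j l, ∑ i, sgZ i * (bivZ 3 (opp i) j * bivZ 5 i l + bivZ 5 (opp i) j * bivZ 3 i l
      - bivZ 4 (opp i) j * bivZ 4 i l) = 0 := by decide
    have t4 : ∀ j l, ∑ i, sgZ i * (bivZ 4 (opp i) j * bivZ 5 i l
      + bivZ 5 (opp i) j * bivZ 4 i l) = 0 := by decide
    have t5 : ∀ j l, ∑ i, sgZ i * (bivZ 5 (opp i) j * bivZ 5 i l) = 0 := by decide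
    have e : ∀ (f : Fin 4 → ℤ) (x : A), ∑ i, sgZ i * f i = 0 →
        ∑ i, (sgZ i : A) * (x * (f i : A)) = 0 := by
      intro f x h
      have : ∑ i, (sgZ i : A) * (x * (f i : A)) = x * ((∑ i, sgZ i * f i : ℤ) : A) := by
        push_cast
        rw [Finset.mul_sum]
        exact Finset.sum_congr rfl fun i _ => by ring
      rw [this, h, Int.cast_zero, mul_zero]
    simp only [mul_add, Finset.sum_add_distrib]
    rw [e _ _ (t0 j l), e _ _ (t1 j l), e _ _ (t2 j l), e _ _ (t3 j l), e _ _ (t4 j l),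
      e _ _ (t5 j l)]
    simp
  · simp [Fin.sum_univ_four, ρ, opp]
  · simp [Fin.sum_univ_four, ρ, opp]

/-- The self-dual components of the covariant derivative of the Weyl tensor. -/
def χ (h : Fin 4) : Fin 4 → A :=
  ![3 * K.ψ₂ * K.γ 3 0 h, K.δ h K.ψ₂ - 2 * K.γ 3 0 h * K.ψ₃,
    K.δ h K.ψ₃ - 3 * K.ψ₂ * K.γ 2 1 h + (K.γ 0 0 h + K.γ 2 2 h) * K.ψ₃ + K.γ 3 0 h * K.ψ₄,
    K.δ h K.ψ₄ + 2 * (K.γ 0 0 h + K.γ 2 2 h) * K.ψ₄ + 4 * K.γ 2 1 h * K.ψ₃]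

/-- The anti-self-dual components of the covariant derivative of the Weyl tensor. -/
def χ' (h : Fin 4) : Fin 4 → A :=
  ![3 * K.ψ₂' * K.γ 2 0 h, K.δ h K.ψ₂' - 2 * K.γ 2 0 h * K.ψ₃',
    K.δ h K.ψ₃' - 3 * K.ψ₂' * K.γ 3 1 h + (K.γ 0 0 h - K.γ 2 2 h) * K.ψ₃' + K.γ 2 0 h * K.ψ₄',
    K.δ h K.ψ₄' + 2 * (K.γ 0 0 h - K.γ 2 2 h) * K.ψ₄' + 4 * K.γ 3 1 h * K.ψ₃']

set_option maxHeartbeats 4000000 in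
/-- The components of the covariant derivative of the Weyl tensor that enter the invariants. -/
theorem χ_spec (K : KVRing D) {Z W t m m1 m2 : A} (hZ : K.Z = Z) (hW : K.W = W)
    (ht : K.t = t) (hm : K.μ 0 = m) (hm1 : K.μ 1 = m1) (hm2 : K.μ 2 = m2) :
    K.χ 0 0 = 0 ∧
    K.χ 0 1 = 12 * Z ^ (4 : ℕ) * m ∧
    K.χ 0 2 = 12 * Z ^ (4 : ℕ) * W * t * m - 12 * Z ^ (3 : ℕ) * W * t * m1 - 4 * Z ^ (2 : ℕ) *
      W ^ (2 : ℕ) * t * m1 - 2 * Z * W ^ (3 : ℕ) * t * m1 ∧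
    K.χ 1 0 = -(12 * Z ^ (5 : ℕ) * t * m) ∧
    K.χ 1 1 = 12 * Z ^ (5 : ℕ) * W * t ^ (2 : ℕ) * m + 12 * Z ^ (5 : ℕ) * m ^ (2 : ℕ) + 12 *
      Z ^ (4 : ℕ) * W * m ^ (2 : ℕ) - 16 * Z ^ (4 : ℕ) * W * t ^ (2 : ℕ) * m1 - 12 * Z ^ (4 : ℕ) *
      m - 4 * Z ^ (3 : ℕ) * W ^ (2 : ℕ) * t ^ (2 : ℕ) * m1 + 8 * Z ^ (3 : ℕ) * m1 ∧
    K.χ 1 2 = -(16 * Z ^ (4 : ℕ) * W * t * m * m1) + 4 * Z ^ (3 : ℕ) * W ^ (3 : ℕ) * t ^ (3 : ℕ)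
      * m1 - 24 * Z ^ (3 : ℕ) * W ^ (2 : ℕ) * t * m * m1 + 10 * Z ^ (3 : ℕ) * W ^ (2 : ℕ) *
      t ^ (3 : ℕ) * m2 + 8 * Z ^ (3 : ℕ) * W * t * m1 - 2 * Z ^ (2 : ℕ) * W ^ (4 : ℕ) *
      t ^ (3 : ℕ) * m1 - 6 * Z ^ (2 : ℕ) * W ^ (3 : ℕ) * t * m * m1 + 6 * Z ^ (2 : ℕ) *
      W ^ (3 : ℕ) * t ^ (3 : ℕ) * m2 + 6 * Z ^ (2 : ℕ) * W ^ (2 : ℕ) * t * m1 - 8 * Z ^ (2 : ℕ) *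
      W * t * m2 - 2 * Z * W ^ (4 : ℕ) * t * m * m1 + 4 * Z * W ^ (3 : ℕ) * t * m1 - 4 * Z *
      W ^ (2 : ℕ) * t * m2 ∧
    K.χ 2 0 = 0 ∧
    K.χ 2 1 = 12 * Z ^ (5 : ℕ) * t * m + 4 * Z ^ (4 : ℕ) * t * m1 ∧
    K.χ 2 2 = 12 * Z ^ (5 : ℕ) * W * t ^ (2 : ℕ) * m + 12 * Z ^ (5 : ℕ) * m ^ (2 : ℕ) + 12 *
      Z ^ (4 : ℕ) * W * m ^ (2 : ℕ) - 12 * Z ^ (4 : ℕ) * W * t ^ (2 : ℕ) * m1 - 12 * Z ^ (4 : ℕ) *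
      m - 4 * Z ^ (3 : ℕ) * W ^ (2 : ℕ) * t ^ (2 : ℕ) * m1 - 4 * Z ^ (3 : ℕ) * W * t ^ (2 : ℕ) *
      m2 + 4 * Z ^ (3 : ℕ) * m1 + 2 * Z ^ (2 : ℕ) * W ^ (3 : ℕ) * t ^ (2 : ℕ) * m1 - 2 *
      Z ^ (2 : ℕ) * W ^ (2 : ℕ) * t ^ (2 : ℕ) * m2 - 2 * Z ^ (2 : ℕ) * W * m1 - 2 * Z *
      W ^ (2 : ℕ) * m1 ∧
    K.χ 3 0 = -(12 * Z ^ (4 : ℕ) * m) ∧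
    K.χ 3 1 = 12 * Z ^ (4 : ℕ) * W * t * m - 12 * Z ^ (3 : ℕ) * W * t * m1 - 4 * Z ^ (2 : ℕ) *
      W ^ (2 : ℕ) * t * m1 ∧
    K.χ 3 2 = 4 * Z ^ (2 : ℕ) * W ^ (3 : ℕ) * t ^ (2 : ℕ) * m1 + 6 * Z ^ (2 : ℕ) * W ^ (2 : ℕ) *
      t ^ (2 : ℕ) * m2 + 2 * Z * W ^ (4 : ℕ) * t ^ (2 : ℕ) * m1 + 4 * Z * W ^ (3 : ℕ) *
      t ^ (2 : ℕ) * m2 ∧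
    K.χ' 0 0 = 0 ∧
    K.χ' 0 1 = 12 * W ^ (4 : ℕ) * m ∧
    K.χ' 0 2 = 2 * Z ^ (3 : ℕ) * W * t * m1 + 4 * Z ^ (2 : ℕ) * W ^ (2 : ℕ) * t * m1 - 12 * Z *
      W ^ (4 : ℕ) * t * m + 12 * Z * W ^ (3 : ℕ) * t * m1 ∧
    K.χ' 1 0 = 12 * W ^ (5 : ℕ) * t * m ∧
    K.χ' 1 1 = -(4 * Z ^ (2 : ℕ) * W ^ (3 : ℕ) * t ^ (2 : ℕ) * m1) + 12 * Z * W ^ (5 : ℕ) *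
      t ^ (2 : ℕ) * m + 12 * Z * W ^ (4 : ℕ) * m ^ (2 : ℕ) - 16 * Z * W ^ (4 : ℕ) * t ^ (2 : ℕ) *
      m1 + 12 * W ^ (5 : ℕ) * m ^ (2 : ℕ) - 12 * W ^ (4 : ℕ) * m + 8 * W ^ (3 : ℕ) * m1 ∧
    K.χ' 1 2 = 2 * Z ^ (4 : ℕ) * W ^ (2 : ℕ) * t ^ (3 : ℕ) * m1 + 2 * Z ^ (4 : ℕ) * W * t * m *
      m1 - 4 * Z ^ (3 : ℕ) * W ^ (3 : ℕ) * t ^ (3 : ℕ) * m1 + 6 * Z ^ (3 : ℕ) * W ^ (2 : ℕ) * t *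
      m * m1 - 6 * Z ^ (3 : ℕ) * W ^ (2 : ℕ) * t ^ (3 : ℕ) * m2 - 4 * Z ^ (3 : ℕ) * W * t * m1 +
      24 * Z ^ (2 : ℕ) * W ^ (3 : ℕ) * t * m * m1 - 10 * Z ^ (2 : ℕ) * W ^ (3 : ℕ) * t ^ (3 : ℕ) *
      m2 - 6 * Z ^ (2 : ℕ) * W ^ (2 : ℕ) * t * m1 + 4 * Z ^ (2 : ℕ) * W * t * m2 + 16 * Z *
      W ^ (4 : ℕ) * t * m * m1 - 8 * Z * W ^ (3 : ℕ) * t * m1 + 8 * Z * W ^ (2 : ℕ) * t * m2 ∧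
    K.χ' 2 0 = -(12 * W ^ (4 : ℕ) * m) ∧
    K.χ' 2 1 = 4 * Z ^ (2 : ℕ) * W ^ (2 : ℕ) * t * m1 - 12 * Z * W ^ (4 : ℕ) * t * m + 12 * Z *
      W ^ (3 : ℕ) * t * m1 ∧
    K.χ' 2 2 = 2 * Z ^ (4 : ℕ) * W * t ^ (2 : ℕ) * m1 + 4 * Z ^ (3 : ℕ) * W ^ (2 : ℕ) *
      t ^ (2 : ℕ) * m1 + 4 * Z ^ (3 : ℕ) * W * t ^ (2 : ℕ) * m2 + 6 * Z ^ (2 : ℕ) * W ^ (2 : ℕ) *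
      t ^ (2 : ℕ) * m2 ∧
    K.χ' 3 0 = 0 ∧
    K.χ' 3 1 = -(12 * W ^ (5 : ℕ) * t * m) - 4 * W ^ (4 : ℕ) * t * m1 ∧
    K.χ' 3 2 = 2 * Z ^ (3 : ℕ) * W ^ (2 : ℕ) * t ^ (2 : ℕ) * m1 - 4 * Z ^ (2 : ℕ) * W ^ (3 : ℕ)
      * t ^ (2 : ℕ) * m1 - 2 * Z ^ (2 : ℕ) * W ^ (2 : ℕ) * t ^ (2 : ℕ) * m2 - 2 * Z ^ (2 : ℕ) * W
      * m1 + 12 * Z * W ^ (5 : ℕ) * t ^ (2 : ℕ) * m + 12 * Z * W ^ (4 : ℕ) * m ^ (2 : ℕ) - 12 * Z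
      * W ^ (4 : ℕ) * t ^ (2 : ℕ) * m1 - 4 * Z * W ^ (3 : ℕ) * t ^ (2 : ℕ) * m2 - 2 * Z *
      W ^ (2 : ℕ) * m1 + 12 * W ^ (5 : ℕ) * m ^ (2 : ℕ) - 12 * W ^ (4 : ℕ) * m + 4 * W ^ (3 : ℕ) *
      m1 := by
  -- Needed for the components in which the cotangents coming from the derivative of t and from γ do
  -- not cancel on their own.
  have key : 2 * t * K.c * Z * W = W - Z := by
    subst hZ hW ht
    linear_combination K.Z * K.W * K.tc + K.W * K.zZ - K.Z * K.wW
  subst hZ hW ht hm hm1 hm2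
  simp only [χ, χ']
  refine ⟨?_, ?_, ?_, ?_, ?_, ?_, ?_, ?_, ?_, ?_, ?_, ?_, ?_, ?_, ?_, ?_, ?_, ?_, ?_, ?_, ?_, ?_,
    ?_, ?_⟩ <;>
    simp [γ, δ0, δ1, δ2, δ3, Derivation.leibniz_pow, ψ₂, ψ₃, ψ₄, ψ₂', ψ₃', ψ₄', der_two, der_four] <;>
    first
    | ring1
    | linear_combination -((2 * K.Z * K.W + 4 * K.Z ^ 2) * K.μ 1) * key
    | linear_combination (2 * K.Z * K.W + 4 * K.W ^ 2) * K.μ 1 * key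

theorem covWeyl_frame (hc : ∀ i j f, D i (D j f) = D j (D i f))
    (hinv : ∀ a b, ∑ c, K.g a c * gi c b = if a = b then 1 else 0) (i j k l h : Fin 4) :
    fr5 K.E (covA D (chrA D K.g gi) (K.weylK gi)) i j k l h
      = bivTab (symT6 (K.χ h) (K.χ' h)) i j k l := by
  rw [fr5_covA (K.nabV_eq hinv), K.weyl_frame hc hinv]
  have hd : dirD D (K.E h) = K.δ h := funext fun f => (K.δ_apply h f).symm
  rw [hd]
  exact actF_symT6 (SkewFrame.of_metric fun i k => K.metric i h k) (K.δ h) _ _ _ _ _ _ i j k l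

/-- The first invariant. -/
def I₁ : A := 24 * K.μ 0 ^ 2 * (K.Z ^ 6 + K.W ^ 6)

theorem contr4_weyl (hc : ∀ i j f, D i (D j f) = D j (D i f))
    (hinv : ∀ a b, ∑ c, K.g a c * gi c b = if a = b then 1 else 0) :
    contr4 gi (K.weylK gi) (K.weylK gi) = K.I₁ := by
  obtain ⟨h1, -⟩ := frame_inverse K.g_symm hinv K.gram
  rw [contr4_frame h1, K.weyl_frame hc hinv, weylT, symT6_contract]
  have h2 : (2 : A) * algebraMap ℂ A (3 / 2) = 3 := by
    rw [← map_ofNat (algebraMap ℂ A) 2, ← map_mul, ← map_ofNat (algebraMap ℂ A) 3]; norm_num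
  simp [ψ₂, ψ₂', I₁, Algebra.smul_def]
  linear_combination (8 * K.μ 0 ^ 2 * (K.Z ^ 6 + K.W ^ 6)) * h2

/-- The invariant `I_3`. -/
def polyI₃ (Z W t m m1 m2 : A) : A :=
    -(360 * Z ^ (9 : ℕ) * m ^ (3 : ℕ)) - 360 * Z ^ (8 : ℕ) * W * m ^ (3 : ℕ) + 144 * Z ^ (8 : ℕ) *
    W * t ^ (2 : ℕ) * m * m1 + 360 * Z ^ (8 : ℕ) * m ^ (2 : ℕ) - 72 * Z ^ (7 : ℕ) * W *
    t ^ (2 : ℕ) * m1 ^ (2 : ℕ) + 48 * Z ^ (7 : ℕ) * W * t ^ (2 : ℕ) * m * m2 - 192 * Z ^ (7 : ℕ) *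
    m * m1 - 48 * Z ^ (6 : ℕ) * W ^ (3 : ℕ) * t ^ (2 : ℕ) * m * m1 - 24 * Z ^ (6 : ℕ) *
    W ^ (2 : ℕ) * t ^ (2 : ℕ) * m1 ^ (2 : ℕ) + 24 * Z ^ (6 : ℕ) * W ^ (2 : ℕ) * t ^ (2 : ℕ) * m *
    m2 + 24 * Z ^ (6 : ℕ) * W * m * m1 + 24 * Z ^ (5 : ℕ) * W ^ (2 : ℕ) * m * m1 - 48 *
    Z ^ (3 : ℕ) * W ^ (6 : ℕ) * t ^ (2 : ℕ) * m * m1 - 24 * Z ^ (2 : ℕ) * W ^ (6 : ℕ) *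
    t ^ (2 : ℕ) * m1 ^ (2 : ℕ) + 24 * Z ^ (2 : ℕ) * W ^ (6 : ℕ) * t ^ (2 : ℕ) * m * m2 + 24 *
    Z ^ (2 : ℕ) * W ^ (5 : ℕ) * m * m1 - 360 * Z * W ^ (8 : ℕ) * m ^ (3 : ℕ) + 144 * Z *
    W ^ (8 : ℕ) * t ^ (2 : ℕ) * m * m1 - 72 * Z * W ^ (7 : ℕ) * t ^ (2 : ℕ) * m1 ^ (2 : ℕ) + 48 *
    Z * W ^ (7 : ℕ) * t ^ (2 : ℕ) * m * m2 + 24 * Z * W ^ (6 : ℕ) * m * m1 - 360 * W ^ (9 : ℕ) *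
    m ^ (3 : ℕ) + 360 * W ^ (8 : ℕ) * m ^ (2 : ℕ) - 192 * W ^ (7 : ℕ) * m * m1

/-- The invariant `I_{3a}`. -/
def polyI₃a (Z W t m m1 m2 : A) : A :=
    -(180 * Z ^ (9 : ℕ) * m ^ (3 : ℕ)) - 180 * Z ^ (8 : ℕ) * W * m ^ (3 : ℕ) + 72 * Z ^ (8 : ℕ) *
    W * t ^ (2 : ℕ) * m * m1 + 180 * Z ^ (8 : ℕ) * m ^ (2 : ℕ) - 36 * Z ^ (7 : ℕ) * W *
    t ^ (2 : ℕ) * m1 ^ (2 : ℕ) + 24 * Z ^ (7 : ℕ) * W * t ^ (2 : ℕ) * m * m2 - 96 * Z ^ (7 : ℕ) *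
    m * m1 - 24 * Z ^ (6 : ℕ) * W ^ (3 : ℕ) * t ^ (2 : ℕ) * m * m1 - 12 * Z ^ (6 : ℕ) *
    W ^ (2 : ℕ) * t ^ (2 : ℕ) * m1 ^ (2 : ℕ) + 12 * Z ^ (6 : ℕ) * W ^ (2 : ℕ) * t ^ (2 : ℕ) * m *
    m2 + 12 * Z ^ (6 : ℕ) * W * m * m1 - 3 * Z ^ (5 : ℕ) * W ^ (3 : ℕ) * t ^ (2 : ℕ) *
    m1 ^ (2 : ℕ) + 12 * Z ^ (5 : ℕ) * W ^ (2 : ℕ) * m * m1 - 24 * Z ^ (3 : ℕ) * W ^ (6 : ℕ) *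
    t ^ (2 : ℕ) * m * m1 - 3 * Z ^ (3 : ℕ) * W ^ (5 : ℕ) * t ^ (2 : ℕ) * m1 ^ (2 : ℕ) - 12 *
    Z ^ (2 : ℕ) * W ^ (6 : ℕ) * t ^ (2 : ℕ) * m1 ^ (2 : ℕ) + 12 * Z ^ (2 : ℕ) * W ^ (6 : ℕ) *
    t ^ (2 : ℕ) * m * m2 + 12 * Z ^ (2 : ℕ) * W ^ (5 : ℕ) * m * m1 - 180 * Z * W ^ (8 : ℕ) *
    m ^ (3 : ℕ) + 72 * Z * W ^ (8 : ℕ) * t ^ (2 : ℕ) * m * m1 - 36 * Z * W ^ (7 : ℕ) * t ^ (2 : ℕ)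
    * m1 ^ (2 : ℕ) + 24 * Z * W ^ (7 : ℕ) * t ^ (2 : ℕ) * m * m2 + 12 * Z * W ^ (6 : ℕ) * m * m1 -
    180 * W ^ (9 : ℕ) * m ^ (3 : ℕ) + 180 * W ^ (8 : ℕ) * m ^ (2 : ℕ) - 96 * W ^ (7 : ℕ) * m * m1

theorem contr5_weyl (hc : ∀ i j f, D i (D j f) = D j (D i f))
    (hinv : ∀ a b, ∑ c, K.g a c * gi c b = if a = b then 1 else 0) :
    contr5 gi (covA D (chrA D K.g gi) (K.weylK gi)) (covA D (chrA D K.g gi) (K.weylK gi))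
      = polyI₃ K.Z K.W K.t (K.μ 0) (K.μ 1) (K.μ 2) := by
  obtain ⟨h1, -⟩ := frame_inverse K.g_symm hinv K.gram
  rw [contr5_frame h1]
  simp_rw [K.covWeyl_frame hc hinv]
  have sw : ∀ f : Fin 4 → Fin 4 → Fin 4 → Fin 4 → Fin 4 → A,
      ∑ i, ∑ j, ∑ k, ∑ l, ∑ h, f i j k l h = ∑ h, ∑ i, ∑ j, ∑ k, ∑ l, f i j k l h := by
    intro f
    rw [Finset.sum_congr rfl fun i _ => Finset.sum_congr rfl fun j _ =>
      Finset.sum_congr rfl fun k _ => Finset.sum_comm,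
      Finset.sum_congr rfl fun i _ => Finset.sum_congr rfl fun j _ => Finset.sum_comm,
      Finset.sum_congr rfl fun i _ => Finset.sum_comm, Finset.sum_comm]
  rw [sw]
  have e : ∀ (i j k l h : Fin 4) (x : A), (wtC i * wtC j * wtC k * wtC l * wtC h) • x
      = wtC h • ((wtC i * wtC j * wtC k * wtC l) • x) := by
    intro i j k l h x
    rw [smul_smul, mul_comm]
  simp_rw [e, ← Finset.smul_sum, symT6_contract]
  have h2 : (2 : A) * algebraMap ℂ A 2⁻¹ = 1 := by
    rw [← map_ofNat (algebraMap ℂ A) 2, ← map_mul]; norm_num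
  have h3 : algebraMap ℂ A (3 / 2) = 3 * algebraMap ℂ A 2⁻¹ := by
    rw [← map_ofNat (algebraMap ℂ A) 3, ← map_mul]; norm_num
  obtain ⟨x00, x01, x02, x10, x11, x12, x20, x21, x22, x30, x31, x32, y00, y01, y02, y10, y11,
    y12, y20, y21, y22, y30, y31, y32⟩ := K.χ_spec rfl rfl rfl rfl rfl rfl
  -- The inverse metric pairs the derivative indices 0 with 1 and 2 with 3, so only the products of
  -- χ₀ with χ₁ and of χ₂ with χ₃ occur. Both sides are doubled to keep the coefficients integral.
  have key : 3 * ((K.χ 2 1 * K.χ 3 1 - K.χ 0 1 * K.χ 1 1)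
        + (K.χ' 2 1 * K.χ' 3 1 - K.χ' 0 1 * K.χ' 1 1))
      + 2 * ((K.χ 2 0 * K.χ 3 2 + K.χ 2 2 * K.χ 3 0 - K.χ 0 0 * K.χ 1 2 - K.χ 0 2 * K.χ 1 0)
        + (K.χ' 2 0 * K.χ' 3 2 + K.χ' 2 2 * K.χ' 3 0 - K.χ' 0 0 * K.χ' 1 2 - K.χ' 0 2 * K.χ' 1 0))
      = 2 * polyI₃ K.Z K.W K.t (K.μ 0) (K.μ 1) (K.μ 2) := by
    simp only [x00, x01, x02, x10, x11, x12, x20, x21, x22, x30, x31, x32,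
      y00, y01, y02, y10, y11, y12, y20, y21, y22, y30, y31, y32, polyI₃]
    ring
  clear x00 x01 x02 x10 x11 x12 x20 x21 x22 x30 x31 x32
  clear y00 y01 y02 y10 y11 y12 y20 y21 y22 y30 y31 y32
  generalize polyI₃ K.Z K.W K.t (K.μ 0) (K.μ 1) (K.μ 2) = P at *
  simp only [Fin.sum_univ_four, wtC, opp, Algebra.smul_def, h3, map_neg, one_div,
    Matrix.cons_val_zero, Matrix.cons_val_one, Matrix.cons_val]
  generalize algebraMap ℂ A 2⁻¹ = H at *
  linear_combination H * key + (P + 3 * H * ((K.χ 2 1 * K.χ 3 1 - K.χ 0 1 * K.χ 1 1)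
    + (K.χ' 2 1 * K.χ' 3 1 - K.χ' 0 1 * K.χ' 1 1))) * h2

theorem contr5_weyl_mixed (hc : ∀ i j f, D i (D j f) = D j (D i f))
    (hinv : ∀ a b, ∑ c, K.g a c * gi c b = if a = b then 1 else 0) :
    contr5 gi (covA D (chrA D K.g gi) (K.weylK gi))
      (fun a b c d e => covA D (chrA D K.g gi) (K.weylK gi) e b c d a) = polyI₃a K.Z K.W K.t (K.μ 0) (K.μ 1) (K.μ 2) := by
  obtain ⟨h1, -⟩ := frame_inverse K.g_symm hinv K.gram
  rw [contr5_frame h1]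
  -- Exchanging the derivative index with the first tensor index in coordinates does the same in
  -- frame components.
  have e : ∀ i j k l h, fr5 K.E (fun a b c d e => covA D (chrA D K.g gi) (K.weylK gi) e b c d a) i j k l h
      = bivTab (symT6 (K.χ i) (K.χ' i)) h j k l := by
    intro i j k l h
    rw [← K.covWeyl_frame hc hinv]
    simp only [fr5, fr4, ten4, Finset.mul_sum]
    rw [Finset.sum_comm]
    exact Finset.sum_congr rfl fun a _ => Finset.sum_congr rfl fun e _ =>
      Finset.sum_congr rfl fun b _ => Finset.sum_congr rfl fun c _ =>
      Finset.sum_congr rfl fun d _ => by ring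
  simp_rw [e, K.covWeyl_frame hc hinv, symT6_contract_mixed]
  have h2 : (8 : A) * algebraMap ℂ A (1 / 8) = 1 := by
    rw [← map_ofNat (algebraMap ℂ A) 8, ← map_mul]; norm_num
  obtain ⟨x00, x01, x02, x10, x11, x12, x20, x21, x22, x30, x31, x32, y00, y01, y02, y10, y11,
    y12, y20, y21, y22, y30, y31, y32⟩ := K.χ_spec rfl rfl rfl rfl rfl rfl
  rw [Algebra.smul_def]
  generalize algebraMap ℂ A (1 / 8) = H at *
  rw [← one_mul (polyI₃a _ _ _ _ _ _), ← h2, mul_comm (8 : A), mul_assoc]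
  congr 1
  simp only [x00, x01, x02, x10, x11, x12, x20, x21, x22, x30, x31, x32,
    y00, y01, y02, y10, y11, y12, y20, y21, y22, y30, y31, y32, polyI₃a]
  ring

/-- The invariant `J_4`. -/
def polyJ₄ (Z W t m m1 m2 : A) : A :=
    m ^ (2 : ℕ) * (-(3456 * Z ^ (15 : ℕ) * m ^ (3 : ℕ)) - 3456 * Z ^ (14 : ℕ) * W * m ^ (3 : ℕ) +
    6912 * Z ^ (14 : ℕ) * W * t ^ (2 : ℕ) * m * m1 + 3456 * Z ^ (14 : ℕ) * m ^ (2 : ℕ) + 1152 *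
    Z ^ (13 : ℕ) * W * t ^ (2 : ℕ) * m1 ^ (2 : ℕ) - 2304 * Z ^ (13 : ℕ) * W * t ^ (2 : ℕ) * m * m2
    - 4608 * Z ^ (13 : ℕ) * m * m1 + 2304 * Z ^ (12 : ℕ) * W ^ (3 : ℕ) * t ^ (2 : ℕ) * m * m1 +
    1152 * Z ^ (12 : ℕ) * W ^ (2 : ℕ) * t ^ (2 : ℕ) * m1 ^ (2 : ℕ) - 1152 * Z ^ (12 : ℕ) *
    W ^ (2 : ℕ) * t ^ (2 : ℕ) * m * m2 - 1152 * Z ^ (12 : ℕ) * W * m * m1 + 1152 * Z ^ (11 : ℕ) *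
    W ^ (3 : ℕ) * t ^ (2 : ℕ) * m1 ^ (2 : ℕ) - 1152 * Z ^ (11 : ℕ) * W ^ (2 : ℕ) * m * m1 + 17280
    * Z ^ (9 : ℕ) * W ^ (6 : ℕ) * m ^ (3 : ℕ) + 2304 * Z ^ (9 : ℕ) * W ^ (6 : ℕ) * t ^ (2 : ℕ) * m
    * m1 + 1152 * Z ^ (9 : ℕ) * W ^ (5 : ℕ) * t ^ (2 : ℕ) * m1 ^ (2 : ℕ) - 82944 * Z ^ (8 : ℕ) *
    W ^ (8 : ℕ) * t ^ (2 : ℕ) * m ^ (2 : ℕ) - 24192 * Z ^ (8 : ℕ) * W ^ (7 : ℕ) * m ^ (3 : ℕ) +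
    6912 * Z ^ (8 : ℕ) * W ^ (7 : ℕ) * t ^ (2 : ℕ) * m * m1 - 17280 * Z ^ (8 : ℕ) * W ^ (6 : ℕ) *
    m ^ (2 : ℕ) + 1152 * Z ^ (8 : ℕ) * W ^ (6 : ℕ) * t ^ (2 : ℕ) * m1 ^ (2 : ℕ) - 1152 *
    Z ^ (8 : ℕ) * W ^ (6 : ℕ) * t ^ (2 : ℕ) * m * m2 - 1152 * Z ^ (8 : ℕ) * W ^ (5 : ℕ) * m * m1 -
    24192 * Z ^ (7 : ℕ) * W ^ (8 : ℕ) * m ^ (3 : ℕ) + 6912 * Z ^ (7 : ℕ) * W ^ (8 : ℕ) *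
    t ^ (2 : ℕ) * m * m1 + 41472 * Z ^ (7 : ℕ) * W ^ (7 : ℕ) * m ^ (2 : ℕ) + 2304 * Z ^ (7 : ℕ) *
    W ^ (7 : ℕ) * t ^ (2 : ℕ) * m1 ^ (2 : ℕ) - 4608 * Z ^ (7 : ℕ) * W ^ (7 : ℕ) * t ^ (2 : ℕ) * m
    * m2 - 5760 * Z ^ (7 : ℕ) * W ^ (6 : ℕ) * m * m1 + 17280 * Z ^ (6 : ℕ) * W ^ (9 : ℕ) *
    m ^ (3 : ℕ) + 2304 * Z ^ (6 : ℕ) * W ^ (9 : ℕ) * t ^ (2 : ℕ) * m * m1 - 17280 * Z ^ (6 : ℕ) *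
    W ^ (8 : ℕ) * m ^ (2 : ℕ) + 1152 * Z ^ (6 : ℕ) * W ^ (8 : ℕ) * t ^ (2 : ℕ) * m1 ^ (2 : ℕ) -
    1152 * Z ^ (6 : ℕ) * W ^ (8 : ℕ) * t ^ (2 : ℕ) * m * m2 - 5760 * Z ^ (6 : ℕ) * W ^ (7 : ℕ) * m
    * m1 + 1152 * Z ^ (5 : ℕ) * W ^ (9 : ℕ) * t ^ (2 : ℕ) * m1 ^ (2 : ℕ) - 1152 * Z ^ (5 : ℕ) *
    W ^ (8 : ℕ) * m * m1 + 2304 * Z ^ (3 : ℕ) * W ^ (12 : ℕ) * t ^ (2 : ℕ) * m * m1 + 1152 *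
    Z ^ (3 : ℕ) * W ^ (11 : ℕ) * t ^ (2 : ℕ) * m1 ^ (2 : ℕ) + 1152 * Z ^ (2 : ℕ) * W ^ (12 : ℕ) *
    t ^ (2 : ℕ) * m1 ^ (2 : ℕ) - 1152 * Z ^ (2 : ℕ) * W ^ (12 : ℕ) * t ^ (2 : ℕ) * m * m2 - 1152 *
    Z ^ (2 : ℕ) * W ^ (11 : ℕ) * m * m1 - 3456 * Z * W ^ (14 : ℕ) * m ^ (3 : ℕ) + 6912 * Z *
    W ^ (14 : ℕ) * t ^ (2 : ℕ) * m * m1 + 1152 * Z * W ^ (13 : ℕ) * t ^ (2 : ℕ) * m1 ^ (2 : ℕ) -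
    2304 * Z * W ^ (13 : ℕ) * t ^ (2 : ℕ) * m * m2 - 1152 * Z * W ^ (12 : ℕ) * m * m1 - 3456 *
    W ^ (15 : ℕ) * m ^ (3 : ℕ) + 3456 * W ^ (14 : ℕ) * m ^ (2 : ℕ) - 4608 * W ^ (13 : ℕ) * m * m1)

/-- The invariant `J_4` of the Kerr-Vaidya metric. -/
def J₄ : A := polyJ₄ K.Z K.W K.t (K.μ 0) (K.μ 1) (K.μ 2)

theorem contr2_grad (hinv : ∀ a b, ∑ c, K.g a c * gi c b = if a = b then 1 else 0) (f h : A) :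
    ∑ a, ∑ b, gi a b * D a f * D b h = ∑ i, wtC i • (K.δ i f * K.δ (opp i) h) := by
  obtain ⟨h1, -⟩ := frame_inverse K.g_symm hinv K.gram
  simp_rw [h1, K.δ_apply, dirD, Finset.sum_mul_sum, Finset.smul_sum, Finset.sum_mul]
  rw [Finset.sum_congr rfl fun a _ => Finset.sum_comm, Finset.sum_comm]
  refine Finset.sum_congr rfl fun i _ => Finset.sum_congr rfl fun a _ =>
    Finset.sum_congr rfl fun b _ => ?_
  simp only [Algebra.smul_def]
  ring

theorem J₄_eq (hinv : ∀ a b, ∑ c, K.g a c * gi c b = if a = b then 1 else 0) :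
    6 * K.I₁ * polyI₃ K.Z K.W K.t (K.μ 0) (K.μ 1) (K.μ 2)
      - 16 * K.I₁ * polyI₃a K.Z K.W K.t (K.μ 0) (K.μ 1) (K.μ 2)
      + ∑ a, ∑ b, gi a b * D a K.I₁ * D b K.I₁ = K.J₄ := by
  have h2 : (2 : A) * algebraMap ℂ A 2⁻¹ = 1 := by
    rw [← map_ofNat (algebraMap ℂ A) 2, ← map_mul]; norm_num
  have d24 : ∀ d : Derivation ℂ A A, d 24 = 0 := fun d => d.map_natCast 24
  rw [K.contr2_grad hinv]
  simp only [Fin.sum_univ_four, wtC, opp, Algebra.smul_def, map_neg, one_div,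
    Matrix.cons_val_zero, Matrix.cons_val_one, Matrix.cons_val]
  generalize algebraMap ℂ A 2⁻¹ = H at *
  have e : 6 * K.I₁ * polyI₃ K.Z K.W K.t (K.μ 0) (K.μ 1) (K.μ 2)
      - 16 * K.I₁ * polyI₃a K.Z K.W K.t (K.μ 0) (K.μ 1) (K.μ 2)
      + (K.δ 2 K.I₁ * K.δ 3 K.I₁ - K.δ 0 K.I₁ * K.δ 1 K.I₁) = K.J₄ := by
    simp [I₁, δ0, δ1, δ2, δ3, Derivation.leibniz_pow, d24, polyI₃, polyI₃a, J₄, polyJ₄]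
    ring
  linear_combination e + (K.δ 2 K.I₁ * K.δ 3 K.I₁ - K.δ 0 K.I₁ * K.δ 1 K.I₁) * h2

end KVRing

/-! ## The Kerr-Vaidya functions at a point -/

section coordinates

variable {p : Coord}

theorem hasFDerivAt_comp_coord {F : ℝ → ℂ} {q : Coord} {j : Fin 4}
    (hF : DifferentiableAt ℝ F (q j)) :
    HasFDerivAt (fun q : Coord => F (q j))
      ((ContinuousLinearMap.toSpanSingleton ℝ (deriv F (q j))).comp
        (ContinuousLinearMap.proj (R := ℝ) (φ := fun _ : Fin 4 => ℝ) j)) q := by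
  have h1 : HasFDerivAt F _ (q j) := hF.hasDerivAt.hasFDerivAt
  exact h1.comp q (ContinuousLinearMap.proj (R := ℝ) (φ := fun _ : Fin 4 => ℝ) j).hasFDerivAt

theorem sm_comp_coord {F : ℝ → ℂ} {j : Fin 4} (hF : ContDiffAt ℝ ∞ F (p j)) :
    Sm p (fun q => F (q j)) :=
  hF.comp p (contDiff_apply ℝ ℝ j).contDiffAt

theorem contDiffAt_deriv {E : Type*} [NormedAddCommGroup E] [NormedSpace ℝ E] {F : ℝ → E} {x : ℝ}
    (hF : ContDiffAt ℝ ∞ F x) : ContDiffAt ℝ ∞ (deriv F) x := by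
  have h : ContDiffAt ℝ ∞ (fderiv ℝ F) x := ContDiffAt.fderiv_right hF (by simp)
  exact h.clm_apply contDiffAt_const

/-- The derivative of a function of one coordinate. -/
theorem der_comp_coord {F : ℝ → ℂ} {j : Fin 4} (hF : ContDiffAt ℝ ∞ F (p j)) (i : Fin 4) :
    SmoothGerm.der p i (germ p (fun q => F (q j)))
      = if i = j then germ p (fun q => deriv F (q j)) else 0 := by
  rw [der_germ (sm_comp_coord hF)]
  have h1 : ContDiffAt ℝ 1 F (p j) := hF.of_le (by simp)
  have h2 : ∀ᶠ q in 𝓝 p, DifferentiableAt ℝ F (q j) := by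
    have := (h1.eventually (by simp)).mono fun x hx => hx.differentiableAt (by simp)
    exact (continuous_apply j).continuousAt.eventually this
  have h3 : (fun q => pdC i (fun q => F (q j)) q)
      =ᶠ[𝓝 p] fun q => if i = j then deriv F (q j) else 0 := by
    filter_upwards [h2] with q hq
    rw [pdC, (hasFDerivAt_comp_coord hq).fderiv]
    by_cases hij : i = j
    · subst hij; simp
    · simp [hij]
  rw [germ_congr h3]
  split_ifs
  · rfl
  · exact (germ_const 0).trans (map_zero _)

/-- The germ of a function of one coordinate. -/
def crd (p : Coord) (j : Fin 4) (F : ℝ → ℂ) : SmoothGerm p := germ p (fun q => F (q j))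

theorem der_inv {A : Type*} [CommRing A] [Algebra ℂ A] (d : Derivation ℂ A A) {x X : A}
    (h : x * X = 1) : d X = -(X ^ 2 * d x) := by
  have h1 : d (x * X) = 0 := by rw [h, d.map_one_eq_zero]
  rw [Derivation.leibniz, smul_eq_mul, smul_eq_mul] at h1
  have h2 : X * (x * d X + X * d x) = 0 := by rw [h1, mul_zero]
  linear_combination h2 - d X * h

end coordinates

/-- The sine with complex values. -/
def sinF (x : ℝ) : ℂ := (Real.sin x : ℝ)
/-- The cosine with complex values. -/
def cosF (x : ℝ) : ℂ := (Real.cos x : ℝ)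
/-- The mass function and its derivatives with complex values. -/
def massF (m : ℝ → ℝ) (k : ℕ) (x : ℝ) : ℂ := (iteratedDeriv k m x : ℝ)
/-- The identity with complex values. -/
def idF (x : ℝ) : ℂ := (x : ℝ)

/-- The complex function `r + i a cos θ`. -/
def zF (a : ℝ) (q : Coord) : ℂ := idF (q 1) + Complex.I * a * cosF (q 2)
/-- The complex function `r - i a cos θ`. -/
def wF (a : ℝ) (q : Coord) : ℂ := idF (q 1) - Complex.I * a * cosF (q 2)

theorem zF_mul_wF (a : ℝ) (q : Coord) : zF a q * wF a q = (Rsq a q : ℂ) := by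
  simp only [zF, wF, Rsq, idF, cosF]
  push_cast
  linear_combination -(a ^ 2 * Complex.cos (q 2) ^ 2 : ℂ) * Complex.I_sq

/-- The points at which the Kerr-Vaidya metric is regular. -/
structure KVPoint (a : ℝ) (m : ℝ → ℝ) (p : Coord) : Prop where
  smooth : ContDiffAt ℝ ∞ m (p 0)
  sin_pos : 0 < Real.sin (p 2)
  Rsq_ne : Rsq a p ≠ 0

theorem KVPoint.of_mem {a : ℝ} {J : Set ℝ} {m : ℝ → ℝ} (hJ : IsOpen J) (hm : ContDiffOn ℝ ∞ m J)
    {p : Coord} (hp : p ∈ kvDomain a J) : KVPoint a m p :=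
  ⟨(hm _ hp.1).contDiffAt (hJ.mem_nhds hp.1), Real.sin_pos_of_pos_of_lt_pi hp.2.1 hp.2.2.1,
    hp.2.2.2.ne'⟩

theorem sm_cosF {x : ℝ} : ContDiffAt ℝ ∞ cosF x :=
  (Complex.ofRealCLM.contDiff.comp Real.contDiff_cos).contDiffAt
theorem sm_sinF {x : ℝ} : ContDiffAt ℝ ∞ sinF x :=
  (Complex.ofRealCLM.contDiff.comp Real.contDiff_sin).contDiffAt
theorem sm_idF {x : ℝ} : ContDiffAt ℝ ∞ idF x :=
  Complex.ofRealCLM.contDiff.contDiffAt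

theorem deriv_idF (x : ℝ) : deriv idF x = 1 := (Complex.ofRealCLM.hasDerivAt (x := x)).deriv
theorem deriv_cosF (x : ℝ) : deriv cosF x = -sinF x := by
  rw [show cosF = fun x => ((Real.cos x : ℝ) : ℂ) from rfl,
    (Real.hasDerivAt_cos x).ofReal_comp.deriv, Complex.ofReal_neg, sinF]
theorem deriv_sinF (x : ℝ) : deriv sinF x = cosF x := by
  rw [show sinF = fun x => ((Real.sin x : ℝ) : ℂ) from rfl,
    (Real.hasDerivAt_sin x).ofReal_comp.deriv, cosF]

theorem germ_inv {p : Coord} {f : Coord → ℂ} (hf : Sm p f) (h0 : f p ≠ 0) :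
    germ p f * germ p (fun q => (f q)⁻¹) = 1 := by
  have h1 : Sm p (fun q => (f q)⁻¹) := ContDiffAt.inv hf h0
  rw [← germ_mul hf h1, ← map_one (algebraMap ℂ (SmoothGerm p)), ← germ_const]
  apply germ_congr
  filter_upwards [hf.continuousAt.eventually_ne h0] with q hq
  exact mul_inv_cancel₀ hq

namespace KVPoint

variable {a : ℝ} {m : ℝ → ℝ} {p : Coord} (h : KVPoint a m p)

theorem sm_z : Sm p (zF a) :=
  (sm_comp_coord sm_idF).add ((Sm.const _).mul (sm_comp_coord sm_cosF))
theorem sm_w : Sm p (wF a) :=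
  (sm_comp_coord sm_idF).sub ((Sm.const _).mul (sm_comp_coord sm_cosF))

include h

theorem z_ne : zF a p ≠ 0 := fun h0 => h.Rsq_ne (by
  have := zF_mul_wF a p; rw [h0, zero_mul] at this; exact_mod_cast this.symm)
theorem w_ne : wF a p ≠ 0 := fun h0 => h.Rsq_ne (by
  have := zF_mul_wF a p; rw [h0, mul_zero] at this; exact_mod_cast this.symm)
theorem sinF_ne : sinF (p 2) ≠ 0 := Complex.ofReal_ne_zero.2 h.sin_pos.ne'

theorem contDiffAt_iteratedDeriv (k : ℕ) : ContDiffAt ℝ ∞ (iteratedDeriv k m) (p 0) := by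
  induction k with
  | zero => simpa using h.smooth
  | succ k ih => rw [iteratedDeriv_succ]; exact contDiffAt_deriv ih

theorem sm_massF (k : ℕ) : ContDiffAt ℝ ∞ (massF m k) (p 0) :=
  Complex.ofRealCLM.contDiff.contDiffAt.comp _ (h.contDiffAt_iteratedDeriv k)

theorem sm_Z : Sm p (fun q => (zF a q)⁻¹) := ContDiffAt.inv sm_z h.z_ne
theorem sm_W : Sm p (fun q => (wF a q)⁻¹) := ContDiffAt.inv sm_w h.w_ne
theorem sm_csc : Sm p (fun q => (sinF (q 2))⁻¹) :=
  ContDiffAt.inv (sm_comp_coord sm_sinF) h.sinF_ne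

theorem der_massF (k : ℕ) (i : Fin 4) : SmoothGerm.der p i (crd p 0 (massF m k))
    = if i = 0 then crd p 0 (massF m (k + 1)) else 0 := by
  rw [crd, der_comp_coord (h.sm_massF k)]
  have h1 : ContDiffAt ℝ 1 (iteratedDeriv k m) (p 0) :=
    (h.contDiffAt_iteratedDeriv k).of_le (by simp)
  have h2 : ∀ᶠ q in 𝓝 p, DifferentiableAt ℝ (iteratedDeriv k m) (q 0) := by
    have := (h1.eventually (by simp)).mono fun x hx => hx.differentiableAt (by simp)
    exact (continuous_apply 0).continuousAt.eventually this
  have h3 : (fun q : Coord => deriv (massF m k) (q 0)) =ᶠ[𝓝 p] fun q => massF m (k + 1) (q 0) := by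
    filter_upwards [h2] with q hq
    rw [show massF m k = fun x => ((iteratedDeriv k m x : ℝ) : ℂ) from rfl,
      hq.hasDerivAt.ofReal_comp.deriv, massF, iteratedDeriv_succ]
  rw [germ_congr h3]; rfl

/-- The Kerr-Vaidya differential ring of germs at a regular point. -/
def ring : KVRing (SmoothGerm.der p) :=
  have hr : ∀ i, SmoothGerm.der p i (crd p 1 idF) = if i = 1 then 1 else 0 := by
    intro i
    rw [crd, der_comp_coord sm_idF]
    simp_rw [deriv_idF, germ_const, map_one]
  have hco : ∀ i, SmoothGerm.der p i (crd p 2 cosF) = if i = 2 then -crd p 2 sinF else 0 := by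
    intro i
    rw [crd, der_comp_coord sm_cosF]
    simp_rw [deriv_cosF, germ_neg (sm_comp_coord sm_sinF)]; rfl
  have hsi : ∀ i, SmoothGerm.der p i (crd p 2 sinF) = if i = 2 then crd p 2 cosF else 0 := by
    intro i
    rw [crd, der_comp_coord sm_sinF]
    simp_rw [deriv_sinF]; rfl
  have hss : crd p 2 sinF * germ p (fun q => (sinF (q 2))⁻¹) = 1 :=
    germ_inv (sm_comp_coord sm_sinF) h.sinF_ne
  have hI : algebraMap ℂ (SmoothGerm p) Complex.I * algebraMap ℂ _ Complex.I = -1 := by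
    rw [← map_mul, Complex.I_mul_I, map_neg, map_one]
  have hz : germ p (zF a) = crd p 1 idF + algebraMap ℂ _ (Complex.I * a) * crd p 2 cosF := by
    rw [← germ_const, crd, crd, ← germ_mul (Sm.const _) (sm_comp_coord sm_cosF),
      ← germ_add (sm_comp_coord sm_idF) ((Sm.const _).mul (sm_comp_coord sm_cosF))]; rfl
  have hw : germ p (wF a) = crd p 1 idF - algebraMap ℂ _ (Complex.I * a) * crd p 2 cosF := by
    rw [← germ_const, crd, crd, ← germ_mul (Sm.const _) (sm_comp_coord sm_cosF),
      ← germ_sub (sm_comp_coord sm_idF) ((Sm.const _).mul (sm_comp_coord sm_cosF))]; rfl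
  have hzZ : germ p (zF a) * germ p (fun q => (zF a q)⁻¹) = 1 := germ_inv sm_z h.z_ne
  have hwW : germ p (wF a) * germ p (fun q => (wF a q)⁻¹) = 1 := germ_inv sm_w h.w_ne
  { z := germ p (zF a)
    w := germ p (wF a)
    Z := germ p (fun q => (zF a q)⁻¹)
    W := germ p (fun q => (wF a q)⁻¹)
    t := algebraMap ℂ _ (Complex.I * a) * crd p 2 sinF
    c := crd p 2 cosF * germ p (fun q => (sinF (q 2))⁻¹)
    y := algebraMap ℂ _ Complex.I * germ p (fun q => (sinF (q 2))⁻¹)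
    Y := -(algebraMap ℂ _ Complex.I * crd p 2 sinF)
    μ := fun k => crd p 0 (massF m k)
    zZ := hzZ
    wW := hwW
    yY := by
      linear_combination -(crd p 2 sinF * germ p (fun q => (sinF (q 2))⁻¹)) * hI + hss
    tc := by
      rw [hz, hw]
      linear_combination (2 * algebraMap ℂ _ (Complex.I * a) * crd p 2 cosF) * hss
    D0Z := by rw [der_inv _ hzZ, hz]; simp [hr, hco]
    D1Z := by rw [der_inv _ hzZ, hz]; simp [hr, hco]
    D2Z := by rw [der_inv _ hzZ, hz]; simp [hr, hco]; ring
    D3Z := by rw [der_inv _ hzZ, hz]; simp [hr, hco]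
    D0W := by rw [der_inv _ hwW, hw]; simp [hr, hco]
    D1W := by rw [der_inv _ hwW, hw]; simp [hr, hco]
    D2W := by rw [der_inv _ hwW, hw]; simp [hr, hco]; ring
    D3W := by rw [der_inv _ hwW, hw]; simp [hr, hco]
    D0t := by simp [hsi]
    D1t := by simp [hsi]
    D2t := by
      rw [Derivation.leibniz, hsi, Derivation.map_algebraMap]
      simp only [if_true, smul_eq_mul]
      linear_combination (-algebraMap ℂ _ (Complex.I * a) * crd p 2 cosF) * hss
    D3t := by simp [hsi]
    D0c := by simp [hco, der_inv _ hss, hsi]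
    D1c := by simp [hco, der_inv _ hss, hsi]
    D2c := by
      simp [hco, der_inv _ hss, hsi]
      linear_combination -hss
    D3c := by simp [hco, der_inv _ hss, hsi]
    D0y := by simp [der_inv _ hss, hsi]
    D1y := by simp [der_inv _ hss, hsi]
    D2y := by simp [der_inv _ hss, hsi]; ring
    D3y := by simp [der_inv _ hss, hsi]
    D0μ := fun k => by simp [h.der_massF]
    D1μ := fun k => by simp [h.der_massF]
    D2μ := fun k => by simp [h.der_massF]
    D3μ := fun k => by simp [h.der_massF] }

end KVPoint

set_option linter.unusedSimpArgs false

/-! ## The Kerr-Vaidya metric as an element of the differential ring -/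

section smoothMetric

variable {g : MetricField} {p : Coord}

theorem contDiffAt_det {M : Coord → Matrix (Fin 4) (Fin 4) ℝ}
    (h : ∀ a b, ContDiffAt ℝ ∞ (fun q => M q a b) p) : ContDiffAt ℝ ∞ (fun q => (M q).det) p := by
  simp only [Matrix.det_apply]
  exact ContDiffAt.sum fun σ _ => (contDiffAt_prod fun i _ => h _ _).const_smul _

/-- Cramer's rule: the entries of the inverse are cofactors divided by the determinant. -/
theorem SmoothMetric.of_det (h : ∀ a b, ContDiffAt ℝ ∞ (fun q => g q a b) p)
    (h0 : (g p).det ≠ 0) : SmoothMetric g p := by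
  refine ⟨h, fun a b => ?_⟩
  have e : ginv g a b = fun q => ((g q).det)⁻¹ * (g q).adjugate a b := by
    funext q
    rw [ginv, Matrix.inv_def, Ring.inverse_eq_inv', Matrix.smul_apply, smul_eq_mul]
  rw [e]
  refine ((contDiffAt_det h).inv h0).mul ?_
  simp only [Matrix.adjugate_apply]
  refine contDiffAt_det fun c d => ?_
  by_cases hc : c = b
  · subst hc; simpa using contDiffAt_const
  · simpa [Matrix.updateRow_ne hc] using h c d

theorem mul_giG (h : SmoothMetric g p) (h0 : (g p).det ≠ 0) (a b : Fin 4) :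
    ∑ c, gG g p a c * giG g p c b = if a = b then 1 else 0 := by
  have e : germR p (fun q => ∑ c, g q a c * ginv g c b q)
      = ∑ c, gG g p a c * giG g p c b := by
    rw [germR_sum fun c => (h.metric a c).mul (h.inverse c b)]
    exact Finset.sum_congr rfl fun c _ => germR_mul (h.metric a c) (h.inverse c b)
  have h1 : (fun q => ∑ c, g q a c * ginv g c b q) =ᶠ[𝓝 p] fun _ => if a = b then 1 else 0 := by
    filter_upwards [(contDiffAt_det h.metric).continuousAt.eventually_ne h0] with q hq
    have := congrFun (congrFun (Matrix.mul_nonsing_inv (g q) (isUnit_iff_ne_zero.2 hq)) a) b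
    rwa [Matrix.mul_apply, Matrix.one_apply] at this
  rw [← e, germR_congr h1, germR_const]
  split_ifs <;> simp

end smoothMetric

/-- A complex function and its germ. -/
structure Rep (p : Coord) (f : Coord → ℂ) (x : SmoothGerm p) : Prop where
  sm : Sm p f
  germ_eq : germ p f = x

namespace Rep

variable {p : Coord} {f g : Coord → ℂ} {x y : SmoothGerm p}

theorem of_sm (hf : Sm p f) : Rep p f (germ p f) := ⟨hf, rfl⟩
theorem add (hf : Rep p f x) (hg : Rep p g y) : Rep p (fun q => f q + g q) (x + y) :=
  ⟨hf.sm.add hg.sm, by rw [germ_add hf.sm hg.sm, hf.germ_eq, hg.germ_eq]⟩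
theorem sub (hf : Rep p f x) (hg : Rep p g y) : Rep p (fun q => f q - g q) (x - y) :=
  ⟨hf.sm.sub hg.sm, by rw [germ_sub hf.sm hg.sm, hf.germ_eq, hg.germ_eq]⟩
theorem mul (hf : Rep p f x) (hg : Rep p g y) : Rep p (fun q => f q * g q) (x * y) :=
  ⟨hf.sm.mul hg.sm, by rw [germ_mul hf.sm hg.sm, hf.germ_eq, hg.germ_eq]⟩
theorem neg (hf : Rep p f x) : Rep p (fun q => -f q) (-x) :=
  ⟨hf.sm.neg, by rw [germ_neg hf.sm, hf.germ_eq]⟩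
theorem const (c : ℂ) : Rep p (fun _ => c) (algebraMap ℂ _ c) := ⟨Sm.const c, germ_const c⟩
theorem one : Rep p (fun _ => 1) 1 := by simpa using const (p := p) 1
theorem sq (hf : Rep p f x) : Rep p (fun q => f q ^ 2) (x ^ 2) := by
  simp only [_root_.sq]; exact hf.mul hf
theorem germR_eq {h : Coord → ℝ} (hf : Rep p f x) (e : (fun q => (h q : ℂ)) =ᶠ[𝓝 p] f) :
    germR p h = x := (germ_congr e).trans hf.germ_eq

end Rep

theorem kvMetric_det {a : ℝ} {m : ℝ → ℝ} {p : Coord} (h : Rsq a p ≠ 0) :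
    (kvMetric a m p).det = -(Rsq a p * Real.sin (p 2)) ^ 2 := by
  have h1 : Real.cos (p 2) ^ 2 = 1 - Real.sin (p 2) ^ 2 := Real.cos_sq' _
  simp [kvMetric, Matrix.det_succ_row_zero, Fin.sum_univ_succ, Fin.succAbove]
  field_simp
  simp only [Delta]
  have h2 : Rsq a p = p 1 ^ 2 + a ^ 2 - a ^ 2 * Real.sin (p 2) ^ 2 := by rw [Rsq, h1]; ring
  rw [h2]
  ring

namespace KVPoint

variable {a : ℝ} {m : ℝ → ℝ} {p : Coord}

theorem contDiffAt_metric (h : KVPoint a m p) (i j : Fin 4) :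
    ContDiffAt ℝ ∞ (fun q => kvMetric a m q i j) p := by
  have hr : ContDiffAt ℝ ∞ (fun q : Coord => q 1) p := (contDiff_apply ℝ ℝ 1).contDiffAt
  have hs : ContDiffAt ℝ ∞ (fun q : Coord => Real.sin (q 2)) p :=
    (Real.contDiff_sin.comp (contDiff_apply ℝ ℝ 2)).contDiffAt
  have hc : ContDiffAt ℝ ∞ (fun q : Coord => Real.cos (q 2)) p :=
    (Real.contDiff_cos.comp (contDiff_apply ℝ ℝ 2)).contDiffAt
  have hm : ContDiffAt ℝ ∞ (fun q : Coord => m (q 0)) p :=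
    h.smooth.comp p (contDiff_apply ℝ ℝ 0).contDiffAt
  have hS : ContDiffAt ℝ ∞ (Rsq a) p := (hr.pow 2).add (contDiffAt_const.mul (hc.pow 2))
  have hD : ContDiffAt ℝ ∞ (Delta a m) p :=
    ((hr.pow 2).add contDiffAt_const).sub ((contDiffAt_const.mul hm).mul hr)
  have e03 : ContDiffAt ℝ ∞ (fun q : Coord => -(2 * a * m (q 0) * q 1 * Real.sin (q 2) ^ 2 / Rsq a q))
      p := (((((contDiffAt_const.mul hm).mul hr).mul (hs.pow 2)).div hS h.Rsq_ne)).neg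
  have e13 : ContDiffAt ℝ ∞ (fun q : Coord => -(a * Real.sin (q 2) ^ 2)) p :=
    (contDiffAt_const.mul (hs.pow 2)).neg
  fin_cases i <;> fin_cases j
  · exact (contDiffAt_const.sub (((contDiffAt_const.mul hm).mul hr).div hS h.Rsq_ne)).neg
  · exact contDiffAt_const
  · exact contDiffAt_const
  · exact e03
  · exact contDiffAt_const
  · exact contDiffAt_const
  · exact contDiffAt_const
  · exact e13
  · exact contDiffAt_const
  · exact contDiffAt_const
  · exact hS
  · exact contDiffAt_const
  · exact e03
  · exact e13
  · exact contDiffAt_const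
  · exact (((((hr.pow 2).add contDiffAt_const).pow 2).sub
      ((contDiffAt_const.mul hD).mul (hs.pow 2))).div hS h.Rsq_ne).mul (hs.pow 2)

theorem det_ne (h : KVPoint a m p) : (kvMetric a m p).det ≠ 0 := by
  rw [kvMetric_det h.Rsq_ne]
  exact neg_ne_zero.2 (pow_ne_zero _ (mul_ne_zero h.Rsq_ne h.sin_pos.ne'))

theorem smoothMetric (h : KVPoint a m p) : SmoothMetric (kvMetric a m) p :=
  .of_det h.contDiffAt_metric h.det_ne

variable (h : KVPoint a m p)
include h

theorem rep_z : Rep p (zF a) h.ring.z := .of_sm sm_z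
theorem rep_w : Rep p (wF a) h.ring.w := .of_sm sm_w
theorem rep_Z : Rep p (fun q => (zF a q)⁻¹) h.ring.Z := .of_sm h.sm_Z
theorem rep_W : Rep p (fun q => (wF a q)⁻¹) h.ring.W := .of_sm h.sm_W
theorem rep_t : Rep p (fun q => Complex.I * a * sinF (q 2)) h.ring.t :=
  (Rep.const _).mul (.of_sm (sm_comp_coord sm_sinF))
theorem rep_y : Rep p (fun q => Complex.I * (sinF (q 2))⁻¹) h.ring.y :=
  (Rep.const _).mul (.of_sm h.sm_csc)
theorem rep_Y : Rep p (fun q => -(Complex.I * sinF (q 2))) h.ring.Y :=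
  ((Rep.const _).mul (.of_sm (sm_comp_coord sm_sinF))).neg
theorem rep_μ (k : ℕ) : Rep p (fun q => massF m k (q 0)) (h.ring.μ k) :=
  .of_sm (sm_comp_coord (h.sm_massF k))

theorem eventually_z : ∀ᶠ q in 𝓝 p, zF a q ≠ 0 ∧ wF a q ≠ 0 :=
  ((sm_z (p := p)).continuousAt.eventually_ne h.z_ne).and
    ((sm_w (p := p)).continuousAt.eventually_ne h.w_ne)

/-- The coordinate entries are translated by 2r = z + w, R² = zw and r² + a² = zw - t²; thus 2mr/R²
becomes m(Z + W), and sin θ enters through t and Y, whose product is a sin²θ. -/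
theorem gG_eq (i j : Fin 4) : gG (kvMetric a m) p i j = h.ring.g i j := by
  have hev : ∀ {f f' : Coord → ℂ}, (∀ q, zF a q ≠ 0 → wF a q ≠ 0 → f q = f' q) → f =ᶠ[𝓝 p] f' := by
    intro f f' hf
    filter_upwards [h.eventually_z] with q hq using hf q hq.1 hq.2
  have h2r : ∀ q, zF a q + wF a q = 2 * (q 1 : ℂ) := fun q => by simp only [zF, wF, idF]; ring
  have hI := Complex.I_sq
  have hs : ∀ q : Coord, ((Real.cos (q 2) : ℝ) : ℂ) ^ 2 = 1 - ((Real.sin (q 2) : ℝ) : ℂ) ^ 2 := by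
    intro q; exact_mod_cast Real.cos_sq' _
  have e01 : germR p (fun _ => (1 : ℝ)) = 1 := by simp [germR_const]
  have e00 : germR p (fun _ => (0 : ℝ)) = 0 := by simp [germR_const]
  have e03 := (((h.rep_t.mul h.rep_Y).mul ((h.rep_μ 0).mul (h.rep_Z.add h.rep_W))).neg).germR_eq
    (h := fun q => -(2 * a * m (q 0) * q 1 * Real.sin (q 2) ^ 2 / Rsq a q)) (hev fun q hz hw => by
      simp only [Complex.ofReal_neg, Complex.ofReal_sub, Complex.ofReal_mul, Complex.ofReal_div,
        Complex.ofReal_add, Complex.ofReal_pow, Complex.ofReal_one, Complex.ofReal_ofNat, ← zF_mul_wF, massF, sinF, iteratedDeriv_zero]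
      field_simp
      linear_combination ((a : ℂ) * m (q 0) * (Real.sin (q 2) : ℝ) ^ 2) * h2r q
        - (a : ℂ) * m (q 0) * (Real.sin (q 2) : ℝ) ^ 2 * (zF a q + wF a q) * hI)
  have e13 := ((h.rep_t.mul h.rep_Y).neg).germR_eq
    (h := fun q => -(a * Real.sin (q 2) ^ 2)) (hev fun q hz hw => by
      simp only [Complex.ofReal_neg, Complex.ofReal_sub, Complex.ofReal_mul, Complex.ofReal_div,
        Complex.ofReal_add, Complex.ofReal_pow, Complex.ofReal_one, Complex.ofReal_ofNat, sinF]
      linear_combination (-(a : ℂ) * (Real.sin (q 2) : ℝ) ^ 2) * hI)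
  fin_cases i <;> fin_cases j
  · exact ((Rep.one.neg).add ((h.rep_μ 0).mul (h.rep_Z.add h.rep_W))).germR_eq
      (h := fun q => -(1 - 2 * m (q 0) * q 1 / Rsq a q)) (hev fun q hz hw => by
        simp only [Complex.ofReal_neg, Complex.ofReal_sub, Complex.ofReal_mul, Complex.ofReal_div,
        Complex.ofReal_add, Complex.ofReal_pow, Complex.ofReal_one, Complex.ofReal_ofNat, ← zF_mul_wF, massF, iteratedDeriv_zero]
        field_simp
        linear_combination -(m (q 0) : ℂ) * h2r q)
  · exact e01
  · exact e00
  · exact e03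
  · exact e01
  · exact e00
  · exact e00
  · exact e13
  · exact e00
  · exact e00
  · exact (h.rep_z.mul h.rep_w).germR_eq (h := Rsq a) (hev fun q hz hw => by
      simp only [Complex.ofReal_neg, Complex.ofReal_sub, Complex.ofReal_mul, Complex.ofReal_div,
        Complex.ofReal_add, Complex.ofReal_pow, Complex.ofReal_one, Complex.ofReal_ofNat, ← zF_mul_wF])
  · exact e00
  · exact e03
  · exact e13
  · exact e00
  · exact ((h.rep_Y.sq.mul (((h.rep_z.mul h.rep_w).sub h.rep_t.sq).sub
      (((h.rep_μ 0).mul (h.rep_Z.add h.rep_W)).mul h.rep_t.sq))).neg).germR_eq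
      (h := fun q => ((q 1 ^ 2 + a ^ 2) ^ 2 - a ^ 2 * Delta a m q * Real.sin (q 2) ^ 2) / Rsq a q
        * Real.sin (q 2) ^ 2) (hev fun q hz hw => by
        have hS : (q 1 : ℂ) ^ 2 + (a : ℂ) ^ 2
            = zF a q * wF a q + (a : ℂ) ^ 2 * (Real.sin (q 2) : ℝ) ^ 2 := by
          rw [zF_mul_wF, Rsq]; push_cast
          linear_combination -(a : ℂ) ^ 2 * Complex.cos_sq' (q 2 : ℂ)
        simp only [Complex.ofReal_neg, Complex.ofReal_sub, Complex.ofReal_mul, Complex.ofReal_div,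
          Complex.ofReal_add, Complex.ofReal_pow, Complex.ofReal_one, Complex.ofReal_ofNat,
          ← zF_mul_wF, massF, sinF, iteratedDeriv_zero, Delta, hS]
        have h3 := h2r q
        have h4 : (2 : ℂ) * m (q 0) * q 1 = m (q 0) * (zF a q + wF a q) := by rw [h3]; ring
        rw [h4]
        field_simp
        simp only [Complex.I_sq]
        ring)

theorem giG_inv (i j : Fin 4) :
    ∑ c, h.ring.g i c * giG (kvMetric a m) p c j = if i = j then 1 else 0 := by
  simp_rw [← h.gG_eq]
  exact mul_giG h.smoothMetric h.det_ne i j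

end KVPoint

/-! ## Germs of curvature invariants -/

/-- A real function and its germ. -/
structure RepR (p : Coord) (f : Coord → ℝ) (x : SmoothGerm p) : Prop where
  sm : ContDiffAt ℝ ∞ f p
  germ_eq : germR p f = x

namespace RepR

variable {p : Coord} {f g : Coord → ℝ} {x y : SmoothGerm p}

theorem add (hf : RepR p f x) (hg : RepR p g y) : RepR p (fun q => f q + g q) (x + y) :=
  ⟨hf.sm.add hg.sm, by rw [germR_add hf.sm hg.sm, hf.germ_eq, hg.germ_eq]⟩
theorem sub (hf : RepR p f x) (hg : RepR p g y) : RepR p (fun q => f q - g q) (x - y) :=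
  ⟨hf.sm.sub hg.sm, by rw [germR_sub hf.sm hg.sm, hf.germ_eq, hg.germ_eq]⟩
theorem mul (hf : RepR p f x) (hg : RepR p g y) : RepR p (fun q => f q * g q) (x * y) :=
  ⟨hf.sm.mul hg.sm, by rw [germR_mul hf.sm hg.sm, hf.germ_eq, hg.germ_eq]⟩
theorem ofNat (n : ℕ) [n.AtLeastTwo] : RepR p (fun _ => OfNat.ofNat n) (OfNat.ofNat n) :=
  ⟨contDiffAt_const, by rw [germR_const, Complex.ofReal_ofNat, map_ofNat]⟩
theorem sum {f : Fin 4 → Coord → ℝ} {x : Fin 4 → SmoothGerm p} (hf : ∀ i, RepR p (f i) (x i)) :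
    RepR p (fun q => ∑ i, f i q) (∑ i, x i) :=
  ⟨ContDiffAt.sum fun i _ => (hf i).sm, by
    rw [germR_sum fun i => (hf i).sm]; exact Finset.sum_congr rfl fun i _ => (hf i).germ_eq⟩
theorem pd (hf : RepR p f x) (i : Fin 4) : RepR p (pd i f) (SmoothGerm.der p i x) :=
  ⟨contDiffAt_pd hf.sm i, by rw [← der_germR hf.sm, hf.germ_eq]⟩
theorem ev_eq (hf : RepR p f x) : SmoothGerm.ev p x = f p := by
  rw [← hf.germ_eq, ev_germR hf.sm]

end RepR

section invariants

variable {g : MetricField} {p : Coord} (h : SmoothMetric g p)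
include h

theorem SmoothMetric.rep_ginv (a b : Fin 4) : RepR p (ginv g a b) (giG g p a b) :=
  ⟨h.inverse a b, rfl⟩
theorem SmoothMetric.rep_weyl (a b c d : Fin 4) : RepR p (weyl g a b c d) (weylG g p a b c d) :=
  ⟨h.contDiffAt_weyl a b c d, rfl⟩
theorem SmoothMetric.rep_covWeyl (a b c d e : Fin 4) : RepR p (covWeyl g a b c d e)
    (covA (SmoothGerm.der p) (chrG g p) (weylG g p) a b c d e) :=
  ⟨h.contDiffAt_covWeyl a b c d e, h.covWeylG_eq a b c d e⟩

theorem SmoothMetric.rep_gradInner {f f' : Coord → ℝ} {x x' : SmoothGerm p} (hf : RepR p f x)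
    (hf' : RepR p f' x') : RepR p (gradInner g f f')
      (∑ a, ∑ b, giG g p a b * SmoothGerm.der p a x * SmoothGerm.der p b x') := by
  change RepR p (fun q => gradInner g f f' q) _
  simp only [gradInner]
  exact .sum fun a => .sum fun b => ((h.rep_ginv a b).mul (hf.pd a)).mul (hf'.pd b)

theorem SmoothMetric.rep_I1 : RepR p (I1 g) (contr4 (giG g p) (weylG g p) (weylG g p)) := by
  change RepR p (fun q => I1 g q) _
  simp only [I1, weylUp]
  exact .sum fun a => .sum fun b => .sum fun c => .sum fun d => (h.rep_weyl a b c d).mul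
    (.sum fun a' => .sum fun b' => .sum fun c' => .sum fun d' => ((((h.rep_ginv a a').mul
      (h.rep_ginv b b')).mul (h.rep_ginv c c')).mul (h.rep_ginv d d')).mul
      (h.rep_weyl a' b' c' d'))

theorem SmoothMetric.rep_covWeylUp (a b c d e : Fin 4) : RepR p (covWeylUp g a b c d e)
    (∑ a', ∑ b', ∑ c', ∑ d', ∑ e', giG g p a a' * giG g p b b' * giG g p c c' * giG g p d d'
      * giG g p e e' * covA (SmoothGerm.der p) (chrG g p) (weylG g p) a' b' c' d' e') := by
  change RepR p (fun q => covWeylUp g a b c d e q) _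
  simp only [covWeylUp]
  exact .sum fun a' => .sum fun b' => .sum fun c' => .sum fun d' => .sum fun e' =>
    (((((h.rep_ginv a a').mul (h.rep_ginv b b')).mul (h.rep_ginv c c')).mul
      (h.rep_ginv d d')).mul (h.rep_ginv e e')).mul (h.rep_covWeyl a' b' c' d' e')

theorem SmoothMetric.rep_I3 : RepR p (I3 g) (contr5 (giG g p)
    (covA (SmoothGerm.der p) (chrG g p) (weylG g p))
    (covA (SmoothGerm.der p) (chrG g p) (weylG g p))) := by
  change RepR p (fun q => I3 g q) _
  simp only [I3]
  exact .sum fun a => .sum fun b => .sum fun c => .sum fun d => .sum fun e =>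
    (h.rep_covWeyl a b c d e).mul (h.rep_covWeylUp a b c d e)

theorem SmoothMetric.rep_I3a : RepR p (I3a g) (contr5 (giG g p)
    (covA (SmoothGerm.der p) (chrG g p) (weylG g p))
    (fun a b c d e => covA (SmoothGerm.der p) (chrG g p) (weylG g p) e b c d a)) := by
  change RepR p (fun q => I3a g q) _
  simp only [I3a]
  refine .sum fun a => .sum fun b => .sum fun c => .sum fun d => .sum fun e =>
    (h.rep_covWeyl a b c d e).mul ?_
  convert h.rep_covWeylUp e b c d a using 1
  have sw : ∀ f : Fin 4 → Fin 4 → Fin 4 → Fin 4 → Fin 4 → SmoothGerm p,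
      ∑ i, ∑ j, ∑ k, ∑ l, ∑ n, f i j k l n = ∑ n, ∑ i, ∑ j, ∑ k, ∑ l, f i j k l n := by
    intro f
    rw [Finset.sum_congr rfl fun i _ => Finset.sum_congr rfl fun j _ =>
      Finset.sum_congr rfl fun k _ => Finset.sum_comm,
      Finset.sum_congr rfl fun i _ => Finset.sum_congr rfl fun j _ => Finset.sum_comm,
      Finset.sum_congr rfl fun i _ => Finset.sum_comm, Finset.sum_comm]
  rw [sw]
  refine Finset.sum_congr rfl fun e' _ => ?_
  have sw' : ∀ f : Fin 4 → Fin 4 → Fin 4 → Fin 4 → SmoothGerm p,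
      ∑ i, ∑ j, ∑ k, ∑ l, f i j k l = ∑ j, ∑ k, ∑ l, ∑ i, f i j k l := by
    intro f
    rw [Finset.sum_comm, Finset.sum_congr rfl fun j _ => Finset.sum_comm,
      Finset.sum_congr rfl fun j _ => Finset.sum_congr rfl fun k _ => Finset.sum_comm]
  rw [sw']
  exact Finset.sum_congr rfl fun b' _ => Finset.sum_congr rfl fun c' _ =>
    Finset.sum_congr rfl fun d' _ => Finset.sum_congr rfl fun a' _ => by ring

end invariants

namespace KVPoint

variable {a : ℝ} {m : ℝ → ℝ} {p : Coord} (h : KVPoint a m p)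
include h

theorem weylG_eq : weylG (kvMetric a m) p = h.ring.weylK (giG (kvMetric a m) p) := by
  have h1 : gG (kvMetric a m) p = h.ring.g := funext fun i => funext fun j => h.gG_eq i j
  have h2 : chrG (kvMetric a m) p
      = chrA (SmoothGerm.der p) h.ring.g (giG (kvMetric a m) p) := by
    funext i j k; rw [h.smoothMetric.chrG_eq, h1]
  funext i j k l
  rw [h.smoothMetric.weylG_eq, h1, h2]; rfl

theorem chrG_eq : chrG (kvMetric a m) p
    = chrA (SmoothGerm.der p) h.ring.g (giG (kvMetric a m) p) := by
  funext i j k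
  rw [h.smoothMetric.chrG_eq, show gG (kvMetric a m) p = h.ring.g from
    funext fun i => funext fun j => h.gG_eq i j]

theorem rep_I1 : RepR p (I1 (kvMetric a m)) h.ring.I₁ := by
  have := h.smoothMetric.rep_I1
  rwa [h.weylG_eq, h.ring.contr4_weyl der_comm h.giG_inv] at this

theorem rep_J4 : RepR p (J4 (kvMetric a m)) h.ring.J₄ := by
  have h3 := h.smoothMetric.rep_I3
  have h3a := h.smoothMetric.rep_I3a
  rw [h.weylG_eq, h.chrG_eq, h.ring.contr5_weyl der_comm h.giG_inv] at h3
  rw [h.weylG_eq, h.chrG_eq, h.ring.contr5_weyl_mixed der_comm h.giG_inv] at h3a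
  rw [← h.ring.J₄_eq h.giG_inv]
  exact ((((RepR.ofNat 6).mul h.rep_I1).mul h3).sub (((RepR.ofNat 16).mul h.rep_I1).mul h3a)).add
    (h.smoothMetric.rep_gradInner h.rep_I1 h.rep_I1)

theorem rep_gradInner {f f' : Coord → ℝ} {x x' : SmoothGerm p} (hf : RepR p f x)
    (hf' : RepR p f' x') : RepR p (gradInner (kvMetric a m) f f')
      (∑ i, wtC i • (h.ring.δ i x * h.ring.δ (opp i) x')) := by
  rw [← h.ring.contr2_grad h.giG_inv]
  exact h.smoothMetric.rep_gradInner hf hf'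

end KVPoint

/-! ## The Hodge dual of the Weyl tensor and the Newman-Penrose scalars -/

/-- Twelve times the sign of a permutation of the four indices. -/
def permZ (a b c d : Fin 4) : ℤ :=
  ((b : ℤ) - a) * (c - a) * (d - a) * (c - b) * (d - b) * (d - c)

/-- The matrix selecting rows. -/
def selM (A : Type*) [CommRing A] (x : Fin 4 → Fin 4) : Matrix (Fin 4) (Fin 4) A :=
  Matrix.of fun i j => if x i = j then 1 else 0

theorem selM_mul {A : Type*} [CommRing A] (x : Fin 4 → Fin 4) (M : Matrix (Fin 4) (Fin 4) A) :
    selM A x * M = Matrix.of fun i => M (x i) := by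
  ext i j
  simp [Matrix.mul_apply, selM]

/-- A Vandermonde matrix with nodes a, b, c, d is a row selection of the one with nodes 0, 1, 2, 3.
The latter has determinant 12, so the sign is a product of differences and later duality checks
become decidable over ℤ. -/
theorem permSymbol_eq (a b c d : Fin 4) : 12 * permSymbol a b c d = (permZ a b c d : ℝ) := by
  have h : permSymbol a b c d = (selM ℝ ![a, b, c, d]).det := rfl
  have e0 : Finset.Ioi (0 : Fin 4) = {1, 2, 3} := by decide
  have e1 : Finset.Ioi (1 : Fin 4) = {2, 3} := by decide
  have e2 : Finset.Ioi (2 : Fin 4) = {3} := by decide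
  have e3 : Finset.Ioi (3 : Fin 4) = ∅ := by decide
  have hv : ∀ v : Fin 4 → ℝ, (Matrix.vandermonde v).det = (v 1 - v 0) * (v 2 - v 0) * (v 3 - v 0)
      * (v 2 - v 1) * (v 3 - v 1) * (v 3 - v 2) := by
    intro v
    rw [Matrix.det_vandermonde, Fin.prod_univ_four, e0, e1, e2, e3]
    rw [Finset.prod_insert (by decide), Finset.prod_insert (by decide), Finset.prod_singleton,
      Finset.prod_insert (by decide), Finset.prod_singleton, Finset.prod_singleton,
      Finset.prod_empty]
    ring
  have h1 := congrArg Matrix.det (selM_mul ![a, b, c, d]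
    (Matrix.vandermonde fun i : Fin 4 => ((i : ℕ) : ℝ)))
  have h2 : (Matrix.of fun i => Matrix.vandermonde (fun i : Fin 4 => ((i : ℕ) : ℝ))
      (![a, b, c, d] i)) = Matrix.vandermonde fun i => ((![a, b, c, d] i : ℕ) : ℝ) := rfl
  rw [Matrix.det_mul, h2, hv, hv, ← h] at h1
  simp only [permZ]
  push_cast
  simp at h1
  norm_num at h1
  linarith

/-- The Hodge dual is diagonal in this basis, with one sign on the first three bivectors and the
other on the last three. The modulus 24 is 2 times the factor 12 in `permZ`. -/
theorem permZ_biv (a : Fin 6) (i j : Fin 4) :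
    ∑ m, ∑ n, permZ i j m n * (sgZ m * sgZ n * bivZ a (opp m) (opp n))
      = ![24, 24, 24, -24, -24, -24] a * bivZ a i j := by
  revert a i j; decide

/-- Multilinear expansion of the determinant in the standard basis; every term is a determinant of
selected unit vectors. -/
theorem ten4_perm (X : Fin 4 → Fin 4 → ℂ) :
    ten4 (fun a b c d => (permSymbol a b c d : ℂ)) (X 0) (X 1) (X 2) (X 3)
      = (Matrix.of X).det := by
  have h : ∀ a b c d, (permSymbol a b c d : ℂ) = (selM ℂ ![a, b, c, d]).det := by
    intro a b c d
    have := Complex.ofRealHom.map_det (selM ℝ ![a, b, c, d])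
    refine this.trans (congrArg _ ?_)
    ext i j
    simp [selM]
  have h1 : (Matrix.of X).det = Matrix.detRowAlternating
      (fun i => ∑ j, X i j • (Pi.single j (1 : ℂ) : Fin 4 → ℂ)) := by
    change Matrix.detRowAlternating X = _
    congr 1
    funext i j
    simp [Finset.sum_apply, Pi.single_apply]
  rw [h1]
  have h2 := (Matrix.detRowAlternating (R := ℂ) (n := Fin 4)).toMultilinearMap.map_sum
    (fun i j => X i j • (Pi.single j (1 : ℂ) : Fin 4 → ℂ))
  refine Eq.trans ?_ h2.symm
  have h3 : ∀ r : Fin 4 → Fin 4, (Matrix.detRowAlternating (R := ℂ) (n := Fin 4)).toMultilinearMap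
      (fun i => X i (r i) • (Pi.single (r i) (1 : ℂ) : Fin 4 → ℂ))
      = (∏ i, X i (r i)) * (selM ℂ r).det := by
    intro r
    rw [MultilinearMap.map_smul_univ, smul_eq_mul]
    congr 1
    change Matrix.det _ = _
    congr 1
    ext i j
    simp [selM, Pi.single_apply, eq_comm]
  simp_rw [h3]
  rw [sum_fun_four]
  simp only [ten4, Finset.mul_sum, Fin.prod_univ_four, h]
  refine Finset.sum_congr rfl fun a _ => Finset.sum_congr rfl fun b _ =>
    Finset.sum_congr rfl fun c _ => Finset.sum_congr rfl fun d _ => ?_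
  simp
  ring

theorem ten4_sum {A : Type*} [CommRing A] [Algebra ℂ A]
    (C : Fin 4 → Fin 4 → Fin 4 → Fin 4 → Fin 4 → A) (X Y Z W : Fin 4 → A) :
    ten4 (fun a b c d => ∑ m, C m a b c d) X Y Z W = ∑ m, ten4 (C m) X Y Z W := by
  simp only [ten4, Finset.mul_sum]
  rw [Finset.sum_congr rfl fun i _ => Finset.sum_congr rfl fun j _ =>
      Finset.sum_congr rfl fun k _ => Finset.sum_comm,
      Finset.sum_congr rfl fun i _ => Finset.sum_congr rfl fun j _ => Finset.sum_comm,
      Finset.sum_congr rfl fun i _ => Finset.sum_comm, Finset.sum_comm]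

theorem ten4_mul {A : Type*} [CommRing A] [Algebra ℂ A] (u v : Fin 4 → Fin 4 → A)
    (X Y Z W : Fin 4 → A) : ten4 (fun a b c d => u a b * v c d) X Y Z W
      = (∑ a, X a * ∑ b, Y b * u a b) * ∑ c, Z c * ∑ d, W d * v c d := by
  simp only [ten4, sum_mul_const_mul, sum_mul_mul_const]

theorem sum_fun_two {ι : Type*} [Fintype ι] {B : Type*} [AddCommMonoid B]
    (f : (Fin 2 → ι) → B) : ∑ x, f x = ∑ a, ∑ b, f ![a, b] := by
  simp only [sum_fun_succ, sum_fun_zero]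

/-- The left dual of a four-index tensor. -/
def dualT (v : ℂ) (gi : Fin 4 → Fin 4 → ℂ) (C : Fin 4 → Fin 4 → Fin 4 → Fin 4 → ℂ)
    (a b c d : Fin 4) : ℂ :=
  (1 / 2) * ∑ e, ∑ f, ∑ e', ∑ f',
    v * (permSymbol a b e f : ℂ) * gi e e' * gi f f' * C e' f' c d

/-- The volume form evaluated on four legs is the permutation symbol times the determinant of the
frame; the two raised indices are contracted by pairing opposite legs. -/
theorem fr4_dualT {gi E : Fin 4 → Fin 4 → ℂ}
    (hgi : ∀ a b, gi a b = ∑ i, wtC i • (E i a * E (opp i) b)) (v : ℂ)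
    (C : Fin 4 → Fin 4 → Fin 4 → Fin 4 → ℂ) (i j k l : Fin 4) :
    fr4 E (dualT v gi C) i j k l = ∑ m, ∑ n, (v / 2 * (wtC m * wtC n)) *
      ((permSymbol i j m n : ℂ) * (Matrix.of E).det * fr4 E C (opp m) (opp n) k l) := by
  have s1 : ∀ u w : Fin 4 → Fin 4 → ℂ, ∑ e, ∑ f, ∑ e', ∑ f', v * u e f * gi e e' * gi f f' * w e' f'
      = ∑ m, ∑ n, (v * (wtC m * wtC n)) * ((∑ e, E m e * ∑ f, E n f * u e f)
        * ∑ e, E (opp m) e * ∑ f, E (opp n) f * w e f) := by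
    intro u w
    have := contract_frame hgi 2 (fun x => u (x 0) (x 1)) (fun x => w (x 0) (x 1))
    simp only [sum_fun_two, Fin.prod_univ_two, Matrix.cons_val_zero, Matrix.cons_val_one] at this
    have e := congrArg (v * ·) this
    simp only [Finset.mul_sum] at e
    convert e using 1
    · exact Finset.sum_congr rfl fun _ _ => Finset.sum_congr rfl fun _ _ =>
        Finset.sum_congr rfl fun _ _ => Finset.sum_congr rfl fun _ _ => by ring
    · simp only [Finset.mul_sum, smul_eq_mul, mul_assoc]
  have s2 : dualT v gi C = fun a b c d => ∑ m, ∑ n, (v / 2 * (wtC m * wtC n)) *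
      ((∑ e, E m e * ∑ f, E n f * (permSymbol a b e f : ℂ))
        * ∑ e, E (opp m) e * ∑ f, E (opp n) f * C e f c d) := by
    funext a b c d
    rw [dualT, s1, Finset.mul_sum]
    refine Finset.sum_congr rfl fun _ _ => ?_
    rw [Finset.mul_sum]
    exact Finset.sum_congr rfl fun _ _ => by ring
  rw [fr4, s2, ten4_sum]
  refine Finset.sum_congr rfl fun m _ => ?_
  rw [ten4_sum]
  refine Finset.sum_congr rfl fun n _ => ?_
  rw [ten4_mul_left, ten4_mul]
  congr 2
  · have h1 := ten4_perm (fun s => E (![i, j, m, n] s))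
    have h2 : (Matrix.of fun s => E (![i, j, m, n] s)) = selM ℂ ![i, j, m, n] * Matrix.of E :=
      (selM_mul _ _).symm
    rw [h2, Matrix.det_mul] at h1
    rw [show ((permSymbol i j m n : ℝ) : ℂ) = (selM ℂ ![i, j, m, n]).det from ?_]
    · exact h1
    · refine (Complex.ofRealHom.map_det (selM ℝ ![i, j, m, n])).trans (congrArg _ ?_)
      ext i j
      simp [selM]
  · simp only [sum_push₂ (E l)]
    rw [sum_push₂ (E k)]
    rfl

/-- The dual of a tensor built from bivectors. -/
theorem fr4_dualT_bivTab {gi E : Fin 4 → Fin 4 → ℂ}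
    (hgi : ∀ a b, gi a b = ∑ i, wtC i • (E i a * E (opp i) b)) {v : ℂ}
    {C : Fin 4 → Fin 4 → Fin 4 → Fin 4 → ℂ} {x y : Fin 4 → ℂ}
    (hC : fr4 E C = bivTab (symT6 x y)) (hv : v * (Matrix.of E).det = -4 * Complex.I) :
    fr4 E (dualT v gi C)
      = bivTab (symT6 (fun s => -Complex.I * x s) (fun s => Complex.I * y s)) := by
  funext i j k l
  rw [fr4_dualT hgi, hC]
  have hp : ∀ m n, (permSymbol i j m n : ℂ) = (permZ i j m n : ℂ) / 12 := by
    intro m n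
    have : ((12 * permSymbol i j m n : ℝ) : ℂ) = ((permZ i j m n : ℝ) : ℂ) := by
      rw [permSymbol_eq]
    push_cast at this
    rw [eq_div_iff (by norm_num)]
    linear_combination this
  have e : ∀ m n, (v / 2 * (wtC m * wtC n)) * ((permSymbol i j m n : ℂ) * (Matrix.of E).det
      * bivTab (symT6 x y) (opp m) (opp n) k l)
      = ∑ a, ∑ b, (-Complex.I / 24 * symT6 x y a b * biv b k l) *
        ((permZ i j m n * (sgZ m * sgZ n * bivZ a (opp m) (opp n)) : ℤ) : ℂ) := by
    intro m n
    rw [hp, wtC_eq, wtC_eq]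
    have : v / 2 * (1 / 2 * (sgZ m : ℂ) * (1 / 2 * (sgZ n : ℂ))) * ((permZ i j m n : ℂ) / 12
        * (Matrix.of E).det * bivTab (symT6 x y) (opp m) (opp n) k l)
        = (-Complex.I / 24 * (permZ i j m n * (sgZ m * sgZ n)))
          * bivTab (symT6 x y) (opp m) (opp n) k l := by
      linear_combination ((sgZ m : ℂ) * sgZ n * permZ i j m n / 96
        * bivTab (symT6 x y) (opp m) (opp n) k l) * hv
    rw [this]
    simp only [bivTab, Finset.mul_sum, biv]
    push_cast
    exact Finset.sum_congr rfl fun a _ => Finset.sum_congr rfl fun b _ => by ring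
  simp_rw [e]
  have s1 : ∀ h : Fin 4 → Fin 4 → Fin 6 → ℂ, ∑ k, ∑ l, ∑ a, h k l a = ∑ a, ∑ k, ∑ l, h k l a := by
    intro h
    rw [Finset.sum_congr rfl fun k _ => Finset.sum_comm, Finset.sum_comm]
  rw [s1]
  simp_rw [s1, ← Finset.mul_sum, ← Int.cast_sum, permZ_biv]
  simp only [bivTab]
  simp [Fin.sum_univ_succ, symT6, biv, Fin.succ]
  ring

/-! ## The adapted tetrad -/

open Filter Topology ComplexConjugate

theorem weylC_eq (g : MetricField) (p : Coord) (X Y Z W : Fin 4 → ℂ) :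
    weylC g p X Y Z W = ten4 (fun a b c d => (weyl g a b c d p : ℂ)) X Y Z W := by
  simp only [weylC, ten4, Finset.mul_sum]
  exact Finset.sum_congr rfl fun _ _ => Finset.sum_congr rfl fun _ _ =>
    Finset.sum_congr rfl fun _ _ => Finset.sum_congr rfl fun _ _ => by ring

theorem weylC_smul (g : MetricField) (p : Coord) (x y z w : ℂ) (X Y Z W : Fin 4 → ℂ) :
    weylC g p (x • X) (y • Y) (z • Z) (w • W) = x * y * z * w * weylC g p X Y Z W := by
  simp only [weylC, Finset.mul_sum, Pi.smul_apply, smul_eq_mul]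
  exact Finset.sum_congr rfl fun _ _ => Finset.sum_congr rfl fun _ _ =>
    Finset.sum_congr rfl fun _ _ => Finset.sum_congr rfl fun _ _ => by ring

theorem metricC_smul (g : MetricField) (p : Coord) (x y : ℂ) (X Y : Fin 4 → ℂ) :
    metricC g p (x • X) (y • Y) = x * y * metricC g p X Y := by
  simp only [metricC, Finset.mul_sum, Pi.smul_apply, smul_eq_mul]
  exact Finset.sum_congr rfl fun _ _ => Finset.sum_congr rfl fun _ _ => by ring

theorem ev_fr4 {p : Coord} (E : Fin 4 → Fin 4 → SmoothGerm p)
    (C : Fin 4 → Fin 4 → Fin 4 → Fin 4 → SmoothGerm p) (i j k l : Fin 4) :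
    SmoothGerm.ev p (fr4 E C i j k l)
      = fr4 (fun i a => SmoothGerm.ev p (E i a)) (fun a b c d => SmoothGerm.ev p (C a b c d))
        i j k l := by
  simp only [fr4, ten4, map_sum, map_mul]

theorem ev_bivTab {p : Coord} (x y : Fin 4 → SmoothGerm p) (i j k l : Fin 4) :
    SmoothGerm.ev p (bivTab (symT6 x y) i j k l)
      = bivTab (symT6 (fun s => SmoothGerm.ev p (x s)) (fun s => SmoothGerm.ev p (y s))) i j k l := by
  simp only [bivTab, map_sum, map_mul, biv, map_intCast]
  refine Finset.sum_congr rfl fun a _ => Finset.sum_congr rfl fun b _ => ?_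
  congr 1
  fin_cases a <;> fin_cases b <;> simp [symT6]

namespace KVPoint

variable {a : ℝ} {m : ℝ → ℝ} {p : Coord} (h : KVPoint a m p)
include h

theorem ev_Z : SmoothGerm.ev p h.ring.Z = (zF a p)⁻¹ := by
  rw [← h.rep_Z.germ_eq, ev_germ h.rep_Z.sm]
theorem ev_W : SmoothGerm.ev p h.ring.W = (wF a p)⁻¹ := by
  rw [← h.rep_W.germ_eq, ev_germ h.rep_W.sm]
theorem ev_t : SmoothGerm.ev p h.ring.t = Complex.I * a * Real.sin (p 2) := by
  rw [← h.rep_t.germ_eq, ev_germ h.rep_t.sm]; rfl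
theorem ev_y : SmoothGerm.ev p h.ring.y = Complex.I * ((Real.sin (p 2) : ℝ) : ℂ)⁻¹ := by
  rw [← h.rep_y.germ_eq, ev_germ h.rep_y.sm]; rfl
theorem ev_μ (k : ℕ) : SmoothGerm.ev p (h.ring.μ k) = (iteratedDeriv k m (p 0) : ℝ) := by
  rw [← (h.rep_μ k).germ_eq, ev_germ (h.rep_μ k).sm]; rfl

/-- The legs of the frame at the point. -/
def frame (i b : Fin 4) : ℂ := SmoothGerm.ev p (h.ring.E i b)

theorem frame_zero : h.frame 0 = ![0, -1, 0, 0] := by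
  funext b; fin_cases b <;> simp [frame, KVRing.E]

theorem frame_one : h.frame 1 = (2 : ℂ) • ![(((p 1 ^ 2 + a ^ 2) / Rsq a p : ℝ) : ℂ),
    ((Delta a m p / (2 * Rsq a p) : ℝ) : ℂ), 0, ((a / Rsq a p : ℝ) : ℂ)] := by
  have hS : ((Rsq a p : ℝ) : ℂ) = zF a p * wF a p := (zF_mul_wF a p).symm
  have hz := h.z_ne
  have hw := h.w_ne
  have hI := Complex.I_sq
  have hs : ((Real.sin (p 2) : ℝ) : ℂ) ≠ 0 := h.sinF_ne
  have h2r : zF a p + wF a p = 2 * (p 1 : ℂ) := by simp only [zF, wF, idF]; ring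
  have hq : (p 1 : ℂ) ^ 2 + (a : ℂ) ^ 2
      = zF a p * wF a p + (a : ℂ) ^ 2 * (Real.sin (p 2) : ℝ) ^ 2 := by
    rw [zF_mul_wF, Rsq]; push_cast
    linear_combination -(a : ℂ) ^ 2 * Complex.cos_sq' (p 2 : ℂ)
  have h4 : (2 : ℂ) * m (p 0) * p 1 = m (p 0) * (zF a p + wF a p) := by rw [h2r]; ring
  funext b
  fin_cases b <;>
    simp only [frame, KVRing.E, map_sub, map_mul, map_neg, map_add, map_pow, map_one, map_ofNat,
      map_zero, h.ev_Z, h.ev_W, h.ev_t, h.ev_y, h.ev_μ, Pi.smul_apply, smul_eq_mul, Delta,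
      Complex.ofReal_sub, Complex.ofReal_mul, Complex.ofReal_div, Complex.ofReal_add,
      Complex.ofReal_pow, Complex.ofReal_ofNat, hS, hq, h4, iteratedDeriv_zero, Fin.zero_eta,
      Fin.mk_one, Fin.reduceFinMk, Matrix.cons_val_zero, Matrix.cons_val_one, Matrix.cons_val] <;>
    field_simp
  · linear_combination -((a : ℂ) ^ 2 * (Real.sin (p 2) : ℝ) ^ 2) * hI
  · linear_combination -((a : ℂ) ^ 2 * (Real.sin (p 2) : ℝ) ^ 2) * hI
  · simp
  · linear_combination -(a : ℂ) * hI

theorem frame_two : h.frame 2 = (1 / ((p 1 : ℂ) + Complex.I * (a * Real.cos (p 2) : ℝ))) •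
    ![Complex.I * (a * Real.sin (p 2) : ℝ), 0, 1, Complex.I / (Real.sin (p 2) : ℝ)] := by
  have hz : (p 1 : ℂ) + Complex.I * (a * Real.cos (p 2) : ℝ) = zF a p := by
    simp only [zF, idF, cosF]; push_cast; ring
  rw [hz]
  funext b
  fin_cases b <;> simp [-Complex.ofReal_sin, frame, KVRing.E, h.ev_Z, h.ev_t, h.ev_y]
  · ring
  · ring

theorem frame_three : h.frame 3 = star (h.frame 2) := by
  have e : conj (zF a p) = wF a p := by
    simp [zF, wF, idF, cosF, -Complex.ofReal_cos]; ring
  funext b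
  rw [Pi.star_apply, Complex.star_def]
  fin_cases b <;> simp [-Complex.ofReal_sin, frame, KVRing.E, h.ev_Z, h.ev_W, h.ev_t, h.ev_y, e]

theorem metricC_frame (i j : Fin 4) :
    metricC (kvMetric a m) p (h.frame i) (h.frame j) = if j = opp i then epC i else 0 := by
  have h1 := congrArg (SmoothGerm.ev p) (h.ring.gram i j)
  simp only [ip, map_sum, map_mul, ← h.gG_eq] at h1
  have h2 : ∀ b c, SmoothGerm.ev p (gG (kvMetric a m) p b c) = (kvMetric a m p b c : ℂ) :=
    fun b c => ev_germR (h.contDiffAt_metric b c)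
  simp only [h2] at h1
  refine Eq.trans h1 ?_
  split_ifs
  · exact (SmoothGerm.ev p).commutes _
  · exact map_zero _

theorem weyl_frame : fr4 h.frame (fun b c d e => (weyl (kvMetric a m) b c d e p : ℂ))
    = bivTab (symT6 ![0, 4 * m (p 0) * (zF a p)⁻¹ ^ 3, SmoothGerm.ev p h.ring.ψ₃,
        SmoothGerm.ev p h.ring.ψ₄] ![0, 4 * m (p 0) * (wF a p)⁻¹ ^ 3, SmoothGerm.ev p h.ring.ψ₃',
        SmoothGerm.ev p h.ring.ψ₄']) := by
  have h1 := h.ring.weyl_frame der_comm h.giG_inv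
  rw [← h.weylG_eq] at h1
  funext i j k l
  have h2 := congrArg (SmoothGerm.ev p) (congrFun (congrFun (congrFun (congrFun h1 i) j) k) l)
  rw [ev_fr4, KVRing.weylT, ev_bivTab] at h2
  have h3 : (fun b c d e => SmoothGerm.ev p (weylG (kvMetric a m) p b c d e))
      = fun b c d e => (weyl (kvMetric a m) b c d e p : ℂ) := by
    funext b c d e; exact (h.smoothMetric.rep_weyl b c d e).ev_eq
  rw [h3] at h2
  refine Eq.trans h2 ?_
  congr 2 <;> funext s <;> fin_cases s <;>
    simp [KVRing.ψ₂, KVRing.ψ₂', h.ev_Z, h.ev_W, h.ev_μ, map_ofNat (SmoothGerm.ev p) 4]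

/-- The algebraic frame is l, 2n, √2 m, √2 m̄. The rescaling clears the square roots and accounts
for the inner products -2 and 2. -/
theorem tetrad_l : (kvTetrad a m).l p = (1 : ℂ) • h.frame 0 := by
  rw [one_smul, h.frame_zero]; rfl
theorem tetrad_n : (kvTetrad a m).n p = (1 / 2 : ℂ) • h.frame 1 := by
  rw [h.frame_one, smul_smul]; norm_num [kvTetrad]
theorem tetrad_m : (kvTetrad a m).m p = (1 / (Real.sqrt 2 : ℂ)) • h.frame 2 := by
  rw [h.frame_two, smul_smul, one_div_mul_one_div]; rfl
theorem tetrad_mbar : star ((kvTetrad a m).m p) = (1 / (Real.sqrt 2 : ℂ)) • h.frame 3 := by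
  rw [h.tetrad_m, h.frame_three, star_smul]
  simp

theorem isNullAt : (kvTetrad a m).IsNullAt (kvMetric a m) p := by
  have h2 : ((Real.sqrt 2 : ℝ) : ℂ) * (Real.sqrt 2 : ℝ) = 2 := by
    rw [← Complex.ofReal_mul, Real.mul_self_sqrt (by norm_num)]; norm_num
  constructor
  · funext b; fin_cases b <;> simp [kvTetrad]
  · funext b
    rw [Pi.star_apply, Complex.star_def]
    fin_cases b <;> simp [kvTetrad, -Complex.ofReal_div, Complex.conj_ofReal]
  all_goals
    try simp only [h.tetrad_l, h.tetrad_n, h.tetrad_mbar]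
    try rw [h.tetrad_m]
    rw [metricC_smul, h.metricC_frame]
    simp [opp, epC]
  rw [← mul_inv, h2]; norm_num

/-- The rescaling of the four legs contributes 1 · (1/√2)² · ½ = ¼, which cancels the 4 in ψ₂; the
sign comes from reading U on the reversed pair (3,1). -/
theorem kvPsi2_eq : kvPsi2 a m p = -(m (p 0) * (zF a p)⁻¹ ^ 3) := by
  have h2 : ((Real.sqrt 2 : ℝ) : ℂ) * (Real.sqrt 2 : ℝ) = 2 := by
    rw [← Complex.ofReal_mul, Real.mul_self_sqrt (by norm_num)]; norm_num
  have h4 : (1 / ((Real.sqrt 2 : ℝ) : ℂ)) * (1 / ((Real.sqrt 2 : ℝ) : ℂ)) = 1 / 2 := by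
    rw [one_div_mul_one_div, h2]
  have key := congrFun (congrFun (congrFun (congrFun h.weyl_frame 0) 2) 3) 1
  rw [kvPsi2, Psi2, h.tetrad_mbar, h.tetrad_l, h.tetrad_m, h.tetrad_n, weylC_smul, weylC_eq]
  rw [fr4] at key
  rw [key]
  simp [bivTab, Fin.sum_univ_succ, symT6, biv, bivZ, Fin.succ]
  linear_combination (2 * m (p 0) * (zF a p ^ 3)⁻¹) * h4

theorem psi_zero_one : Psi0 (kvMetric a m) (kvTetrad a m) p = 0 ∧
    Psi1 (kvMetric a m) (kvTetrad a m) p = 0 := by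
  have k0 := congrFun (congrFun (congrFun (congrFun h.weyl_frame 0) 2) 0) 2
  have k1 := congrFun (congrFun (congrFun (congrFun h.weyl_frame 0) 1) 0) 2
  rw [fr4] at k0 k1
  rw [Psi0, Psi1, h.tetrad_l, h.tetrad_m, h.tetrad_n, weylC_smul, weylC_smul, weylC_eq, weylC_eq,
    k0, k1]
  constructor <;> simp [bivTab, Fin.sum_univ_succ, symT6, biv, bivZ, Fin.succ]

theorem I1_eq : (I1 (kvMetric a m) p : ℂ)
    = 24 * (m (p 0) : ℂ) ^ 2 * ((zF a p)⁻¹ ^ 6 + (wF a p)⁻¹ ^ 6) := by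
  rw [← h.rep_I1.ev_eq]
  simp [KVRing.I₁, h.ev_Z, h.ev_W, h.ev_μ, map_ofNat (SmoothGerm.ev p) 24]

theorem ginv_frame (b c : Fin 4) : (ginv (kvMetric a m) b c p : ℂ)
    = ∑ i, wtC i • (h.frame i b * h.frame (opp i) c) := by
  have h1 := congrArg (SmoothGerm.ev p)
    ((frame_inverse h.ring.g_symm h.giG_inv h.ring.gram).1 b c)
  rw [(h.smoothMetric.rep_ginv b c).ev_eq] at h1
  rw [h1]
  simp only [map_sum, map_smul, map_mul, frame]

/-- This value carries the orientation: with the opposite sign the two blocks of bivectors would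
exchange their duality eigenvalues, and the conjugate of Ψ₂ would appear in `I1_add_I2`. -/
theorem det_frame : ((Real.sqrt |(kvMetric a m p).det| : ℝ) : ℂ) * (Matrix.of h.frame).det
    = -4 * Complex.I := by
  have hpos : Real.sqrt |(kvMetric a m p).det| = |Rsq a p| * Real.sin (p 2) := by
    rw [kvMetric_det h.Rsq_ne, abs_neg, abs_pow, Real.sqrt_sq (abs_nonneg _), abs_mul,
      abs_of_pos h.sin_pos]
  have hR : 0 ≤ Rsq a p := by unfold Rsq; positivity
  have hS : ((Rsq a p : ℝ) : ℂ) = zF a p * wF a p := (zF_mul_wF a p).symm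
  have hz := h.z_ne
  have hw := h.w_ne
  have hs : ((Real.sin (p 2) : ℝ) : ℂ) ≠ 0 := h.sinF_ne
  have hd : (Matrix.of h.ring.E).det = -(4 * h.ring.y * h.ring.Z * h.ring.W) := by
    simp [Matrix.det_succ_row_zero, Fin.sum_univ_succ, Fin.succAbove, KVRing.E]
    ring
  have hd' : (Matrix.of h.frame).det = SmoothGerm.ev p (Matrix.of h.ring.E).det := by
    rw [AlgHom.map_det]; rfl
  rw [hpos, abs_of_nonneg hR, Complex.ofReal_mul, hS, hd', hd]
  simp only [map_neg, map_mul, map_ofNat, h.ev_Z, h.ev_W, h.ev_y]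
  field_simp

/-- Dualising multiplies the ψ₂ block by -i and the conjugate block by i. Adding i times I₂ to I₁
therefore doubles the contribution of Z⁶ and cancels that of W⁶; ψ₃ and ψ₄ never enter the
contraction. -/
theorem I1_add_I2 : (I1 (kvMetric a m) p : ℂ) + Complex.I * (I2 (kvMetric a m) p : ℂ)
    = 48 * kvPsi2 a m p ^ 2 := by
  set C : Fin 4 → Fin 4 → Fin 4 → Fin 4 → ℂ := fun b c d e => (weyl (kvMetric a m) b c d e p : ℂ)
    with hC
  set gi : Fin 4 → Fin 4 → ℂ := fun b c => (ginv (kvMetric a m) b c p : ℂ) with hgi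
  set v : ℂ := ((Real.sqrt |(kvMetric a m p).det| : ℝ) : ℂ) with hv
  have h2 : (I2 (kvMetric a m) p : ℂ) = contr4 gi (dualT v gi C) C := by
    simp only [I2, weylUp, weylDual, volForm, contr4, dualT, hC, hgi, hv]
    push_cast
    rfl
  have hf : ∀ b c, gi b c = ∑ i, wtC i • (h.frame i b * h.frame (opp i) c) := h.ginv_frame
  rw [h2, contr4_frame hf, fr4_dualT_bivTab hf h.weyl_frame h.det_frame, h.weyl_frame,
    symT6_contract, h.I1_eq, h.kvPsi2_eq]
  simp
  linear_combination (-(24 * (m (p 0) : ℂ) ^ 2 * ((zF a p ^ 6)⁻¹ - (wF a p ^ 6)⁻¹)))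
    * Complex.I_sq

end KVPoint

/-! ## Conformal invariants of the Kerr-Vaidya metric in the differential ring -/

/-- The reduced form of the invariant `J_4`. -/
def polyj {A : Type*} [CommRing A] (Z W τ m m1 m2 : A) : A :=
    -(3 * Z ^ (15 : ℕ) * m ^ (3 : ℕ)) - 3 * Z ^ (14 : ℕ) * W * m ^ (3 : ℕ) + 3 * Z ^ (14 : ℕ) *
    m ^ (2 : ℕ) + 6 * Z ^ (13 : ℕ) * τ * m * m1 - 4 * Z ^ (13 : ℕ) * m * m1 - Z ^ (12 : ℕ) * W * m
    * m1 - 2 * Z ^ (12 : ℕ) * τ * m * m2 + Z ^ (12 : ℕ) * τ * m1 ^ (2 : ℕ) + 2 * Z ^ (11 : ℕ) *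
    W ^ (2 : ℕ) * τ * m * m1 - Z ^ (11 : ℕ) * W ^ (2 : ℕ) * m * m1 - Z ^ (11 : ℕ) * W * τ * m * m2
    + Z ^ (11 : ℕ) * W * τ * m1 ^ (2 : ℕ) + Z ^ (10 : ℕ) * W ^ (2 : ℕ) * τ * m1 ^ (2 : ℕ) + 15 *
    Z ^ (9 : ℕ) * W ^ (6 : ℕ) * m ^ (3 : ℕ) - 21 * Z ^ (8 : ℕ) * W ^ (7 : ℕ) * m ^ (3 : ℕ) - 15 *
    Z ^ (8 : ℕ) * W ^ (6 : ℕ) * m ^ (2 : ℕ) + 2 * Z ^ (8 : ℕ) * W ^ (5 : ℕ) * τ * m * m1 -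
    Z ^ (8 : ℕ) * W ^ (5 : ℕ) * m * m1 + Z ^ (8 : ℕ) * W ^ (4 : ℕ) * τ * m1 ^ (2 : ℕ) - 21 *
    Z ^ (7 : ℕ) * W ^ (8 : ℕ) * m ^ (3 : ℕ) - 72 * Z ^ (7 : ℕ) * W ^ (7 : ℕ) * τ * m ^ (2 : ℕ) +
    36 * Z ^ (7 : ℕ) * W ^ (7 : ℕ) * m ^ (2 : ℕ) + 6 * Z ^ (7 : ℕ) * W ^ (6 : ℕ) * τ * m * m1 - 5
    * Z ^ (7 : ℕ) * W ^ (6 : ℕ) * m * m1 - Z ^ (7 : ℕ) * W ^ (5 : ℕ) * τ * m * m2 + Z ^ (7 : ℕ) *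
    W ^ (5 : ℕ) * τ * m1 ^ (2 : ℕ) + 15 * Z ^ (6 : ℕ) * W ^ (9 : ℕ) * m ^ (3 : ℕ) - 15 *
    Z ^ (6 : ℕ) * W ^ (8 : ℕ) * m ^ (2 : ℕ) + 6 * Z ^ (6 : ℕ) * W ^ (7 : ℕ) * τ * m * m1 - 5 *
    Z ^ (6 : ℕ) * W ^ (7 : ℕ) * m * m1 - 4 * Z ^ (6 : ℕ) * W ^ (6 : ℕ) * τ * m * m2 + 2 *
    Z ^ (6 : ℕ) * W ^ (6 : ℕ) * τ * m1 ^ (2 : ℕ) + 2 * Z ^ (5 : ℕ) * W ^ (8 : ℕ) * τ * m * m1 -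
    Z ^ (5 : ℕ) * W ^ (8 : ℕ) * m * m1 - Z ^ (5 : ℕ) * W ^ (7 : ℕ) * τ * m * m2 + Z ^ (5 : ℕ) *
    W ^ (7 : ℕ) * τ * m1 ^ (2 : ℕ) + Z ^ (4 : ℕ) * W ^ (8 : ℕ) * τ * m1 ^ (2 : ℕ) + 2 *
    Z ^ (2 : ℕ) * W ^ (11 : ℕ) * τ * m * m1 - Z ^ (2 : ℕ) * W ^ (11 : ℕ) * m * m1 + Z ^ (2 : ℕ) *
    W ^ (10 : ℕ) * τ * m1 ^ (2 : ℕ) - 3 * Z * W ^ (14 : ℕ) * m ^ (3 : ℕ) - Z * W ^ (12 : ℕ) * m *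
    m1 - Z * W ^ (11 : ℕ) * τ * m * m2 + Z * W ^ (11 : ℕ) * τ * m1 ^ (2 : ℕ) - 3 * W ^ (15 : ℕ) *
    m ^ (3 : ℕ) + 3 * W ^ (14 : ℕ) * m ^ (2 : ℕ) + 6 * W ^ (13 : ℕ) * τ * m * m1 - 4 *
    W ^ (13 : ℕ) * m * m1 - 2 * W ^ (12 : ℕ) * τ * m * m2 + W ^ (12 : ℕ) * τ * m1 ^ (2 : ℕ)

set_option maxHeartbeats 4000000 in
/-- The polynomial factor of the wedge of the three conformal invariants. -/
def polyT {A : Type*} [CommRing A] (Z W τ m m1 m2 m3 : A) : A :=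
    -(12 * Z ^ (15 : ℕ) * W * m ^ (2 : ℕ) * m1) + 6 * Z ^ (15 : ℕ) * m * m1 ^ (2 : ℕ) + 12 *
    Z ^ (14 : ℕ) * W * τ * m ^ (2 : ℕ) * m2 - 24 * Z ^ (14 : ℕ) * W * τ * m * m1 ^ (2 : ℕ) - 8 *
    Z ^ (14 : ℕ) * W * m ^ (2 : ℕ) * m2 + 20 * Z ^ (14 : ℕ) * W * m * m1 ^ (2 : ℕ) - 2 *
    Z ^ (14 : ℕ) * m * m1 * m2 + Z ^ (14 : ℕ) * m1 ^ (3 : ℕ) - 2 * Z ^ (13 : ℕ) * W ^ (2 : ℕ) *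
    m ^ (2 : ℕ) * m2 + 16 * Z ^ (13 : ℕ) * W ^ (2 : ℕ) * m * m1 ^ (2 : ℕ) - 4 * Z ^ (13 : ℕ) * W *
    τ * m ^ (2 : ℕ) * m3 + 16 * Z ^ (13 : ℕ) * W * τ * m * m1 * m2 - 8 * Z ^ (13 : ℕ) * W * τ *
    m1 ^ (3 : ℕ) + 3 * Z ^ (13 : ℕ) * W * m * m1 * m2 - Z ^ (13 : ℕ) * W * m1 ^ (3 : ℕ) + 4 *
    Z ^ (12 : ℕ) * W ^ (3 : ℕ) * τ * m ^ (2 : ℕ) * m2 - 8 * Z ^ (12 : ℕ) * W ^ (3 : ℕ) * τ * m *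
    m1 ^ (2 : ℕ) - 2 * Z ^ (12 : ℕ) * W ^ (3 : ℕ) * m ^ (2 : ℕ) * m2 + 4 * Z ^ (12 : ℕ) *
    W ^ (3 : ℕ) * m * m1 ^ (2 : ℕ) - 2 * Z ^ (12 : ℕ) * W ^ (2 : ℕ) * τ * m ^ (2 : ℕ) * m3 + 10 *
    Z ^ (12 : ℕ) * W ^ (2 : ℕ) * τ * m * m1 * m2 - 8 * Z ^ (12 : ℕ) * W ^ (2 : ℕ) * τ *
    m1 ^ (3 : ℕ) + 2 * Z ^ (11 : ℕ) * W ^ (4 : ℕ) * m * m1 ^ (2 : ℕ) + 4 * Z ^ (11 : ℕ) *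
    W ^ (3 : ℕ) * τ * m * m1 * m2 - 8 * Z ^ (11 : ℕ) * W ^ (3 : ℕ) * τ * m1 ^ (3 : ℕ) -
    Z ^ (11 : ℕ) * W ^ (3 : ℕ) * m * m1 * m2 - Z ^ (11 : ℕ) * W ^ (3 : ℕ) * m1 ^ (3 : ℕ) + 2 *
    Z ^ (10 : ℕ) * W ^ (5 : ℕ) * m * m1 ^ (2 : ℕ) + 2 * Z ^ (10 : ℕ) * W ^ (4 : ℕ) * m1 ^ (3 : ℕ)
    - 12 * Z ^ (9 : ℕ) * W ^ (7 : ℕ) * m ^ (2 : ℕ) * m1 + 4 * Z ^ (9 : ℕ) * W ^ (6 : ℕ) * τ *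
    m ^ (2 : ℕ) * m2 - 8 * Z ^ (9 : ℕ) * W ^ (6 : ℕ) * τ * m * m1 ^ (2 : ℕ) - 2 * Z ^ (9 : ℕ) *
    W ^ (6 : ℕ) * m ^ (2 : ℕ) * m2 + 10 * Z ^ (9 : ℕ) * W ^ (6 : ℕ) * m * m1 ^ (2 : ℕ) + 4 *
    Z ^ (9 : ℕ) * W ^ (5 : ℕ) * τ * m * m1 * m2 - 8 * Z ^ (9 : ℕ) * W ^ (5 : ℕ) * τ * m1 ^ (3 : ℕ)
    - Z ^ (9 : ℕ) * W ^ (5 : ℕ) * m * m1 * m2 - Z ^ (9 : ℕ) * W ^ (5 : ℕ) * m1 ^ (3 : ℕ) + 12 *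
    Z ^ (8 : ℕ) * W ^ (7 : ℕ) * τ * m ^ (2 : ℕ) * m2 - 24 * Z ^ (8 : ℕ) * W ^ (7 : ℕ) * τ * m *
    m1 ^ (2 : ℕ) - 10 * Z ^ (8 : ℕ) * W ^ (7 : ℕ) * m ^ (2 : ℕ) * m2 + 36 * Z ^ (8 : ℕ) *
    W ^ (7 : ℕ) * m * m1 ^ (2 : ℕ) - 2 * Z ^ (8 : ℕ) * W ^ (6 : ℕ) * τ * m ^ (2 : ℕ) * m3 + 10 *
    Z ^ (8 : ℕ) * W ^ (6 : ℕ) * τ * m * m1 * m2 - 8 * Z ^ (8 : ℕ) * W ^ (6 : ℕ) * τ * m1 ^ (3 : ℕ)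
    - 2 * Z ^ (8 : ℕ) * W ^ (6 : ℕ) * m * m1 * m2 + Z ^ (8 : ℕ) * W ^ (6 : ℕ) * m1 ^ (3 : ℕ) - 12
    * Z ^ (7 : ℕ) * W ^ (9 : ℕ) * m ^ (2 : ℕ) * m1 + 12 * Z ^ (7 : ℕ) * W ^ (8 : ℕ) * τ *
    m ^ (2 : ℕ) * m2 - 24 * Z ^ (7 : ℕ) * W ^ (8 : ℕ) * τ * m * m1 ^ (2 : ℕ) - 10 * Z ^ (7 : ℕ) *
    W ^ (8 : ℕ) * m ^ (2 : ℕ) * m2 + 36 * Z ^ (7 : ℕ) * W ^ (8 : ℕ) * m * m1 ^ (2 : ℕ) - 8 *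
    Z ^ (7 : ℕ) * W ^ (7 : ℕ) * τ * m ^ (2 : ℕ) * m3 + 32 * Z ^ (7 : ℕ) * W ^ (7 : ℕ) * τ * m * m1
    * m2 - 16 * Z ^ (7 : ℕ) * W ^ (7 : ℕ) * τ * m1 ^ (3 : ℕ) + 6 * Z ^ (7 : ℕ) * W ^ (7 : ℕ) * m *
    m1 * m2 - 2 * Z ^ (7 : ℕ) * W ^ (7 : ℕ) * m1 ^ (3 : ℕ) + 4 * Z ^ (6 : ℕ) * W ^ (9 : ℕ) * τ *
    m ^ (2 : ℕ) * m2 - 8 * Z ^ (6 : ℕ) * W ^ (9 : ℕ) * τ * m * m1 ^ (2 : ℕ) - 2 * Z ^ (6 : ℕ) *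
    W ^ (9 : ℕ) * m ^ (2 : ℕ) * m2 + 10 * Z ^ (6 : ℕ) * W ^ (9 : ℕ) * m * m1 ^ (2 : ℕ) - 2 *
    Z ^ (6 : ℕ) * W ^ (8 : ℕ) * τ * m ^ (2 : ℕ) * m3 + 10 * Z ^ (6 : ℕ) * W ^ (8 : ℕ) * τ * m * m1
    * m2 - 8 * Z ^ (6 : ℕ) * W ^ (8 : ℕ) * τ * m1 ^ (3 : ℕ) - 2 * Z ^ (6 : ℕ) * W ^ (8 : ℕ) * m *
    m1 * m2 + Z ^ (6 : ℕ) * W ^ (8 : ℕ) * m1 ^ (3 : ℕ) + 2 * Z ^ (5 : ℕ) * W ^ (10 : ℕ) * m *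
    m1 ^ (2 : ℕ) + 4 * Z ^ (5 : ℕ) * W ^ (9 : ℕ) * τ * m * m1 * m2 - 8 * Z ^ (5 : ℕ) * W ^ (9 : ℕ)
    * τ * m1 ^ (3 : ℕ) - Z ^ (5 : ℕ) * W ^ (9 : ℕ) * m * m1 * m2 - Z ^ (5 : ℕ) * W ^ (9 : ℕ) *
    m1 ^ (3 : ℕ) + 2 * Z ^ (4 : ℕ) * W ^ (11 : ℕ) * m * m1 ^ (2 : ℕ) + 2 * Z ^ (4 : ℕ) *
    W ^ (10 : ℕ) * m1 ^ (3 : ℕ) + 4 * Z ^ (3 : ℕ) * W ^ (12 : ℕ) * τ * m ^ (2 : ℕ) * m2 - 8 *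
    Z ^ (3 : ℕ) * W ^ (12 : ℕ) * τ * m * m1 ^ (2 : ℕ) - 2 * Z ^ (3 : ℕ) * W ^ (12 : ℕ) *
    m ^ (2 : ℕ) * m2 + 4 * Z ^ (3 : ℕ) * W ^ (12 : ℕ) * m * m1 ^ (2 : ℕ) + 4 * Z ^ (3 : ℕ) *
    W ^ (11 : ℕ) * τ * m * m1 * m2 - 8 * Z ^ (3 : ℕ) * W ^ (11 : ℕ) * τ * m1 ^ (3 : ℕ) -
    Z ^ (3 : ℕ) * W ^ (11 : ℕ) * m * m1 * m2 - Z ^ (3 : ℕ) * W ^ (11 : ℕ) * m1 ^ (3 : ℕ) - 2 *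
    Z ^ (2 : ℕ) * W ^ (13 : ℕ) * m ^ (2 : ℕ) * m2 + 16 * Z ^ (2 : ℕ) * W ^ (13 : ℕ) * m *
    m1 ^ (2 : ℕ) - 2 * Z ^ (2 : ℕ) * W ^ (12 : ℕ) * τ * m ^ (2 : ℕ) * m3 + 10 * Z ^ (2 : ℕ) *
    W ^ (12 : ℕ) * τ * m * m1 * m2 - 8 * Z ^ (2 : ℕ) * W ^ (12 : ℕ) * τ * m1 ^ (3 : ℕ) - 12 * Z *
    W ^ (15 : ℕ) * m ^ (2 : ℕ) * m1 + 12 * Z * W ^ (14 : ℕ) * τ * m ^ (2 : ℕ) * m2 - 24 * Z *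
    W ^ (14 : ℕ) * τ * m * m1 ^ (2 : ℕ) - 8 * Z * W ^ (14 : ℕ) * m ^ (2 : ℕ) * m2 + 20 * Z *
    W ^ (14 : ℕ) * m * m1 ^ (2 : ℕ) - 4 * Z * W ^ (13 : ℕ) * τ * m ^ (2 : ℕ) * m3 + 16 * Z *
    W ^ (13 : ℕ) * τ * m * m1 * m2 - 8 * Z * W ^ (13 : ℕ) * τ * m1 ^ (3 : ℕ) + 3 * Z *
    W ^ (13 : ℕ) * m * m1 * m2 - Z * W ^ (13 : ℕ) * m1 ^ (3 : ℕ) + 6 * W ^ (15 : ℕ) * m *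
    m1 ^ (2 : ℕ) - 2 * W ^ (14 : ℕ) * m * m1 * m2 + W ^ (14 : ℕ) * m1 ^ (3 : ℕ)

namespace KVRing

variable {A : Type*} [CommRing A] [Algebra ℂ A] {D : Fin 4 → Derivation ℂ A A} (K : KVRing D)

/-- The function `-a² sin² θ / R²`. -/
def τ : A := K.t ^ 2 * K.Z * K.W

theorem two_tc : 2 * K.t * K.c * K.Z * K.W = K.W - K.Z := by
  linear_combination K.Z * K.W * K.tc + K.W * K.zZ - K.Z * K.wW

theorem D0τ : D 0 K.τ = 0 := by simp [τ, Derivation.leibniz_pow]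
theorem D1τ : D 1 K.τ = -(K.τ * (K.Z + K.W)) := by
  simp [τ, Derivation.leibniz_pow]; ring
theorem D2τ : D 2 K.τ = K.t * (K.W - K.Z) * (1 - K.τ) := by
  simp [τ, Derivation.leibniz_pow]
  linear_combination K.t * K.two_tc
theorem D3τ : D 3 K.τ = 0 := by simp [τ, Derivation.leibniz_pow]

attribute [simp] D0τ D1τ D2τ D3τ

/-- The derivation along the vector field in the `(r, θ)`-plane that annihilates `Z / W`. -/
def ξ : Derivation ℂ A A := (K.t * (K.Z + K.W)) • D 1 - (K.W - K.Z) • D 2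

theorem ξ_apply (f : A) : K.ξ f = K.t * (K.Z + K.W) * D 1 f - (K.W - K.Z) * D 2 f := by
  simp [ξ]

/-- The function `-4 a² / R⁴`. -/
def H : A := (K.Z - K.W) ^ 2 + 4 * K.τ * K.Z * K.W

/-- Both derivatives are -2tZW times the function itself, so on polynomials in Z and W with constant
coefficients ξ acts as -2tZW times the Euler operator. The numerical coefficients in the identities
for ξ below are such weights. -/
theorem ξZ : K.ξ K.Z = -(2 * K.t * K.Z ^ 2 * K.W) := by simp [ξ_apply]; ring
theorem ξW : K.ξ K.W = -(2 * K.t * K.Z * K.W ^ 2) := by simp [ξ_apply]; ring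
theorem ξτ : K.ξ K.τ = -(K.t * K.H) := by simp [ξ_apply, H]; ring
theorem ξμ (k : ℕ) : K.ξ (K.μ k) = 0 := by simp [ξ_apply]

attribute [simp] ξZ ξW ξτ ξμ

/-- The squared norm of `dZ / Z - dW / W`. -/
def N₀ : A := (K.Z - K.W) ^ 2 * (1 - K.μ 0 * (K.Z + K.W)) + 4 * K.τ * K.Z * K.W

/-- The reduced form of the invariant `J_4`. -/
def j : A := polyj K.Z K.W K.τ (K.μ 0) (K.μ 1) (K.μ 2)

/-- The polynomial factor of the wedge of the three conformal invariants. -/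
def T : A := polyT K.Z K.W K.τ (K.μ 0) (K.μ 1) (K.μ 2) (K.μ 3)

theorem J₄_eq_j : K.J₄ = 1152 * (K.μ 0 ^ 2 * K.j) := by
  simp only [J₄, polyJ₄, j, polyj, τ]
  ring

theorem D3j : D 3 K.j = 0 := by
  simp [j, polyj, Derivation.leibniz_pow, show ∀ n : ℕ, ∀ [n.AtLeastTwo], D 3 (OfNat.ofNat n : A) = 0 from fun n _ => (D 3).map_natCast n]

/-- N₀ equals H - m(Z - W)²(Z + W), with H independent of v; the part linear in m cancels from the
combination. -/
theorem D0N₀ : K.μ 0 * D 0 K.N₀ - K.N₀ * K.μ 1 = -(K.μ 1 * K.H) := by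
  have h4 := der_four (A := A) (D 0)
  simp [N₀, H, Derivation.leibniz_pow, h4]
  ring

theorem D3N₀ : D 3 K.N₀ = 0 := by
  simp [N₀, Derivation.leibniz_pow, der_four]

/-- The part of N₀ linear in m has degree 3 in Z and W, hence weight -6tZW, and cancels. H
represents -4a²(ZW)², of weight -8tZW, and leaves the right-hand side. -/
theorem ξN₀ : K.ξ K.N₀ + 6 * K.t * K.Z * K.W * K.N₀ = -(2 * K.t * K.Z * K.W * K.H) := by
  simp [N₀, Derivation.leibniz_pow, der_four]
  simp only [H]
  ring

-- This is where T comes from. The left side is the combination of derivatives of j that survives in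
-- the Jacobian of the three invariants, apart from the factors m and H. The coefficient 36 is 30
-- from the ξ-derivative of |I₁|^{5/2} plus 6 from its v-derivative.
set_option maxHeartbeats 4000000 in
theorem ξj : -(K.μ 1 * K.ξ K.j) - 36 * K.t * K.Z * K.W * K.μ 1 * K.j
    + 2 * K.t * K.Z * K.W * K.μ 0 * D 0 K.j = K.t * K.T := by
  have hn : ∀ (d : Derivation ℂ A A) (n : ℕ) [n.AtLeastTwo], d (OfNat.ofNat n : A) = 0 :=
    fun d n _ => d.map_natCast n
  simp only [j, T, polyj, Derivation.leibniz_pow, Derivation.leibniz, map_add, map_sub, map_neg, hn,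
    ξZ, ξW, ξτ, ξμ, D0Z, D0W, D0τ, D0μ, smul_eq_mul, nsmul_eq_mul, smul_zero, mul_zero, zero_add,
    add_zero, polyT, H]
  ring

/-- The gradient of a function whose differential is a multiple of `dZ / Z - dW / W`. -/
theorem grad_conf {x : A} {k : A} (h0 : D 0 x = 0) (h1 : D 1 x = k * (K.W - K.Z))
    (h2 : D 2 x = k * (K.t * (K.Z + K.W))) (h3 : D 3 x = 0) :
    ∑ i, wtC i • (K.δ i x * K.δ (opp i) x) = k ^ 2 * K.N₀ := by
  have h5 : (2 : A) * algebraMap ℂ A 2⁻¹ = 1 := by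
    rw [← map_ofNat (algebraMap ℂ A) 2, ← map_mul]; norm_num
  simp only [Fin.sum_univ_four, wtC, opp, Algebra.smul_def, map_neg, one_div,
    Matrix.cons_val_zero, Matrix.cons_val_one, Matrix.cons_val]
  generalize algebraMap ℂ A 2⁻¹ = h at *
  simp only [δ0, δ1, δ2, δ3, h0, h1, h2, h3, N₀, τ]
  linear_combination (k ^ 2 * ((K.Z - K.W) ^ 2 * (1 - K.μ 0 * (K.Z + K.W))
    + 4 * (K.t ^ 2 * K.Z * K.W) * K.Z * K.W)) * h5

end KVRing

/-! ## The conformal invariants near a point -/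

open Filter Topology ComplexConjugate

/-- A continuous logarithm of a smooth function is smooth. -/
theorem sm_of_exp {p : Coord} {L F : Coord → ℂ} (hL : ContinuousAt L p) (hF : Sm p F)
    (h : ∀ᶠ q in 𝓝 p, Complex.exp (L q) = F q) : Sm p L := by
  have h0 : F p ≠ 0 := by rw [← h.self_of_nhds]; exact Complex.exp_ne_zero _
  -- Within distance π of L(p) the principal logarithm of F/F(p) recovers L - L(p), so a continuous
  -- branch inherits smoothness from the principal one near 1.
  have hc : ∀ᶠ q in 𝓝 p, ‖L q - L p‖ < Real.pi := by
    have h1 : ContinuousAt (fun q => ‖L q - L p‖) p := (hL.sub continuousAt_const).norm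
    exact h1.eventually (by simpa using gt_mem_nhds Real.pi_pos)
  have e : L =ᶠ[𝓝 p] fun q => L p + Complex.log (F q / F p) := by
    filter_upwards [hc, h] with q h1 h2
    have h3 := (Complex.abs_im_le_norm (L q - L p)).trans_lt h1
    rw [← h2, ← h.self_of_nhds, ← Complex.exp_sub,
      Complex.log_exp (abs_lt.1 h3).1 (abs_lt.1 h3).2.le]
    ring
  refine Sm.congr (f := fun q => L p + Complex.log (F q / F p)) ?_ e
  refine (Sm.const _).add ?_
  have h1 : Sm p (fun q => F q / F p) := ContDiffAt.div_const hF _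
  have h2 : ContDiffAt ℝ ∞ Complex.log (F p / F p) := by
    rw [div_self h0]
    exact (Complex.contDiffAt_log (n := ∞) Complex.one_mem_slitPlane).restrict_scalars ℝ
  exact ContDiffAt.comp p h2 h1

/-- The logarithmic derivative in multiplied-out form, as the ring of germs has no division. -/
theorem der_of_exp {p : Coord} {L F : Coord → ℂ} (hL : Sm p L) (hF : Sm p F)
    (h : ∀ᶠ q in 𝓝 p, Complex.exp (L q) = F q) (i : Fin 4) :
    SmoothGerm.der p i (germ p L) * germ p F = SmoothGerm.der p i (germ p F) := by
  rw [der_germ hL, der_germ hF, ← germ_mul (hL.pdC i) hF]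
  apply germ_congr
  filter_upwards [hL.eventually_diff, h.eventually_nhds] with q h1 h2
  have h3 : F =ᶠ[𝓝 q] fun q => Complex.exp (L q) := by
    filter_upwards [h2] with x hx using hx.symm
  rw [pdC, pdC, h3.fderiv_eq, h1.hasFDerivAt.cexp.fderiv, ← h2.self_of_nhds]
  simp [mul_comm]

/-- The derivative of a function divided by a power of an absolute value. -/
theorem pd_div_rpow {p : Coord} {f h : Coord → ℝ} (hf : ContDiffAt ℝ ∞ f p)
    (hh : ContDiffAt ℝ ∞ h p) (h0 : h p ≠ 0) (k : ℝ) (i : Fin 4) :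
    pd i (fun q => f q / |h q| ^ k) p
      = (pd i f p - k * f p * (pd i h p / h p)) / |h p| ^ k := by
  have hf' : HasFDerivAt f (fderiv ℝ f p) p :=
    ((hf.of_le (m := 1) (by simp)).differentiableAt (by simp)).hasFDerivAt
  have hh' : HasFDerivAt h (fderiv ℝ h p) p :=
    ((hh.of_le (m := 1) (by simp)).differentiableAt (by simp)).hasFDerivAt
  -- Near p the function h does not vanish, and `Real.log` ignores the sign of its argument; the
  -- power of |h| is thus an exponential of a smooth function.
  have e : (fun q => f q / |h q| ^ k) =ᶠ[𝓝 p] fun q => f q * Real.exp (-(Real.log (h q) * k)) := by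
    filter_upwards [hh.continuousAt.eventually_ne h0] with q hq
    rw [Real.rpow_def_of_pos (abs_pos.2 hq), Real.log_abs, Real.exp_neg, div_eq_mul_inv]
  have h1 : HasFDerivAt (fun q => f q * Real.exp (-(Real.log (h q) * k)))
      (f p • (Real.exp (-(Real.log (h p) * k)) • -(k • (h p)⁻¹ • fderiv ℝ h p))
        + Real.exp (-(Real.log (h p) * k)) • fderiv ℝ f p) p :=
    hf'.mul (((hh'.log h0).mul_const k).neg.exp)
  rw [pd, e.fderiv_eq, h1.fderiv, Real.rpow_def_of_pos (abs_pos.2 h0), Real.log_abs, Real.exp_neg]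
  simp [pd]
  field_simp
  ring

namespace KVPoint

variable {a : ℝ} {m : ℝ → ℝ} {p : Coord} (h : KVPoint a m p)
include h

/-- The regular points form an open set. -/
theorem eventually_exists (hm : ∀ᶠ x in 𝓝 (p 0), ContDiffAt ℝ ∞ m x) :
    ∀ᶠ q in 𝓝 p, KVPoint a m q := by
  have h1 : ∀ᶠ q : Coord in 𝓝 p, ContDiffAt ℝ ∞ m (q 0) :=
    (continuous_apply 0).continuousAt.eventually hm
  have h2 : ∀ᶠ q : Coord in 𝓝 p, 0 < Real.sin (q 2) :=
    (Real.continuous_sin.comp (continuous_apply 2)).continuousAt.eventually (lt_mem_nhds h.sin_pos)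
  have h3 : ∀ᶠ q : Coord in 𝓝 p, Rsq a q ≠ 0 := by
    have : Continuous (Rsq a) := ((continuous_apply 1).pow 2).add
      (continuous_const.mul ((Real.continuous_cos.comp (continuous_apply 2)).pow 2))
    exact this.continuousAt.eventually_ne h.Rsq_ne
  filter_upwards [h1, h2, h3] with q a b c using ⟨a, b, c⟩

theorem rep_psi : Rep p (fun q => -(massF m 0 (q 0) * (zF a q)⁻¹ ^ 3))
    (-(h.ring.μ 0 * h.ring.Z ^ 3)) := by
  simp only [pow_succ, pow_zero, one_mul]
  exact ((h.rep_μ 0).mul ((h.rep_Z.mul h.rep_Z).mul h.rep_Z)).neg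

theorem rep_psi_conj : Rep p (fun q => -(massF m 0 (q 0) * (wF a q)⁻¹ ^ 3))
    (-(h.ring.μ 0 * h.ring.W ^ 3)) := by
  simp only [pow_succ, pow_zero, one_mul]
  exact ((h.rep_μ 0).mul ((h.rep_W.mul h.rep_W).mul h.rep_W)).neg

/-- The germ of the first conformal invariant and its differential. -/
theorem rep_confI {L : Coord → ℂ} (hm : ∀ᶠ x in 𝓝 (p 0), ContDiffAt ℝ ∞ m x)
    (hL : ContinuousAt L p) (he : ∀ᶠ q in 𝓝 p, Complex.exp (L q) = kvPsi2 a m q) :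
    ∃ x, RepR p (confI L) x ∧ SmoothGerm.der p 0 x = 0 ∧
      SmoothGerm.der p 1 x = algebraMap ℂ _ (-6 * Complex.I) * (h.ring.W - h.ring.Z) ∧
      SmoothGerm.der p 2 x
        = algebraMap ℂ _ (-6 * Complex.I) * (h.ring.t * (h.ring.Z + h.ring.W)) ∧
      SmoothGerm.der p 3 x = 0 := by
  have he1 : ∀ᶠ q in 𝓝 p, Complex.exp (L q) = -(massF m 0 (q 0) * (zF a q)⁻¹ ^ 3) := by
    filter_upwards [he, h.eventually_exists hm] with q h1 h2
    rw [h1, h2.kvPsi2_eq]; simp [massF]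
  have he2 : ∀ᶠ q in 𝓝 p, Complex.exp (conj (L q)) = -(massF m 0 (q 0) * (wF a q)⁻¹ ^ 3) := by
    filter_upwards [he1] with q h1
    have e : conj (zF a q) = wF a q := by
      simp [zF, wF, idF, cosF, -Complex.ofReal_cos]; ring
    rw [Complex.exp_conj, h1]
    simp [massF, e]
  have sL := sm_of_exp hL h.rep_psi.sm he1
  have sL' : Sm p (fun q => conj (L q)) :=
    sm_of_exp (Complex.continuous_conj.continuousAt.comp hL) h.rep_psi_conj.sm he2
  have d1 := der_of_exp sL h.rep_psi.sm he1
  have d2 := der_of_exp sL' h.rep_psi_conj.sm he2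
  rw [h.rep_psi.germ_eq] at d1
  rw [h.rep_psi_conj.germ_eq] at d2
  have hm0 : massF m 0 (p 0) ≠ 0 := by
    intro h0
    have := he1.self_of_nhds
    rw [h0, zero_mul, neg_zero] at this
    exact Complex.exp_ne_zero _ this
  have hM := germ_inv (h.rep_μ 0).sm hm0
  rw [(h.rep_μ 0).germ_eq] at hM
  set M := germ p (fun q => (massF m 0 (q 0))⁻¹)
  -- dL = dm/m + 3 dZ/Z with 1/Z written as z. The conjugate has the same first term, so m
  -- disappears from the difference that defines I₁'.
  have d1' : ∀ i, SmoothGerm.der p i (germ p L) = M * SmoothGerm.der p i (h.ring.μ 0)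
      + 3 * h.ring.z * SmoothGerm.der p i h.ring.Z := by
    intro i
    have := d1 i
    simp only [map_neg, Derivation.leibniz, Derivation.leibniz_pow, smul_eq_mul, nsmul_eq_mul] at this
    have hz := h.ring.zZ
    push_cast at this
    generalize SmoothGerm.der p i (germ p L) = x at *
    generalize SmoothGerm.der p i (h.ring.μ 0) = y at *
    generalize SmoothGerm.der p i h.ring.Z = y' at *
    generalize h.ring.Z = Z at *
    generalize h.ring.z = z at *
    generalize h.ring.μ 0 = μ at *
    clear d1 d2 he1 he2
    grind
  have d2' : ∀ i, SmoothGerm.der p i (germ p (fun q => conj (L q)))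
      = M * SmoothGerm.der p i (h.ring.μ 0) + 3 * h.ring.w * SmoothGerm.der p i h.ring.W := by
    intro i
    have := d2 i
    simp only [map_neg, Derivation.leibniz, Derivation.leibniz_pow, smul_eq_mul, nsmul_eq_mul] at this
    have hz := h.ring.wW
    push_cast at this
    generalize SmoothGerm.der p i (germ p (fun q => conj (L q))) = x at *
    generalize SmoothGerm.der p i (h.ring.μ 0) = y at *
    generalize SmoothGerm.der p i h.ring.W = y' at *
    generalize h.ring.W = Z at *
    generalize h.ring.w = z at *
    generalize h.ring.μ 0 = μ at *
    clear d1 d2 he1 he2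
    grind
  have rx : Rep p (fun q => -2 * Complex.I * (L q - conj (L q)))
      (algebraMap ℂ _ (-2 * Complex.I) * (germ p L - germ p (fun q => conj (L q)))) :=
    (Rep.const _).mul ((Rep.of_sm sL).sub (Rep.of_sm sL'))
  have ex : (fun q => ((confI L q : ℝ) : ℂ)) = fun q => -2 * Complex.I * (L q - conj (L q)) := by
    funext q
    apply Complex.ext <;> simp [confI]
  have hs : ContDiffAt ℝ ∞ (confI L) p := by
    have h1 : ContDiffAt ℝ ∞ (fun q => ((confI L q : ℝ) : ℂ)) p := by rw [ex]; exact rx.sm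
    exact (Complex.reCLM.contDiff.contDiffAt.comp p h1 : _)
  have h6 : algebraMap ℂ (SmoothGerm p) (-6 * Complex.I)
      = 3 * algebraMap ℂ (SmoothGerm p) (-2 * Complex.I) := by
    rw [← map_ofNat (algebraMap ℂ (SmoothGerm p)) 3, ← map_mul]; congr 1; ring
  refine ⟨_, ⟨hs, rx.germ_eq ▸ congrArg (germ p) ex⟩, ?_, ?_, ?_, ?_⟩
  all_goals
    rw [Derivation.leibniz, Derivation.map_algebraMap, map_sub, d1', d2']
    simp only [smul_eq_mul, KVRing.D0Z, KVRing.D0W, KVRing.D1Z, KVRing.D1W,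
      KVRing.D2Z, KVRing.D2W, KVRing.D3Z, KVRing.D3W, h6]
  · ring
  · linear_combination (3 * algebraMap ℂ (SmoothGerm p) (-2 * Complex.I)) *
      (h.ring.W * h.ring.wW - h.ring.Z * h.ring.zZ)
  · linear_combination (3 * algebraMap ℂ (SmoothGerm p) (-2 * Complex.I) * h.ring.t) *
      (h.ring.W * h.ring.wW + h.ring.Z * h.ring.zZ)
  · ring

end KVPoint

/-! ## The wedge of the three conformal invariants -/

namespace KVRing

variable {A : Type*} [CommRing A] [Algebra ℂ A] {D : Fin 4 → Derivation ℂ A A} (K : KVRing D)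

theorem D0I₁ : K.μ 0 * D 0 K.I₁ = 2 * K.μ 1 * K.I₁ := by
  have h24 : D 0 (24 : A) = 0 := (D 0).map_natCast 24
  simp [I₁, Derivation.leibniz_pow, h24]; ring

theorem D3I₁ : D 3 K.I₁ = 0 := by
  have h24 : D 3 (24 : A) = 0 := (D 3).map_natCast 24
  simp [I₁, Derivation.leibniz_pow, h24]

theorem ξI₁ : K.ξ K.I₁ = -(12 * K.t * K.Z * K.W * K.I₁) := by
  have h24 : K.ξ (24 : A) = 0 := K.ξ.map_natCast 24
  simp [I₁, Derivation.leibniz_pow, h24]; ring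

end KVRing

/-- The bilinear form of gradients of functions of `(v, r, θ)`. -/
def gradForm (Z W τ m : ℂ) (x y : Fin 3 → ℂ) : ℂ :=
  (1 - τ) * (x 0 * y 1 + x 1 * y 0) + (1 - τ - m * (Z + W)) * (x 1 * y 1) - τ * (x 0 * y 0)
    + Z * W * (x 2 * y 2)

/-- A Gram matrix of three covectors in three variables is x G xᵀ, so its determinant is det(x)² det
G. The prefactor is the minor of the inverse metric in v, r, θ; φ does not matter since none of the
invariants depends on it. -/
theorem gradForm_det (Z W τ m : ℂ) (x : Fin 3 → Fin 3 → ℂ) :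
    (Matrix.of fun i j => gradForm Z W τ m (x i) (x j)).det
      = Z * W * (τ - 1 + τ * m * (Z + W)) * (Matrix.of x).det ^ 2 := by
  simp only [Matrix.det_fin_three, gradForm, Matrix.of_apply]
  ring

/-- The first row has no v-entry, so the determinant is k times the 2×2 determinant formed with ∂_v
and ξ on the other two rows. Here e stands for d ln I₁: its half, subtracted from dN₀ with the
factor N₀, leaves multiples of H (`r1`, `r2`), and in the third row the weights combine to the left
side of `q3`. -/
theorem wedge_det {Z W t μ μ1 N H T j k u v : ℂ} {n e j' : Fin 4 → ℂ}
    (q1 : μ * n 0 - N * μ1 = -(μ1 * H))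
    (q2 : t * (Z + W) * n 1 - (W - Z) * n 2 + 6 * t * Z * W * N = -(2 * t * Z * W * H))
    (q3 : -(μ1 * (t * (Z + W) * j' 1 - (W - Z) * j' 2)) - 36 * t * Z * W * μ1 * j
      + 2 * t * Z * W * μ * j' 0 = t * T)
    (q4 : μ * e 0 = 2 * μ1)
    (q5 : t * (Z + W) * e 1 - (W - Z) * e 2 = -(12 * t * Z * W)) :
    (Matrix.of ![![0, k * (W - Z), k * (t * (Z + W))],
      fun b : Fin 3 => u * (-36 * (n (![0, 1, 2] b) - 1 / 2 * N * e (![0, 1, 2] b))),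
      fun b : Fin 3 => v * (1152 * (2 * μ * ![μ1, 0, 0] b * j + μ ^ 2 * j' (![0, 1, 2] b)
        - 5 / 2 * (μ ^ 2 * j) * e (![0, 1, 2] b)))]).det
      = k * (-36 * u) * (1152 * v) * (t * μ * H * T) := by
  rw [Matrix.det_fin_three]
  simp only [Matrix.of_apply, Matrix.cons_val_zero, Matrix.cons_val_one, Matrix.cons_val]
  have r1 : (n 0 - 1 / 2 * N * e 0) * μ = -(μ1 * H) := by linear_combination q1 - 1 / 2 * N * q4
  have r2 : t * (Z + W) * (n 1 - 1 / 2 * N * e 1) - (W - Z) * (n 2 - 1 / 2 * N * e 2)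
      = -(2 * t * Z * W * H) := by linear_combination q2 - 1 / 2 * N * q5
  have r3 : 2 * μ * μ1 * j + μ ^ 2 * j' 0 - 5 / 2 * (μ ^ 2 * j) * e 0
      = μ ^ 2 * j' 0 - 3 * μ * μ1 * j := by linear_combination -(5 / 2 * μ * j) * q4
  have r4 : t * (Z + W) * (μ ^ 2 * j' 1 - 5 / 2 * (μ ^ 2 * j) * e 1)
      - (W - Z) * (μ ^ 2 * j' 2 - 5 / 2 * (μ ^ 2 * j) * e 2)
      = μ ^ 2 * (t * (Z + W) * j' 1 - (W - Z) * j' 2 + 30 * t * Z * W * j) := by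
    linear_combination -(5 / 2 * (μ ^ 2 * j)) * q5
  have r5 : (n 0 - 1 / 2 * N * e 0)
        * (μ ^ 2 * (t * (Z + W) * j' 1 - (W - Z) * j' 2 + 30 * t * Z * W * j))
      + 2 * t * Z * W * H * (μ ^ 2 * j' 0 - 3 * μ * μ1 * j) = t * μ * H * T := by
    linear_combination
      (μ * (t * (Z + W) * j' 1 - (W - Z) * j' 2 + 30 * t * Z * W * j)) * r1 + μ * H * q3
  rw [← r5, ← r4, ← r3]
  linear_combination (-k * (-36 * u) * (1152 * v)
    * (2 * μ * μ1 * j + μ ^ 2 * j' 0 - 5 / 2 * (μ ^ 2 * j) * e 0)) * r2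

namespace KVPoint

variable {a : ℝ} {m : ℝ → ℝ} {p : Coord} (h : KVPoint a m p)
include h

theorem gradInner_eq {f f' : Coord → ℝ} (hf : pd 3 f p = 0) (hf' : pd 3 f' p = 0) :
    (gradInner (kvMetric a m) f f' p : ℂ)
      = gradForm (SmoothGerm.ev p h.ring.Z) (SmoothGerm.ev p h.ring.W) (SmoothGerm.ev p h.ring.τ)
        (SmoothGerm.ev p (h.ring.μ 0)) ![pd 0 f p, pd 1 f p, pd 2 f p]
        ![pd 0 f' p, pd 1 f' p, pd 2 f' p] := by
  have h2 : SmoothGerm.ev p (2 : SmoothGerm p) = 2 := map_ofNat _ 2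
  rw [gradInner]
  push_cast
  simp only [h.ginv_frame]
  simp only [Fin.sum_univ_four, hf, hf', Complex.ofReal_zero, mul_zero, zero_mul, add_zero]
  simp [frame, KVRing.E, wtC, opp, gradForm, KVRing.τ, h2]
  ring

/-- The constant is 36 · 36² · 1152². Its sign and first factor are (-6i)², the second factor comes
from |∇I₁'|² = -36N₀ and the third from J₄ = 1152 m² j. The powers 1/2 and 5/2 of |I₁| multiply to
|I₁|³, whose square is I₁⁶. -/
theorem kvWedge_eq {L : Coord → ℂ} (hm : ∀ᶠ x in 𝓝 (p 0), ContDiffAt ℝ ∞ m x)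
    (hL : ContinuousAt L p) (he : ∀ᶠ q in 𝓝 p, Complex.exp (L q) = kvPsi2 a m q)
    (hI : I1 (kvMetric a m) p ≠ 0) :
    (kvWedge a m L p : ℂ) = -61917364224 * SmoothGerm.ev p (h.ring.Z * h.ring.W
      * (h.ring.τ - 1 + h.ring.τ * h.ring.μ 0 * (h.ring.Z + h.ring.W))
      * (h.ring.t * h.ring.μ 0 * h.ring.H * h.ring.T) ^ 2) / (I1 (kvMetric a m) p : ℂ) ^ 6 := by
  obtain ⟨x, rx, x0, x1, x2, x3⟩ := h.rep_confI hm hL he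
  set K := h.ring with hK
  set k : ℂ := -6 * Complex.I with hk
  have hk2 : k ^ 2 = -36 := by rw [hk]; linear_combination 36 * Complex.I_sq
  have rN := h.rep_gradInner rx rx
  rw [← hK, K.grad_conf x0 x1 x2 x3] at rN
  have rI := h.rep_I1
  have rJ := h.rep_J4
  rw [← hK] at rI rJ
  rw [K.J₄_eq_j] at rJ
  set ev := SmoothGerm.ev p with hev
  have hIe : ev K.I₁ = (I1 (kvMetric a m) p : ℂ) := rI.ev_eq
  have hI' : ev K.I₁ ≠ 0 := by rw [hIe]; exact_mod_cast hI
  have hμ : ev (K.μ 0) ≠ 0 := by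
    intro h0
    apply hI'
    simp [KVRing.I₁, h0]
  have hevk : ∀ c : ℂ, ev (algebraMap ℂ _ c) = c := ev.commutes
  have dk : ∀ (i : Fin 4) (c : ℂ), SmoothGerm.der p i (algebraMap ℂ (SmoothGerm p) c) = 0 :=
    fun i c => Derivation.map_algebraMap _ c
  have h1152 : ∀ i : Fin 4, SmoothGerm.der p i (1152 : SmoothGerm p) = 0 :=
    fun i => (SmoothGerm.der p i).map_natCast 1152
  have e1152 : ev (1152 : SmoothGerm p) = 1152 := map_ofNat _ 1152
  -- the partial derivatives of the three invariants
  have p0 : ∀ i, (pd i (confI L) p : ℂ) = ev (SmoothGerm.der p i x) := fun i => ((rx.pd i).ev_eq).symm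
  have pN : ∀ i, (pd i (gradInner (kvMetric a m) (confI L) (confI L)) p : ℂ)
      = -36 * ev (SmoothGerm.der p i K.N₀) := by
    intro i
    rw [← (rN.pd i).ev_eq, Derivation.leibniz, ← map_pow, dk, smul_zero, add_zero, smul_eq_mul,
      map_mul, ← hev, hevk, hk2]
  have vN : (gradInner (kvMetric a m) (confI L) (confI L) p : ℂ) = -36 * ev K.N₀ := by
    rw [← rN.ev_eq, map_mul, map_pow, ← hev, hevk, hk2]
  have pJ : ∀ i, (pd i (J4 (kvMetric a m)) p : ℂ)
      = 1152 * (2 * ev (K.μ 0) * ev (SmoothGerm.der p i (K.μ 0)) * ev K.j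
        + ev (K.μ 0) ^ 2 * ev (SmoothGerm.der p i K.j)) := by
    intro i
    rw [← (rJ.pd i).ev_eq, Derivation.leibniz, h1152, Derivation.leibniz, Derivation.leibniz_pow,
      ← hev]
    simp [e1152]
    have : ev (2 : SmoothGerm p) = 2 := map_ofNat _ 2
    rw [this]
    ring
  have vJ : (J4 (kvMetric a m) p : ℂ) = 1152 * (ev (K.μ 0) ^ 2 * ev K.j) := by
    rw [← rJ.ev_eq, ← hev]; simp [e1152]
  have pI : ∀ i, (pd i (I1 (kvMetric a m)) p : ℂ) = ev (SmoothGerm.der p i K.I₁) :=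
    fun i => ((rI.pd i).ev_eq).symm
  set u : ℝ := (|I1 (kvMetric a m) p| ^ (1 / 2 : ℝ))⁻¹ with hu
  set v : ℝ := (|I1 (kvMetric a m) p| ^ (5 / 2 : ℝ))⁻¹ with hv
  have huv : ((u * v : ℝ) : ℂ) ^ 2 = 1 / ev K.I₁ ^ 6 := by
    have h1 : (u * v) ^ 2 = 1 / I1 (kvMetric a m) p ^ 6 := by
      rw [hu, hv, ← mul_inv, ← Real.rpow_add (abs_pos.2 hI)]
      norm_num
      rw [← pow_mul, show 3 * 2 = 2 * 3 from rfl, pow_mul, sq_abs, ← pow_mul]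
    rw [hIe]
    exact_mod_cast h1
  have pG : ∀ i, (pd i (confGradI (kvMetric a m) L) p : ℂ) = u * (-36 * (ev (SmoothGerm.der p i K.N₀)
      - 1 / 2 * ev K.N₀ * (ev (SmoothGerm.der p i K.I₁) / ev K.I₁))) := by
    intro i
    have := pd_div_rpow rN.sm rI.sm hI (1 / 2) i
    rw [show confGradI (kvMetric a m) L = fun q => gradInner (kvMetric a m) (confI L) (confI L) q
      / |I1 (kvMetric a m) q| ^ (1 / 2 : ℝ) from rfl, this, div_eq_mul_inv, ← hu]
    push_cast
    rw [pN, vN, pI, hIe]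
    ring
  have pC : ∀ i, (pd i (confJ (kvMetric a m)) p : ℂ) = v * (1152 * (2 * ev (K.μ 0)
      * ev (SmoothGerm.der p i (K.μ 0)) * ev K.j + ev (K.μ 0) ^ 2 * ev (SmoothGerm.der p i K.j)
      - 5 / 2 * (ev (K.μ 0) ^ 2 * ev K.j) * (ev (SmoothGerm.der p i K.I₁) / ev K.I₁))) := by
    intro i
    have := pd_div_rpow rJ.sm rI.sm hI (5 / 2) i
    rw [show confJ (kvMetric a m) = fun q => J4 (kvMetric a m) q
      / |I1 (kvMetric a m) q| ^ (5 / 2 : ℝ) from rfl, this, div_eq_mul_inv, ← hv]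
    push_cast
    rw [pJ, vJ, pI, hIe]
    ring
  have z0 : pd 3 (confI L) p = 0 := by
    have := p0 3
    rw [x3, map_zero] at this
    exact_mod_cast this
  have z1 : pd 3 (confGradI (kvMetric a m) L) p = 0 := by
    have := pG 3
    rw [K.D3N₀, K.D3I₁, map_zero, zero_div] at this
    exact_mod_cast (by rw [this]; ring : (pd 3 (confGradI (kvMetric a m) L) p : ℂ) = 0)
  have z2 : pd 3 (confJ (kvMetric a m)) p = 0 := by
    have := pC 3
    rw [K.D3j, K.D3I₁, K.D3μ, map_zero, zero_div] at this
    exact_mod_cast (by rw [this]; ring : (pd 3 (confJ (kvMetric a m)) p : ℂ) = 0)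
  -- the Gram determinant
  set F : Fin 3 → Coord → ℝ := ![confI L, confGradI (kvMetric a m) L, confJ (kvMetric a m)] with hF
  have hz : ∀ i, pd 3 (F i) p = 0 := by
    intro i; fin_cases i
    · exact z0
    · exact z1
    · exact z2
  have hG : (kvWedge a m L p : ℂ) = (Matrix.of fun i j => gradForm (ev K.Z) (ev K.W) (ev K.τ)
      (ev (K.μ 0)) (fun b => pd (![0, 1, 2] b) (F i) p) (fun b => pd (![0, 1, 2] b) (F j) p)).det := by
    have h1 := Complex.ofRealHom.map_det
      (Matrix.of fun i j : Fin 3 => gradInner (kvMetric a m) (F i) (F j) p)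
    refine Eq.trans h1 (congrArg Matrix.det ?_)
    ext i j
    refine (h.gradInner_eq (hz i) (hz j)).trans ?_
    simp only [gradForm, Matrix.of_apply, ← hev, ← hK]
    rfl
  rw [hG, gradForm_det]
  set n : Fin 4 → ℂ := fun i => ev (SmoothGerm.der p i K.N₀) with hn
  set e : Fin 4 → ℂ := fun i => ev (SmoothGerm.der p i K.I₁) / ev K.I₁ with he'
  set j' : Fin 4 → ℂ := fun i => ev (SmoothGerm.der p i K.j) with hj'
  have hdet : (Matrix.of fun i b => (pd (![0, 1, 2] b) (F i) p : ℂ)).det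
      = k * (-36 * u) * (1152 * v) * ev (K.t * K.μ 0 * K.H * K.T) := by
    have a0 : ev (SmoothGerm.der p 0 (K.μ 0)) = ev (K.μ 1) := by rw [K.D0μ]
    have a1 : ev (SmoothGerm.der p 1 (K.μ 0)) = 0 := by rw [K.D1μ, map_zero]
    have a2 : ev (SmoothGerm.der p 2 (K.μ 0)) = 0 := by rw [K.D2μ, map_zero]
    have e2 : ev (2 : SmoothGerm p) = 2 := map_ofNat _ 2
    have e6 : ev (6 : SmoothGerm p) = 6 := map_ofNat _ 6
    have e12 : ev (12 : SmoothGerm p) = 12 := map_ofNat _ 12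
    have e36 : ev (36 : SmoothGerm p) = 36 := map_ofNat _ 36
    have q1 := congrArg ev K.D0N₀
    have q2 := congrArg ev K.ξN₀
    have q3 := congrArg ev K.ξj
    have q4 := congrArg ev K.D0I₁
    have q5 := congrArg ev K.ξI₁
    simp only [K.ξ_apply, map_mul, map_sub, map_add, map_neg, e2, e6, e12, e36] at q1 q2 q3 q4 q5
    have q4' : ev (K.μ 0) * e 0 = 2 * ev (K.μ 1) := by
      simp only [he']
      field_simp
      linear_combination q4
    have q5' : ev K.t * (ev K.Z + ev K.W) * e 1 - (ev K.W - ev K.Z) * e 2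
        = -(12 * ev K.t * ev K.Z * ev K.W) := by
      simp only [he']
      field_simp
      linear_combination q5
    have b0 : ∀ b : Fin 4, (pd b (F 0) p : ℂ) = ev (SmoothGerm.der p b x) := p0
    have b1 : ∀ b : Fin 4, (pd b (F 1) p : ℂ) = u * (-36 * (n b - 1 / 2 * ev K.N₀ * e b)) := pG
    have b2 : ∀ b : Fin 4, (pd b (F 2) p : ℂ) = v * (1152 * (2 * ev (K.μ 0)
      * ev (SmoothGerm.der p b (K.μ 0)) * ev K.j + ev (K.μ 0) ^ 2 * j' b
      - 5 / 2 * (ev (K.μ 0) ^ 2 * ev K.j) * e b)) := pC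
    have hM : (Matrix.of fun i b => (pd (![0, 1, 2] b) (F i) p : ℂ))
        = Matrix.of ![![0, k * (ev K.W - ev K.Z), k * (ev K.t * (ev K.Z + ev K.W))],
          fun b : Fin 3 => u * (-36 * (n (![0, 1, 2] b) - 1 / 2 * ev K.N₀ * e (![0, 1, 2] b))),
          fun b : Fin 3 => v * (1152 * (2 * ev (K.μ 0) * ![ev (K.μ 1), 0, 0] b * ev K.j
            + ev (K.μ 0) ^ 2 * j' (![0, 1, 2] b)
            - 5 / 2 * (ev (K.μ 0) ^ 2 * ev K.j) * e (![0, 1, 2] b)))] := by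
      ext i b
      fin_cases i
      · refine (b0 _).trans ?_
        fin_cases b
        · exact (congrArg ev x0).trans (map_zero _)
        · exact (congrArg ev x1).trans (by simp only [map_mul, map_sub, hevk]; rfl)
        · exact (congrArg ev x2).trans (by simp only [map_mul, map_add, hevk]; rfl)
      · exact b1 _
      · refine (b2 _).trans ?_
        have : ev (SmoothGerm.der p (![0, 1, 2] b) (K.μ 0)) = ![ev (K.μ 1), 0, 0] b := by
          fin_cases b
          · exact a0
          · exact a1
          · exact a2
        rw [this]; rfl
    rw [hM]
    simp only [map_mul]
    change ev (K.μ 0) * n 0 - _ = _ at q1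
    change ev K.t * (ev K.Z + ev K.W) * n 1 - (ev K.W - ev K.Z) * n 2 + _ = _ at q2
    change -(_ * (ev K.t * (ev K.Z + ev K.W) * j' 1 - (ev K.W - ev K.Z) * j' 2)) - _ + _ * j' 0 = _
      at q3
    exact wedge_det q1 q2 q3 q4' q5'
  rw [hdet, mul_pow, mul_pow, mul_pow k, hk2, hIe.symm]
  have : (u : ℂ) ^ 2 * (v : ℂ) ^ 2 = 1 / ev K.I₁ ^ 6 := by rw [← huv]; push_cast; ring
  have e1 : ev (1 : SmoothGerm p) = 1 := map_one _
  simp only [map_mul, map_sub, map_add, map_pow, e1]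
  linear_combination (-36 * 36 ^ 2 * 1152 ^ 2 * (ev K.Z * ev K.W * (ev K.τ - 1
    + ev K.τ * ev (K.μ 0) * (ev K.Z + ev K.W)))
    * (ev K.t * ev (K.μ 0) * ev K.H * ev K.T) ^ 2) * this

end KVPoint

/-! ## Polynomials in the Kerr-Vaidya parameters -/

/-- The element `f` lies in the subring `S` after multiplication by `z ^ i * w ^ j`. -/
structure PoleLE {A : Type*} [CommRing A] (S : Subring A) (z w : A) (i j : ℕ) (f : A) : Prop where
  mem : f * z ^ i * w ^ j ∈ S

namespace PoleLE

variable {A : Type*} [CommRing A] {S : Subring A} {z w : A} {i j i' j' : ℕ} {f g : A}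

theorem of_mem (hf : f ∈ S) : PoleLE S z w 0 0 f := ⟨by simpa using hf⟩
theorem natLit (n : ℕ) [n.AtLeastTwo] : PoleLE S z w 0 0 (OfNat.ofNat n : A) :=
  of_mem (ofNat_mem S n)
theorem add (hf : PoleLE S z w i j f) (hg : PoleLE S z w i j g) : PoleLE S z w i j (f + g) :=
  ⟨by simpa only [add_mul] using S.add_mem hf.mem hg.mem⟩
theorem neg (hf : PoleLE S z w i j f) : PoleLE S z w i j (-f) :=
  ⟨by simpa only [neg_mul] using S.neg_mem hf.mem⟩
theorem sub (hf : PoleLE S z w i j f) (hg : PoleLE S z w i j g) : PoleLE S z w i j (f - g) :=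
  ⟨by simpa only [sub_mul] using S.sub_mem hf.mem hg.mem⟩
theorem mul (hf : PoleLE S z w i j f) (hg : PoleLE S z w i' j' g) :
    PoleLE S z w (i + i') (j + j') (f * g) :=
  ⟨by convert S.mul_mem hf.mem hg.mem using 1; ring⟩
theorem pow (hf : PoleLE S z w i j f) (n : ℕ) : PoleLE S z w (i * n) (j * n) (f ^ n) :=
  ⟨by convert S.pow_mem hf.mem n using 1; ring⟩
theorem mono (hz : z ∈ S) (hw : w ∈ S) (hf : PoleLE S z w i j f) (hi : i ≤ i') (hj : j ≤ j') :
    PoleLE S z w i' j' f := by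
  obtain ⟨k, rfl⟩ := Nat.exists_eq_add_of_le hi
  obtain ⟨l, rfl⟩ := Nat.exists_eq_add_of_le hj
  exact ⟨by
    convert S.mul_mem hf.mem (S.mul_mem (S.pow_mem hz k) (S.pow_mem hw l)) using 1; ring⟩

-- Pole orders add under multiplication, so the bound is found monomial by monomial; no monomial of
-- T exceeds order 15 in either variable, with τ contributing one pole in each.
set_option maxHeartbeats 4000000 in
theorem polyT (hz : z ∈ S) (hw : w ∈ S) {Z W τ m m1 m2 m3 : A} (hZ : PoleLE S z w 1 0 Z)
    (hW : PoleLE S z w 0 1 W) (hτ : PoleLE S z w 1 1 τ) (hm : m ∈ S) (hm1 : m1 ∈ S)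
    (hm2 : m2 ∈ S) (hm3 : m3 ∈ S) : PoleLE S z w 15 15 (polyT Z W τ m m1 m2 m3) := by
  replace hm := of_mem (z := z) (w := w) hm
  replace hm1 := of_mem (z := z) (w := w) hm1
  replace hm2 := of_mem (z := z) (w := w) hm2
  replace hm3 := of_mem (z := z) (w := w) hm3
  unfold KerrVaidya.polyT
  repeat' first
    | with_reducible refine add ?_ ?_
    | with_reducible refine sub ?_ ?_
    | with_reducible refine neg ?_
  all_goals
    apply mono hz hw
    · repeat' first
        | with_reducible assumption
        | with_reducible exact natLit _
        | with_reducible apply mul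
        | with_reducible apply pow
    · decide
    · decide

end PoleLE

/-- The function `r + i a cos θ` of the parameters `a, r, cos θ, m, m', m'', m'''`. -/
def zP (y : Fin 7 → ℝ) : ℂ := y 1 + Complex.I * y 0 * y 2
/-- The function `r - i a cos θ` of the parameters. -/
def wP (y : Fin 7 → ℝ) : ℂ := y 1 - Complex.I * y 0 * y 2
/-- The function `-a² sin² θ / R²` of the parameters. -/
def τP (y : Fin 7 → ℝ) : ℂ := -(y 0 ^ 2 * (1 - y 2 ^ 2)) * (zP y)⁻¹ * (wP y)⁻¹
/-- The factor `T` as a function of the parameters. -/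
def TP (y : Fin 7 → ℝ) : ℂ := polyT (zP y)⁻¹ (wP y)⁻¹ (τP y) (y 3) (y 4) (y 5) (y 6)
/-- The factor `τ - 1 + τ m (Z + W)` as a function of the parameters. -/
def VP (y : Fin 7 → ℝ) : ℂ := τP y - 1 + τP y * y 3 * ((zP y)⁻¹ + (wP y)⁻¹)

/-- Parameter values off the ring singularity. -/
abbrev Params : Type := {y : Fin 7 → ℝ // zP y ≠ 0 ∧ wP y ≠ 0}

/-- Evaluation of complex polynomials as functions of the parameters. -/
def evalParams : MvPolynomial (Fin 7) ℂ →+* (Params → ℂ) :=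
  RingHom.pi fun y => MvPolynomial.eval fun k => (y.1 k : ℂ)

theorem evalParams_apply (P : MvPolynomial (Fin 7) ℂ) (y : Params) :
    evalParams P y = MvPolynomial.eval (fun k => (y.1 k : ℂ)) P := rfl

theorem mem_var (k : Fin 7) : (fun y : Params => (y.1 k : ℂ)) ∈ evalParams.range :=
  ⟨.X k, by ext y; simp [evalParams_apply]⟩

theorem mem_z : (fun y : Params => zP y.1) ∈ evalParams.range :=
  ⟨.X 1 + .C Complex.I * .X 0 * .X 2, by ext y; simp [evalParams_apply, zP]⟩

theorem mem_w : (fun y : Params => wP y.1) ∈ evalParams.range :=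
  ⟨.X 1 - .C Complex.I * .X 0 * .X 2, by ext y; simp [evalParams_apply, wP]⟩

/-- Multiplication by powers of `zP` and `wP` turns the function into a polynomial. -/
abbrev PoleP (i j : ℕ) (f : Params → ℂ) : Prop :=
  PoleLE evalParams.range (fun y : Params => zP y.1) (fun y => wP y.1) i j f

theorem PoleP.inv_z : PoleP 1 0 (fun y => (zP y.1)⁻¹) :=
  ⟨1, by ext y; simp [evalParams_apply, y.2.1]⟩

theorem PoleP.inv_w : PoleP 0 1 (fun y => (wP y.1)⁻¹) :=
  ⟨1, by ext y; simp [evalParams_apply, y.2.2]⟩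

theorem PoleP.tau : PoleP 1 1 (fun y => τP y.1) :=
  ⟨-(.X 0 ^ 2 * (1 - .X 2 ^ 2)), by
    ext y
    have h1 := y.2.1
    have h2 := y.2.2
    simp only [evalParams_apply, map_neg, map_mul, map_pow, map_sub, map_one,
      MvPolynomial.eval_X, τP, Pi.mul_apply, Pi.pow_apply]
    field_simp⟩

theorem PoleP.T : PoleP 15 15 (fun y => TP y.1) := by
  have h := PoleLE.polyT mem_z mem_w PoleP.inv_z PoleP.inv_w PoleP.tau
    (mem_var 3) (mem_var 4) (mem_var 5) (mem_var 6)
  convert h using 1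
  ext y
  simp [TP, polyT]

theorem PoleP.V : PoleP 2 2 (fun y => VP y.1) := by
  have h1 : PoleP 2 2 (1 : Params → ℂ) :=
    (PoleLE.of_mem (Subring.one_mem _)).mono mem_z mem_w (by norm_num) (by norm_num)
  have hs : PoleP 1 1 (fun y => (zP y.1)⁻¹ + (wP y.1)⁻¹) :=
    (PoleP.inv_z.mono mem_z mem_w le_rfl (by norm_num)).add
      (PoleP.inv_w.mono mem_z mem_w (by norm_num) le_rfl)
  exact ((PoleP.tau.mono mem_z mem_w (by norm_num) (by norm_num)).sub h1).add
    ((PoleP.tau.mul (PoleLE.of_mem (mem_var 3))).mul hs)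

/-- The polynomial part of the squared wedge. -/
theorem exists_wedge_poly : ∃ P : MvPolynomial (Fin 7) ℂ, ∀ y, zP y ≠ 0 → wP y ≠ 0 →
    61917364224 * 16 * y 0 ^ 3 * (1 - y 2 ^ 2) * y 3 * VP y * TP y ^ 2
      * ((zP y)⁻¹ * (wP y)⁻¹) ^ 5 * (zP y * wP y) ^ 37
      = MvPolynomial.eval (fun k => (y k : ℂ)) P := by
  -- The exponent 37 of R² is 2 for V, 2 · 15 for T² and 5 for the explicit power of ZW.
  obtain ⟨P, hP⟩ := ((PoleP.V.mul (PoleP.T.pow 2)).mul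
    (((PoleP.inv_z.pow 5).mul (PoleP.inv_w.pow 5)))).mem
  refine ⟨.C (61917364224 * 16) * .X 0 ^ 3 * (1 - .X 2 ^ 2) * .X 3 * P, fun y h1 h2 => ?_⟩
  have h := congrFun hP ⟨y, h1, h2⟩
  simp only [map_mul, map_pow, map_sub, map_one, MvPolynomial.eval_X, MvPolynomial.eval_C]
  rw [← evalParams_apply P ⟨y, h1, h2⟩, h]
  simp only [Pi.mul_apply, Pi.pow_apply]
  ring

/-- The factorisation through z and w has complex coefficients although the wedge is real. Real and
imaginary parts are built together, because multiplication mixes them; by a real variable it does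
not, but both are needed to state the induction. -/
theorem exists_re_poly {σ : Type*} (P : MvPolynomial σ ℂ) : ∃ F : MvPolynomial σ ℝ,
    ∀ y : σ → ℝ, MvPolynomial.eval y F = (MvPolynomial.eval (fun k => (y k : ℂ)) P).re := by
  have : ∃ F G : MvPolynomial σ ℝ, ∀ y : σ → ℝ,
      MvPolynomial.eval y F = (MvPolynomial.eval (fun k => (y k : ℂ)) P).re ∧
      MvPolynomial.eval y G = (MvPolynomial.eval (fun k => (y k : ℂ)) P).im := by
    induction P using MvPolynomial.induction_on with
    | C c => exact ⟨.C c.re, .C c.im, fun y => by simp⟩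
    | add p q hp hq =>
      obtain ⟨F, G, h⟩ := hp
      obtain ⟨F', G', h'⟩ := hq
      exact ⟨F + F', G + G', fun y => by simp [h, h']⟩
    | mul_X p k hp =>
      obtain ⟨F, G, h⟩ := hp
      exact ⟨F * .X k, G * .X k, fun y => by simp [h]⟩
  obtain ⟨F, _, h⟩ := this
  exact ⟨F, fun y => (h y).1⟩

/-! ## The squared wedge of the conformal invariants -/

theorem map_polyT {A B : Type*} [CommRing A] [CommRing B] (f : A →+* B) (Z W τ m m1 m2 m3 : A) :
    f (polyT Z W τ m m1 m2 m3) = polyT (f Z) (f W) (f τ) (f m) (f m1) (f m2) (f m3) := by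
  simp only [polyT, map_add, map_sub, map_neg, map_mul, map_pow, map_ofNat]

/-- The parameters `a, r, cos θ, m, m', m'', m'''` at a point. -/
def prm (a : ℝ) (m : ℝ → ℝ) (p : Coord) : Fin 7 → ℝ :=
  ![a, p 1, Real.cos (p 2), m (p 0), deriv m (p 0), iteratedDeriv 2 m (p 0),
    iteratedDeriv 3 m (p 0)]

theorem zP_prm (a : ℝ) (m : ℝ → ℝ) (p : Coord) : zP (prm a m p) = zF a p := rfl
theorem wP_prm (a : ℝ) (m : ℝ → ℝ) (p : Coord) : wP (prm a m p) = wF a p := rfl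

namespace KVPoint

variable {a : ℝ} {m : ℝ → ℝ} {p : Coord} (h : KVPoint a m p)
include h

theorem ev_τ : SmoothGerm.ev p h.ring.τ = τP (prm a m p) := by
  have hs : ((Real.sin (p 2) : ℝ) : ℂ) ^ 2 = 1 - ((Real.cos (p 2) : ℝ) : ℂ) ^ 2 := by
    rw [← Complex.ofReal_pow, Real.sin_sq]; push_cast; rfl
  simp only [KVRing.τ, map_mul, map_pow, h.ev_Z, h.ev_W, h.ev_t, τP, zP_prm, wP_prm]
  simp only [prm, Matrix.cons_val]
  linear_combination (Complex.I ^ 2 * a ^ 2 * (zF a p)⁻¹ * (wF a p)⁻¹) * hs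
    + (a ^ 2 * (1 - ((Real.cos (p 2) : ℝ) : ℂ) ^ 2) * (zF a p)⁻¹ * (wF a p)⁻¹) * Complex.I_sq

theorem ev_T : SmoothGerm.ev p h.ring.T = TP (prm a m p) := by
  rw [KVRing.T, ← RingHom.coe_coe, map_polyT]
  simp only [RingHom.coe_coe, h.ev_Z, h.ev_W, h.ev_μ, h.ev_τ, TP, zP_prm, wP_prm,
    iteratedDeriv_zero, iteratedDeriv_one]
  rfl

theorem ev_H : SmoothGerm.ev p h.ring.H = -4 * a ^ 2 * ((zF a p)⁻¹ * (wF a p)⁻¹) ^ 2 := by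
  have h1 := mul_inv_cancel₀ h.z_ne
  have h2 := mul_inv_cancel₀ h.w_ne
  have h3 : (zF a p)⁻¹ - (wF a p)⁻¹ = (wF a p - zF a p) * ((zF a p)⁻¹ * (wF a p)⁻¹) := by
    linear_combination (wF a p)⁻¹ * h1 - (zF a p)⁻¹ * h2
  simp only [KVRing.H, map_add, map_mul, map_sub, map_pow, map_ofNat, h.ev_Z, h.ev_W, h.ev_τ, h3]
  simp only [τP, zP_prm, wP_prm]
  simp only [prm, Matrix.cons_val, zF, wF, idF, cosF]
  linear_combination (4 * a ^ 2 * ((Real.cos (p 2) : ℝ) : ℂ) ^ 2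
    * ((p 1 + Complex.I * a * (Real.cos (p 2) : ℝ))⁻¹
    * (p 1 - Complex.I * a * (Real.cos (p 2) : ℝ))⁻¹) ^ 2) * Complex.I_sq

/-- The squared wedge in terms of the parameters. -/
theorem kvWedge_eq_prm {L : Coord → ℂ} (hm : ∀ᶠ x in 𝓝 (p 0), ContDiffAt ℝ ∞ m x)
    (hL : ContinuousAt L p) (he : ∀ᶠ q in 𝓝 p, Complex.exp (L q) = kvPsi2 a m q)
    (hI : I1 (kvMetric a m) p ≠ 0) :
    (kvWedge a m L p : ℂ) * (I1 (kvMetric a m) p : ℂ) ^ 6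
      = 61917364224 * 16 * a ^ 6 * Real.sin (p 2) ^ 2 * m (p 0) ^ 2 * VP (prm a m p)
        * TP (prm a m p) ^ 2 * ((zF a p)⁻¹ * (wF a p)⁻¹) ^ 5 := by
  have hI' : (I1 (kvMetric a m) p : ℂ) ^ 6 ≠ 0 := pow_ne_zero _ (Complex.ofReal_ne_zero.2 hI)
  have hV : SmoothGerm.ev p (h.ring.τ - 1 + h.ring.τ * h.ring.μ 0 * (h.ring.Z + h.ring.W))
      = VP (prm a m p) := by
    simp only [map_add, map_sub, map_mul, map_one, h.ev_Z, h.ev_W, h.ev_μ, h.ev_τ, VP,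
      iteratedDeriv_zero]
    rfl
  rw [h.kvWedge_eq hm hL he hI, div_mul_cancel₀ _ hI', map_mul, map_mul, hV, map_mul, map_pow,
    map_mul, map_mul, map_mul, h.ev_Z, h.ev_W, h.ev_t, h.ev_H, h.ev_T, h.ev_μ, iteratedDeriv_zero]
  linear_combination (-61917364224 * 16 * a ^ 6 * Real.sin (p 2) ^ 2 * m (p 0) ^ 2
    * VP (prm a m p) * TP (prm a m p) ^ 2 * ((zF a p)⁻¹ * (wF a p)⁻¹) ^ 5) * Complex.I_sq

end KVPoint

theorem logBranch_eventually {a : ℝ} {m : ℝ → ℝ} {U : Set Coord} {L : Coord → ℂ} (hU : IsOpen U)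
    (hL : IsLogBranch a m U L) {p : Coord} (hp : p ∈ U) :
    ContinuousAt L p ∧ ∀ᶠ q in 𝓝 p, Complex.exp (L q) = kvPsi2 a m q :=
  ⟨hL.1.continuousAt (hU.mem_nhds hp), by filter_upwards [hU.mem_nhds hp] with q hq using hL.2 q hq⟩

theorem eventually_contDiffAt {J : Set ℝ} {m : ℝ → ℝ} (hJ : IsOpen J) (hm : ContDiffOn ℝ ∞ m J)
    {x : ℝ} (hx : x ∈ J) : ∀ᶠ y in 𝓝 x, ContDiffAt ℝ ∞ m y := by
  filter_upwards [hJ.mem_nhds hx] with y hy using hm.contDiffAt (hJ.mem_nhds hy)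

/-- The computation yields a⁶m²; one factor a³m is displayed and the other is absorbed in the
polynomial, as is sin²θ = 1 - cos²θ. -/
theorem kvWedge_formula : ∃ F : MvPolynomial (Fin 7) ℝ,
    ∀ (a : ℝ) (J : Set ℝ) (m : ℝ → ℝ), IsOpen J → ContDiffOn ℝ ∞ m J →
    ∀ (U : Set Coord) (L : Coord → ℂ), IsOpen U → U ⊆ kvDomain a J →
      (∀ p ∈ U, I1 (kvMetric a m) p ≠ 0) → IsLogBranch a m U L →
      ∀ p ∈ U, kvWedge a m L p = a ^ 3 * m (p 0) * (MvPolynomial.eval (prm a m p) F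
        / (Rsq a p ^ 37 * I1 (kvMetric a m) p ^ 6)) := by
  obtain ⟨P, hP⟩ := exists_wedge_poly
  obtain ⟨F, hF⟩ := exists_re_poly P
  refine ⟨F, fun a J m hJ hm U L hU hUJ hI hL p hp => ?_⟩
  have h := KVPoint.of_mem hJ hm (hUJ hp)
  obtain ⟨hL1, hL2⟩ := logBranch_eventually hU hL hp
  have hw := h.kvWedge_eq_prm (eventually_contDiffAt hJ hm (hUJ hp).1) hL1 hL2 (hI p hp)
  have hP' := hP (prm a m p) h.z_ne h.w_ne
  have hs : ((Real.sin (p 2) : ℝ) : ℂ) ^ 2 = 1 - ((Real.cos (p 2) : ℝ) : ℂ) ^ 2 := by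
    rw [← Complex.ofReal_pow, Real.sin_sq]; push_cast; rfl
  have hE : ((kvWedge a m L p * (Rsq a p ^ 37 * I1 (kvMetric a m) p ^ 6) : ℝ) : ℂ)
      = ((a ^ 3 * m (p 0) : ℝ) : ℂ) * MvPolynomial.eval (fun k => (prm a m p k : ℂ)) P := by
    rw [← hP', zP_prm, wP_prm, zF_mul_wF]
    push_cast
    rw [mul_left_comm, hw, hs]
    simp only [prm, Matrix.cons_val]
    ring
  have hE' := congrArg Complex.re hE
  rw [Complex.ofReal_re, Complex.re_ofReal_mul, ← hF] at hE'
  have h0 : Rsq a p ^ 37 * I1 (kvMetric a m) p ^ 6 ≠ 0 :=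
    mul_ne_zero (pow_ne_zero _ h.Rsq_ne) (pow_ne_zero _ (hI p hp))
  rw [← mul_div_assoc, eq_div_iff h0, hE']

/-! ## Vanishing of the squared wedge -/

/-- On the equator Z = W = 1/r, and only three powers of 1/r survive. The two odd ones, 15 and 17,
carry different combinations of m m'' and m'², which is what the vanishing argument exploits. -/
theorem TP_equator (a r m m1 m2 m3 : ℝ) : TP ![a, r, 0, m, m1, m2, m3]
    = (192 * m * m1 ^ 2 - 48 * m ^ 2 * m2) * (r : ℂ)⁻¹ ^ 15
      + (a ^ 2 * (-120 * m * m1 * m2 + 24 * m ^ 2 * m3 + 96 * m1 ^ 3) - 48 * m ^ 2 * m1)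
        * (r : ℂ)⁻¹ ^ 16
      + a ^ 2 * (128 * m * m1 ^ 2 - 64 * m ^ 2 * m2) * (r : ℂ)⁻¹ ^ 17 := by
  simp only [TP, zP, wP, τP, polyT, Matrix.cons_val, Complex.ofReal_zero, mul_zero, add_zero,
    sub_zero]
  ring

theorem TP_of_const (y : Fin 7 → ℝ) (h1 : y 4 = 0) (h2 : y 5 = 0) (h3 : y 6 = 0) : TP y = 0 := by
  simp [TP, h1, h2, h3, polyT]

/-- At a fixed v the values of m and its derivatives are constants. Clearing denominators leaves a
polynomial in r and cos θ, which can be evaluated off the given open set, in particular on the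
equator. -/
theorem exists_pole_poly {i j : ℕ} {f : (Fin 7 → ℝ) → ℂ} (hf : PoleP i j fun y => f y.1)
    (a m m1 m2 m3 : ℝ) : ∃ Q : MvPolynomial (Fin 2) ℂ, ∀ r x : ℝ,
      zP ![a, r, x, m, m1, m2, m3] ≠ 0 → wP ![a, r, x, m, m1, m2, m3] ≠ 0 →
      MvPolynomial.eval ![(r : ℂ), (x : ℂ)] Q = f ![a, r, x, m, m1, m2, m3]
        * zP ![a, r, x, m, m1, m2, m3] ^ i * wP ![a, r, x, m, m1, m2, m3] ^ j := by
  obtain ⟨P, hP⟩ := hf.mem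
  refine ⟨MvPolynomial.aeval ![.C (a : ℂ), .X 0, .X 1, .C (m : ℂ), .C (m1 : ℂ), .C (m2 : ℂ),
    .C (m3 : ℂ)] P, fun r x h1 h2 => ?_⟩
  have h := congrFun hP ⟨_, h1, h2⟩
  rw [evalParams_apply] at h
  simp only [Pi.mul_apply, Pi.pow_apply] at h
  rw [← h]
  clear hP h
  induction P using MvPolynomial.induction_on with
  | C c => simp
  | add P Q hP hQ => simp only [map_add, hP, hQ]
  | mul_X P k hP =>
    simp only [map_mul, hP, MvPolynomial.aeval_X, MvPolynomial.eval_X]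
    congr 1
    fin_cases k <;> simp

/-- If the product of the two factors vanishes on a box, then the mass function is stationary. -/
theorem deriv_eq_zero_of_box {a m m1 m2 m3 : ℝ} (ha : a ≠ 0) (hm : m ≠ 0) {A B : Set ℝ}
    (hA : A.Infinite) (hB : B.Infinite)
    (hAB : ∀ r ∈ A, ∀ x ∈ B, zP ![a, r, x, m, m1, m2, m3] ≠ 0 ∧ wP ![a, r, x, m, m1, m2, m3] ≠ 0 ∧
      VP ![a, r, x, m, m1, m2, m3] * TP ![a, r, x, m, m1, m2, m3] = 0) : m1 = 0 := by
  obtain ⟨QT, hT⟩ := exists_pole_poly PoleP.T a m m1 m2 m3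
  obtain ⟨QV, hV⟩ := exists_pole_poly PoleP.V a m m1 m2 m3
  -- A polynomial vanishing on a product of infinite sets is zero; the polynomial ring is a domain,
  -- so one of the two factors is zero.
  have hprod : QV * QT = 0 := by
    refine MvPolynomial.funext_set ![Complex.ofReal '' A, Complex.ofReal '' B] (fun i => ?_)
      fun y hy => ?_
    · fin_cases i
      · exact hA.image Complex.ofReal_injective.injOn
      · exact hB.image Complex.ofReal_injective.injOn
    · obtain ⟨r, hr, hr'⟩ := hy 0 trivial
      obtain ⟨x, hx, hx'⟩ := hy 1 trivial
      have hy' : y = ![(r : ℂ), (x : ℂ)] := by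
        ext i; fin_cases i
        · exact hr'.symm
        · exact hx'.symm
      obtain ⟨h1, h2, h3⟩ := hAB r hr x hx
      rw [hy', map_mul, hV r x h1 h2, hT r x h1 h2, map_zero]
      linear_combination (zP ![a, r, x, m, m1, m2, m3] ^ 17
        * wP ![a, r, x, m, m1, m2, m3] ^ 17) * h3
  have hz : ∀ r : ℝ, zP ![a, r, 0, m, m1, m2, m3] = r := fun r => by simp [zP]
  have hw : ∀ r : ℝ, wP ![a, r, 0, m, m1, m2, m3] = r := fun r => by simp [wP]
  -- On the equator V = -1 - a²/r² - 2a²m/r³. Adding the values at r = 1 and r = -1 removes the term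
  -- with m and leaves -2a² - 2, which is negative.
  have hQV : QV ≠ 0 := by
    rintro rfl
    have e : ∀ r : ℝ, r ≠ 0 → VP ![a, r, 0, m, m1, m2, m3] = 0 := fun r hr => by
      have hr' : (r : ℂ) ≠ 0 := Complex.ofReal_ne_zero.2 hr
      have := hV r 0 (by rwa [hz]) (by rwa [hw])
      rw [hz, hw, map_zero] at this
      simpa [hr'] using this.symm
    have e1 := e 1 one_ne_zero
    have e2 := e (-1) (by norm_num)
    simp only [VP, τP, hz, hw, Matrix.cons_val] at e1 e2
    have e3 : ((-2 * a ^ 2 - 2 : ℝ) : ℂ) = 0 := by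
      push_cast at e1 e2 ⊢
      norm_num at e1 e2
      linear_combination e1 + e2
    have e4 : -2 * a ^ 2 - 2 = 0 := by exact_mod_cast e3
    nlinarith [sq_nonneg a]
  have hQT : QT = 0 := (mul_eq_zero.1 hprod).resolve_left hQV
  subst hQT
  have e : ∀ r : ℝ, r ≠ 0 → TP ![a, r, 0, m, m1, m2, m3] = 0 := fun r hr => by
    have hr' : (r : ℂ) ≠ 0 := Complex.ofReal_ne_zero.2 hr
    have := hT r 0 (by rwa [hz]) (by rwa [hw])
    rw [hz, hw, map_zero] at this
    simpa [hr'] using this.symm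
  have e1 := e 1 one_ne_zero
  have e2 := e (-1) (by norm_num)
  have e3 := e 2 two_ne_zero
  have e4 := e (-2) (by norm_num)
  rw [TP_equator] at e1 e2 e3 e4
  push_cast at e1 e2 e3 e4
  norm_num at e1 e2 e3 e4
  -- The differences of T at r and -r retain only the powers 15 and 17 of 1/r. The two radii 1 and 2
  -- determine both coefficients, and m ≠ 0, a ≠ 0 reduce them to m m'' = 4m'² and m m'' = 2m'².
  have hA0 : (m : ℂ) * (192 * m1 ^ 2 - 48 * m * m2) = 0 := by
    linear_combination -(1 / 6) * (e1 - e2) + (1 / 6) * 2 ^ 17 * (e3 - e4)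
  have hC0 : (a : ℂ) ^ 2 * m * (128 * m1 ^ 2 - 64 * m * m2) = 0 := by
    linear_combination (1 / 2) * (e1 - e2) - hA0
  have ha' : (a : ℂ) ≠ 0 := Complex.ofReal_ne_zero.2 ha
  have hm' : (m : ℂ) ≠ 0 := Complex.ofReal_ne_zero.2 hm
  have hA1 := (mul_eq_zero.1 hA0).resolve_left hm'
  have hC1 := (mul_eq_zero.1 hC0).resolve_left (mul_ne_zero (pow_ne_zero 2 ha') hm')
  have : (m1 : ℂ) ^ 2 = 0 := by linear_combination (1 / 96) * hA1 - (1 / 128) * hC1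
  exact_mod_cast pow_eq_zero_iff two_ne_zero |>.1 this

theorem mass_ne_zero {a : ℝ} {m : ℝ → ℝ} {p : Coord} (h : KVPoint a m p)
    (hI : I1 (kvMetric a m) p ≠ 0) : m (p 0) ≠ 0 := fun h0 => hI (by
  have := h.I1_eq
  rw [h0] at this
  simpa using this)

theorem kvWedge_eq_zero_iff {a : ℝ} {J : Set ℝ} {m : ℝ → ℝ} (hJ : IsOpen J)
    (hm : ContDiffOn ℝ ∞ m J) {U : Set Coord} {L : Coord → ℂ} (hU : IsOpen U)
    (hUc : IsPreconnected U) (hUJ : U ⊆ kvDomain a J)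
    (hI : ∀ p ∈ U, I1 (kvMetric a m) p ≠ 0) (hL : IsLogBranch a m U L) :
    (∀ p ∈ U, kvWedge a m L p = 0) ↔ ((∃ c : ℝ, ∀ p ∈ U, m (p 0) = c) ∨ a = 0) := by
  have key : ∀ p ∈ U, (kvWedge a m L p : ℂ) * (I1 (kvMetric a m) p : ℂ) ^ 6
      = 61917364224 * 16 * a ^ 6 * Real.sin (p 2) ^ 2 * m (p 0) ^ 2 * VP (prm a m p)
        * TP (prm a m p) ^ 2 * ((zF a p)⁻¹ * (wF a p)⁻¹) ^ 5 := fun p hp => by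
    obtain ⟨hL1, hL2⟩ := logBranch_eventually hU hL hp
    exact (KVPoint.of_mem hJ hm (hUJ hp)).kvWedge_eq_prm
      (eventually_contDiffAt hJ hm (hUJ hp).1) hL1 hL2 (hI p hp)
  constructor
  · intro h0
    by_cases ha : a = 0
    · exact Or.inr ha
    refine Or.inl ?_
    have hVT : ∀ p ∈ U, VP (prm a m p) * TP (prm a m p) = 0 := fun p hp => by
      have h := KVPoint.of_mem hJ hm (hUJ hp)
      have hk := key p hp
      have hs : (Real.sin (p 2) : ℂ) ≠ 0 := Complex.ofReal_ne_zero.2 h.sin_pos.ne'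
      have hm0 : (m (p 0) : ℂ) ≠ 0 := Complex.ofReal_ne_zero.2 (mass_ne_zero h (hI p hp))
      have ha' : (a : ℂ) ≠ 0 := Complex.ofReal_ne_zero.2 ha
      rw [h0 p hp, Complex.ofReal_zero, zero_mul] at hk
      have := hk.symm
      simpa [ha', hs, hm0, h.z_ne, h.w_ne, -Complex.ofReal_sin] using this
    have hd : ∀ p ∈ U, deriv m (p 0) = 0 := fun p hp => by
      have h := KVPoint.of_mem hJ hm (hUJ hp)
      -- Around each point r and θ vary in a small box while v and φ are held fixed. Cosine is
      -- injective on (0,π), so cos θ takes infinitely many values.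
      obtain ⟨ε, hε, hball⟩ := Metric.isOpen_iff.1 hU p hp
      have hq : ∀ r ∈ Metric.ball (p 1) ε, ∀ θ ∈ Metric.ball (p 2) ε,
          ![p 0, r, θ, p 3] ∈ U := fun r hr θ hθ => hball (by
        rw [Metric.mem_ball, dist_pi_lt_iff hε]
        intro i
        fin_cases i
        · simpa using hε
        · exact hr
        · exact hθ
        · simpa using hε)
      have hpi : p 2 ∈ Set.Ioo 0 Real.pi := ⟨(hUJ hp).2.1, (hUJ hp).2.2.1⟩
      refine deriv_eq_zero_of_box (m2 := iteratedDeriv 2 m (p 0)) (m3 := iteratedDeriv 3 m (p 0))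
        (A := Metric.ball (p 1) ε)
        (B := Real.cos '' (Metric.ball (p 2) ε ∩ Set.Ioo 0 Real.pi))
        ha (mass_ne_zero h (hI p hp)) ?_ ?_ ?_
      · exact infinite_of_mem_nhds (p 1) (Metric.ball_mem_nhds _ hε)
      · refine Set.Infinite.image (Real.injOn_cos.mono fun x hx =>
          Set.Ioo_subset_Icc_self hx.2) ?_
        exact infinite_of_mem_nhds (p 2) (inter_mem (Metric.ball_mem_nhds _ hε)
          (isOpen_Ioo.mem_nhds hpi))
      · rintro r hr _ ⟨θ, ⟨hθ, -⟩, rfl⟩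
        have hqU := hq r hr θ hθ
        have h' := KVPoint.of_mem hJ hm (hUJ hqU)
        have e : prm a m ![p 0, r, θ, p 3] = ![a, r, Real.cos θ, m (p 0), deriv m (p 0),
            iteratedDeriv 2 m (p 0), iteratedDeriv 3 m (p 0)] := rfl
        rw [← e]
        exact ⟨h'.z_ne, h'.w_ne, hVT _ hqU⟩
    have hdiff : ∀ p ∈ U, HasFDerivAt (fun q : Coord => m (q 0)) (0 : Coord →L[ℝ] ℝ) p :=
        fun p hp => by
      have h := KVPoint.of_mem hJ hm (hUJ hp)
      have h1 : HasDerivAt m 0 (p 0) := by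
        rw [← hd p hp]; exact (h.smooth.differentiableAt (by simp)).hasDerivAt
      have h2 := h1.comp_hasFDerivAt p
        ((ContinuousLinearMap.proj (R := ℝ) (φ := fun _ : Fin 4 => ℝ) 0).hasFDerivAt)
      rwa [zero_smul] at h2
    rcases U.eq_empty_or_nonempty with rfl | ⟨p₀, hp₀⟩
    · exact ⟨0, by simp⟩
    · refine ⟨m (p₀ 0), fun p hp => ?_⟩
      exact hU.is_const_of_fderiv_eq_zero hUc
        (fun q hq => (hdiff q hq).differentiableAt.differentiableWithinAt)
        (fun q hq => (hdiff q hq).fderiv) hp hp₀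
  · intro hc p hp
    have h := KVPoint.of_mem hJ hm (hUJ hp)
    have hI' : (I1 (kvMetric a m) p : ℂ) ^ 6 ≠ 0 :=
      pow_ne_zero _ (Complex.ofReal_ne_zero.2 (hI p hp))
    suffices hz : (kvWedge a m L p : ℂ) * (I1 (kvMetric a m) p : ℂ) ^ 6 = 0 from
      Complex.ofReal_eq_zero.1 ((mul_eq_zero.1 hz).resolve_right hI')
    rw [key p hp]
    rcases hc with ⟨c, hc⟩ | rfl
    -- The projection of U to the v-axis is open, so m is constant near v and all the derivatives
    -- entering T vanish.
    · have hev : m =ᶠ[𝓝 (p 0)] fun _ => c := by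
        have h1 := (isOpenMap_eval 0).image_mem_nhds (hU.mem_nhds hp)
        filter_upwards [h1]
        rintro _ ⟨q, hq, rfl⟩
        exact hc q hq
      have hz : ∀ k, 0 < k → iteratedDeriv k m (p 0) = 0 := fun k hk => by
        rw [hev.iteratedDeriv_eq, iteratedDeriv_const]; simp [hk.ne']
      have h1 := hz 1 one_pos
      rw [iteratedDeriv_one] at h1
      rw [TP_of_const _ h1 (hz 2 (by norm_num)) (hz 3 (by norm_num))]
      ring
    · simp

/-! ## Conformal Killing fields over a differential ring -/

section conformalKilling

variable {A : Type*} [CommRing A] [Algebra ℂ A] {D : Fin 4 → Derivation ℂ A A}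
  {g gi : Fin 4 → Fin 4 → A} {Γ : Fin 4 → Fin 4 → Fin 4 → A} {K : Fin 4 → A} {lam : A}

/-- The derivation along a vector field. -/
def vecD (D : Fin 4 → Derivation ℂ A A) (K : Fin 4 → A) : Derivation ℂ A A := ∑ c, K c • D c

theorem vecD_apply (f : A) : vecD D K f = ∑ c, K c * D c f := by
  simp [vecD, Fin.sum_univ_four]

theorem der_vecD (hc : ∀ i j f, D i (D j f) = D j (D i f)) (i : Fin 4) (f : A) :
    D i (vecD D K f) = vecD D K (D i f) + ∑ c, D i (K c) * D c f := by
  simp only [vecD_apply, map_sum, Derivation.leibniz, smul_eq_mul, hc i, ← Finset.sum_add_distrib]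
  exact Finset.sum_congr rfl fun _ _ => by ring

/-- The conformal Killing equation. -/
def ConfKilling (D : Fin 4 → Derivation ℂ A A) (g : Fin 4 → Fin 4 → A) (K : Fin 4 → A)
    (lam : A) : Prop :=
  ∀ a b, vecD D K (g a b) + ∑ c, (g c b * D a (K c) + g a c * D b (K c)) = 2 * lam * g a b

/-- The Lie derivative of a connection. -/
def lieΓ (D : Fin 4 → Derivation ℂ A A) (Γ : Fin 4 → Fin 4 → Fin 4 → A) (K : Fin 4 → A)
    (a b c : Fin 4) : A :=
  vecD D K (Γ a b c) + ∑ e, (Γ a e c * D b (K e) + Γ a b e * D c (K e) - Γ e b c * D e (K a))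
    + D b (D c (K a))

/-- The variation of the curvature under a variation of the connection. -/
def varR (D : Fin 4 → Derivation ℂ A A) (Γ V : Fin 4 → Fin 4 → Fin 4 → A)
    (a b c d : Fin 4) : A :=
  D c (V a d b) - D d (V a c b) + ∑ e, (V a c e * Γ e d b + Γ a c e * V e d b
    - V a d e * Γ e c b - Γ a d e * V e c b)

-- The curvature is a natural polynomial in Γ and its first derivatives. Its Lie derivative is
-- therefore its linearisation at Γ in the direction L_KΓ, which contains the second derivatives of
-- K.
set_option maxHeartbeats 4000000 in
theorem lie_riemUpA (hc : ∀ i j f, D i (D j f) = D j (D i f)) (a b c d : Fin 4) :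
    vecD D K (riemUpA D Γ a b c d) + ∑ e, (riemUpA D Γ a e c d * D b (K e)
      + riemUpA D Γ a b e d * D c (K e) + riemUpA D Γ a b c e * D d (K e)
      - riemUpA D Γ e b c d * D e (K a)) = varR D Γ (lieΓ D Γ K) a b c d := by
  simp only [varR, lieΓ, riemUpA, map_add, map_sub, Derivation.leibniz, smul_eq_mul,
    der_vecD hc, Fin.sum_univ_four]
  simp only [hc c d, hc c 0, hc c 1, hc c 2, hc c 3, hc d 0, hc d 1, hc d 2, hc d 3]
  ring

-- The Lie derivative of the Koszul formula: the variation of g is 2λg, so the part of the lowered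
-- variation of Γ proportional to λ is accounted for by g itself and only first derivatives of λ
-- remain.
set_option maxHeartbeats 4000000 in
theorem lower_lieΓ (hc : ∀ i j f, D i (D j f) = D j (D i f)) (hg : ∀ a b, g a b = g b a)
    (hlow : ∀ a b c, 2 * ∑ e, g a e * Γ e b c = D b (g a c) + D c (g a b) - D a (g b c))
    (hK : ConfKilling D g K lam) (a b c : Fin 4) : 2 * ∑ e, g a e * lieΓ D Γ K e b c
      = 2 * (D b lam * g a c + D c lam * g a b - D a lam * g b c) := by
  have h1 := congrArg (vecD D K) (hlow a b c)
  have k1 := congrArg (D b) (hK a c)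
  have k2 := congrArg (D c) (hK a b)
  have k3 := congrArg (D a) (hK b c)
  have hX2 : vecD D K 2 = 0 := (vecD D K).map_natCast 2
  have hD2 : ∀ i, D i 2 = 0 := fun i => (D i).map_natCast 2
  have e1 : ∀ e, _ := fun e => hK a e
  have l1 : ∀ e, 2 * ∑ f, g a f * Γ f e c = D e (g a c) + D c (g a e) - D a (g c e) :=
    fun e => by rw [hlow, hg e c]
  have l2 : ∀ e, _ := fun e => hlow a b e
  have l3 : ∀ e, 2 * ∑ f, g e f * Γ f b c = D b (g c e) + D c (g b e) - D e (g b c) :=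
    fun e => by rw [hlow, hg e c, hg e b]
  have l4 := hlow a b c
  simp only [lieΓ, map_add, map_sub, Derivation.leibniz, smul_eq_mul, der_vecD hc,
    Fin.sum_univ_four, hX2, hD2] at h1 k1 k2 k3 e1 l1 l2 l3 l4 ⊢
  simp only [hg 0 b, hg 1 b, hg 2 b, hg 3 b, hg 0 c, hg 1 c,
    hg 2 c, hg 3 c, hc b a, hc c a, hc c b] at h1 k1 k2 k3 e1 l1 l2 l3 l4 ⊢
  linear_combination h1 + k1 + k2 - k3 - 2 * (Γ 0 b c * e1 0 + Γ 1 b c * e1 1 + Γ 2 b c * e1 2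
    + Γ 3 b c * e1 3) + D b (K 0) * l1 0 + D b (K 1) * l1 1 + D b (K 2) * l1 2 + D b (K 3) * l1 3
    + D c (K 0) * l2 0 + D c (K 1) * l2 1 + D c (K 2) * l2 2 + D c (K 3) * l2 3
    + D a (K 0) * l3 0 + D a (K 1) * l3 1 + D a (K 2) * l3 2 + D a (K 3) * l3 3 - 2 * lam * l4

/-- The Kronecker symbol. -/
def kr (a b : Fin 4) : A := if a = b then 1 else 0

theorem kr_mul (a : Fin 4) (f : Fin 4 → A) : ∑ e, kr a e * f e = f a := by simp [kr]
theorem mul_kr (a : Fin 4) (f : Fin 4 → A) : ∑ e, f e * kr e a = f a := by simp [kr]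
theorem der_kr (d : Derivation ℂ A A) (a b : Fin 4) : d (kr a b) = 0 := by
  unfold kr; split_ifs <;> simp

/-- The Hessian of a function. -/
def hess (D : Fin 4 → Derivation ℂ A A) (Γ : Fin 4 → Fin 4 → Fin 4 → A) (f : A)
    (a b : Fin 4) : A := D a (D b f) - ∑ e, Γ e a b * D e f

-- Insertion of the conformal variation of the connection into the linearised curvature. The terms
-- quadratic in Γ and dλ assemble into covariant derivatives; metricity absorbs the derivatives of
-- g, and symmetry of Γ removes the rest.
set_option maxHeartbeats 4000000 in
theorem varR_conf (hc : ∀ i j f, D i (D j f) = D j (D i f)) (hs : ∀ a b c, Γ a b c = Γ a c b)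
    (hΓ : Compat D g Γ) (up : Fin 4 → A) (a b c d : Fin 4) :
    varR D Γ (fun a b c => kr a b * D c lam + kr a c * D b lam - up a * g b c) a b c d
      = kr a d * hess D Γ lam c b - kr a c * hess D Γ lam d b - nab D Γ c up a * g d b
        + nab D Γ d up a * g c b := by
  have h1 := hΓ d b c
  have h2 := hΓ c b d
  have m1 := kr_mul a fun e => Γ e d b
  have m2 := kr_mul a fun e => Γ e c b
  have m3 := mul_kr d fun e => Γ a c e
  have m4 := mul_kr b fun e => Γ a c e
  have m5 := mul_kr c fun e => Γ a d e
  have m6 := mul_kr b fun e => Γ a d e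
  simp only [varR, hess, nab, map_add, map_sub, Derivation.leibniz, smul_eq_mul, der_kr,
    Fin.sum_univ_four, h1, h2] at m1 m2 m3 m4 m5 m6 ⊢
  simp only [hc c d, hs _ d c]
  linear_combination D c lam * m1 - D d lam * m2 + D b lam * m3 + D d lam * m4 - D b lam * m5
    - D c lam * m6 + D b lam * hs a c d

end conformalKilling

/-! ### Lie derivatives of curvature and Weyl tensor along a conformal Killing field -/

section conformalKilling

variable {A : Type*} [CommRing A] [Algebra ℂ A] {D : Fin 4 → Derivation ℂ A A}
  {g gi : Fin 4 → Fin 4 → A} {Γ : Fin 4 → Fin 4 → Fin 4 → A} {K : Fin 4 → A} {lam : A}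

theorem two_mul_cancel {x y : A} (h : 2 * x = 2 * y) : x = y := by
  have h2 : (2 : ℂ) • x = (2 : ℂ) • y := by rwa [Algebra.smul_def, Algebra.smul_def, map_ofNat]
  simpa [smul_smul] using congrArg (fun z => (1 / 2 : ℂ) • z) h2

/-- The Lie bracket of vector fields. -/
def bracket (D : Fin 4 → Derivation ℂ A A) (K X : Fin 4 → A) : Fin 4 → A :=
  nab (fun _ => vecD D K) (fun a _ b => -D b (K a)) 0 X

/-- The Lie derivative of a four-index tensor. -/
def lie4 (D : Fin 4 → Derivation ℂ A A) (K : Fin 4 → A)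
    (C : Fin 4 → Fin 4 → Fin 4 → Fin 4 → A) (a b c d : Fin 4) : A :=
  covA (fun _ => vecD D K) (fun a _ b => -D b (K a)) C a b c d 0

/-- A Lie derivative has the form of a covariant derivative with derivation K and coefficients -∂_b
K^a, so `der_ten4` applies unchanged; the index 0 is a dummy. -/
theorem vecD_ten4 (C : Fin 4 → Fin 4 → Fin 4 → Fin 4 → A) (X Y Z W : Fin 4 → A) :
    vecD D K (ten4 C X Y Z W) = ten4 (lie4 D K C) X Y Z W
      + (ten4 C (bracket D K X) Y Z W + ten4 C X (bracket D K Y) Z W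
        + ten4 C X Y (bracket D K Z) W + ten4 C X Y Z (bracket D K W)) :=
  der_ten4 (D := fun _ => vecD D K) (Γ := fun a _ b => -D b (K a)) C 0 X Y Z W

theorem vecD_ip (hK : ConfKilling D g K lam) (X Y : Fin 4 → A) :
    vecD D K (ip g X Y) = 2 * lam * ip g X Y + ip g (bracket D K X) Y + ip g X (bracket D K Y) := by
  have e : ∀ a b, vecD D K (g a b)
      = 2 * lam * g a b - ∑ c, (g c b * D a (K c) + g a c * D b (K c)) := fun a b => by
    rw [← hK a b]; ring
  simp only [ip, bracket, nab, map_sum, Derivation.leibniz, smul_eq_mul, e]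
  simp only [Fin.sum_univ_four]
  ring

/-- X is the defect of the claimed equation. Differentiating g⁻¹g = 1 shows that X contracted with g
is zero, and g is invertible. -/
theorem lie_inv (hinv : ∀ a b, ∑ c, g a c * gi c b = if a = b then 1 else 0)
    (hinv' : ∀ a b, ∑ c, gi a c * g c b = if a = b then 1 else 0)
    (hK : ConfKilling D g K lam) (a b : Fin 4) : vecD D K (gi a b)
      = ∑ c, (gi c b * D c (K a) + gi a c * D c (K b)) - 2 * lam * gi a b := by
  set X : Fin 4 → A := fun b => vecD D K (gi a b)
    - ∑ c, (gi c b * D c (K a) + gi a c * D c (K b)) + 2 * lam * gi a b with hX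
  have h1 : ∀ c, ∑ b, X b * g b c = 0 := by
    intro c
    have h2 := congrArg (vecD D K) (hinv' a c)
    have h3 := fun b => hK b c
    have h4 := fun e => hinv' e c
    have h5 := fun e => hinv' a e
    have h6 := kr_mul a fun e => D c (K e)
    have h7 := mul_kr c fun e => D e (K a)
    have h8 : vecD D K (if a = c then 1 else 0) = 0 := der_kr _ a c
    simp only [kr] at h6 h7
    simp only [h8, map_add, Derivation.leibniz, smul_eq_mul, Fin.sum_univ_four, hX]
      at h2 h3 h4 h5 h6 h7 ⊢
    linear_combination h2 - (gi a 0 * h3 0 + gi a 1 * h3 1 + gi a 2 * h3 2 + gi a 3 * h3 3)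
      - (D 0 (K a) * h4 0 + D 1 (K a) * h4 1 + D 2 (K a) * h4 2 + D 3 (K a) * h4 3)
      + (D c (K 0) * h5 0 + D c (K 1) * h5 1 + D c (K 2) * h5 2 + D c (K 3) * h5 3) + h6 - h7
  have h2 : X b = ∑ c, (∑ e, X e * g e c) * gi c b := by
    have h3 := fun e => hinv e b
    have h4 : ∑ e, X e * (if e = b then 1 else 0) = X b := by simp
    simp only [Fin.sum_univ_four] at h3 h4 ⊢
    linear_combination -h4 - (X 0 * h3 0 + X 1 * h3 1 + X 2 * h3 2 + X 3 * h3 3)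
  have h3 : X b = 0 := by rw [h2]; simp [h1]
  simp only [hX] at h3
  linear_combination h3

/-- The inner product of gradients scales under a conformal Killing field. -/
theorem lie_grad (hc : ∀ i j f, D i (D j f) = D j (D i f))
    (hinv : ∀ a b, ∑ c, g a c * gi c b = if a = b then 1 else 0)
    (hinv' : ∀ a b, ∑ c, gi a c * g c b = if a = b then 1 else 0)
    (hK : ConfKilling D g K lam) (x y : A) :
    vecD D K (∑ a, ∑ b, gi a b * D a x * D b y)
      = ∑ a, ∑ b, gi a b * D a (vecD D K x) * D b y + ∑ a, ∑ b, gi a b * D a x * D b (vecD D K y)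
        - 2 * lam * ∑ a, ∑ b, gi a b * D a x * D b y := by
  simp only [map_sum, Derivation.leibniz, smul_eq_mul, lie_inv hinv hinv' hK, der_vecD hc]
  simp only [Fin.sum_univ_four]
  ring

theorem lieΓ_conf (hc : ∀ i j f, D i (D j f) = D j (D i f)) (hg : ∀ a b, g a b = g b a)
    (hinv' : ∀ a b, ∑ c, gi a c * g c b = if a = b then 1 else 0)
    (hlow : ∀ a b c, 2 * ∑ e, g a e * Γ e b c = D b (g a c) + D c (g a b) - D a (g b c))
    (hK : ConfKilling D g K lam) : lieΓ D Γ K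
      = fun a b c => kr a b * D c lam + kr a c * D b lam - (∑ e, gi a e * D e lam) * g b c := by
  funext d b c
  have h1 : ∀ a, ∑ e, g a e * lieΓ D Γ K e b c
      = D b lam * g a c + D c lam * g a b - D a lam * g b c :=
    fun a => two_mul_cancel (lower_lieΓ hc hg hlow hK a b c)
  have h2 := fun e => hinv' d e
  have h3 : ∑ e, (if d = e then 1 else 0) * lieΓ D Γ K e b c = lieΓ D Γ K d b c := by simp
  simp only [kr]
  simp only [Fin.sum_univ_four] at h1 h3 ⊢
  have h4 := h2 b
  have h5 := h2 c
  simp only [Fin.sum_univ_four] at h2 h4 h5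
  linear_combination -h3 + gi d 0 * h1 0 + gi d 1 * h1 1 + gi d 2 * h1 2 + gi d 3 * h1 3
    - (lieΓ D Γ K 0 b c * h2 0 + lieΓ D Γ K 1 b c * h2 1 + lieΓ D Γ K 2 b c * h2 2
      + lieΓ D Γ K 3 b c * h2 3) + D c lam * h4 + D b lam * h5

theorem lower_nab_grad (hΓ : Compat D g Γ) {f : A} {up : Fin 4 → A}
    (hup : ∀ a, ∑ e, g a e * up e = D a f) (c a : Fin 4) :
    ∑ e, g a e * nab D Γ c up e = hess D Γ f c a := by
  have h1 := congrArg (D c) (hup a)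
  have h2 := fun e => hΓ a e c
  simp only [nab, hess, map_add, Derivation.leibniz, smul_eq_mul, Fin.sum_univ_four]
    at h1 h2 hup ⊢
  simp only [h2] at h1
  linear_combination h1 - (Γ 0 c a * hup 0 + Γ 1 c a * hup 1 + Γ 2 c a * hup 2 + Γ 3 c a * hup 3)

theorem hess_symm (hc : ∀ i j f, D i (D j f) = D j (D i f)) (hs : ∀ a b c, Γ a b c = Γ a c b)
    (f : A) (a b : Fin 4) : hess D Γ f a b = hess D Γ f b a := by
  simp only [hess, hc a b, hs _ a b]

/-- The Lie derivative of the curvature along a conformal Killing field. -/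
structure LieCurv (D : Fin 4 → Derivation ℂ A A) (g : Fin 4 → Fin 4 → A) (K : Fin 4 → A)
    (R : Fin 4 → Fin 4 → Fin 4 → Fin 4 → A) (S N : Fin 4 → Fin 4 → A) : Prop where
  lie : ∀ a b c d, vecD D K (R a b c d) + ∑ e, (R a e c d * D b (K e)
      + R a b e d * D c (K e) + R a b c e * D d (K e) - R e b c d * D e (K a))
    = kr a d * S c b - kr a c * S d b - N c a * g d b + N d a * g c b
  lower : ∀ c a, ∑ e, g a e * N c e = S c a
  symm : ∀ a b, S a b = S b a

variable {R : Fin 4 → Fin 4 → Fin 4 → Fin 4 → A} {S N : Fin 4 → Fin 4 → A}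

theorem LieCurv.lie_riemA (h : LieCurv D g K R S N) (hK : ConfKilling D g K lam)
    (a b c d : Fin 4) : lie4 D K (riemA g R) a b c d = 2 * lam * riemA g R a b c d
      + g a d * S c b - g a c * S d b - S c a * g d b + S d a * g c b := by
  have h1 := fun e => h.lie e b c d
  have h2 := fun e => hK a e
  have h3 := h.lower c a
  have h4 := h.lower d a
  have h5 := mul_kr d fun e => g a e
  have h6 := mul_kr c fun e => g a e
  simp only [lie4, covA, riemA, map_add, Derivation.leibniz, smul_eq_mul, Fin.sum_univ_four]
    at h1 h2 h3 h4 h5 h6 ⊢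
  linear_combination g a 0 * h1 0 + g a 1 * h1 1 + g a 2 * h1 2 + g a 3 * h1 3
    + R 0 b c d * h2 0 + R 1 b c d * h2 1 + R 2 b c d * h2 2 + R 3 b c d * h2 3
    - g d b * h3 + g c b * h4 + S c b * h5 - S d b * h6

theorem LieCurv.lie_ricA (h : LieCurv D g K R S N) (hg : ∀ a b, g a b = g b a) (b d : Fin 4) :
    vecD D K (ricA R b d) + ∑ e, (ricA R e d * D b (K e) + ricA R b e * D d (K e))
      = -2 * S b d - (∑ c, N c c) * g b d := by
  have h1 := fun c => h.lie c b c d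
  have h2 := h.lower d b
  have h3 : ∑ c, kr c d * S c b = S d b := by simp [kr]
  have h4 : ∑ c : Fin 4, (kr c c : A) = 4 := by simp [kr]
  simp only [h.symm b d, hg b d, ricA, map_add, Fin.sum_univ_four] at h1 h2 h3 h4 ⊢
  simp only [hg b 0, hg b 1, hg b 2, hg b 3] at h2
  linear_combination h1 0 + h1 1 + h1 2 + h1 3 + h2 + h3 - S d b * h4

/-- Tracing -2S - (tr N)g in dimension four gives -2 - 4 = -6 times tr N, since tr S = tr N; the
weight -2λ is that of the inverse metric. -/
theorem LieCurv.lie_scA (h : LieCurv D g K R S N) (hg : ∀ a b, g a b = g b a)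
    (hinv : ∀ a b, ∑ c, g a c * gi c b = if a = b then 1 else 0)
    (hinv' : ∀ a b, ∑ c, gi a c * g c b = if a = b then 1 else 0)
    (hK : ConfKilling D g K lam) :
    vecD D K (scA gi (ricA R)) = -2 * lam * scA gi (ricA R) - 6 * ∑ c, N c c := by
  have h1 : ∀ b d, vecD D K (ricA R b d) = -2 * S b d - (∑ c, N c c) * g b d
      - ∑ e, (ricA R e d * D b (K e) + ricA R b e * D d (K e)) := fun b d => by
    rw [← h.lie_ricA hg b d]; ring
  have h2 : ∑ a, ∑ b, gi a b * S a b = ∑ c, N c c := by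
    have e : ∀ a, ∑ b, gi a b * S a b = N a a := fun a => by
      have e1 := fun b => h.lower a b
      have e2 := fun e => hinv' a e
      have e3 : ∑ e, (if a = e then 1 else 0) * N a e = N a a := by simp
      simp only [Fin.sum_univ_four] at e1 e2 e3 ⊢
      linear_combination e3 - (gi a 0 * e1 0 + gi a 1 * e1 1 + gi a 2 * e1 2 + gi a 3 * e1 3)
        + (N a 0 * e2 0 + N a 1 * e2 1 + N a 2 * e2 2 + N a 3 * e2 3)
    exact Finset.sum_congr rfl fun a _ => e a
  have h3 : ∑ a, ∑ b, gi a b * g a b = 4 := by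
    have e : ∀ a, ∑ b, gi a b * g a b = 1 := fun a => by
      simp_rw [hg a]; rw [hinv' a a, if_pos rfl]
    simp [e]
  generalize ∑ c, N c c = s at *
  simp only [scA, map_sum, Derivation.leibniz, smul_eq_mul, lie_inv hinv hinv' hK, h1]
  simp only [Fin.sum_univ_four] at h2 h3 ⊢
  linear_combination -2 * h2 - s * h3

/-- The Weyl tensor is conformally covariant under a conformal Killing field. -/
theorem LieCurv.lie_weylA (h : LieCurv D g K R S N) (hg : ∀ a b, g a b = g b a)
    (hinv : ∀ a b, ∑ c, g a c * gi c b = if a = b then 1 else 0)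
    (hinv' : ∀ a b, ∑ c, gi a c * g c b = if a = b then 1 else 0)
    (hK : ConfKilling D g K lam) (a b c d : Fin 4) :
    lie4 D K (weylA g (riemA g R) (ricA R) (scA gi (ricA R))) a b c d
      = 2 * lam * weylA g (riemA g R) (ricA R) (scA gi (ricA R)) a b c d := by
  have h1 := h.lie_riemA hK a b c d
  have h2 := h.lie_scA hg hinv hinv' hK
  have h3 := fun b d => h.lie_ricA hg b d
  have p1 := h3 b d
  have p2 := h3 b c
  have p3 := h3 a d
  have p4 := h3 a c
  have q1 := hK a c
  have q2 := hK a d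
  have q3 := hK b c
  have q4 := hK b d
  have e2 : (2 : A) * algebraMap ℂ A (1 / 2) = 1 := by
    rw [← map_ofNat (algebraMap ℂ A) 2, ← map_mul]; norm_num
  have e6 : (6 : A) * algebraMap ℂ A (1 / 6) = 1 := by
    rw [← map_ofNat (algebraMap ℂ A) 6, ← map_mul]; norm_num
  generalize riemA g R = Rl at *
  generalize ricA R = P at *
  generalize scA gi P = s at *
  generalize ∑ c, N c c = σ at *
  simp only [lie4, covA, weylA, map_add, map_sub, Derivation.leibniz, smul_eq_mul,
    Algebra.smul_def, Derivation.map_algebraMap, Fin.sum_univ_four] at h1 h2 p1 p2 p3 p4 q1 q2 q3 q4 ⊢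
  generalize algebraMap ℂ A (1 / 2) = x at *
  generalize algebraMap ℂ A (1 / 6) = y at *
  simp only [h.symm d a, h.symm c a, h.symm d b, h.symm c b, hg d b, hg c b] at h1
  -- All Hessian terms cancel: those with S through the coefficient 1/2 of the Ricci part, those
  -- with the trace σ between that part and the 1/6 of the scalar part.
  linear_combination h1 - x * (g a c * p1 - g a d * p2 - g b c * p3 + g b d * p4
      + P b d * q1 - P b c * q2 - P a d * q3 + P a c * q4)
    + y * (h2 * (g a c * g b d - g a d * g b c))
    + y * s * (g b d * q1 + g a c * q4 - g b c * q2 - g a d * q3)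
    + (g a c * S b d - g a d * S b c - g b c * S a d + g b d * S a c
      + σ * (g a c * g b d - g a d * g b c)) * e2
    - σ * (g a c * g b d - g a d * g b c) * e6

theorem lieCurv (hc : ∀ i j f, D i (D j f) = D j (D i f)) (hg : ∀ a b, g a b = g b a)
    (hinv : ∀ a b, ∑ c, g a c * gi c b = if a = b then 1 else 0)
    (hinv' : ∀ a b, ∑ c, gi a c * g c b = if a = b then 1 else 0)
    (hK : ConfKilling D g K lam) :
    LieCurv D g K (riemUpA D (chrA D g gi)) (hess D (chrA D g gi) lam)
      (fun c => nab D (chrA D g gi) c fun a => ∑ e, gi a e * D e lam) := by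
  have hlow : ∀ a b c, 2 * ∑ e, g a e * chrA D g gi e b c
      = D b (g a c) + D c (g a b) - D a (g b c) := fun a b c => by
    rw [lower_chrA hinv, Algebra.smul_def, ← mul_assoc, ← map_ofNat (algebraMap ℂ A) 2, ← map_mul]
    norm_num
  have hs := chrA_symm (D := D) (gi := gi) hg
  have hΓ := chrA_compat (D := D) hg hinv
  refine ⟨fun a b c d => ?_, fun c a => ?_, hess_symm hc hs lam⟩
  · rw [lie_riemUpA hc, lieΓ_conf hc hg hinv' hlow hK]
    exact varR_conf hc hs hΓ _ a b c d
  · refine lower_nab_grad hΓ (fun a => ?_) c a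
    have e : ∀ e, _ := fun e => hinv a e
    have e3 : ∑ e, (if a = e then 1 else 0) * D e lam = D a lam := by simp
    simp only [Fin.sum_univ_four] at e e3 ⊢
    linear_combination e3 + (D 0 lam * e 0 + D 1 lam * e 1 + D 2 lam * e 2 + D 3 lam * e 3)

end conformalKilling

/-! ### Conformal Killing fields in a null frame -/

section conformalKilling

variable {A : Type*} [CommRing A] [Algebra ℂ A] {D : Fin 4 → Derivation ℂ A A}
  {g gi : Fin 4 → Fin 4 → A} {K : Fin 4 → A} {lam : A} {E : Fin 4 → Fin 4 → A}

theorem frame_expand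
    (key : ∀ a b, ∑ i, wtC i • (E i a * ∑ c, g b c * E (opp i) c) = if a = b then 1 else 0)
    (Y : Fin 4 → A) : Y = fun a => ∑ i, (wtC i • ip g Y (E (opp i))) * E i a := by
  funext a
  have e : Y a = ∑ b, (if a = b then 1 else 0) * Y b := by simp
  rw [e]
  simp_rw [← key]
  simp only [ip, Fin.sum_univ_four, Algebra.smul_def]
  ring

/-- In a null frame, a conformally covariant tensor is invariant, up to scale, under the matrix
by which a conformal Killing field acts on the frame. -/
theorem exists_skewFrame (hg : ∀ a b, g a b = g b a)
    (gram : ∀ i j, ip g (E i) (E j) = if j = opp i then algebraMap ℂ A (epC i) else 0)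
    (key : ∀ a b, ∑ i, wtC i • (E i a * ∑ c, g b c * E (opp i) c) = if a = b then 1 else 0)
    (hK : ConfKilling D g K lam) {C : Fin 4 → Fin 4 → Fin 4 → Fin 4 → A}
    (hC : ∀ a b c d, lie4 D K C a b c d = 2 * lam * C a b c d) :
    ∃ M : Fin 4 → Fin 4 → A, SkewFrame M ∧ ∀ i j k l,
      actF M (vecD D K) (fr4 E C) i j k l = -2 * lam * fr4 E C i j k l := by
  set Q : Fin 4 → Fin 4 → A := fun m i => wtC m • ip g (bracket D K (E i)) (E (opp m)) with hQ
  have hQE : ∀ i, bracket D K (E i) = fun a => ∑ m, Q m i * E m a := fun i => frame_expand key _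
  -- A conformal Killing field acts on the legs by a rotation minus the dilation λ. Adding λ leaves
  -- a matrix in the Lie algebra of the frame metric, and the four slots of C shift the weight from
  -- 2λ to -2λ.
  refine ⟨fun m i => Q m i + lam * kr m i, SkewFrame.of_metric fun i k => ?_, fun i j k l => ?_⟩
  · have e1 : ∀ i k, epC k • Q (opp k) i = ip g (bracket D K (E i)) (E k) := fun i k => by
      rw [hQ]; dsimp only
      rw [opp_opp, smul_smul, ← epC_opp, epC_mul_wtC, one_smul]
    have e2 : ∀ i k, epC k • (kr (opp k) i : A) = ip g (E i) (E k) := fun i k => by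
      rw [gram, kr]
      by_cases h : k = opp i
      · subst h
        rw [opp_opp, if_pos rfl, if_pos rfl, epC_opp, Algebra.smul_def, mul_one]
      · rw [if_neg h, if_neg, smul_zero]
        intro h'; exact h (by rw [← h', opp_opp])
    have e3 : vecD D K (ip g (E i) (E k)) = 0 := by
      rw [gram]; split_ifs
      · exact (vecD D K).map_algebraMap _
      · exact map_zero _
    have e4 := vecD_ip hK (E i) (E k)
    rw [smul_add, smul_add, e1, e1, ← mul_smul_comm, ← mul_smul_comm, e2, e2,
      ip_comm hg (E k) (E i), ip_comm hg (bracket D K (E k)) (E i)]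
    linear_combination e3 - e4
  · have h0 := vecD_ten4 (D := D) (K := K) C (E i) (E j) (E k) (E l)
    have h1 : ten4 (lie4 D K C) (E i) (E j) (E k) (E l)
        = 2 * lam * ten4 C (E i) (E j) (E k) (E l) := by
      rw [← ten4_mul_left]; congr 1; funext a b c d; exact hC a b c d
    rw [h1, hQE, hQE, hQE, hQE, ten4_sum₁, ten4_sum₂, ten4_sum₃, ten4_sum₄] at h0
    have k1 := kr_mul (A := A) i fun m => ten4 C (E m) (E j) (E k) (E l)
    have k2 := kr_mul (A := A) j fun m => ten4 C (E i) (E m) (E k) (E l)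
    have k3 := kr_mul (A := A) k fun m => ten4 C (E i) (E j) (E m) (E l)
    have k4 := kr_mul (A := A) l fun m => ten4 C (E i) (E j) (E k) (E m)
    have kc : ∀ a b : Fin 4, (kr a b : A) = kr b a := fun a b => by simp only [kr, eq_comm]
    simp only [kc i, kc j, kc k, kc l] at k1 k2 k3 k4
    simp only [actF, fr4, Fin.sum_univ_four] at h0 k1 k2 k3 k4 ⊢
    linear_combination h0 - lam * (k1 + k2 + k3 + k4)

end conformalKilling

/-- The inner product of the differentials of the first two conformal invariants of the
Kerr-Vaidya metric, up to scale. -/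
def polyG {A : Type*} [CommRing A] (Z W τ m m1 : A) : A :=
    Z ^ (5 : ℕ) * W * m ^ (3 : ℕ) + Z ^ (5 : ℕ) * m ^ (2 : ℕ) + Z ^ (4 : ℕ) * W ^ (2 : ℕ) *
    m ^ (3 : ℕ) + 4 * Z ^ (4 : ℕ) * W * τ * m ^ (2 : ℕ) - 5 * Z ^ (4 : ℕ) * W * m ^ (2 : ℕ) -
    Z ^ (4 : ℕ) * m - 6 * Z ^ (3 : ℕ) * W ^ (3 : ℕ) * m ^ (3 : ℕ) - 12 * Z ^ (3 : ℕ) * W ^ (2 : ℕ)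
    * τ * m ^ (2 : ℕ) + 4 * Z ^ (3 : ℕ) * W ^ (2 : ℕ) * m ^ (2 : ℕ) - 10 * Z ^ (3 : ℕ) * W * τ * m
    + 5 * Z ^ (3 : ℕ) * W * m - Z ^ (3 : ℕ) * τ * m1 + Z ^ (3 : ℕ) * m1 + 2 * Z ^ (2 : ℕ) *
    W ^ (4 : ℕ) * m ^ (3 : ℕ) - 12 * Z ^ (2 : ℕ) * W ^ (3 : ℕ) * τ * m ^ (2 : ℕ) + 8 * Z ^ (2 : ℕ)
    * W ^ (3 : ℕ) * m ^ (2 : ℕ) - 24 * Z ^ (2 : ℕ) * W ^ (2 : ℕ) * τ ^ (2 : ℕ) * m + 24 *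
    Z ^ (2 : ℕ) * W ^ (2 : ℕ) * τ * m - 9 * Z ^ (2 : ℕ) * W ^ (2 : ℕ) * m - 4 * Z ^ (2 : ℕ) * W *
    τ ^ (2 : ℕ) * m1 + 7 * Z ^ (2 : ℕ) * W * τ * m1 - 3 * Z ^ (2 : ℕ) * W * m1 + 5 * Z *
    W ^ (5 : ℕ) * m ^ (3 : ℕ) + 20 * Z * W ^ (4 : ℕ) * τ * m ^ (2 : ℕ) - 13 * Z * W ^ (4 : ℕ) *
    m ^ (2 : ℕ) - 14 * Z * W ^ (3 : ℕ) * τ * m + 7 * Z * W ^ (3 : ℕ) * m + 4 * Z * W ^ (2 : ℕ) *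
    τ ^ (2 : ℕ) * m1 - 7 * Z * W ^ (2 : ℕ) * τ * m1 + 3 * Z * W ^ (2 : ℕ) * m1 - 3 * W ^ (6 : ℕ) *
    m ^ (3 : ℕ) + 5 * W ^ (5 : ℕ) * m ^ (2 : ℕ) - 2 * W ^ (4 : ℕ) * m + W ^ (3 : ℕ) * τ * m1 -
    W ^ (3 : ℕ) * m1

/-- The Jacobian of three conformal invariants of the Kerr-Vaidya metric, up to scale. -/
def polyJac {A : Type*} [CommRing A] (Z W τ m m1 m2 : A) : A :=
    2 * Z ^ (4 : ℕ) * W * m * m1 + Z ^ (4 : ℕ) * m1 ^ (2 : ℕ) + 8 * Z ^ (3 : ℕ) * W ^ (2 : ℕ) * τ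
    * m * m1 - 2 * Z ^ (3 : ℕ) * W ^ (2 : ℕ) * m * m1 + 2 * Z ^ (3 : ℕ) * W * τ * m * m2 - 2 *
    Z ^ (3 : ℕ) * W * m * m2 + 4 * Z ^ (3 : ℕ) * W * m1 ^ (2 : ℕ) + 8 * Z ^ (2 : ℕ) * W ^ (3 : ℕ)
    * τ * m * m1 - 2 * Z ^ (2 : ℕ) * W ^ (3 : ℕ) * m * m1 + 8 * Z ^ (2 : ℕ) * W ^ (2 : ℕ) *
    τ ^ (2 : ℕ) * m * m2 - 16 * Z ^ (2 : ℕ) * W ^ (2 : ℕ) * τ ^ (2 : ℕ) * m1 ^ (2 : ℕ) - 12 *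
    Z ^ (2 : ℕ) * W ^ (2 : ℕ) * τ * m * m2 + 32 * Z ^ (2 : ℕ) * W ^ (2 : ℕ) * τ * m1 ^ (2 : ℕ) + 4
    * Z ^ (2 : ℕ) * W ^ (2 : ℕ) * m * m2 - 10 * Z ^ (2 : ℕ) * W ^ (2 : ℕ) * m1 ^ (2 : ℕ) + 2 * Z *
    W ^ (4 : ℕ) * m * m1 + 2 * Z * W ^ (3 : ℕ) * τ * m * m2 - 2 * Z * W ^ (3 : ℕ) * m * m2 + 4 * Z
    * W ^ (3 : ℕ) * m1 ^ (2 : ℕ) + W ^ (4 : ℕ) * m1 ^ (2 : ℕ)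

/-! ### Three invariants of conformal Killing fields and their Jacobian -/

namespace KVRing

variable {A : Type*} [CommRing A] [Algebra ℂ A] {D : Fin 4 → Derivation ℂ A A} (K : KVRing D)
  {gi : Fin 4 → Fin 4 → A} {X : Fin 4 → A} {lam : A}

/-- Up to scale the Weyl matrix is preserved by an infinitesimal Lorentz transformation. Its VW
entry is zero, while its variation is 3ψ₂M₃₀; as ψ₂ is a unit, M₃₀ = 0, and the VU entry then says
that ψ₂ scales by itself, unaffected by ψ₃. The other block is treated alike. -/
theorem kill_psi (hc : ∀ i j f, D i (D j f) = D j (D i f))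
    (hinv : ∀ a b, ∑ c, K.g a c * gi c b = if a = b then 1 else 0)
    (hinv' : ∀ a b, ∑ c, gi a c * K.g c b = if a = b then 1 else 0)
    (hX : ConfKilling D K.g X lam) {mi : A} (hm : K.μ 0 * mi = 1) :
    vecD D X (K.μ 0 * K.Z ^ 3) = -2 * lam * (K.μ 0 * K.Z ^ 3) ∧
    vecD D X (K.μ 0 * K.W ^ 3) = -2 * lam * (K.μ 0 * K.W ^ 3) := by
  have hL := (lieCurv hc K.g_symm hinv hinv' hX).lie_weylA K.g_symm hinv hinv' hX
  obtain ⟨-, h2⟩ := frame_inverse K.g_symm hinv K.gram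
  obtain ⟨M, hM, hact⟩ := exists_skewFrame K.g_symm K.gram h2 hX hL
  change ∀ i j k l, actF M _ (fr4 K.E (K.weylK gi)) i j k l
    = -2 * lam * fr4 K.E (K.weylK gi) i j k l at hact
  rw [K.weyl_frame hc hinv, weylT] at hact
  simp only [actF_symT6 hM] at hact
  have h4 : vecD D X (4 : A) = 0 := (vecD D X).map_natCast 4
  -- The index pair (0,2) selects V, (1,3) selects U, and (0,1) meets both W and its conjugate, of
  -- which only W couples to V. So `t1` reads the VW entry and `t2` the VU entry; `t3` and `t4` do
  -- this for the conjugate block.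
  have t1 := hact 0 2 0 1
  have t2 := hact 0 2 1 3
  have t3 := hact 0 3 0 1
  have t4 := hact 0 3 1 2
  simp [bivTab, Fin.sum_univ_six, biv, bivZ, symT6, ψ₂, ψ₂', Derivation.leibniz, h4]
    at t1 t2 t3 t4
  have c12 : (12 : A) * algebraMap ℂ A (1 / 12) = 1 := by
    rw [← map_ofNat (algebraMap ℂ A) 12, ← map_mul]; norm_num
  have c4 : (4 : A) * algebraMap ℂ A (1 / 4) = 1 := by
    rw [← map_ofNat (algebraMap ℂ A) 4, ← map_mul]; norm_num
  have hZ : K.z ^ 3 * K.Z ^ 3 = 1 := by rw [← mul_pow, K.zZ, one_pow]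
  have hW : K.w ^ 3 * K.W ^ 3 = 1 := by rw [← mul_pow, K.wW, one_pow]
  generalize algebraMap ℂ A (1 / 12) = x at *
  generalize algebraMap ℂ A (1 / 4) = y at *
  have u1 : 12 * K.μ 0 * K.Z ^ 3 * (x * mi * K.z ^ 3) = 1 := by
    linear_combination (K.μ 0 * mi * (K.z ^ 3 * K.Z ^ 3)) * c12 + (K.z ^ 3 * K.Z ^ 3) * hm + hZ
  have u2 : 12 * K.μ 0 * K.W ^ 3 * (x * mi * K.w ^ 3) = 1 := by
    linear_combination (K.μ 0 * mi * (K.w ^ 3 * K.W ^ 3)) * c12 + (K.w ^ 3 * K.W ^ 3) * hm + hW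
  have m1 : M 3 0 = 0 := by linear_combination (x * mi * K.z ^ 3) * t1 - M 3 0 * u1
  have m2 : M 2 0 = 0 := by linear_combination (x * mi * K.w ^ 3) * t3 - M 2 0 * u2
  rw [m1] at t2
  rw [m2] at t4
  simp only [Derivation.leibniz, Derivation.leibniz_pow, smul_eq_mul, nsmul_eq_mul]
  push_cast
  constructor
  · linear_combination y * t2 - (K.μ 0 * (3 * (K.Z ^ 2 * vecD D X K.Z)) + K.Z ^ 3 * vecD D X (K.μ 0)
      + 2 * lam * (K.μ 0 * K.Z ^ 3)) * c4
  · linear_combination y * t4 - (K.μ 0 * (3 * (K.W ^ 2 * vecD D X K.W)) + K.W ^ 3 * vecD D X (K.μ 0)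
      + 2 * lam * (K.μ 0 * K.W ^ 3)) * c4

theorem dz (d : Derivation ℂ A A) : d K.z = -(K.z ^ 2 * d K.Z) :=
  der_inv d (by rw [mul_comm, K.zZ])
theorem dw (d : Derivation ℂ A A) : d K.w = -(K.w ^ 2 * d K.W) :=
  der_inv d (by rw [mul_comm, K.wW])

/-- The inner product with a gradient proportional to `dZ / Z - dW / W`. -/
theorem grad_conf_left {x y k : A} (h0 : D 0 x = 0) (h1 : D 1 x = k * (K.W - K.Z))
    (h2 : D 2 x = k * (K.t * (K.Z + K.W))) (h3 : D 3 x = 0) (hy : D 3 y = 0) :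
    ∑ i, wtC i • (K.δ i x * K.δ (opp i) y) = k * ((1 - K.τ) * (K.W - K.Z) * D 0 y
      + (1 - K.τ - K.μ 0 * (K.Z + K.W)) * (K.W - K.Z) * D 1 y
      + K.Z * K.W * K.t * (K.Z + K.W) * D 2 y) := by
  have h5 : (2 : A) * algebraMap ℂ A 2⁻¹ = 1 := by
    rw [← map_ofNat (algebraMap ℂ A) 2, ← map_mul]; norm_num
  simp only [Fin.sum_univ_four, wtC, opp, Algebra.smul_def, map_neg, one_div,
    Matrix.cons_val_zero, Matrix.cons_val_one, Matrix.cons_val]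
  generalize algebraMap ℂ A 2⁻¹ = h at *
  simp only [δ0, δ1, δ2, δ3, h0, h1, h2, h3, hy, τ]
  linear_combination (k * ((1 - K.t ^ 2 * K.Z * K.W) * (K.W - K.Z) * D 0 y
      + (1 - K.t ^ 2 * K.Z * K.W - K.μ 0 * (K.Z + K.W)) * (K.W - K.Z) * D 1 y
      + K.Z * K.W * K.t * (K.Z + K.W) * D 2 y)) * h5

theorem D1N₀ : D 1 K.N₀ = -(2 * (K.Z - K.W) * (K.Z ^ 2 - K.W ^ 2)
    * (1 - K.μ 0 * (K.Z + K.W))) + (K.Z - K.W) ^ 2 * (K.μ 0 * (K.Z ^ 2 + K.W ^ 2))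
    - 8 * K.τ * K.Z * K.W * (K.Z + K.W) := by
  simp [N₀, Derivation.leibniz_pow, der_four]
  ring

theorem D2N₀ : D 2 K.N₀ = K.t * (2 * (K.Z - K.W) * (K.Z ^ 2 + K.W ^ 2)
    * (1 - K.μ 0 * (K.Z + K.W)) - (K.Z - K.W) ^ 2 * (K.μ 0 * (K.Z ^ 2 - K.W ^ 2))
    + 4 * (K.W - K.Z) * (1 - K.τ) * K.Z * K.W
    + 4 * K.τ * K.Z * K.W * (K.Z - K.W)) := by
  simp [N₀, Derivation.leibniz_pow, der_four]
  ring

/-- The inner product of the gradients of the first two conformal invariants, up to scale. -/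
def G : A := polyG K.Z K.W K.τ (K.μ 0) (K.μ 1)

/-- With x = Z/W and y = N₀/(mZ³), the inner product of dx and dy is x · G/(m²Z³). The expression on
the right is that inner product with the powers of m and Z cleared. -/
theorem G_eq : K.G = -((1 - K.τ) * (K.W - K.Z) * (K.μ 1 * K.H))
    + K.μ 0 * ((1 - K.τ - K.μ 0 * (K.Z + K.W)) * (K.W - K.Z) * (D 1 K.N₀ + 3 * K.Z * K.N₀)
      + K.Z * K.W * K.t * (K.Z + K.W) * (D 2 K.N₀ - 3 * K.t * K.Z * K.N₀)) := by
  rw [D1N₀, D2N₀]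
  simp only [G, polyG, N₀, H, τ]
  ring

-- The combination of derivatives of G left over when X₀ and X₁ are eliminated from the three
-- invariance equations. The 18 is 12 from the powers of z under ξ plus 6 from those of 1/m under
-- ∂_v.
set_option maxHeartbeats 1000000 in
theorem jacobian : 2 * K.t * K.Z * K.W * K.μ 0 * D 0 K.G - 18 * K.t * K.Z * K.W * K.μ 1 * K.G
    - K.μ 1 * K.ξ K.G
    = K.t * (K.W - K.Z) * polyJac K.Z K.W K.τ (K.μ 0) (K.μ 1) (K.μ 2) := by
  have hn : ∀ (d : Derivation ℂ A A) (n : ℕ) [n.AtLeastTwo], d (OfNat.ofNat n : A) = 0 :=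
    fun d n _ => d.map_natCast n
  simp only [G, polyG, Derivation.leibniz_pow, Derivation.leibniz, map_add, map_sub, hn,
    ξZ, ξW, ξτ, ξμ, D0Z, D0W, D0τ, D0μ, smul_eq_mul, nsmul_eq_mul, smul_zero, mul_zero, zero_add,
    add_zero, polyJac, H]
  ring

theorem D3G : D 3 K.G = 0 := by
  have hn : ∀ (n : ℕ) [n.AtLeastTwo], D 3 (OfNat.ofNat n : A) = 0 :=
    fun n _ => (D 3).map_natCast n
  simp [G, polyG, Derivation.leibniz_pow, hn]

/-- The equations satisfied by a conformal Killing field of the Kerr-Vaidya metric. -/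
theorem kill_eqs (hc : ∀ i j f, D i (D j f) = D j (D i f))
    (hinv : ∀ a b, ∑ c, K.g a c * gi c b = if a = b then 1 else 0)
    (hinv' : ∀ a b, ∑ c, gi a c * K.g c b = if a = b then 1 else 0)
    (hX : ConfKilling D K.g X lam) {mi : A} (hm : K.μ 0 * mi = 1) :
    X 1 * (K.W - K.Z) + X 2 * (K.t * (K.Z + K.W)) = 0 ∧
    -(X 0 * K.μ 1 * K.H) + K.μ 0 * (X 1 * (D 1 K.N₀ + 3 * K.Z * K.N₀)
      + X 2 * (D 2 K.N₀ - 3 * K.t * K.Z * K.N₀)) = 0 ∧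
    X 0 * (K.μ 0 * D 0 K.G - 3 * K.μ 1 * K.G) + K.μ 0 * (X 1 * (D 1 K.G + 6 * K.Z * K.G)
      + X 2 * (D 2 K.G - 6 * K.t * K.Z * K.G)) = 0 := by
  obtain ⟨p1, p2⟩ := K.kill_psi hc hinv hinv' hX hm
  have c3 : (3 : A) * algebraMap ℂ A (1 / 3) = 1 := by
    rw [← map_ofNat (algebraMap ℂ A) 3, ← map_mul]; norm_num
  generalize algebraMap ℂ A (1 / 3) = x3 at c3
  have hzZ := K.zZ
  have hwW := K.wW
  have hmi : ∀ d : Derivation ℂ A A, d mi = -(mi ^ 2 * d (K.μ 0)) := fun d => der_inv d hm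
  have hV : ∀ f, vecD D X f = X 0 * D 0 f + X 1 * D 1 f + X 2 * D 2 f + X 3 * D 3 f := fun f => by
    rw [vecD_apply, Fin.sum_univ_four]
  set L := vecD D X with hL
  -- the ratio `Z / W` is invariant
  have q1 : K.W * L K.Z - K.Z * L K.W = 0 := by
    simp only [Derivation.leibniz, Derivation.leibniz_pow, smul_eq_mul, nsmul_eq_mul] at p1 p2
    push_cast at p1 p2
    have e : 3 * (K.μ 0 ^ 2 * K.Z ^ 2 * K.W ^ 2 * (K.W * L K.Z - K.Z * L K.W)) = 0 := by
      linear_combination K.μ 0 * K.W ^ 3 * p1 - K.μ 0 * K.Z ^ 3 * p2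
    have u : (K.μ 0 ^ 2 * K.Z ^ 2 * K.W ^ 2) * (mi ^ 2 * K.z ^ 2 * K.w ^ 2) = 1 := by
      have : (K.μ 0 * mi) ^ 2 * (K.z * K.Z) ^ 2 * (K.w * K.W) ^ 2 = 1 := by
        rw [hm, hzZ, hwW]; ring
      linear_combination this
    linear_combination (x3 * (mi ^ 2 * K.z ^ 2 * K.w ^ 2)) * e
      - (K.W * L K.Z - K.Z * L K.W) * u * (3 * x3) - (K.W * L K.Z - K.Z * L K.W) * c3
  have x0 : D 0 (K.Z * K.w) = 0 := by simp [dw]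
  have x1 : D 1 (K.Z * K.w) = (K.Z * K.w) * (K.W - K.Z) := by
    simp [dw]; linear_combination K.Z * K.w * K.W * hwW
  have x2 : D 2 (K.Z * K.w) = (K.Z * K.w) * (K.t * (K.Z + K.W)) := by
    simp [dw]; linear_combination K.Z * K.w * K.W * K.t * hwW
  have x3' : D 3 (K.Z * K.w) = 0 := by simp [dw]
  have hx : L (K.Z * K.w) = 0 := by
    rw [Derivation.leibniz, dw, smul_eq_mul, smul_eq_mul]
    linear_combination K.w ^ 2 * q1 - K.w * L K.Z * hwW
  have ux : (K.Z * K.w) * (K.z * K.W) = 1 := by linear_combination K.w * K.W * hzZ + hwW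
  -- the scale factor
  have hs : L (K.z ^ 3 * mi) = 2 * lam * (K.z ^ 3 * mi) := by
    have e : (K.μ 0 * K.Z ^ 3) * (K.z ^ 3 * mi) = 1 := by
      have : (K.μ 0 * mi) * (K.z * K.Z) ^ 3 = 1 := by rw [hm, hzZ]; ring
      linear_combination this
    rw [der_inv L e, p1]
    linear_combination 2 * lam * (K.z ^ 3 * mi) * e
  -- the first gradient
  have g1 := lie_grad hc hinv hinv' hX (K.Z * K.w) (K.Z * K.w)
  rw [← hL, hx] at g1
  simp only [map_zero, mul_zero, zero_mul, Finset.sum_const_zero, K.contr2_grad hinv,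
    K.grad_conf x0 x1 x2 x3'] at g1
  have n1 : L K.N₀ = -2 * lam * K.N₀ := by
    rw [Derivation.leibniz, Derivation.leibniz_pow, hx] at g1
    simp only [smul_eq_mul, smul_zero, mul_zero, add_zero] at g1
    have u : (K.Z * K.w) ^ 2 * (K.z * K.W) ^ 2 = 1 := by rw [← mul_pow, ux, one_pow]
    linear_combination (K.z * K.W) ^ 2 * g1 - (L K.N₀ + 2 * lam * K.N₀) * u
  -- The squared gradient of an invariant function has weight -2λ like g⁻¹, and 1/(mZ³) has weight
  -- 2λ, so the product is again invariant.
  have hy : L (K.N₀ * (K.z ^ 3 * mi)) = 0 := by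
    rw [Derivation.leibniz, n1, hs, smul_eq_mul, smul_eq_mul]; ring
  -- the second gradient
  have y0 : D 0 (K.N₀ * (K.z ^ 3 * mi)) = -(K.z ^ 3 * mi ^ 2 * (K.μ 1 * K.H)) := by
    simp [Derivation.leibniz_pow, hmi, dz]
    linear_combination K.z ^ 3 * mi ^ 2 * K.D0N₀ - K.z ^ 3 * mi * D 0 K.N₀ * hm
  have y1 : D 1 (K.N₀ * (K.z ^ 3 * mi)) = K.z ^ 3 * mi * (D 1 K.N₀ + 3 * K.Z * K.N₀) := by
    simp [Derivation.leibniz_pow, hmi, dz]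
    linear_combination 3 * K.N₀ * mi * K.z ^ 3 * K.Z * hzZ
  have y2 : D 2 (K.N₀ * (K.z ^ 3 * mi)) = K.z ^ 3 * mi * (D 2 K.N₀ - 3 * K.t * K.Z * K.N₀) := by
    simp [Derivation.leibniz_pow, hmi, dz]
    linear_combination -3 * K.N₀ * mi * K.z ^ 3 * K.t * K.Z * hzZ
  have y3 : D 3 (K.N₀ * (K.z ^ 3 * mi)) = 0 := by
    simp [Derivation.leibniz_pow, hmi, dz, D3N₀]
  have g2 := lie_grad hc hinv hinv' hX (K.Z * K.w) (K.N₀ * (K.z ^ 3 * mi))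
  rw [← hL, hx, hy] at g2
  simp only [map_zero, mul_zero, zero_mul, Finset.sum_const_zero, K.contr2_grad hinv,
    K.grad_conf_left x0 x1 x2 x3' y3, y0, y1, y2] at g2
  have e2 : (1 - K.τ) * (K.W - K.Z) * -(K.z ^ 3 * mi ^ 2 * (K.μ 1 * K.H))
      + (1 - K.τ - K.μ 0 * (K.Z + K.W)) * (K.W - K.Z)
        * (K.z ^ 3 * mi * (D 1 K.N₀ + 3 * K.Z * K.N₀))
      + K.Z * K.W * K.t * (K.Z + K.W) * (K.z ^ 3 * mi * (D 2 K.N₀ - 3 * K.t * K.Z * K.N₀))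
      = K.z ^ 3 * mi ^ 2 * K.G := by
    rw [G_eq]
    linear_combination -(K.z ^ 3 * mi * ((1 - K.τ - K.μ 0 * (K.Z + K.W)) * (K.W - K.Z)
        * (D 1 K.N₀ + 3 * K.Z * K.N₀) + K.Z * K.W * K.t * (K.Z + K.W)
        * (D 2 K.N₀ - 3 * K.t * K.Z * K.N₀))) * hm
  rw [e2] at g2
  have n2 : L (K.z ^ 3 * mi ^ 2 * K.G) = -2 * lam * (K.z ^ 3 * mi ^ 2 * K.G) := by
    rw [Derivation.leibniz, hx] at g2
    simp only [smul_eq_mul, mul_zero, add_zero] at g2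
    linear_combination (K.z * K.W) * g2
      - (L (K.z ^ 3 * mi ^ 2 * K.G) + 2 * lam * (K.z ^ 3 * mi ^ 2 * K.G)) * ux
  -- The third invariant, by the same weight count applied to the inner product of the gradients of
  -- the first two.
  have hf : L ((K.z ^ 3 * mi ^ 2 * K.G) * (K.z ^ 3 * mi)) = 0 := by
    rw [Derivation.leibniz, n2, hs, smul_eq_mul, smul_eq_mul]; ring
  have hZ3 : K.z ^ 3 * K.Z ^ 3 = 1 := by rw [← mul_pow, K.zZ, one_pow]
  refine ⟨?_, ?_, ?_⟩
  · rw [hV, x0, x1, x2, x3'] at hx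
    linear_combination (K.z * K.W) * hx
      - (X 1 * (K.W - K.Z) + X 2 * (K.t * (K.Z + K.W))) * ux
  · rw [hV, y0, y1, y2, y3] at hy
    linear_combination (K.μ 0 ^ 2 * K.Z ^ 3) * hy
      - (-(X 0 * K.μ 1 * K.H) * (1 + K.μ 0 * mi) + K.μ 0 * (X 1 * (D 1 K.N₀ + 3 * K.Z * K.N₀)
      + X 2 * (D 2 K.N₀ - 3 * K.t * K.Z * K.N₀))) * (K.z ^ 3 * K.Z ^ 3) * hm
      - (-(X 0 * K.μ 1 * K.H) + K.μ 0 * (X 1 * (D 1 K.N₀ + 3 * K.Z * K.N₀)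
      + X 2 * (D 2 K.N₀ - 3 * K.t * K.Z * K.N₀))) * hZ3
  · have d0 : D 0 ((K.z ^ 3 * mi ^ 2 * K.G) * (K.z ^ 3 * mi))
        = K.z ^ 6 * mi ^ 4 * (K.μ 0 * D 0 K.G - 3 * K.μ 1 * K.G) := by
      simp [Derivation.leibniz_pow, hmi, dz]
      linear_combination -(K.z ^ 6 * mi ^ 3 * D 0 K.G) * hm
    have d1 : D 1 ((K.z ^ 3 * mi ^ 2 * K.G) * (K.z ^ 3 * mi))
        = K.z ^ 6 * mi ^ 3 * (D 1 K.G + 6 * K.Z * K.G) := by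
      simp [Derivation.leibniz_pow, hmi, dz]
      linear_combination (6 * K.z ^ 6 * mi ^ 3 * K.Z * K.G) * hzZ
    have d2 : D 2 ((K.z ^ 3 * mi ^ 2 * K.G) * (K.z ^ 3 * mi))
        = K.z ^ 6 * mi ^ 3 * (D 2 K.G - 6 * K.t * K.Z * K.G) := by
      simp [Derivation.leibniz_pow, hmi, dz]
      linear_combination -(6 * K.z ^ 6 * mi ^ 3 * K.t * K.Z * K.G) * hzZ
    have d3 : D 3 ((K.z ^ 3 * mi ^ 2 * K.G) * (K.z ^ 3 * mi)) = 0 := by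
      simp [Derivation.leibniz_pow, hmi, dz, D3G]
    rw [hV, d0, d1, d2, d3] at hf
    have u6 : K.z ^ 6 * K.Z ^ 6 = 1 := by rw [← mul_pow, K.zZ, one_pow]
    have u4 : K.μ 0 ^ 4 * mi ^ 4 = 1 := by rw [← mul_pow, hm, one_pow]
    have u3 : K.μ 0 ^ 3 * mi ^ 3 = 1 := by rw [← mul_pow, hm, one_pow]
    linear_combination (K.μ 0 ^ 4 * K.Z ^ 6) * hf
      - (X 0 * (K.μ 0 * D 0 K.G - 3 * K.μ 1 * K.G)) * (K.z ^ 6 * K.Z ^ 6) * u4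
      - (K.μ 0 * (X 1 * (D 1 K.G + 6 * K.Z * K.G)
        + X 2 * (D 2 K.G - 6 * K.t * K.Z * K.G))) * (K.z ^ 6 * K.Z ^ 6) * u3
      - (X 0 * (K.μ 0 * D 0 K.G - 3 * K.μ 1 * K.G) + K.μ 0 * (X 1 * (D 1 K.G + 6 * K.Z * K.G)
        + X 2 * (D 2 K.G - 6 * K.t * K.Z * K.G))) * u6

/-- The part of a conformal Killing field in the orbit space is annihilated by the Jacobian. -/
theorem kill_jacobian (hc : ∀ i j f, D i (D j f) = D j (D i f))
    (hinv : ∀ a b, ∑ c, K.g a c * gi c b = if a = b then 1 else 0)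
    (hinv' : ∀ a b, ∑ c, gi a c * K.g c b = if a = b then 1 else 0)
    (hX : ConfKilling D K.g X lam) {mi : A} (hm : K.μ 0 * mi = 1) :
    K.H * (2 * K.t * K.Z * K.W * K.μ 0 * X 2 - X 0 * K.μ 1 * (K.W - K.Z)) = 0 ∧
    K.H * (K.μ 0 * X 2 * (K.t * (K.W - K.Z)
      * polyJac K.Z K.W K.τ (K.μ 0) (K.μ 1) (K.μ 2))) = 0 ∧
    X 1 * (K.W - K.Z) + X 2 * (K.t * (K.Z + K.W)) = 0 := by
  obtain ⟨e1, e2, e3⟩ := K.kill_eqs hc hinv hinv' hX hm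
  have f1 := K.ξN₀
  have f2 := K.jacobian
  rw [ξ_apply] at f1 f2
  -- The first equation makes (X₁,X₂) proportional to ξ; clearing it from the other two turns their
  -- (r,θ)-part into ξ acting on N₀ and on G.
  have E2 : K.H * (2 * K.t * K.Z * K.W * K.μ 0 * X 2 - X 0 * K.μ 1 * (K.W - K.Z)) = 0 := by
    linear_combination (K.W - K.Z) * e2 - K.μ 0 * (D 1 K.N₀ + 3 * K.Z * K.N₀) * e1
      + K.μ 0 * X 2 * f1
  have E3 : X 0 * (K.W - K.Z) * (K.μ 0 * D 0 K.G - 3 * K.μ 1 * K.G)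
      - K.μ 0 * X 2 * (K.t * (K.Z + K.W) * D 1 K.G - (K.W - K.Z) * D 2 K.G
        + 12 * K.t * K.Z * K.W * K.G) = 0 := by
    linear_combination (K.W - K.Z) * e3 - K.μ 0 * (D 1 K.G + 6 * K.Z * K.G) * e1
  refine ⟨E2, ?_, e1⟩
  rw [← f2]
  linear_combination K.μ 1 * K.H * E3 + (K.μ 0 * D 0 K.G - 3 * K.μ 1 * K.G) * E2

end KVRing

/-! ## Conformal Killing fields of the Kerr-Vaidya metric -/

theorem contDiffAt_comp {W : Set Coord} {K : Coord → Coord} {p : Coord} (hW : IsOpen W) (hp : p ∈ W)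
    (hK : ContDiffOn ℝ ∞ K W) (c : Fin 4) : ContDiffAt ℝ ∞ (fun q => K q c) p :=
  (contDiff_apply ℝ ℝ c).contDiffAt.comp p (hK.contDiffAt (hW.mem_nhds hp))

/-- The germ of a Killing field of a conformally related metric. -/
theorem IsKillingOn.confKilling {g : MetricField} {u : Coord → ℝ} {W : Set Coord}
    {K : Coord → Coord} {p : Coord} (hK : IsKillingOn (conformalMetric u g) W K) (hW : IsOpen W)
    (hp : p ∈ W) (hg : ∀ a b, ContDiffAt ℝ ∞ (fun q => g q a b) p) (hu : ContDiffAt ℝ ∞ u p) :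
    ∃ lam, ConfKilling (SmoothGerm.der p) (gG g p) (fun c => germR p fun q => K q c) lam := by
  have hKs : ∀ c, ContDiffAt ℝ ∞ (fun q => K q c) p := contDiffAt_comp hW hp hK.1
  set f : Coord → ℝ := fun q => Real.exp (2 * u q) with hf
  have h2u : ContDiffAt ℝ ∞ (fun q => 2 * u q) p := contDiffAt_const.mul hu
  have hfs : ContDiffAt ℝ ∞ f p := Real.contDiff_exp.contDiffAt.comp p h2u
  have hGs : ∀ a b, ContDiffAt ℝ ∞ (fun q => conformalMetric u g q a b) p :=
    fun a b => hfs.mul (hg a b)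
  have hG : ∀ a b, germR p (fun q => conformalMetric u g q a b) = germR p f * gG g p a b :=
    fun a b => germR_mul hfs (hg a b)
  have hfd : ∀ i, SmoothGerm.der p i (germR p f)
      = germR p f * (2 * SmoothGerm.der p i (germR p u)) := fun i => by
    have e : pd i f =ᶠ[𝓝 p] fun q => f q * (2 * pd i u q) := by
      have h1 : ContDiffAt ℝ 1 u p := hu.of_le (by simp)
      filter_upwards [h1.eventually (by simp)] with q hq
      have hd := (hq.differentiableAt (by simp)).hasFDerivAt
      have := ((hd.const_mul 2).exp).fderiv
      simp only [pd, hf, this]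
      simp [smul_eq_mul]
    have hp' := contDiffAt_pd hu i
    rw [der_germR hfs, germR_congr e, germR_mul hfs (contDiffAt_const.mul hp'),
      germR_const_mul 2 hp', der_germR hu, Algebra.smul_def,
      Complex.ofReal_ofNat, map_ofNat]
  -- The exponential never vanishes, so e^{2u} can be cancelled from the Killing equation; what its
  -- derivative leaves behind is the conformal factor λ = -K(u).
  have hunit : IsUnit (germR p f) :=
    .of_mul_eq_one _ (germ_inv (sm_ofReal hfs) (Complex.ofReal_ne_zero.2 (Real.exp_pos _).ne'))
  refine ⟨-vecD (SmoothGerm.der p) (fun c => germR p fun q => K q c) (germR p u), fun a b => ?_⟩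
  have hz : germR p (fun q => ∑ c, (K q c * pd c (fun q => conformalMetric u g q a b) q
      + conformalMetric u g q c b * pd a (fun q => K q c) q
      + conformalMetric u g q a c * pd b (fun q => K q c) q)) = 0 := by
    rw [germR_congr (g := fun _ => 0) (by
      filter_upwards [hW.mem_nhds hp] with q hq using hK.2 q hq a b), germR_const]
    simp
  have t1 : ∀ c, ContDiffAt ℝ ∞ (fun q => K q c * pd c (fun q => conformalMetric u g q a b) q) p :=
    fun c => (hKs c).mul (contDiffAt_pd (hGs a b) c)
  have t2 : ∀ c, ContDiffAt ℝ ∞ (fun q => conformalMetric u g q c b * pd a (fun q => K q c) q) p :=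
    fun c => (hGs c b).mul (contDiffAt_pd (hKs c) a)
  have t3 : ∀ c, ContDiffAt ℝ ∞ (fun q => conformalMetric u g q a c * pd b (fun q => K q c) q) p :=
    fun c => (hGs a c).mul (contDiffAt_pd (hKs c) b)
  rw [germR_sum fun c => ((t1 c).add (t2 c)).add (t3 c)] at hz
  have e : ∀ c, germR p (fun q => K q c * pd c (fun q => conformalMetric u g q a b) q
      + conformalMetric u g q c b * pd a (fun q => K q c) q
      + conformalMetric u g q a c * pd b (fun q => K q c) q)
      = germR p f * (germR p (fun q => K q c) * SmoothGerm.der p c (gG g p a b)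
        + 2 * (germR p (fun q => K q c) * SmoothGerm.der p c (germR p u)) * gG g p a b
        + (gG g p c b * SmoothGerm.der p a (germR p fun q => K q c)
          + gG g p a c * SmoothGerm.der p b (germR p fun q => K q c))) := fun c => by
    rw [germR_add ((t1 c).add (t2 c)) (t3 c), germR_add (t1 c) (t2 c),
      germR_mul (hKs c) (contDiffAt_pd (hGs a b) c), germR_mul (hGs c b) (contDiffAt_pd (hKs c) a),
      germR_mul (hGs a c) (contDiffAt_pd (hKs c) b), ← der_germR (hGs a b), ← der_germR (hKs c),
      ← der_germR (hKs c), hG, hG, hG, Derivation.leibniz, hfd, smul_eq_mul, smul_eq_mul]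
    ring
  simp only [e, ← Finset.mul_sum] at hz
  have hz' := hunit.mul_left_cancel (hz.trans (mul_zero _).symm)
  simp only [Finset.sum_add_distrib, ← Finset.sum_mul, ← Finset.mul_sum] at hz'
  simp only [vecD_apply, Finset.sum_add_distrib]
  linear_combination hz'

/-- The Jacobian factor as a function of the parameters. -/
def JP (y : Fin 7 → ℝ) : ℂ := polyJac (zP y)⁻¹ (wP y)⁻¹ (τP y) (y 3) (y 4) (y 5)

theorem map_polyJac {A B : Type*} [CommRing A] [CommRing B] (f : A →+* B) (Z W τ m m1 m2 : A) :
    f (polyJac Z W τ m m1 m2) = polyJac (f Z) (f W) (f τ) (f m) (f m1) (f m2) := by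
  simp only [polyJac, map_add, map_sub, map_mul, map_pow, map_ofNat]

namespace KVPoint

variable {a : ℝ} {m : ℝ → ℝ} {p : Coord} (h : KVPoint a m p)
include h

/-- At a generic point a conformal Killing field has no part in the orbit space. -/
theorem killing_vanish (ha : a ≠ 0) (hm0 : m (p 0) ≠ 0) (hm1 : deriv m (p 0) ≠ 0)
    (hcos : Real.cos (p 2) ≠ 0) (hJ : JP (prm a m p) ≠ 0) {X : Fin 4 → SmoothGerm p}
    {lam : SmoothGerm p} (hX : ConfKilling (SmoothGerm.der p) (gG (kvMetric a m) p) X lam) :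
    SmoothGerm.ev p (X 0) = 0 ∧ SmoothGerm.ev p (X 1) = 0 ∧ SmoothGerm.ev p (X 2) = 0 := by
  have hgG : gG (kvMetric a m) p = h.ring.g := funext fun i => funext fun j => h.gG_eq i j
  rw [hgG] at hX
  have hinv' : ∀ i j, ∑ c, giG (kvMetric a m) p i c * h.ring.g c j = if i = j then 1 else 0 := by
    have h1 : Matrix.of h.ring.g * Matrix.of (giG (kvMetric a m) p) = 1 := by
      ext i j
      rw [Matrix.mul_apply, Matrix.one_apply]
      exact h.giG_inv i j
    have h2 : Matrix.of (giG (kvMetric a m) p) * Matrix.of h.ring.g = 1 := mul_eq_one_comm.1 h1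
    intro i j
    have h3 := congrArg (fun M : Matrix (Fin 4) (Fin 4) (SmoothGerm p) => M i j) h2
    simpa only [Matrix.mul_apply, Matrix.one_apply, Matrix.of_apply] using h3
  have hM0 : massF m 0 (p 0) ≠ 0 := by
    simpa [massF] using hm0
  have hM := germ_inv (h.rep_μ 0).sm hM0
  rw [(h.rep_μ 0).germ_eq] at hM
  obtain ⟨e1, e2, e3⟩ := h.ring.kill_jacobian der_comm h.giG_inv hinv' hX hM
  replace e1 := congrArg (SmoothGerm.ev p) e1
  replace e2 := congrArg (SmoothGerm.ev p) e2
  replace e3 := congrArg (SmoothGerm.ev p) e3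
  have hs : (Real.sin (p 2) : ℂ) ≠ 0 := Complex.ofReal_ne_zero.2 h.sin_pos.ne'
  have ha' : (a : ℂ) ≠ 0 := Complex.ofReal_ne_zero.2 ha
  have hc' : (Real.cos (p 2) : ℂ) ≠ 0 := Complex.ofReal_ne_zero.2 hcos
  have hH : SmoothGerm.ev p h.ring.H ≠ 0 := by
    rw [h.ev_H]
    exact mul_ne_zero (mul_ne_zero (by norm_num) (pow_ne_zero 2 ha'))
      (pow_ne_zero 2 (mul_ne_zero (inv_ne_zero h.z_ne) (inv_ne_zero h.w_ne)))
  have ht : SmoothGerm.ev p h.ring.t ≠ 0 := by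
    rw [h.ev_t]
    exact mul_ne_zero (mul_ne_zero Complex.I_ne_zero ha') hs
  -- Z = W exactly on the equator, where d(Z/W) loses its r-component; this is why cos θ ≠ 0 is
  -- required.
  have hWZ : SmoothGerm.ev p h.ring.W - SmoothGerm.ev p h.ring.Z ≠ 0 := by
    rw [h.ev_W, h.ev_Z]
    intro h0
    have h1 := inv_injective (sub_eq_zero.1 h0)
    have h2 : Complex.I * (a : ℂ) * (Real.cos (p 2) : ℂ) = 0 := by
      have h3 : zF a p = p 1 + Complex.I * a * (Real.cos (p 2) : ℝ) := rfl
      have h4 : wF a p = p 1 - Complex.I * a * (Real.cos (p 2) : ℝ) := rfl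
      rw [h3, h4] at h1
      linear_combination -(1 / 2) * h1
    exact mul_ne_zero (mul_ne_zero Complex.I_ne_zero ha') hc' h2
  have hμ0 : SmoothGerm.ev p (h.ring.μ 0) ≠ 0 := by
    rw [h.ev_μ, iteratedDeriv_zero]; exact Complex.ofReal_ne_zero.2 hm0
  have hμ1 : SmoothGerm.ev p (h.ring.μ 1) ≠ 0 := by
    rw [h.ev_μ, iteratedDeriv_one]; exact Complex.ofReal_ne_zero.2 hm1
  have hjac : SmoothGerm.ev p (polyJac h.ring.Z h.ring.W h.ring.τ (h.ring.μ 0) (h.ring.μ 1)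
      (h.ring.μ 2)) ≠ 0 := by
    rw [← RingHom.coe_coe, map_polyJac]
    simp only [RingHom.coe_coe, h.ev_Z, h.ev_W, h.ev_μ, h.ev_τ, iteratedDeriv_zero,
      iteratedDeriv_one]
    exact hJ
  simp only [map_mul, map_sub, map_add, map_zero] at e1 e2 e3
  have x2 : SmoothGerm.ev p (X 2) = 0 := by
    simpa only [mul_eq_zero, hH, hμ0, ht, hWZ, hjac, or_false, false_or] using e2
  rw [x2, zero_mul, add_zero] at e3
  rw [x2, mul_zero, zero_sub] at e1
  refine ⟨?_, (mul_eq_zero.1 e3).resolve_right hWZ, x2⟩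
  simpa only [neg_eq_zero, mul_eq_zero, hH, hμ1, hWZ, or_false, false_or] using e1

end KVPoint

/-! ## The cohomogeneity -/

set_option maxHeartbeats 4000000 in
theorem PoleP.J : PoleP 6 6 (fun y => JP y.1) := by
  have hZ := PoleP.inv_z
  have hW := PoleP.inv_w
  have hτ := PoleP.tau
  have hm : PoleP 0 0 _ := PoleLE.of_mem (mem_var 3)
  have hm1 : PoleP 0 0 _ := PoleLE.of_mem (mem_var 4)
  have hm2 : PoleP 0 0 _ := PoleLE.of_mem (mem_var 5)
  have h : PoleP 6 6 (polyJac (fun y => (zP y.1)⁻¹) (fun y => (wP y.1)⁻¹) (fun y => τP y.1)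
      (fun y => (y.1 3 : ℂ)) (fun y => (y.1 4 : ℂ)) (fun y => (y.1 5 : ℂ))) := by
    unfold KerrVaidya.polyJac
    repeat' first
      | with_reducible refine PoleLE.add ?_ ?_
      | with_reducible refine PoleLE.sub ?_ ?_
    all_goals
      apply PoleLE.mono mem_z mem_w
      · repeat' first
          | with_reducible assumption
          | with_reducible exact PoleLE.natLit _
          | with_reducible apply PoleLE.mul
          | with_reducible apply PoleLE.pow
      · decide
      · decide
  convert h using 1
  ext y
  simp [JP, polyJac]

/-- After clearing r⁸ the odd part in r is the single term -16a²m m' r. Comparing r and -r thus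
detects m' without any information on m''. -/
theorem JP_equator (a r m m1 m2 m3 : ℝ) (hr : r ≠ 0) : JP ![a, r, 0, m, m1, m2, m3] * r ^ 8
    = a ^ 2 * (8 * m * m2 - 32 * m1 ^ 2) * r ^ 2 - 16 * a ^ 2 * m * m1 * r
      + a ^ 4 * (8 * m * m2 - 16 * m1 ^ 2) := by
  have hr' : (r : ℂ) ≠ 0 := Complex.ofReal_ne_zero.2 hr
  simp only [JP, zP, wP, τP, polyJac, Matrix.cons_val, Complex.ofReal_zero, mul_zero, add_zero,
    sub_zero]
  field_simp
  ring

/-- If the Jacobian factor vanishes on a box, then the mass function is stationary. -/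
theorem deriv_eq_zero_of_JP_box {a m m1 m2 m3 : ℝ} (ha : a ≠ 0) (hm : m ≠ 0) {A B : Set ℝ}
    (hA : A.Infinite) (hB : B.Infinite)
    (hAB : ∀ r ∈ A, ∀ x ∈ B, zP ![a, r, x, m, m1, m2, m3] ≠ 0 ∧ wP ![a, r, x, m, m1, m2, m3] ≠ 0 ∧
      JP ![a, r, x, m, m1, m2, m3] = 0) : m1 = 0 := by
  obtain ⟨Q, hQ⟩ := exists_pole_poly PoleP.J a m m1 m2 m3
  have hQ0 : Q = 0 := by
    refine MvPolynomial.funext_set ![Complex.ofReal '' A, Complex.ofReal '' B] (fun i => ?_)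
      fun y hy => ?_
    · fin_cases i
      · exact hA.image Complex.ofReal_injective.injOn
      · exact hB.image Complex.ofReal_injective.injOn
    · obtain ⟨r, hr, hr'⟩ := hy 0 trivial
      obtain ⟨x, hx, hx'⟩ := hy 1 trivial
      have hy' : y = ![(r : ℂ), (x : ℂ)] := by
        ext i; fin_cases i
        · exact hr'.symm
        · exact hx'.symm
      obtain ⟨h1, h2, h3⟩ := hAB r hr x hx
      rw [hy', hQ r x h1 h2, h3, map_zero]
      ring
  subst hQ0
  have hz : ∀ r : ℝ, zP ![a, r, 0, m, m1, m2, m3] = r := fun r => by simp [zP]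
  have hw : ∀ r : ℝ, wP ![a, r, 0, m, m1, m2, m3] = r := fun r => by simp [wP]
  have e : ∀ r : ℝ, r ≠ 0 → JP ![a, r, 0, m, m1, m2, m3] = 0 := fun r hr => by
    have hr' : (r : ℂ) ≠ 0 := Complex.ofReal_ne_zero.2 hr
    have := hQ r 0 (by rwa [hz]) (by rwa [hw])
    rw [hz, hw, map_zero] at this
    simpa [hr'] using this.symm
  have e1 := JP_equator a 1 m m1 m2 m3 one_ne_zero
  have e2 := JP_equator a (-1) m m1 m2 m3 (by norm_num)
  rw [e _ one_ne_zero] at e1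
  rw [e _ (by norm_num)] at e2
  have e3 : ((a ^ 2 * m * m1 : ℝ) : ℂ) = 0 := by
    push_cast at e1 e2 ⊢
    linear_combination (1 / 32) * e1 - (1 / 32) * e2
  have e4 : a ^ 2 * m * m1 = 0 := by exact_mod_cast e3
  exact (mul_eq_zero.1 e4).resolve_left (mul_ne_zero (pow_ne_zero 2 ha) hm)

/-- The points where conformal Killing fields are axial are dense. -/
theorem exists_generic {a : ℝ} {J : Set ℝ} {m : ℝ → ℝ} (hJ : IsOpen J) (hm : ContDiffOn ℝ ∞ m J)
    (ha : a ≠ 0) {V : Set Coord} (hV : IsOpen V) (hVJ : V ⊆ kvDomain a J)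
    (hne : ∃ p ∈ V, deriv m (p 0) ≠ 0) :
    ∃ p ∈ V, m (p 0) ≠ 0 ∧ deriv m (p 0) ≠ 0 ∧ Real.cos (p 2) ≠ 0 ∧ JP (prm a m p) ≠ 0 := by
  obtain ⟨p₁, hp₁, hd₁⟩ := hne
  have hsm := eventually_contDiffAt hJ hm (hVJ hp₁).1
  have hcd : ContinuousAt (deriv m) (p₁ 0) := by
    have h1 := (KVPoint.of_mem hJ hm (hVJ hp₁)).contDiffAt_iteratedDeriv 1
    rw [iteratedDeriv_one] at h1
    exact h1.continuousAt
  have hproj : Tendsto (fun s : ℝ => Function.update p₁ 0 s) (𝓝 (p₁ 0)) (𝓝 p₁) := by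
    have : Continuous fun s : ℝ => Function.update p₁ 0 s := continuous_const.update 0 continuous_id
    simpa using this.tendsto (p₁ 0)
  -- If m vanished near this v, so would m'. A small shift in v therefore reaches m ≠ 0 and keeps m'
  -- ≠ 0.
  have hm0 : ∃ᶠ s in 𝓝 (p₁ 0), m s ≠ 0 := by
    intro h0
    have h1 : m =ᶠ[𝓝 (p₁ 0)] fun _ => 0 := by
      filter_upwards [h0] with s hs using not_not.1 hs
    exact hd₁ (by rw [h1.deriv_eq, deriv_const])
  obtain ⟨s, hs0, hs1, hsV⟩ := (hm0.and_eventually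
    ((hcd.eventually_ne hd₁).and (hproj.eventually_mem (hV.mem_nhds hp₁)))).exists
  set p : Coord := Function.update p₁ 0 s with hpdef
  have hps : p 0 = s := by simp [hpdef]
  rw [← hps] at hs0 hs1
  have hp : p ∈ V := hsV
  by_contra! hall
  obtain ⟨ε, hε, hball⟩ := Metric.isOpen_iff.1 hV p hp
  have hq : ∀ r ∈ Metric.ball (p 1) ε, ∀ θ ∈ Metric.ball (p 2) ε,
      ![p 0, r, θ, p 3] ∈ V := fun r hr θ hθ => hball (by
    rw [Metric.mem_ball, dist_pi_lt_iff hε]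
    intro i
    fin_cases i
    · simpa using hε
    · exact hr
    · exact hθ
    · simpa using hε)
  have hpi : p 2 ∈ Set.Ioo 0 Real.pi := ⟨(hVJ hp).2.1, (hVJ hp).2.2.1⟩
  -- If no point of the box were generic, the Jacobian factor would vanish for all r and all nonzero
  -- cos θ in it; dropping the value 0 leaves an infinite set.
  refine hs1 (deriv_eq_zero_of_JP_box (m2 := iteratedDeriv 2 m (p 0))
    (m3 := iteratedDeriv 3 m (p 0)) (A := Metric.ball (p 1) ε)
    (B := Real.cos '' (Metric.ball (p 2) ε ∩ Set.Ioo 0 Real.pi) \ {0}) ha hs0 ?_ ?_ ?_)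
  · exact infinite_of_mem_nhds (p 1) (Metric.ball_mem_nhds _ hε)
  · refine Set.Infinite.sdiff (Set.Infinite.image (Real.injOn_cos.mono fun x hx =>
      Set.Ioo_subset_Icc_self hx.2) ?_) (Set.finite_singleton 0)
    exact infinite_of_mem_nhds (p 2) (inter_mem (Metric.ball_mem_nhds _ hε)
      (isOpen_Ioo.mem_nhds hpi))
  · rintro r hr _ ⟨⟨θ, ⟨hθ, -⟩, rfl⟩, hθ0⟩
    have hqV := hq r hr θ hθ
    have h' := KVPoint.of_mem hJ hm (hVJ hqV)
    have e : prm a m ![p 0, r, θ, p 3] = ![a, r, Real.cos θ, m (p 0), deriv m (p 0),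
        iteratedDeriv 2 m (p 0), iteratedDeriv 3 m (p 0)] := rfl
    rw [← e]
    exact ⟨h'.z_ne, h'.w_ne, hall _ hqV hs0 hs1 hθ0⟩

/-- Killing fields of metrics conformal to the Kerr-Vaidya metric are axial. -/
theorem killing_axial {a : ℝ} {J : Set ℝ} {m : ℝ → ℝ} (hJ : IsOpen J) (hm : ContDiffOn ℝ ∞ m J)
    (ha : a ≠ 0) {U : Set Coord} (hU : IsOpen U) (hUJ : U ⊆ kvDomain a J)
    (hd : ∀ W ⊆ U, IsOpen W → W.Nonempty → ∃ p ∈ W, deriv m (p 0) ≠ 0) {u : Coord → ℝ}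
    (hu : ContDiffOn ℝ ∞ u U) {W : Set Coord} {K : Coord → Coord} (hW : IsOpen W)
    (hK : IsKillingOn (conformalMetric u (kvMetric a m)) W K) {p : Coord} (hp : p ∈ U)
    (hpW : p ∈ W) : K p 0 = 0 ∧ K p 1 = 0 ∧ K p 2 = 0 := by
  -- A component of K nonzero at p stays nonzero nearby, and that neighbourhood contains a generic
  -- point, where it has to vanish.
  have key : ∀ c : Fin 4, (∀ q ∈ U ∩ W, m (q 0) ≠ 0 → deriv m (q 0) ≠ 0 → Real.cos (q 2) ≠ 0 →
      JP (prm a m q) ≠ 0 → K q c = 0) → K p c = 0 := by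
    intro c hc
    by_contra hne
    have hcont : ContinuousAt (fun q => K q c) p := (contDiffAt_comp hW hpW hK.1 c).continuousAt
    obtain ⟨V, hV1, hV2, hV3⟩ := mem_nhds_iff.1
      (inter_mem ((hU.inter hW).mem_nhds ⟨hp, hpW⟩) (hcont.eventually_ne hne))
    obtain ⟨q, hq, g1, g2, g3, g4⟩ := exists_generic hJ hm ha hV2
      (fun x hx => hUJ (hV1 hx).1.1) (hd V (fun x hx => (hV1 hx).1.1) hV2 ⟨p, hV3⟩)
    exact (hV1 hq).2 (hc q (hV1 hq).1 g1 g2 g3 g4)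
  have van : ∀ q ∈ U ∩ W, m (q 0) ≠ 0 → deriv m (q 0) ≠ 0 → Real.cos (q 2) ≠ 0 →
      JP (prm a m q) ≠ 0 → K q 0 = 0 ∧ K q 1 = 0 ∧ K q 2 = 0 := fun q hq g1 g2 g3 g4 => by
    have h := KVPoint.of_mem hJ hm (hUJ hq.1)
    obtain ⟨lam, hX⟩ := hK.confKilling hW hq.2 h.contDiffAt_metric (hu.contDiffAt (hU.mem_nhds hq.1))
    have hv := h.killing_vanish ha g1 g2 g3 g4 hX
    simp only [ev_germR (contDiffAt_comp hW hq.2 hK.1 _)] at hv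
    exact_mod_cast hv
  exact ⟨key 0 fun q hq g1 g2 g3 g4 => (van q hq g1 g2 g3 g4).1,
    key 1 fun q hq g1 g2 g3 g4 => (van q hq g1 g2 g3 g4).2.1,
    key 2 fun q hq g1 g2 g3 g4 => (van q hq g1 g2 g3 g4).2.2⟩

theorem orbitDim_conformal_le {a : ℝ} {J : Set ℝ} {m : ℝ → ℝ} (hJ : IsOpen J)
    (hm : ContDiffOn ℝ ∞ m J) (ha : a ≠ 0) {U : Set Coord} (hU : IsOpen U) (hUJ : U ⊆ kvDomain a J)
    (hd : ∀ W ⊆ U, IsOpen W → W.Nonempty → ∃ p ∈ W, deriv m (p 0) ≠ 0) {u : Coord → ℝ}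
    (hu : ContDiffOn ℝ ∞ u U) {p : Coord} (hp : p ∈ U) :
    orbitDim (conformalMetric u (kvMetric a m)) p ≤ 1 := by
  refine (Submodule.finrank_mono (Submodule.span_le.2 ?_)).trans
    (finrank_span_singleton (K := ℝ) (v := (Pi.single 3 1 : Coord)) (by simp)).le
  rintro _ ⟨W, K, hW, hpW, hK, rfl⟩
  obtain ⟨h0, h1, h2⟩ := killing_axial hJ hm ha hU hUJ hd hu hW hK hp hpW
  refine Submodule.mem_span_singleton.2 ⟨K p 3, ?_⟩
  ext i
  fin_cases i <;> simp [h0, h1, h2]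

theorem conformalMetric_zero (g : MetricField) : conformalMetric 0 g = g := by
  funext p
  simp [conformalMetric]

theorem pd_const (i : Fin 4) (c : ℝ) (p : Coord) : pd i (fun _ => c) p = 0 := by simp [pd]

/-- The axial vector field is a Killing field. -/
theorem isKillingOn_axial {a : ℝ} {m : ℝ → ℝ} {W : Set Coord}
    (hW : ∀ p ∈ W, ∀ i j, ContDiffAt ℝ ∞ (fun q => kvMetric a m q i j) p) :
    IsKillingOn (kvMetric a m) W fun _ => Pi.single 3 1 := by
  refine ⟨contDiffOn_const, fun p hp i j => ?_⟩
  have hpd : pd 3 (fun q => kvMetric a m q i j) p = 0 := by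
    have h1 := ((hW p hp i j).differentiableAt (by simp)).hasFDerivAt
    have h2 : HasDerivAt (fun s : ℝ => p + s • (Pi.single 3 1 : Coord)) (Pi.single 3 1) 0 := by
      simpa using ((hasDerivAt_id (0 : ℝ)).smul_const (Pi.single 3 1 : Coord)).const_add p
    have h3 := HasFDerivAt.comp_hasDerivAt_of_eq (0 : ℝ) h1 h2 (by simp)
    have h4 : (fun q => kvMetric a m q i j) ∘ (fun s : ℝ => p + s • (Pi.single 3 1 : Coord))
        = fun _ => kvMetric a m p i j := by
      funext s
      simp [kvMetric, Rsq, Delta]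
    rw [h4] at h3
    exact h3.unique (hasDerivAt_const _ _)
  simp only [pd_const, mul_zero, add_zero]
  rw [Finset.sum_eq_single 3 (fun c _ hc => by simp [hc]) (by simp), hpd, mul_zero]

/-- The upper bound is the conformal one with u = 0; the lower bound is ∂_φ, which is Killing
because the metric components do not depend on φ. -/
theorem orbitDim_kvMetric {a : ℝ} {J : Set ℝ} {m : ℝ → ℝ} (hJ : IsOpen J)
    (hm : ContDiffOn ℝ ∞ m J) (ha : a ≠ 0) {U : Set Coord} (hU : IsOpen U) (hUJ : U ⊆ kvDomain a J)
    (hd : ∀ W ⊆ U, IsOpen W → W.Nonempty → ∃ p ∈ W, deriv m (p 0) ≠ 0) {p : Coord} (hp : p ∈ U) :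
    orbitDim (kvMetric a m) p = 1 := by
  refine le_antisymm ?_ ?_
  · have := orbitDim_conformal_le hJ hm ha hU hUJ hd (u := 0) contDiffOn_const hp
    rwa [conformalMetric_zero] at this
  · rw [← finrank_span_singleton (K := ℝ) (v := (Pi.single 3 1 : Coord)) (by simp)]
    refine Submodule.finrank_mono (Submodule.span_mono (Set.singleton_subset_iff.2 ?_))
    exact ⟨U, _, hU, hp, isKillingOn_axial fun q hq =>
      (KVPoint.of_mem hJ hm (hUJ hq)).contDiffAt_metric, rfl⟩

theorem cohomogeneity_kvMetric {a : ℝ} {J : Set ℝ} {m : ℝ → ℝ} (hJ : IsOpen J)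
    (hm : ContDiffOn ℝ ∞ m J) (ha : a ≠ 0) {U : Set Coord} (hU : IsOpen U) (hne : U.Nonempty)
    (hUJ : U ⊆ kvDomain a J)
    (hd : ∀ W ⊆ U, IsOpen W → W.Nonempty → ∃ p ∈ W, deriv m (p 0) ≠ 0) :
    cohomogeneity (kvMetric a m) U = 3 ∧ ∀ u : Coord → ℝ, ContDiffOn ℝ ∞ u U →
      3 ≤ cohomogeneity (conformalMetric u (kvMetric a m)) U := by
  obtain ⟨p₀, hp₀⟩ := hne
  constructor
  · have : {n : ℕ | ∃ p ∈ U, n = 4 - orbitDim (kvMetric a m) p} = {3} := by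
      ext n
      constructor
      · rintro ⟨p, hp, rfl⟩
        rw [orbitDim_kvMetric hJ hm ha hU hUJ hd hp]; rfl
      · rintro rfl
        exact ⟨p₀, hp₀, by rw [orbitDim_kvMetric hJ hm ha hU hUJ hd hp₀]⟩
    rw [cohomogeneity, this, csInf_singleton]
  · intro u hu
    refine le_csInf ⟨_, p₀, hp₀, rfl⟩ ?_
    rintro _ ⟨p, hp, rfl⟩
    have := orbitDim_conformal_le hJ hm ha hU hUJ hd hu hp
    omega

end KerrVaidya

end

theorem mainTheorem7 :
    -- The tetrad is a null frame of type II form, and `I_1 + i I_2 = 48 Ψ_2²`.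
    (∀ (a : ℝ) (J : Set ℝ) (m : ℝ → ℝ), IsOpen J → ContDiffOn ℝ ∞ m J →
      ∀ p ∈ KerrVaidya.kvDomain a J,
        (KerrVaidya.kvTetrad a m).IsNullAt (KerrVaidya.kvMetric a m) p ∧
        KerrVaidya.Psi0 (KerrVaidya.kvMetric a m) (KerrVaidya.kvTetrad a m) p = 0 ∧
        KerrVaidya.Psi1 (KerrVaidya.kvMetric a m) (KerrVaidya.kvTetrad a m) p = 0 ∧
        (KerrVaidya.I1 (KerrVaidya.kvMetric a m) p : ℂ)
            + Complex.I * (KerrVaidya.I2 (KerrVaidya.kvMetric a m) p : ℂ)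
          = 48 * KerrVaidya.kvPsi2 a m p ^ 2) ∧
    -- The squared wedge is `a³ m F₀`, with `F₀` a universal polynomial in
    -- `a, r, cos θ, m, m_{,v}, m_{,vv}, m_{,vvv}` over the denominator `R^{74} I_1^6`.
    (∃ F : MvPolynomial (Fin 7) ℝ,
      ∀ (a : ℝ) (J : Set ℝ) (m : ℝ → ℝ), IsOpen J → ContDiffOn ℝ ∞ m J →
      ∀ (U : Set KerrVaidya.Coord) (L : KerrVaidya.Coord → ℂ), IsOpen U →
        U ⊆ KerrVaidya.kvDomain a J →
        (∀ p ∈ U, KerrVaidya.I1 (KerrVaidya.kvMetric a m) p ≠ 0) →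
        KerrVaidya.IsLogBranch a m U L →
        ∀ p ∈ U, KerrVaidya.kvWedge a m L p =
          a ^ 3 * m (p 0) *
            (MvPolynomial.eval ![a, p 1, Real.cos (p 2), m (p 0), deriv m (p 0),
                iteratedDeriv 2 m (p 0), iteratedDeriv 3 m (p 0)] F
              / (KerrVaidya.Rsq a p ^ 37 * KerrVaidya.I1 (KerrVaidya.kvMetric a m) p ^ 6))) ∧
    -- The squared wedge vanishes identically exactly when `m` is constant or `a = 0`.
    (∀ (a : ℝ) (J : Set ℝ) (m : ℝ → ℝ), IsOpen J → ContDiffOn ℝ ∞ m J →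
      ∀ (U : Set KerrVaidya.Coord) (L : KerrVaidya.Coord → ℂ), IsOpen U → IsPreconnected U →
        U ⊆ KerrVaidya.kvDomain a J →
        (∀ p ∈ U, KerrVaidya.I1 (KerrVaidya.kvMetric a m) p ≠ 0) →
        KerrVaidya.IsLogBranch a m U L →
        ((∀ p ∈ U, KerrVaidya.kvWedge a m L p = 0) ↔
          ((∃ c : ℝ, ∀ p ∈ U, m (p 0) = c) ∨ a = 0))) ∧
    -- If `a ≠ 0` and `m_{,v}` vanishes identically on no open set, then the cohomogeneity is `3`
    -- and no conformally related metric has lower cohomogeneity.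
    (∀ (a : ℝ) (J : Set ℝ) (m : ℝ → ℝ), IsOpen J → ContDiffOn ℝ ∞ m J → a ≠ 0 →
      ∀ U : Set KerrVaidya.Coord, IsOpen U → U.Nonempty → U ⊆ KerrVaidya.kvDomain a J →
        (∀ W ⊆ U, IsOpen W → W.Nonempty → ∃ p ∈ W, deriv m (p 0) ≠ 0) →
        KerrVaidya.cohomogeneity (KerrVaidya.kvMetric a m) U = 3 ∧
        ∀ u : KerrVaidya.Coord → ℝ, ContDiffOn ℝ ∞ u U →
          ¬ KerrVaidya.cohomogeneity
              (KerrVaidya.conformalMetric u (KerrVaidya.kvMetric a m)) U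
            < KerrVaidya.cohomogeneity (KerrVaidya.kvMetric a m) U) := by
  refine ⟨fun a J m hJ hm p hp => ?_, KerrVaidya.kvWedge_formula,
    fun a J m hJ hm U L hU hUc hUJ hI hL =>
    KerrVaidya.kvWedge_eq_zero_iff hJ hm hU hUc hUJ hI hL, fun a J m hJ hm ha U hU hne hUJ hd => ?_⟩
  · have h := KerrVaidya.KVPoint.of_mem hJ hm hp
    exact ⟨h.isNullAt, h.psi_zero_one.1, h.psi_zero_one.2, h.I1_add_I2⟩
  · obtain ⟨h3, hu⟩ := KerrVaidya.cohomogeneity_kvMetric hJ hm ha hU hne hUJ hd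
    exact ⟨h3, fun u hu' => by rw [h3]; exact (hu u hu').not_gt⟩
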